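/- **Setting.** Let $M$ be a compact manifold with corners of dimension $m+1$, $Y\subset M$ a closed union of boundary hyperfaces (the regular boundary), with interiors $M_0$, $Y_0$; the other boundary hyperfaces are called singular. Let $(M,\mathcal A,\mathcal V)$ be a Lie manifold with boundary $Y$: $\mathcal A\to M$ is a smooth vector bundle with a smooth anchor $\varrho:\mathcal A\to TM$, the space $\mathcal V=\varrho(\Gamma(\mathcal A))$ is a Lie algebra of vector fields tangent to the singular hyperfaces, $\varrho$ is an isomorphism over $M_0\cup Y_0$, and $T_pM=\varrho(\mathcal A_p)+T_pY$ for $p\in Y$. Put $\mathcal B_y=\{a\in\mathcal A_y:\varrho(a)\in T_yY\}$ for $y \in Y$ and $\mathcal W=\varrho(\Gamma(\mathcal B))$. Fix an $\mathcal A$-metric $g$ with volume measure $\mu=\mu_g$, the volume measure $\nu$ on $Y$ of the restricted $\mathcal B$-metric, the inward unit normal field $\mathfrak n\in\Gamma(\mathcal A|_Y)$ orthogonal to $\mathcal B$, and the form $\tau\in\Gamma(\mathcal A^*|_Y)$ with $\tau(\mathfrak n)=1$, $\tau|_{\mathcal B}=0$. Fix a tubular neighbourhood $\Phi:\mathcal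 U\to[0,r)\times Y$, that is, a diffeomorphism from an open neighbourhood $\mathcal U$ of $Y$ with first component $u$ such that $\Phi(y)=(0,y)$ for $y\in Y$, $\partial_u$ comes from a smooth section of $\mathcal A|_{\mathcal U}$ that is equal to $\mathfrak n$ along $Y$, and $\Phi_*\mu=|du|\otimes\nu$. Let $E,F\to M$ be smooth hermitian vector bundles, with smooth unitary identifications of $E|_{\mathcal U}$, $F|_{\mathcal U}$ with the pullbacks of $E|_Y$, $F|_Y$ to $[0,r)\times Y$ that are the identity over $Y$ (for instance parallel transport of metric connections along the $u$-curves); thus sections over $\mathcal U$ are families, in $t\in[0,r)$, of sections over $Y$. Let $\mathrm{Diff}^1_{\mathcal V}(M;E,F)$ be the space of differential operators of order at most one generated by $\mathcal V$ with coefficients smooth on $M$. The principal symbol $\sigma_D(\xi):E_x\to F_x$, $\xi\in\mathcal A_x^*$, is normalised by $\sigma_D(df\circ\varrho)=[D,f]$, and $D$ is elliptic if $\sigma_D(\xi)$ is invertible for all $x\in M$ and $0\ne\xi\in\mathcal A_x^*$; similarly for $\mathcal W$-operators on $Y$, with $\mathcal B^*$. An elliptic $D$ is boundary symmetric if, with $\sigma_0=\sigma_D(\tau)$,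 the endomorphisms $\sigma_0(y)^{-1}\sigma_D(\xi)$ of $E_y$ and $\sigma_D(\xi)\sigma_0(y)^{-1}$ of $F_y$ are skew-hermitian for all $y\in Y$ and all $\xi\in\mathcal B_y^*=\{\xi\in\mathcal A_y^*:\xi(\mathfrak n)=0\}$. **Lemma.** Let $D\in\mathrm{Diff}^1_{\mathcal V}(M;E,F)$ be elliptic and boundary symmetric, with formal adjoint $D^*\in\mathrm{Diff}^1_{\mathcal V}(M;F,E)$ with respect to $\mu$, and let $\sigma_t(y)=\sigma_D(du\circ\varrho)_{(t,y)}:E_y\to F_y$. Then there are elliptic $\mathcal W$-differential operators $A$ on $E|_Y$ and $\tilde A$ on $F|_Y$ of order at most one, and for $t\in[0,r)$ operators $R_t\in\mathrm{Diff}^1_{\mathcal W}(Y;E|_Y)$ and $\tilde R_t\in\mathrm{Diff}^1_{\mathcal W}(Y;F|_Y)$ (of order at most one), such that over $\mathcal U\cong[0,r)\times Y$ $$D=\sigma_t(\partial_t+A+R_t),\qquad D^*=-\sigma_t^*(\partial_t+\tilde A+\tilde R_t),$$ and such that for each $r'<r$ there is a constant $C$ with $$\|R_tf\|_{L^2(Y,\nu)}\le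 C\big(t\,\|Af\|_{L^2(Y,\nu)}+\|f\|_{L^2(Y,\nu)}\big),\qquad \|\tilde R_tg\|_{L^2(Y,\nu)}\le C\big(t\,\|\tilde Ag\|_{L^2(Y,\nu)}+\|g\|_{L^2(Y,\nu)}\big)$$ for all $t\in[0,r')$, $f\in C_c^\infty(Y_0,E|_Y)$ and $g\in C_c^\infty(Y_0,F|_Y)$. -/

import Mathlib

open Set Filter Topology MeasureTheory Bundle
open scoped Manifold ContDiff ENNReal

noncomputable section

namespace LieMfd

/-- The model of `n`-dimensional manifolds with corners: the closed quadrant in `ℝⁿ`. -/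
abbrev Q (n : ℕ) : ModelWithCorners ℝ (EuclideanSpace ℝ (Fin n)) (EuclideanQuadrant n) :=
  modelWithCornersEuclideanQuadrant n

/-! ### Smooth sections -/

section Sections

variable (k : ℕ) {M : Type*} [TopologicalSpace M] [ChartedSpace (EuclideanQuadrant k) M]
  (F : Type*) [NormedAddCommGroup F] [NormedSpace ℝ F]
  (E : M → Type*) [TopologicalSpace (TotalSpace F E)] [∀ x, TopologicalSpace (E x)]
  [FiberBundle F E]

/-- The space `Γ(M; E)` of smooth sections of a bundle `E → M` with model fibre `F`. -/
def smoothSections : Set (∀ x, E x) :=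
  {s | ContMDiff (Q k) ((Q k).prod 𝓘(ℝ, F)) ∞ fun x => (⟨x, s x⟩ : TotalSpace F E)}

/-- The space `Γ(Y; φ^* E)` of smooth sections of the pullback of `E → M` along `φ : Y → M`. -/
def smoothSectionsAlong (l : ℕ) {Y : Type*} [TopologicalSpace Y]
    [ChartedSpace (EuclideanQuadrant l) Y] (φ : Y → M) : Set (∀ y, E (φ y)) :=
  {s | ContMDiff (Q l) ((Q k).prod 𝓘(ℝ, F)) ∞ fun y => (⟨φ y, s y⟩ : TotalSpace F E)}

/-- Smooth sections along a map `Ψ : ℝ × Y → M`, over the subset `[0, r) × Y`. -/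
def smoothSectionsCollar (l : ℕ) {Y : Type*} [TopologicalSpace Y]
    [ChartedSpace (EuclideanQuadrant l) Y] (r : ℝ) (Ψ : ℝ × Y → M) : Set (∀ p, E (Ψ p)) :=
  {s | ContMDiffOn (𝓘(ℝ, ℝ).prod (Q l)) ((Q k).prod 𝓘(ℝ, F)) ∞
    (fun p => (⟨Ψ p, s p⟩ : TotalSpace F E)) (Ico 0 r ×ˢ univ)}

/-- The hermitian metric of a complex vector bundle is smooth. -/
def IsSmoothHermitian (E' : M → Type*) [∀ x, NormedAddCommGroup (E' x)] [∀ x, InnerProductSpace ℂ (E' x)]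
    [TopologicalSpace (TotalSpace F E')] [FiberBundle F E'] : Prop :=
  ∀ s ∈ smoothSections k F E', ∀ s' ∈ smoothSections k F E',
    ContMDiff (Q k) 𝓘(ℝ, ℂ) ∞ fun x => (inner ℂ (s x) (s' x) : ℂ)

end Sections

/-- The components of a tangent vector at `x` in the preferred chart at `x`. -/
def coord {n : ℕ} {N : Type*} [TopologicalSpace N] [ChartedSpace (EuclideanQuadrant n) N] {x : N}
    (v : TangentSpace (Q n) x) (i : Fin n) : ℝ :=
  (show EuclideanSpace ℝ (Fin n) from v) i

/-- The derivative of a complex-valued function along a vector field. -/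
def lieDeriv {n : ℕ} {N : Type*} [TopologicalSpace N] [ChartedSpace (EuclideanQuadrant n) N]
    (V : ∀ y : N, TangentSpace (Q n) y) (f : N → ℂ) (y : N) : ℂ :=
  mfderiv (Q n) 𝓘(ℝ, ℂ) f y (V y)

/-- Elements of `Γ` with compact support in the interior of the compact manifold with corners
`N`. -/
def compactlySupported (n : ℕ) {N : Type*} [TopologicalSpace N]
    [ChartedSpace (EuclideanQuadrant n) N] {G : N → Type*} [∀ y, Zero (G y)]
    (Γ : Set (∀ y, G y)) : Set (∀ y, G y) :=
  {s | s ∈ Γ ∧ IsCompact (closure {y | s y ≠ 0}) ∧ closure {y | s y ≠ 0} ⊆ (Q n).interior N}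

/-! ### First order differential operators generated by a Lie algebra of vector fields

`𝔸` is a family of vector spaces over `N` with anchor `ρ : 𝔸 → TN` and smooth sections `ΓA`; `G`
and `H` are families of hermitian vector spaces with smooth sections `ΓG` and `ΓH`. -/

section Operators

variable {n : ℕ} {N : Type*} [TopologicalSpace N] [ChartedSpace (EuclideanQuadrant n) N]
  {𝔸 : N → Type*} [∀ y, AddCommGroup (𝔸 y)] [∀ y, Module ℝ (𝔸 y)]
  {G H : N → Type*}
  [∀ y, NormedAddCommGroup (G y)] [∀ y, InnerProductSpace ℂ (G y)]
  [∀ y, NormedAddCommGroup (H y)] [∀ y, InnerProductSpace ℂ (H y)]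

/-- `P` is a differential operator of order at most one generated by the vector fields
`{ρ ∘ X | X ∈ ΓA}`, and `σ` is its principal symbol (normalised by `σ_P(ρ^* df) = [P, f]`).
Such operators are the finite sums `P s = ∑ₖ (Lₖ ⟨eₖ, s⟩) bₖ` with scalar operators
`Lₖ = ρ(Xₖ) + cₖ`, where `Xₖ ∈ ΓA` and `cₖ` is a smooth function, and with smooth sections `eₖ` of
`G` and `bₖ` of `H`, that is, the operators in `e_H · Mat(Diff¹(N)) · e_G` if `G` and `H` are
realised as ranges of projections `e_G` and `e_H` of trivial bundles. The symbol is then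
`σ_P(ξ) v = ∑ₖ ξ(Xₖ) ⟨eₖ, v⟩ bₖ`. -/
def HasSymbol (ρ : ∀ y, 𝔸 y →ₗ[ℝ] TangentSpace (Q n) y) (ΓA : Set (∀ y, 𝔸 y))
    (ΓG : Set (∀ y, G y)) (ΓH : Set (∀ y, H y)) (P : (∀ y, G y) → ∀ y, H y)
    (σ : ∀ y, Module.Dual ℝ (𝔸 y) → G y →ₗ[ℂ] H y) : Prop :=
  ∃ (K : ℕ) (X : Fin K → ∀ y, 𝔸 y) (c : Fin K → N → ℂ) (e : Fin K → ∀ y, G y)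
    (b : Fin K → ∀ y, H y),
    (∀ k, X k ∈ ΓA) ∧ (∀ k, ContMDiff (Q n) 𝓘(ℝ, ℂ) ∞ (c k)) ∧ (∀ k, e k ∈ ΓG) ∧
    (∀ k, b k ∈ ΓH) ∧
    (∀ s ∈ ΓG, ∀ y, P s y = ∑ k,
      (lieDeriv (fun z => ρ z (X k z)) (fun z => inner ℂ (e k z) (s z)) y
        + c k y * inner ℂ (e k y) (s y)) • b k y) ∧
    (∀ y ξ v, σ y ξ v = ∑ k, ((ξ (X k y) : ℂ) * inner ℂ (e k y) v) • b k y)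

/-- Differential operators of order at most one generated by `{ρ ∘ X | X ∈ ΓA}`. -/
def IsDiffOp (ρ : ∀ y, 𝔸 y →ₗ[ℝ] TangentSpace (Q n) y) (ΓA : Set (∀ y, 𝔸 y))
    (ΓG : Set (∀ y, G y)) (ΓH : Set (∀ y, H y)) (P : (∀ y, G y) → ∀ y, H y) : Prop :=
  ∃ σ, HasSymbol ρ ΓA ΓG ΓH P σ

/-- The symbol is invertible at all nonzero covectors `ξ ∈ 𝔸_y^*`, for all `y ∈ N`. -/
def IsEllipticSymbol (σ : ∀ y, Module.Dual ℝ (𝔸 y) → G y →ₗ[ℂ] H y) : Prop :=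
  ∀ y, ∀ ξ : Module.Dual ℝ (𝔸 y), ξ ≠ 0 → Function.Bijective (σ y ξ)

/-- Elliptic first order differential operators generated by `{ρ ∘ X | X ∈ ΓA}`. -/
def IsEllipticOp (ρ : ∀ y, 𝔸 y →ₗ[ℝ] TangentSpace (Q n) y) (ΓA : Set (∀ y, 𝔸 y))
    (ΓG : Set (∀ y, G y)) (ΓH : Set (∀ y, H y)) (P : (∀ y, G y) → ∀ y, H y) : Prop :=
  ∃ σ, HasSymbol ρ ΓA ΓG ΓH P σ ∧ IsEllipticSymbol σ

/-- `P'` is formally adjoint to `P` with respect to the measure `μ`. -/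
def IsFormalAdjoint (n : ℕ) {N : Type*} [TopologicalSpace N]
    [ChartedSpace (EuclideanQuadrant n) N] {G H : N → Type*}
    [∀ y, NormedAddCommGroup (G y)] [∀ y, InnerProductSpace ℂ (G y)]
    [∀ y, NormedAddCommGroup (H y)] [∀ y, InnerProductSpace ℂ (H y)]
    [MeasurableSpace N] (μ : Measure N)
    (ΓG : Set (∀ y, G y)) (ΓH : Set (∀ y, H y))
    (P : (∀ y, G y) → ∀ y, H y) (P' : (∀ y, H y) → ∀ y, G y) : Prop :=
  ∀ s ∈ compactlySupported n ΓG, ∀ w ∈ compactlySupported n ΓH,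
    ∫ y, inner ℂ (w y) (P s y) ∂μ = ∫ y, inner ℂ (P' w y) (s y) ∂μ

/-- The `L²`-norm with respect to `ν`. -/
def normL2 [MeasurableSpace N] (ν : Measure N) (f : ∀ y, G y) : ℝ≥0∞ :=
  eLpNorm (fun y => ‖f y‖) 2 ν

end Operators

/-- `μ` is the Riemannian volume measure `μ_g` of the metric `g` that the fibrewise inner product
of `𝔸` induces, through the anchor, on the interior of `N`: the boundary is a null set and in
every chart the density is `√det (g(∂ᵢ, ∂ⱼ))`. -/
def IsVolume {n : ℕ} {N : Type*} [TopologicalSpace N] [ChartedSpace (EuclideanQuadrant n) N]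
    [MeasurableSpace N] {𝔸 : N → Type*} [∀ y, NormedAddCommGroup (𝔸 y)]
    [∀ y, InnerProductSpace ℝ (𝔸 y)]
    (ρ : ∀ y, 𝔸 y →ₗ[ℝ] TangentSpace (Q n) y) (μ : Measure N) : Prop :=
  μ ((Q n).boundary N) = 0 ∧
  ∀ q : N, ∀ S : Set N, MeasurableSet S →
    S ⊆ (chartAt (EuclideanQuadrant n) q).source ∩ (Q n).interior N →
    μ S = ∫⁻ x in extChartAt (Q n) q '' S, ENNReal.ofReal (Real.sqrt (Matrix.det
      (Matrix.gram ℝ fun i : Fin n =>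
        Function.invFun (ρ ((extChartAt (Q n) q).symm x))
          (mfderivWithin 𝓘(ℝ, EuclideanSpace ℝ (Fin n)) (Q n) (extChartAt (Q n) q).symm
            (range (Q n)) x (EuclideanSpace.single i 1 : EuclideanSpace ℝ (Fin n))))))

/-! ### Lie manifolds with boundary -/

section LieManifold

variable (m : ℕ)
  (M : Type*) [TopologicalSpace M] [ChartedSpace (EuclideanQuadrant (m + 1)) M]
  [IsManifold (Q (m + 1)) ∞ M]
  (Y : Type*) [TopologicalSpace Y] [ChartedSpace (EuclideanQuadrant m) Y]
  (FA : Type*) [NormedAddCommGroup FA] [NormedSpace ℝ FA]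
  (A : M → Type*) [TopologicalSpace (TotalSpace FA A)]
  [∀ x, NormedAddCommGroup (A x)] [∀ x, InnerProductSpace ℝ (A x)] [FiberBundle FA A]

/-- A Lie manifold `(M, 𝒜, 𝒱)` with (regular) boundary `Y`. The Lie algebra of vector fields is
`𝒱 = {ϱ ∘ X | X ∈ Γ(M; 𝒜)}`. The singular faces of `M` are the boundary hyperfaces not
contained in `Y`. -/
structure LieManifoldWithBoundary where
  /-- the inclusion `Y → M` -/
  incl : Y → M
  contMDiff_incl : ContMDiff (Q m) (Q (m + 1)) ∞ incl
  injective_incl : Function.Injective incl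
  immersion_incl : ∀ y, Function.Injective (mfderiv (Q m) (Q (m + 1)) incl y)
  /-- `Y` is a union of boundary hyperfaces: near each of its points it is the zero set of one of
  the nonnegative coordinates. -/
  hyperface : ∀ y, ∃ i, extChartAt (Q (m + 1)) (incl y) (incl y) i = 0 ∧
    ∀ᶠ q in 𝓝 (incl y), q ∈ range incl ↔ extChartAt (Q (m + 1)) (incl y) q i = 0
  /-- the anchor `ϱ : 𝒜 → TM` -/
  anchor : ∀ x, A x →ₗ[ℝ] TangentSpace (Q (m + 1)) x
  contMDiff_anchor : ∀ X ∈ smoothSections (m + 1) FA A,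
    ContMDiff (Q (m + 1)) (Q (m + 1)).tangent ∞
      fun x => (⟨x, anchor x (X x)⟩ : TangentBundle (Q (m + 1)) M)
  /-- `𝒱` is closed under the Lie bracket. -/
  bracket : ∀ X ∈ smoothSections (m + 1) FA A, ∀ X' ∈ smoothSections (m + 1) FA A,
    ∃ X'' ∈ smoothSections (m + 1) FA A, ∀ x, anchor x (X'' x) =
      VectorField.mlieBracket (Q (m + 1)) (fun z => anchor z (X z)) (fun z => anchor z (X' z)) x
  /-- `𝒜 = TM` over the interior `M₀` of `M`. -/
  bijective_anchor : ∀ x ∈ (Q (m + 1)).interior M, Function.Bijective (anchor x)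
  /-- `𝒜 = TM` over the interior `Y₀` of `Y`. -/
  bijective_anchor_bdry : ∀ y ∈ (Q m).interior Y, Function.Bijective (anchor (incl y))
  /-- The vector fields in `𝒱` are tangent to the singular faces: if the face `{xᵢ = 0}` through
  `x` does not lie in `Y`, then the `i`-th component of the vector field vanishes at `x`. -/
  tangent_singular : ∀ x, ∀ i, extChartAt (Q (m + 1)) x x i = 0 →
    (¬ ∀ᶠ q in 𝓝 x, extChartAt (Q (m + 1)) x q i = 0 → q ∈ range incl) →
    ∀ a : A x, coord (anchor x a) i = 0
  /-- `Y` is transverse: `T_p M = ϱ(𝒜_p) + T_p Y`. -/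
  transverse : ∀ y, ∀ v : TangentSpace (Q (m + 1)) (incl y),
    ∃ (a : A (incl y)) (w : TangentSpace (Q m) y),
      v = anchor (incl y) a + mfderiv (Q m) (Q (m + 1)) incl y w

variable {m M Y FA A}

namespace LieManifoldWithBoundary

variable (L : LieManifoldWithBoundary m M Y FA A)

/-- The fibre `ℬ_y = {a ∈ 𝒜_y | ϱ(a) ∈ T_y Y}` of the Lie algebroid `ℬ ⊆ 𝒜|_Y` of `Y`. -/
def B (y : Y) : Submodule ℝ (A (L.incl y)) :=
  (LinearMap.range (mfderiv (Q m) (Q (m + 1)) L.incl y).toLinearMap).comap (L.anchor (L.incl y))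

/-- The anchor `ℬ → TY`. -/
def anchorB (y : Y) : L.B y →ₗ[ℝ] TangentSpace (Q m) y :=
  (LinearEquiv.ofInjective (mfderiv (Q m) (Q (m + 1)) L.incl y).toLinearMap
      (L.immersion_incl y)).symm.toLinearMap ∘ₗ
    ((L.anchor (L.incl y)).comp (L.B y).subtype).codRestrict _ fun b => b.2

/-- Smooth sections of `ℬ`, so that `𝒲 = {ϱ ∘ X | X ∈ Γ(Y; ℬ)}`. -/
def sectionsB : Set (∀ y, L.B y) :=
  {X | (fun y => (X y : A (L.incl y))) ∈ smoothSectionsAlong (m + 1) FA A m L.incl}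

/-- `nv` is a smooth unit normal field of `Y`: a section of `𝒜|_Y` of length one, orthogonal to
`ℬ`. -/
def IsUnitNormal (nv : ∀ y, A (L.incl y)) : Prop :=
  nv ∈ smoothSectionsAlong (m + 1) FA A m L.incl ∧ ∀ y, ‖nv y‖ = 1 ∧ ∀ b ∈ L.B y, inner ℝ (nv y) b = 0

/-- Boundary symmetry of an operator with principal symbol `σ`, with regard to the normal field
`nv`: with `τ(nv) = 1`, `τ = 0` on `ℬ` and `σ₀ = σ(τ)`, the endomorphisms `S = σ₀⁻¹ σ(ξ)` of `E_y`
and `S' = σ(ξ) σ₀⁻¹` of `F_y` are skew-hermitian for all `ξ ∈ ℬ_y^* = {ξ ∈ 𝒜_y^* | ξ(nv) = 0}`. -/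
def IsBoundarySymmetric {E F : M → Type*}
    [∀ x, NormedAddCommGroup (E x)] [∀ x, InnerProductSpace ℂ (E x)]
    [∀ x, NormedAddCommGroup (F x)] [∀ x, InnerProductSpace ℂ (F x)]
    (nv : ∀ y, A (L.incl y)) (σ : ∀ x, Module.Dual ℝ (A x) → E x →ₗ[ℂ] F x) : Prop :=
  IsEllipticSymbol σ ∧
  ∀ (y : Y) (τ ξ : Module.Dual ℝ (A (L.incl y))),
    τ (nv y) = 1 → (∀ b ∈ L.B y, τ b = 0) → ξ (nv y) = 0 →
    (∀ S : E (L.incl y) →ₗ[ℂ] E (L.incl y), σ (L.incl y) τ ∘ₗ S = σ (L.incl y) ξ →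
      ∀ v w, inner ℂ (S v) w = - inner ℂ v (S w)) ∧
    (∀ S' : F (L.incl y) →ₗ[ℂ] F (L.incl y), S' ∘ₗ σ (L.incl y) τ = σ (L.incl y) ξ →
      ∀ v w, inner ℂ (S' v) w = - inner ℂ v (S' w))

/-- A tubular neighbourhood of `Y` compatible with the Lie structure: a diffeomorphism
`Φ : U → [0, r) × Y` of manifolds with corners, with inverse `Ψ`, which is the identity on `Y` and
for which `∂_u` is (the image under the anchor of) a smooth section of `𝒜` over `U`. -/
structure Tube where
  r : ℝ
  r_pos : 0 < r
  U : Set M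
  isOpen_U : IsOpen U
  Φ : M → ℝ × Y
  Ψ : ℝ × Y → M
  mapsTo_Φ : MapsTo Φ U (Ico 0 r ×ˢ univ)
  mapsTo_Ψ : MapsTo Ψ (Ico 0 r ×ˢ univ) U
  left_inv : ∀ p ∈ U, Ψ (Φ p) = p
  right_inv : ∀ p ∈ Ico 0 r ×ˢ (univ : Set Y), Φ (Ψ p) = p
  contMDiffOn_Φ : ContMDiffOn (Q (m + 1)) (𝓘(ℝ, ℝ).prod (Q m)) ∞ Φ U
  contMDiffOn_Ψ : ContMDiffOn (𝓘(ℝ, ℝ).prod (Q m)) (Q (m + 1)) ∞ Ψ (Ico 0 r ×ˢ univ)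
  Ψ_zero : ∀ y, Ψ (0, y) = L.incl y
  /-- the section of `𝒜` over `U` representing `∂_u` -/
  T : ∀ p : ℝ × Y, A (Ψ p)
  smooth_T : T ∈ smoothSectionsCollar (m + 1) FA A m r Ψ
  anchor_T : ∀ t ∈ Ico 0 r, ∀ y, L.anchor (Ψ (t, y)) (T (t, y)) =
    mfderivWithin 𝓘(ℝ, ℝ) (Q (m + 1)) (fun s => Ψ (s, y)) (Ico 0 r) t (1 : ℝ)

namespace Tube

variable {L} (c : L.Tube)

/-- The tube is normal: `∂_u = nv` along `Y`. -/
def IsNormal (nv : ∀ y, A (L.incl y)) : Prop :=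
  ∀ y, (⟨c.Ψ (0, y), c.T (0, y)⟩ : TotalSpace FA A) = ⟨L.incl y, nv y⟩

/-- The tube is adapted to the measures: `Φ_* μ = |du| ⊗ ν` on `[0, r) × Y`. -/
def IsMeasureProduct [MeasurableSpace M] [MeasurableSpace Y] (μ : Measure M) (ν : Measure Y) :
    Prop :=
  Measure.map c.Φ (μ.restrict c.U) = (volume.restrict (Ico 0 c.r)).prod ν

/-- The covector `du`, pulled back to `𝒜` by the anchor. -/
def du (p : M) : Module.Dual ℝ (A p) :=
  (mfderiv (Q (m + 1)) 𝓘(ℝ, ℝ) (fun q => (c.Φ q).1) p).toLinearMap ∘ₗ L.anchor p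

variable (FE : Type*) [NormedAddCommGroup FE] [NormedSpace ℝ FE]
  (E : M → Type*) [TopologicalSpace (TotalSpace FE E)]
  [∀ x, NormedAddCommGroup (E x)] [∀ x, InnerProductSpace ℂ (E x)] [FiberBundle FE E]

/-- A smooth unitary identification of `E|_U` with the pullback of `E|_Y` to `[0, r) × Y`, equal
to the identity over `Y` (for instance the parallel transport along the curves `u ↦ Ψ(u, y)` of a
metric connection). -/
structure Ident where
  map : ∀ (t : ℝ) (y : Y), E (L.incl y) ≃ₗᵢ[ℂ] E (c.Ψ (t, y))
  smooth_map : ∀ f ∈ smoothSectionsAlong (m + 1) FE E m L.incl,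
    (fun p : ℝ × Y => map p.1 p.2 (f p.2)) ∈ smoothSectionsCollar (m + 1) FE E m c.r c.Ψ
  map_zero : ∀ y v, (⟨c.Ψ (0, y), map 0 y v⟩ : TotalSpace FE E) = ⟨L.incl y, v⟩

variable {c FE E}

/-- A section of `E`, restricted to the slice `u = t` and considered as a section of `E|_Y`. -/
def Ident.slice (θ : c.Ident FE E) (s : ∀ x, E x) (t : ℝ) (y : Y) : E (L.incl y) :=
  (θ.map t y).symm (s (c.Ψ (t, y)))

/-- The normal derivative `∂_t` (one-sided at `t = 0`) of a section of `E` over `U`, considered as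
a family of sections of `E|_Y`. -/
def Ident.normalDeriv (θ : c.Ident FE E) (s : ∀ x, E x) (t : ℝ) (y : Y) : E (L.incl y) :=
  derivWithin (fun u => θ.slice s u y) (Ico 0 c.r) t

/-- `σ_t(y) : E_y → F_y`, the value `σ(du)` at the point `Ψ(t, y)` of the symbol `σ`, in the given
identifications. -/
def symbolSlice {FF : Type*} [NormedAddCommGroup FF] [NormedSpace ℝ FF]
    {F : M → Type*} [TopologicalSpace (TotalSpace FF F)]
    [∀ x, NormedAddCommGroup (F x)] [∀ x, InnerProductSpace ℂ (F x)] [FiberBundle FF F]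
    (θE : c.Ident FE E) (θF : c.Ident FF F) (σ : ∀ x, Module.Dual ℝ (A x) → E x →ₗ[ℂ] F x)
    (t : ℝ) (y : Y) : E (L.incl y) →ₗ[ℂ] F (L.incl y) :=
  (θF.map t y).symm.toLinearEquiv.toLinearMap ∘ₗ σ (c.Ψ (t, y)) (c.du (c.Ψ (t, y))) ∘ₗ
    (θE.map t y).toLinearEquiv.toLinearMap

end Tube

/-- `Diff¹_𝒱(M; E, F)`, together with the principal symbol. -/
abbrev HasSymbolV (FE : Type*) [NormedAddCommGroup FE] [NormedSpace ℝ FE]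
    (E : M → Type*) [TopologicalSpace (TotalSpace FE E)]
    [∀ x, NormedAddCommGroup (E x)] [∀ x, InnerProductSpace ℂ (E x)] [FiberBundle FE E]
    (FF : Type*) [NormedAddCommGroup FF] [NormedSpace ℝ FF]
    (F : M → Type*) [TopologicalSpace (TotalSpace FF F)]
    [∀ x, NormedAddCommGroup (F x)] [∀ x, InnerProductSpace ℂ (F x)] [FiberBundle FF F]
    (P : (∀ x, E x) → ∀ x, F x) (σ : ∀ x, Module.Dual ℝ (A x) → E x →ₗ[ℂ] F x) : Prop :=
  HasSymbol L.anchor (smoothSections (m + 1) FA A) (smoothSections (m + 1) FE E) (smoothSections (m + 1) FF F) P σ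

section W

variable (FE : Type*) [NormedAddCommGroup FE] [NormedSpace ℝ FE]
  (E : M → Type*) [TopologicalSpace (TotalSpace FE E)]
  [∀ x, NormedAddCommGroup (E x)] [∀ x, InnerProductSpace ℂ (E x)] [FiberBundle FE E]

/-- `Diff¹_𝒲(Y; E|_Y)`: the `𝒲`-differential operators of order at most one. -/
abbrev IsDiffOpW (P : (∀ y, E (L.incl y)) → ∀ y, E (L.incl y)) : Prop :=
  IsDiffOp L.anchorB L.sectionsB (smoothSectionsAlong (m + 1) FE E m L.incl)
    (smoothSectionsAlong (m + 1) FE E m L.incl) P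

/-- Elliptic first order `𝒲`-differential operators on `E|_Y`. -/
abbrev IsEllipticOpW (P : (∀ y, E (L.incl y)) → ∀ y, E (L.incl y)) : Prop :=
  IsEllipticOp L.anchorB L.sectionsB (smoothSectionsAlong (m + 1) FE E m L.incl)
    (smoothSectionsAlong (m + 1) FE E m L.incl) P

end W

end LieManifoldWithBoundary

end LieManifold

end LieMfd

end

noncomputable section

namespace LieMfd

set_option linter.unusedSectionVars false
set_option synthInstance.maxHeartbeats 200000
open Finset (sum_congr mul_sum sum_comm sum_add_distrib sum_le_sum smul_sum sum_mul sum_sub_distrib card_univ sum_smul sum_eq_zero sum_const sum_eq_single sum_nonneg sum_ite_eq)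
open EuclideanSpace (single proj)
open InnerProductSpace (gramSchmidt gramSchmidt_orthogonal)
open Real (sqrt exp)
open Matrix (of det trace)
open ContinuousLinearMap (restrictScalarsL opNorm_le_bound)

notation:max "ℝ^" n:max => EuclideanSpace ℝ (Fin n)
notation:max "ℝ₊^" n:max => EuclideanQuadrant n
notation:max "κ" n:max => extChartAt (Q n)
notation:max "C∞(" n ", " F ")" => ContMDiff (Q n) 𝓘(ℝ, F) ∞
notation:max "MD(" n ", " F ")" => MDifferentiableAt (Q n) 𝓘(ℝ, F)
notation "⟪" x ", " y "⟫" => inner ℂ x y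
notation "⟪" x "; " y "⟫" => inner ℝ x y

/-! ### Volterra integral equations on an interval -/

instance curveNormedAddCommGroup {T : ℝ} {X : Type*} [NormedAddCommGroup X] :
    NormedAddCommGroup C(Icc 0 T, X) := inferInstance

instance curveNormedSpace {T : ℝ} {X : Type*} [NormedAddCommGroup X] [NormedSpace ℝ X] :
    NormedSpace ℝ C(Icc 0 T, X) := inferInstance

section Volterra

variable {T : ℝ} {X Y : Type*} [NormedAddCommGroup X] [NormedSpace ℝ X]
  [NormedAddCommGroup Y] [NormedSpace ℝ Y]

/-- The operator `f ↦ ∫₀ᵗ f` on continuous curves over `[0, T]`. -/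
def volterra (hT : 0 ≤ T) : C(Icc 0 T, X) →L[ℝ] C(Icc 0 T, X) :=
  LinearMap.mkContinuous
    { toFun := fun f => ⟨fun t => ∫ s in (0 : ℝ)..t, IccExtend hT f s,
        (intervalIntegral.continuous_primitive (fun a b =>
          (f.continuous.Icc_extend' (h := hT)).intervalIntegrable a b) 0).comp continuous_subtype_val⟩
      map_add' := fun f g => by
        ext t
        have hf := (f.continuous.Icc_extend' (h := hT)).intervalIntegrable (μ := volume) 0 t
        have hg := (g.continuous.Icc_extend' (h := hT)).intervalIntegrable (μ := volume) 0 t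
        simpa [IccExtend, Function.comp_def] using intervalIntegral.integral_add hf hg
      map_smul' := fun c f => by
        ext t
        simp [IccExtend] } T (fun f => by
    refine (ContinuousMap.norm_le _ (by positivity)).2 fun t => ?_
    have : ‖∫ s in (0 : ℝ)..t, IccExtend hT f s‖ ≤ ‖f‖ * |(t : ℝ) - 0| :=
      intervalIntegral.norm_integral_le_of_norm_le_const fun s _ => f.norm_coe_le_norm _
    calc _ ≤ ‖f‖ * |(t : ℝ) - 0| := this
      _ ≤ T * ‖f‖ := by
        rw [sub_zero, abs_of_nonneg t.2.1, mul_comm]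
        exact mul_le_mul_of_nonneg_right t.2.2 (norm_nonneg _))

lemma volterra_apply (hT : 0 ≤ T) (f : C(Icc 0 T, X)) (t : Icc 0 T) : volterra hT f t = ∫ s in (0 : ℝ)..t, IccExtend hT f s := rfl

/-- Pointwise application of a curve of operators to a curve of vectors. -/
def mulOp : C(Icc 0 T, X →L[ℝ] Y) →L[ℝ] C(Icc 0 T, X) →L[ℝ] C(Icc 0 T, Y) :=
  LinearMap.mkContinuous₂
    (LinearMap.mk₂ ℝ (fun (a : C(Icc 0 T, X →L[ℝ] Y)) (f : C(Icc 0 T, X)) => (⟨fun t => a t (f t), a.continuous.clm_apply f.continuous⟩ :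
        C(Icc 0 T, Y)))
      (fun a b f => by ext t; simp) (fun c a f => by ext t; simp)
      (fun a f g => by ext t; simp) (fun c a f => by ext t; simp)) 1
    (fun a f => by
      refine (ContinuousMap.norm_le _ (by positivity)).2 fun t => ?_
      refine ((a t).le_opNorm _).trans ?_
      rw [one_mul]
      exact mul_le_mul (a.norm_coe_le_norm t) (f.norm_coe_le_norm t) (norm_nonneg (f t)) (norm_nonneg a))

@[simp] lemma mulOp_apply (a : C(Icc 0 T, X →L[ℝ] Y)) (f : C(Icc 0 T, X)) (t : Icc 0 T) : mulOp a f t = a t (f t) := rfl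

lemma norm_volterra_mulOp_pow (hT : 0 ≤ T) (a : C(Icc 0 T, X →L[ℝ] X)) (n : ℕ) (f : C(Icc 0 T, X)) (t : Icc 0 T) :
    ‖((volterra hT ∘L mulOp a) ^ n) f t‖ ≤ (‖a‖ * t) ^ n / n.factorial * ‖f‖ := by
  induction n generalizing t with
  | zero => simpa using f.norm_coe_le_norm t
  | succ n ih =>
    rw [pow_succ', mul_apply_eq_comp]
    set g := ((volterra hT ∘L mulOp a) ^ n) f with hg
    have h1 : (volterra hT ∘L mulOp a) g t = ∫ s in (0 : ℝ)..t, IccExtend hT (mulOp a g) s := rfl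
    rw [h1]
    have h2 : ∀ s ∈ Icc (0 : ℝ) t, ‖IccExtend hT (mulOp a g) s‖ ≤ ‖a‖ * ((‖a‖ * s) ^ n / n.factorial * ‖f‖) := by
      intro s hs
      have hsT : s ∈ Icc 0 T := ⟨hs.1, hs.2.trans t.2.2⟩
      rw [IccExtend_of_mem hT _ hsT, mulOp_apply]
      exact ((a _).le_opNorm _).trans (mul_le_mul (a.norm_coe_le_norm _) (ih ⟨s, hsT⟩) (norm_nonneg _) (norm_nonneg a))
    refine (intervalIntegral.norm_integral_le_of_norm_le t.2.1 (g := fun s => ‖a‖ * ((‖a‖ * s) ^ n / n.factorial * ‖f‖))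
      (.of_forall fun s hs => h2 s (Ioc_subset_Icc_self hs)) ?_).trans ?_
    · exact Continuous.intervalIntegrable (by fun_prop) _ _
    · have : ∀ s : ℝ, ‖a‖ * ((‖a‖ * s) ^ n / n.factorial * ‖f‖) = (‖a‖ ^ (n + 1) / n.factorial * ‖f‖) * s ^ n := fun s => by ring
      simp_rw [this]
      rw [intervalIntegral.integral_const_mul, integral_pow, Nat.factorial_succ]
      have hn : (n.factorial : ℝ) ≠ 0 := by positivity
      have hn' : (n + 1 : ℝ) ≠ 0 := by positivity
      apply le_of_eq
      push_cast
      field_simp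
      ring

variable [CompleteSpace X]

lemma isUnit_one_sub_volterra (hT : 0 ≤ T) (a : C(Icc 0 T, X →L[ℝ] X)) : IsUnit (1 - volterra hT ∘L mulOp a) := by
  set S := volterra hT ∘L mulOp a with hS
  obtain ⟨n, hn⟩ : ∃ n : ℕ, (‖a‖ * T) ^ n / n.factorial < 1 := ((FloorSemiring.tendsto_pow_div_factorial_atTop (‖a‖ * T)).eventually
      (gt_mem_nhds one_pos)).exists
  have hlt : ‖S ^ n‖ < 1 := by
    refine lt_of_le_of_lt (opNorm_le_bound _ (by positivity) fun f => ?_) hn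
    refine (ContinuousMap.norm_le _ (by positivity)).2 fun t => ?_
    refine (norm_volterra_mulOp_pow hT a n f t).trans ?_
    have : (‖a‖ * t) ≤ ‖a‖ * T := mul_le_mul_of_nonneg_left t.2.2 (norm_nonneg a)
    have h0 : 0 ≤ ‖a‖ * (t : ℝ) := mul_nonneg (norm_nonneg a) t.2.1
    gcongr
  have h1 : IsUnit (1 - S ^ n) := (Units.oneSub _ hlt).isUnit
  have h2 : (1 - S) * ∑ i ∈ Finset.range n, S ^ i = 1 - S ^ n := mul_neg_geom_sum S n
  have h3 : Commute (1 - S) (∑ i ∈ Finset.range n, S ^ i) := by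
    refine Commute.sum_right _ _ _ fun i _ => ?_
    exact ((Commute.one_left _).sub_left ((Commute.refl S).pow_right i))
  rw [← h2] at h1
  exact (h3.isUnit_mul_iff.1 h1).1

lemma hasDerivWithinAt_of_eq_volterra (hT : 0 ≤ T) {f g : C(Icc 0 T, X)} {x : X}
    (h : f = ContinuousMap.const _ x + volterra hT g) (t : Icc 0 T) :
    HasDerivWithinAt (IccExtend hT f) (g t) (Icc 0 T) t := by
  have hc := g.continuous.Icc_extend' (h := hT)
  have h1 : HasDerivAt (fun u => x + ∫ s in (0 : ℝ)..u, IccExtend hT g s) (IccExtend hT g t) t :=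
    (intervalIntegral.integral_hasDerivAt_right (hc.intervalIntegrable _ _)
      hc.aestronglyMeasurable.stronglyMeasurableAtFilter hc.continuousAt).const_add x
  rw [IccExtend_of_mem hT g t.2] at h1
  refine h1.hasDerivWithinAt.congr (fun u hu => ?_) ?_
  · rw [IccExtend_of_mem hT f hu, h]; rfl
  · rw [IccExtend_of_mem hT f t.2, h]; rfl

lemma eq_volterra_of_hasDerivWithinAt (hT : 0 ≤ T) {f g : C(Icc 0 T, X)}
    (h : ∀ t : Icc 0 T, HasDerivWithinAt (IccExtend hT f) (g t) (Icc 0 T) t) :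
    f = ContinuousMap.const _ (f ⟨0, left_mem_Icc.2 hT⟩) + volterra hT g := by
  have hc := g.continuous.Icc_extend' (h := hT)
  ext t
  have := intervalIntegral.integral_eq_sub_of_hasDeriv_right_of_le (f := IccExtend hT f)
    (f' := IccExtend hT g) t.2.1 (f.continuous.Icc_extend' (h := hT)).continuousOn
    (fun s hs => by
      have hsT : s ∈ Icc 0 T := ⟨hs.1.le, hs.2.le.trans t.2.2⟩
      have h' := h ⟨s, hsT⟩
      rw [← IccExtend_of_mem hT g hsT] at h'
      exact (h'.hasDerivAt (Icc_mem_nhds hs.1 (hs.2.trans_le t.2.2))).hasDerivWithinAt)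
    (hc.intervalIntegrable _ _)
  simp only [ContinuousMap.add_apply, ContinuousMap.const_apply, volterra_apply]
  rw [this, IccExtend_of_mem hT f t.2, IccExtend_of_mem hT f (left_mem_Icc.2 hT)]
  simp

end Volterra

/-! ### Superposition operators -/

section Superposition

lemma hasFDerivAt_superposition {T : ℝ} {X Y : Type*} [NormedAddCommGroup X] [NormedSpace ℝ X]
    [NormedAddCommGroup Y] [NormedSpace ℝ Y] {V : X → Y} {V' : X → X →L[ℝ] Y}
    (hV : ∀ x, HasFDerivAt V (V' x) x) (hV' : Continuous V') (γ : C(Icc 0 T, X)) :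
    HasFDerivAt (fun γ : C(Icc 0 T, X) => (⟨fun t => V (γ t), (continuous_iff_continuousAt.2 fun x =>
        (hV x).continuousAt).comp γ.continuous⟩ : C(Icc 0 T, Y)))
      (mulOp ((⟨V', hV'⟩ : C(X, X →L[ℝ] Y)).comp γ)) γ := by
  rw [hasFDerivAt_iff_isLittleO_nhds_zero, Asymptotics.isLittleO_iff]
  intro ε hε
  have hcont : Continuous fun γ : C(Icc 0 T, X) => (⟨V', hV'⟩ : C(X, X →L[ℝ] Y)).comp γ := ContinuousMap.continuous_postcomp _
  have hc := (Metric.continuousAt_iff (f := fun γ : C(Icc 0 T, X) =>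
    (⟨V', hV'⟩ : C(X, X →L[ℝ] Y)).comp γ) (a := γ)).1 (hcont.continuousAt (x := γ)) ε hε
  obtain ⟨δ, hδ, h⟩ := hc
  filter_upwards [Metric.ball_mem_nhds (0 : C(Icc 0 T, X)) hδ] with η hη
  refine (ContinuousMap.norm_le _ (by positivity)).2 fun t => ?_
  have key : ∀ z ∈ segment ℝ (γ t) (γ t + η t), ‖V' z - V' (γ t)‖ ≤ ε := by
    intro z hz
    rw [segment_eq_image'] at hz
    obtain ⟨s, hs, rfl⟩ := hz
    have h1 : dist (γ + s • η) γ < δ := by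
      rw [dist_eq_norm, add_sub_cancel_left, norm_smul, Real.norm_of_nonneg hs.1]
      have : ‖η‖ < δ := by simpa using hη
      exact (mul_le_of_le_one_left (norm_nonneg _) hs.2).trans_lt this
    have h2 := (ContinuousMap.dist_apply_le_dist t).trans_lt (h h1)
    rw [dist_eq_norm] at h2
    simpa using h2.le
  have := (convex_segment (γ t) (γ t + η t)).norm_image_sub_le_of_norm_hasFDerivWithin_le'
    (fun z _ => (hV z).hasFDerivWithinAt) key (left_mem_segment ℝ _ _) (right_mem_segment ℝ _ _)
  simp only [add_sub_cancel_left] at this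
  calc _ = ‖V (γ t + η t) - V (γ t) - V' (γ t) (η t)‖ := rfl
    _ ≤ ε * ‖η t‖ := this
    _ ≤ ε * ‖η‖ := mul_le_mul_of_nonneg_left (η.norm_coe_le_norm t) hε.le

lemma contDiff_superposition_nat {T : ℝ} {X : Type} [NormedAddCommGroup X] [NormedSpace ℝ X]
    (n : ℕ) : ∀ {Y : Type} [NormedAddCommGroup Y] [NormedSpace ℝ Y] (V : C(X, Y)),
    ContDiff ℝ n V → ContDiff ℝ n fun γ : C(Icc 0 T, X) => V.comp γ := by
  induction n with
  | zero =>
    intro Y _ _ V _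
    exact contDiff_zero.2 (ContinuousMap.continuous_postcomp V)
  | succ n ih =>
    intro Y _ _ V hV
    have h1 : ContDiff ℝ n (fderiv ℝ V) := hV.fderiv_right (by norm_cast)
    have hd : ∀ x, HasFDerivAt V (fderiv ℝ V x) x := fun x => (hV.differentiable (by norm_cast)).differentiableAt.hasFDerivAt
    refine contDiff_succ_iff_hasFDerivAt.2 ⟨fun γ => mulOp ((⟨fderiv ℝ V, h1.continuous⟩ :
      C(X, X →L[ℝ] Y)).comp γ), ?_, fun γ => hasFDerivAt_superposition hd h1.continuous γ⟩
    exact mulOp.contDiff.comp (ih (⟨fderiv ℝ V, h1.continuous⟩ : C(X, X →L[ℝ] Y)) h1)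

lemma contDiff_superposition {T : ℝ} {X Y : Type} [NormedAddCommGroup X] [NormedSpace ℝ X]
    [NormedAddCommGroup Y] [NormedSpace ℝ Y] (V : C(X, Y)) (hV : ContDiff ℝ ∞ V) :
    ContDiff ℝ ∞ fun γ : C(Icc 0 T, X) => V.comp γ :=
  contDiff_infty.2 fun n => contDiff_superposition_nat n V (hV.of_le (by exact_mod_cast le_top))

end Superposition

/-! ### The elliptic estimate for constant coefficients -/

open scoped FourierTransform LineDeriv SchwartzMap
open SchwartzMap

section ConstCoeff

variable {K : ℕ} {H H' : Type} [NormedAddCommGroup H] [InnerProductSpace ℂ H] [CompleteSpace H]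
  [NormedAddCommGroup H'] [InnerProductSpace ℂ H'] [CompleteSpace H']

/-- A constant coefficient first order operator, applied to a Schwartz function. -/
def constCoeffOp (q : Fin K → H →L[ℂ] H') (f : 𝓢(ℝ^K, H)) :
    𝓢(ℝ^K, H') :=
  ∑ j, postcompCLM (q j) (∂_{single j (1 : ℝ)} f : 𝓢(ℝ^K, H))

lemma fourier_sum_clm_lineDeriv (q : Fin K → H →L[ℂ] H') (f : 𝓢(ℝ^K, H)) (ξ : ℝ^K) : 𝓕 (constCoeffOp q f) ξ =
      (2 * Real.pi * Complex.I) • (∑ j, (ξ j : ℂ) • q j) (𝓕 f ξ) := by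
  have h1 : ∀ g : 𝓢(ℝ^K, H), ∀ L : H →L[ℂ] H', 𝓕 (postcompCLM L g) ξ = L (𝓕 g ξ) := by
    intro g L
    rw [fourier_coe, fourier_coe, Real.fourier_eq, Real.fourier_eq, ← L.integral_comp_comm]
    · refine integral_congr_ae (.of_forall fun x => ?_)
      simp [Circle.smul_def]
    · exact (Real.fourierIntegral_convergent_iff ξ).2 g.integrable
  have h2 : 𝓕 (constCoeffOp q f) = ∑ j, 𝓕 (postcompCLM (q j) (∂_{single j (1 : ℝ)} f : 𝓢(ℝ^K, H))) :=
    map_sum (FourierTransform.fourierCLM ℂ 𝓢(ℝ^K, H')) _ _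
  rw [h2]
  simp only [_root_.sum_apply, h1, fourier_lineDerivOp_eq]
  have : ∀ j, (inner ℝ · (single j (1 : ℝ)) : ℝ^K → ℝ).HasTemperateGrowth := fun j => by fun_prop
  simp only [this, smulLeftCLM_apply_apply, smul_sum, map_smul, FunLike.coe_smul, Pi.smul_apply, sum_apply]
  simp [this, smul_sum, EuclideanSpace.inner_single_right]

theorem constCoeff_estimate (q : Fin K → H →L[ℂ] H') (P : Fin K → Fin K → ℝ) (c : ℝ) (hq : ∀ (η : ℝ^K) (w : H),
      c * (∑ k, (∑ j, P k j * η j) ^ 2) * ‖w‖ ^ 2 ≤ ‖∑ j, (η j : ℂ) • q j w‖ ^ 2)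
    (h : ℝ^K → H) (hs : ContDiff ℝ ∞ h) (hc : HasCompactSupport h) :
    c * ∑ k, ∫ v, ‖∑ j, P k j • fderiv ℝ h v (single j 1)‖ ^ 2 ≤ ∫ v, ‖∑ j, q j (fderiv ℝ h v (single j 1))‖ ^ 2 := by
  set f : 𝓢(ℝ^K, H) := hc.toSchwartzMap hs with hf
  have hfd : ∀ j v, (∂_{single j (1 : ℝ)} f : 𝓢(ℝ^K, H)) v = fderiv ℝ h v (single j 1) := fun j v => rfl
  have e1 : ∀ {H' : Type} [NormedAddCommGroup H'] [InnerProductSpace ℂ H'] [CompleteSpace H'],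
      ∀ q : Fin K → H →L[ℂ] H', ∫ v, ‖∑ j, q j (fderiv ℝ h v (single j 1))‖ ^ 2 =
      ∫ ξ : ℝ^K, ‖𝓕 (constCoeffOp q f) ξ‖ ^ 2 := by
    intro H' _ _ _ q
    rw [integral_norm_sq_fourier]
    refine integral_congr_ae (.of_forall fun v => ?_)
    simp [constCoeffOp, _root_.sum_apply, hfd]
  have e2 : ∀ k, ∫ v, ‖∑ j, P k j • fderiv ℝ h v (single j 1)‖ ^ 2 = ∫ ξ : ℝ^K, ‖𝓕 (constCoeffOp
        (fun j => (P k j : ℂ) • ContinuousLinearMap.id ℂ H) f) ξ‖ ^ 2 := by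
    intro k
    rw [← e1]
    simp
  have hint : ∀ {H' : Type} [NormedAddCommGroup H'] [InnerProductSpace ℂ H'] [CompleteSpace H'],
      ∀ g : 𝓢(ℝ^K, H'), Integrable fun ξ => ‖g ξ‖ ^ 2 := by
    intro H' _ _ _ g
    have := (g.memLp 2 volume).integrable_norm_pow (by norm_num)
    simpa using this
  rw [e1]
  simp_rw [e2]
  rw [← integral_finsetSum _ (fun k _ => hint _), ← integral_const_mul]
  refine integral_mono ((integrable_finsetSum _ fun k _ => hint _).const_mul _) (hint _) fun ξ => ?_
  simp only [fourier_sum_clm_lineDeriv, norm_smul, mul_pow, ← mul_sum]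
  have h1 : ∀ k, ‖(∑ j, (ξ j : ℂ) • (P k j : ℂ) • ContinuousLinearMap.id ℂ H) (𝓕 f ξ)‖ ^ 2 = (∑ j, P k j * ξ j) ^ 2 * ‖𝓕 f ξ‖ ^ 2 := by
    intro k
    have : (∑ j, (ξ j : ℂ) • (P k j : ℂ) • ContinuousLinearMap.id ℂ H) (𝓕 f ξ) = ((∑ j, P k j * ξ j : ℝ) : ℂ) • 𝓕 f ξ := by
      simp only [_root_.sum_apply, smul_apply, ContinuousLinearMap.id_apply, smul_smul, Complex.ofReal_sum, Complex.ofReal_mul, sum_smul]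
      exact sum_congr rfl fun j _ => by rw [mul_comm]
    rw [this, norm_smul, mul_pow, Complex.norm_real, Real.norm_eq_abs, sq_abs]
  have h2 := hq ξ (𝓕 f ξ)
  simp_rw [h1]
  have h3 : (∑ j, (ξ j : ℂ) • q j) (𝓕 f ξ) = ∑ j, (ξ j : ℂ) • q j (𝓕 f ξ) := by
    simp [_root_.sum_apply]
  rw [h3, ← sum_mul]
  calc _ = (‖(2 : ℂ)‖ ^ 2 * ‖(Real.pi : ℂ)‖ ^ 2 * ‖Complex.I‖ ^ 2) *
      (c * (∑ k, (∑ j, P k j * ξ j) ^ 2) * ‖𝓕 f ξ‖ ^ 2) := by simp only [norm_mul]; ring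
    _ ≤ _ := by
      simp only [norm_mul, mul_pow]
      exact mul_le_mul_of_nonneg_left h2 (by positivity)

end ConstCoeff

/-! ### Flows of linear families of vector fields -/

/-- A finite family of bounded smooth vector fields with bounded derivative, closed under brackets
with bounded continuous structure functions. -/
structure BoundedFrame (K : ℕ) (E₀ : Type) [NormedAddCommGroup E₀] [NormedSpace ℝ E₀] where
  V : Fin K → E₀ → E₀
  contDiff_V : ∀ j, ContDiff ℝ ∞ (V j)
  bound : ℝ
  bound_nonneg : 0 ≤ bound
  norm_V_le : ∀ j x, ‖V j x‖ ≤ bound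
  norm_fderiv_V_le : ∀ j x, ‖fderiv ℝ (V j) x‖ ≤ bound
  c : Fin K → Fin K → Fin K → E₀ → ℝ
  continuous_c : ∀ i j k, Continuous (c i j k)
  abs_c_le : ∀ i j k x, |c i j k x| ≤ bound
  bracket : ∀ i j x, fderiv ℝ (V j) x (V i x) - fderiv ℝ (V i) x (V j x) = ∑ k, c i j k x • V k x

namespace BoundedFrame

section Flow

variable {K : ℕ} {E₀ : Type} [NormedAddCommGroup E₀] [NormedSpace ℝ E₀] [CompleteSpace E₀]
  (W : BoundedFrame K E₀)

/-- The vector field `∑ vⱼ Vⱼ`. -/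
def field (v : ℝ^K) (x : E₀) : E₀ := ∑ j, v j • W.V j x

lemma differentiable_V (j : Fin K) : Differentiable ℝ (W.V j) := (W.contDiff_V j).differentiable (by simp)

lemma contDiff_field (v : ℝ^K) : ContDiff ℝ ∞ (W.field v) := ContDiff.sum fun j _ => (W.contDiff_V j).const_smul _

lemma fderiv_field (v : ℝ^K) (x : E₀) : fderiv ℝ (W.field v) x = ∑ j, v j • fderiv ℝ (W.V j) x := by
  have : HasFDerivAt (W.field v) (∑ j, v j • fderiv ℝ (W.V j) x) x :=
    HasFDerivAt.fun_sum fun j _ => ((W.differentiable_V j).differentiableAt.hasFDerivAt).const_smul _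
  exact this.fderiv

lemma abs_apply_le (v : ℝ^K) (j : Fin K) : |v j| ≤ ‖v‖ := PiLp.norm_apply_le v j

lemma norm_field_le (v : ℝ^K) (x : E₀) : ‖W.field v x‖ ≤ K * (‖v‖ * W.bound) := by
  refine (norm_sum_le _ _).trans ((sum_le_sum (g := fun _ => ‖v‖ * W.bound) fun j _ => ?_).trans (by simp))
  rw [norm_smul]
  exact mul_le_mul (abs_apply_le v j) (W.norm_V_le j x) (norm_nonneg _) (norm_nonneg _)

lemma norm_fderiv_field_le (v : ℝ^K) (x : E₀) : ‖fderiv ℝ (W.field v) x‖ ≤ K * (‖v‖ * W.bound) := by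
  rw [fderiv_field]
  refine (norm_sum_le _ _).trans ((sum_le_sum (g := fun _ => ‖v‖ * W.bound) fun j _ => ?_).trans (by simp))
  rw [norm_smul]
  exact mul_le_mul (abs_apply_le v j) (W.norm_fderiv_V_le j x) (norm_nonneg _) (norm_nonneg _)

lemma lipschitz_field (v : ℝ^K) : LipschitzWith (K * (‖v‖ * W.bound)).toNNReal (W.field v) := by
  refine lipschitzWith_of_nnnorm_fderiv_le ((W.contDiff_field v).differentiable (by simp)) fun x => ?_
  rw [← NNReal.coe_le_coe, coe_nnnorm, Real.coe_toNNReal _ (by have := W.bound_nonneg; positivity)]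
  exact W.norm_fderiv_field_le v x

/-- The vector fields as continuous maps. -/
def VC (j : Fin K) : C(E₀, E₀) := ⟨W.V j, (W.contDiff_V j).continuous⟩

/-- The integral equation for flow lines. -/
def eqn (p : (ℝ^K × E₀) × C(Icc (0 : ℝ) 1, E₀)) : C(Icc (0 : ℝ) 1, E₀) :=
  p.2 - ContinuousMap.const _ p.1.2 - volterra zero_le_one (∑ j, p.1.1 j • (W.VC j).comp p.2)

/-- Constant curves. -/
def constL : E₀ →L[ℝ] C(Icc (0 : ℝ) 1, E₀) :=
  LinearMap.mkContinuous
    { toFun := fun x => ContinuousMap.const _ x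
      map_add' := fun _ _ => rfl
      map_smul' := fun _ _ => rfl } 1 (fun x => by
      rw [one_mul]; exact (ContinuousMap.norm_le _ (norm_nonneg _)).2 fun _ => le_rfl)

lemma contDiff_eqn : ContDiff ℝ ∞ W.eqn := by
  have h1 : ContDiff ℝ ∞ fun p : (ℝ^K × E₀) × C(Icc (0 : ℝ) 1, E₀) => constL p.1.2 :=
    (ContinuousLinearMap.contDiff (constL (E₀ := E₀))).comp (contDiff_snd.comp contDiff_fst)
  have h2 : ∀ j, ContDiff ℝ ∞ fun p : (ℝ^K × E₀) × C(Icc (0 : ℝ) 1, E₀) => p.1.1 j • (W.VC j).comp p.2 := fun j => by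
    have h3 : ContDiff ℝ ∞ fun p : (ℝ^K × E₀) × C(Icc (0 : ℝ) 1, E₀) =>
        (W.VC j).comp p.2 := (contDiff_superposition (W.VC j) (W.contDiff_V j)).comp contDiff_snd
    have h4 : ContDiff ℝ ∞ fun p : (ℝ^K × E₀) × C(Icc (0 : ℝ) 1, E₀) =>
        p.1.1 j := (proj (𝕜 := ℝ) j).contDiff.comp (contDiff_fst.comp contDiff_fst)
    exact h4.smul h3
  exact (contDiff_snd.sub h1).sub ((volterra (X := E₀) zero_le_one).contDiff.comp (ContDiff.sum fun j _ => h2 j))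

/-- The derivative of the field along a curve. -/
def DW (v : ℝ^K) (γ : C(Icc (0 : ℝ) 1, E₀)) :
    C(Icc (0 : ℝ) 1, E₀ →L[ℝ] E₀) :=
  (⟨fderiv ℝ (W.field v), (W.contDiff_field v).continuous_fderiv (by simp)⟩ : C(E₀, E₀ →L[ℝ] E₀)).comp γ

lemma hasFDerivAt_sum_superposition (v : ℝ^K) (γ : C(Icc (0 : ℝ) 1, E₀)) :
    HasFDerivAt (fun γ : C(Icc (0 : ℝ) 1, E₀) => ∑ j, v j • (W.VC j).comp γ) (mulOp (W.DW v γ)) γ := by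
  have := hasFDerivAt_superposition (T := 1) (V := W.field v) (V' := fderiv ℝ (W.field v))
    (fun x => ((W.contDiff_field v).differentiable (by simp)).differentiableAt.hasFDerivAt)
    ((W.contDiff_field v).continuous_fderiv (by simp)) γ
  convert! this using 1
  ext γ t
  simp [field, VC]

lemma fderiv_eqn_inr (p : (ℝ^K × E₀) × C(Icc (0 : ℝ) 1, E₀)) :
    fderiv ℝ W.eqn p ∘L .inr ℝ _ _ = 1 - volterra zero_le_one ∘L mulOp (W.DW p.1.1 p.2) := by
  have h1 : HasFDerivAt (fun γ => W.eqn (p.1, γ)) (fderiv ℝ W.eqn p ∘L .inr ℝ _ _) p.2 :=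
    ((W.contDiff_eqn.differentiable (by simp)).differentiableAt.hasFDerivAt).comp p.2 (hasFDerivAt_prodMk_right p.1 p.2)
  have h2 : HasFDerivAt (fun γ => W.eqn (p.1, γ)) (1 - volterra zero_le_one ∘L mulOp (W.DW p.1.1 p.2)) p.2 := by
    have := ((hasFDerivAt_id p.2).sub_const (ContinuousMap.const _ p.1.2)).sub
      ((volterra (X := E₀) zero_le_one).hasFDerivAt.comp p.2 (W.hasFDerivAt_sum_superposition p.1.1 p.2))
    exact this
  exact h1.unique h2

lemma eqn_eq_zero_iff (v : ℝ^K) (x : E₀) (γ : C(Icc (0 : ℝ) 1, E₀)) : W.eqn ((v, x), γ) = 0 ↔ γ ⟨0, left_mem_Icc.2 zero_le_one⟩ = x ∧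
      ∀ t : Icc (0 : ℝ) 1, HasDerivWithinAt (IccExtend zero_le_one γ) (W.field v (γ t)) (Icc 0 1) t := by
  set g : C(Icc (0 : ℝ) 1, E₀) := ∑ j, v j • (W.VC j).comp γ with hg
  have hgt : ∀ t, g t = W.field v (γ t) := fun t => by simp [hg, field, VC]
  have h : W.eqn ((v, x), γ) = 0 ↔ γ = ContinuousMap.const _ x + volterra zero_le_one g := by
    rw [eqn, sub_sub, sub_eq_zero]
  rw [h]
  constructor
  · intro h
    refine ⟨?_, fun t => hgt t ▸ hasDerivWithinAt_of_eq_volterra _ h t⟩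
    rw [h]; simp [volterra_apply]
  · rintro ⟨h0, h1⟩
    have := eq_volterra_of_hasDerivWithinAt zero_le_one (f := γ) (g := g) fun t => hgt t ▸ h1 t
    rwa [h0] at this

lemma exists_curve (v : ℝ^K) (x : E₀) : ∃ γ, W.eqn ((v, x), γ) = 0 := by
  set L : NNReal := (K * (‖v‖ * W.bound)).toNNReal with hL
  have hLc : (L : ℝ) = K * (‖v‖ * W.bound) := Real.coe_toNNReal _ (by have := W.bound_nonneg; positivity)
  have hpl : IsPicardLindelof (fun _ : ℝ => W.field v) (⟨0, left_mem_Icc.2 zero_le_one⟩ : Icc (0 : ℝ) 1) x L 0 L L :=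
    IsPicardLindelof.of_time_independent (fun y _ => (W.norm_field_le v y).trans hLc.ge) (W.lipschitz_field v).lipschitzOnWith (by simp)
  obtain ⟨α, h0, hα⟩ := hpl.exists_eq_forall_mem_Icc_hasDerivWithinAt₀
  refine ⟨⟨fun t => α t, continuousOn_iff_continuous_domRestrict.1
    fun t ht => (hα t ht).continuousWithinAt⟩, (W.eqn_eq_zero_iff v x _).2 ⟨h0, fun t => ?_⟩⟩
  refine (hα t t.2).congr (fun u hu => ?_) ?_
  · rw [IccExtend_of_mem _ _ hu]; rfl
  · rw [IccExtend_of_mem _ _ t.2]; rfl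

lemma curve_unique {v : ℝ^K} {x : E₀} {γ γ' : C(Icc (0 : ℝ) 1, E₀)} (h : W.eqn ((v, x), γ) = 0) (h' : W.eqn ((v, x), γ') = 0) : γ = γ' := by
  rw [eqn_eq_zero_iff] at h h'
  have aux : ∀ {γ : C(Icc (0 : ℝ) 1, E₀)}, (∀ t : Icc (0 : ℝ) 1, HasDerivWithinAt
      (IccExtend zero_le_one γ) (W.field v (γ t)) (Icc 0 1) t) → ∀ t ∈ Ico (0 : ℝ) 1,
      HasDerivWithinAt (IccExtend zero_le_one γ) (W.field v (IccExtend zero_le_one γ t)) (Ici t) t := by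
    intro γ h t ht
    have hI : t ∈ Icc (0 : ℝ) 1 := ⟨ht.1, ht.2.le⟩
    rw [IccExtend_of_mem _ _ hI]
    exact (h ⟨t, hI⟩).mono_of_mem_nhdsWithin (Icc_mem_nhdsGE_of_mem ht)
  have := ODE_solution_unique (v := fun _ => W.field v) (fun _ => W.lipschitz_field v)
    (γ.continuous.Icc_extend' (h := zero_le_one)).continuousOn (aux h.2)
    (γ'.continuous.Icc_extend' (h := zero_le_one)).continuousOn (aux h'.2)
    (by rw [IccExtend_of_mem _ _ (left_mem_Icc.2 zero_le_one), IccExtend_of_mem _ _ (left_mem_Icc.2 zero_le_one), h.1, h'.1])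
  ext t
  have ht := this t.2
  rwa [IccExtend_of_mem _ _ t.2, IccExtend_of_mem _ _ t.2] at ht

/-- The flow line of `∑ vⱼ Vⱼ` through `x`. -/
def curve (p : ℝ^K × E₀) : C(Icc (0 : ℝ) 1, E₀) :=
  (W.exists_curve p.1 p.2).choose

lemma eqn_curve (p : ℝ^K × E₀) : W.eqn (p, W.curve p) = 0 := (W.exists_curve p.1 p.2).choose_spec

lemma isInvertible_fderiv (p : (ℝ^K × E₀) × C(Icc (0 : ℝ) 1, E₀)) : (fderiv ℝ W.eqn p ∘L .inr ℝ _ _).IsInvertible := by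
  rw [fderiv_eqn_inr]
  obtain ⟨u, hu⟩ := isUnit_one_sub_volterra (X := E₀) zero_le_one (W.DW p.1.1 p.2)
  exact ⟨ContinuousLinearEquiv.unitsEquiv ℝ _ u, by rw [← hu]; rfl⟩

lemma contDiff_curve : ContDiff ℝ ∞ W.curve := by
  rw [contDiff_iff_contDiffAt]
  intro p
  have hc := W.contDiff_eqn.contDiffAt (x := (p, W.curve p))
  have hi := W.isInvertible_fderiv (p, W.curve p)
  refine (hc.contDiffAt_implicitFunction (by simp) hi).congr_of_eventuallyEq ?_
  filter_upwards [hc.eventually_apply_implicitFunction (by simp) hi] with q hq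
  rw [W.eqn_curve] at hq
  exact W.curve_unique (W.eqn_curve q) hq

/-- The time one flow of `∑ vⱼ Vⱼ`. -/
def flow (v : ℝ^K) (x : E₀) : E₀ :=
  W.curve (v, x) ⟨1, right_mem_Icc.2 zero_le_one⟩

/-- Evaluation of curves. -/
def evalL (t : Icc (0 : ℝ) 1) : C(Icc (0 : ℝ) 1, E₀) →L[ℝ] E₀ :=
  LinearMap.mkContinuous
    { toFun := fun f => f t
      map_add' := fun _ _ => rfl
      map_smul' := fun _ _ => rfl } 1 (fun f => by rw [one_mul]; exact f.norm_coe_le_norm t)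

lemma contDiff_flow : ContDiff ℝ ∞ fun p : ℝ^K × E₀ => W.flow p.1 p.2 :=
  (ContinuousLinearMap.contDiff (evalL (E₀ := E₀) ⟨1, right_mem_Icc.2 zero_le_one⟩)).comp W.contDiff_curve

lemma hasDerivWithinAt_curve (v : ℝ^K) (x : E₀) (t : Icc (0 : ℝ) 1) :
    HasDerivWithinAt (IccExtend zero_le_one (W.curve (v, x))) (W.field v (W.curve (v, x) t)) (Icc 0 1) t :=
  ((W.eqn_eq_zero_iff v x _).1 (W.eqn_curve (v, x))).2 t

lemma curve_zero (v : ℝ^K) (x : E₀) : W.curve (v, x) ⟨0, left_mem_Icc.2 zero_le_one⟩ = x :=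
  ((W.eqn_eq_zero_iff v x _).1 (W.eqn_curve (v, x))).1

lemma field_smul (t : ℝ) (v : ℝ^K) (x : E₀) : W.field (t • v) x = t • W.field v x := by
  simp [field, smul_sum, smul_smul]

lemma curve_eq_flow (v : ℝ^K) (x : E₀) (t : Icc (0 : ℝ) 1) : W.curve (v, x) t = W.flow ((t : ℝ) • v) x := by
  have hm : ∀ s ∈ Icc (0 : ℝ) 1, (t : ℝ) * s ∈ Icc (0 : ℝ) 1 := fun s hs => ⟨mul_nonneg t.2.1 hs.1, mul_le_one₀ t.2.2 hs.1 hs.2⟩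
  have h : W.eqn (((t : ℝ) • v, x), ⟨fun s => W.curve (v, x) ⟨t * s, hm s s.2⟩, by fun_prop⟩) = 0 := by
    refine (W.eqn_eq_zero_iff _ _ _).2 ⟨?_, fun s => ?_⟩
    · simpa using W.curve_zero v x
    · have h0 : HasDerivAt (fun u : ℝ => (t : ℝ) * u) t s := by
        simpa using (hasDerivAt_id (s : ℝ)).const_mul (t : ℝ)
      have h1 := (W.hasDerivWithinAt_curve v x ⟨t * s, hm s s.2⟩).scomp (s : ℝ) (h0.hasDerivWithinAt (s := Icc 0 1)) (fun u hu => hm u hu)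
      rw [W.field_smul]
      have h2 : HasDerivWithinAt (fun u : ℝ => IccExtend zero_le_one (W.curve (v, x)) ((t : ℝ) * u))
        ((t : ℝ) • W.field v (W.curve (v, x) ⟨t * s, hm s s.2⟩)) (Icc 0 1) s := h1
      refine h2.congr (fun u hu => ?_) ?_
      · rw [IccExtend_of_mem _ _ hu]
        rw [IccExtend_of_mem _ _ (hm u hu)]; rfl
      · rw [IccExtend_of_mem _ _ s.2]
        rw [IccExtend_of_mem _ _ (hm s s.2)]; rfl
  have := W.curve_unique h (W.eqn_curve _)
  rw [flow, ← this]
  simp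

lemma flow_zero (x : E₀) : W.flow 0 x = x := by
  have := W.curve_eq_flow 0 x ⟨0, left_mem_Icc.2 zero_le_one⟩
  rw [W.curve_zero] at this
  simpa using this.symm

lemma hasDerivAt_flow (v : ℝ^K) (x : E₀) (t : ℝ) : HasDerivAt (fun t : ℝ => W.flow (t • v) x) (W.field v (W.flow (t • v) x)) t := by
  have hd : ∀ v : ℝ^K, ∀ t : ℝ, DifferentiableAt ℝ (fun t : ℝ => W.flow (t • v) x) t := fun v t => by
    have h : ContDiff ℝ ∞ fun t : ℝ => (t • v, x) := by fun_prop
    exact ((W.contDiff_flow.comp h).differentiable (by simp)).differentiableAt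
  have h1 : ∀ v : ℝ^K, ∀ t ∈ Icc (0 : ℝ) 1, HasDerivAt (fun t : ℝ => W.flow (t • v) x) (W.field v (W.flow (t • v) x)) t := by
    intro v t ht
    have h2 := W.hasDerivWithinAt_curve v x ⟨t, ht⟩
    rw [curve_eq_flow] at h2
    have h3 : HasDerivWithinAt (fun t : ℝ => W.flow (t • v) x) (W.field v (W.flow (t • v) x)) (Icc 0 1) t := by
      refine h2.congr (fun u hu => ?_) ?_
      · rw [IccExtend_of_mem _ _ hu, curve_eq_flow]
      · rw [IccExtend_of_mem _ _ ht, curve_eq_flow]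
    have h4 := (hd v t).hasDerivAt
    rwa [(uniqueDiffOn_Icc zero_lt_one t ht).eq_deriv _ h3 h4.hasDerivWithinAt]
  rcases eq_or_ne t 0 with rfl | ht
  · exact h1 v 0 (left_mem_Icc.2 zero_le_one)
  · have h2 := h1 (t • v) 1 (right_mem_Icc.2 zero_le_one)
    have h3 : HasDerivAt (fun s : ℝ => t⁻¹ * s) t⁻¹ t := by
      simpa using (hasDerivAt_id t).const_mul t⁻¹
    have h4 := h2.scomp_of_eq t h3 (by field_simp)
    simp only [Function.comp_def, smul_smul, one_smul, field_smul, inv_mul_cancel₀ ht, one_mul] at h4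
    refine h4.congr_of_eventuallyEq (.of_forall fun s => ?_)
    simp only
    congr 2
    field_simp

lemma flow_add (v : ℝ^K) (x : E₀) (s t : ℝ) : W.flow ((s + t) • v) x = W.flow (t • v) (W.flow (s • v) x) := by
  have h1 : ∀ t : ℝ, HasDerivAt (fun t : ℝ => W.flow ((s + t) • v) x) (W.field v (W.flow ((s + t) • v) x)) t := fun t => by
    have := (W.hasDerivAt_flow v x (s + t)).scomp t ((hasDerivAt_id t).const_add s)
    simpa [Function.comp_def] using this
  have := ODE_solution_unique_univ (v := fun _ => W.field v) (s := fun _ => univ) (t₀ := 0)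
    (fun _ => (W.lipschitz_field v).lipschitzOnWith) (fun t => ⟨h1 t, trivial⟩)
    (fun t => ⟨W.hasDerivAt_flow v (W.flow (s • v) x) t, trivial⟩) (by simp [flow_zero])
  exact congrFun this t

lemma fderiv_curve_eq (v : ℝ^K) (x : E₀) (j : Fin K) : (1 - volterra zero_le_one ∘L mulOp (W.DW v (W.curve (v, x))))
      (fderiv ℝ W.curve (v, x) (single j 1, 0)) =
    volterra zero_le_one ((W.VC j).comp (W.curve (v, x))) := by
  set p := ((v, x) : ℝ^K × E₀)
  have h1 : HasFDerivAt (fun p => W.eqn (p, W.curve p)) (fderiv ℝ W.eqn (p, W.curve p) ∘L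
      (ContinuousLinearMap.id ℝ _).prod (fderiv ℝ W.curve p)) p :=
    ((W.contDiff_eqn.differentiable (by simp)).differentiableAt.hasFDerivAt).comp p
      ((hasFDerivAt_id p).prodMk ((W.contDiff_curve.differentiable (by simp)).differentiableAt.hasFDerivAt))
  have h2 : HasFDerivAt (fun p => W.eqn (p, W.curve p)) (0 : ℝ^K × E₀ →L[ℝ] C(Icc (0 : ℝ) 1, E₀)) p := by
    simp_rw [W.eqn_curve]; exact hasFDerivAt_const _ _
  have h3 := congrArg (fun L => L (single j 1, 0)) (h1.unique h2)
  have h4 : HasDerivAt (fun s : ℝ => W.eqn (p + s • (single j 1, 0), W.curve p))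
      (fderiv ℝ W.eqn (p, W.curve p) ((single j 1, 0), 0)) 0 := by
    have h5 : HasFDerivAt W.eqn (fderiv ℝ W.eqn (p, W.curve p)) (p + (0 : ℝ) • (single j 1, 0), W.curve p) := by
      rw [zero_smul, add_zero]
      exact (W.contDiff_eqn.differentiable (by simp)).differentiableAt.hasFDerivAt
    have h6 : HasDerivAt (fun s : ℝ => p + s • ((single j 1, 0) : ℝ^K × E₀)) (single j 1, 0) 0 := by
      simpa using ((hasDerivAt_id (0 : ℝ)).smul_const ((single j 1, 0) : ℝ^K × E₀)).const_add p
    exact h5.comp_hasDerivAt (0 : ℝ) (h6.prodMk (hasDerivAt_const (0 : ℝ) (W.curve p)))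
  have h6 : (fun s : ℝ => W.eqn (p + s • (single j 1, 0), W.curve p)) = fun s : ℝ =>
      W.eqn (p, W.curve p) - s • volterra zero_le_one ((W.VC j).comp (W.curve p)) := by
    funext s
    simp only [eqn, Prod.fst_add, Prod.snd_add, Prod.smul_fst, Prod.smul_snd, smul_zero, add_zero,
      PiLp.add_apply, PiLp.smul_apply, add_smul, sum_add_distrib, map_add, smul_eq_mul]
    rw [sub_sub, sub_sub, sub_sub, ← map_smul]
    congr 4
    rw [sum_eq_single j (fun i _ hi => by simp [hi]) (by simp)]
    simp
  have h7 : HasDerivAt (fun s : ℝ => W.eqn (p + s • (single j 1, 0), W.curve p)) (-volterra zero_le_one ((W.VC j).comp (W.curve p))) 0 := by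
    rw [h6]
    simpa using ((hasDerivAt_id (0 : ℝ)).smul_const (volterra zero_le_one ((W.VC j).comp (W.curve p)))).const_sub (W.eqn (p, W.curve p))
  have h8 := W.fderiv_eqn_inr (p, W.curve p)
  have h9 := congrArg (fun L => L (fderiv ℝ W.curve p (single j 1, 0))) h8
  simp only at h9
  rw [← h9]
  have h10 : (((single j 1, 0) : ℝ^K × E₀), fderiv ℝ W.curve p (single j 1, 0)) = ((single j 1, 0), 0) +
      (0, fderiv ℝ W.curve p (single j 1, 0)) := by simp
  simp only [ContinuousLinearMap.comp_apply, ContinuousLinearMap.prod_apply, ContinuousLinearMap.id_apply, zero_apply] at h3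
  rw [h10, map_add, h4.unique h7] at h3
  simpa [sub_eq_zero, neg_add_eq_sub] using h3

/-- The matrix of the linear equation for the coefficients of the derivative of the flow. -/
def coeffOp (v : ℝ^K) (γ : C(Icc (0 : ℝ) 1, E₀)) :
    C(Icc (0 : ℝ) 1, (Fin K → ℝ) →L[ℝ] (Fin K → ℝ)) :=
  ⟨fun t => ∑ k, ∑ p, (-∑ l, v l * W.c l k p (γ t)) •
    (ContinuousLinearMap.proj (R := ℝ) (φ := fun _ : Fin K => ℝ) k).smulRight (Pi.single p (1 : ℝ)), by
    have := W.continuous_c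
    fun_prop⟩

lemma coeffOp_apply (v : ℝ^K) (γ : C(Icc (0 : ℝ) 1, E₀)) (t : Icc (0 : ℝ) 1) (n : Fin K → ℝ) (p : Fin K) :
    W.coeffOp v γ t n p = -∑ k, n k * ∑ l, v l * W.c l k p (γ t) := by
  simp only [coeffOp, ContinuousMap.coe_mk, _root_.sum_apply, smul_apply,
    ContinuousLinearMap.smulRight_apply, ContinuousLinearMap.proj_apply, Finset.sum_apply,
    Pi.smul_apply, smul_eq_mul, Pi.single_apply]
  rw [← Finset.sum_neg_distrib]
  refine sum_congr rfl fun k _ => ?_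
  rw [sum_eq_single p (fun q _ hq => by simp [hq.symm]) (by simp)]
  simp; ring

lemma norm_coeffOp_le (v : ℝ^K) (γ : C(Icc (0 : ℝ) 1, E₀)) : ‖W.coeffOp v γ‖ ≤ K ^ 2 * W.bound * ‖v‖ := by
  have hb := W.bound_nonneg
  refine (ContinuousMap.norm_le _ (by positivity)).2 fun t => ?_
  refine opNorm_le_bound _ (by positivity) fun n => ?_
  refine (pi_norm_le_iff_of_nonneg (by positivity)).2 fun p => ?_
  rw [coeffOp_apply, norm_neg]
  calc _ ≤ ∑ _k : Fin K, ‖n‖ * ∑ _l : Fin K, ‖v‖ * W.bound := by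
        refine (norm_sum_le _ _).trans (sum_le_sum fun k _ => ?_)
        rw [norm_mul]
        refine mul_le_mul (norm_le_pi_norm n k) ?_ (norm_nonneg _) (norm_nonneg _)
        refine (norm_sum_le _ _).trans (sum_le_sum fun l _ => ?_)
        rw [norm_mul]
        exact mul_le_mul (abs_apply_le v l) (W.abs_c_le l k p _) (norm_nonneg _) (norm_nonneg _)
    _ = K ^ 2 * W.bound * ‖v‖ * ‖n‖ := by simp; ring

lemma exists_fderiv_flow_eq (v : ℝ^K) (x : E₀) (j : Fin K) (hv : K ^ 2 * W.bound * ‖v‖ ≤ 1 / 2) :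
    ∃ n : Fin K → ℝ, fderiv ℝ (fun v => W.flow v x) v (single j 1) = ∑ k, n k • W.V k (W.flow v x) ∧
      ∀ k, |n k - (Pi.single j 1 : Fin K → ℝ) k| ≤ 2 * (K ^ 2 * W.bound * ‖v‖) := by
  set γ := W.curve (v, x) with hγ
  set A := W.coeffOp v γ with hA
  set e : C(Icc (0 : ℝ) 1, Fin K → ℝ) := ContinuousMap.const _ (Pi.single j 1) with he
  have hu := isUnit_one_sub_volterra (X := Fin K → ℝ) zero_le_one A
  obtain ⟨u, hu⟩ := hu
  set n : C(Icc (0 : ℝ) 1, Fin K → ℝ) := (↑u⁻¹ : _ →L[ℝ] _) (volterra zero_le_one e) with hn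
  have hneq : n = volterra zero_le_one (e + mulOp A n) := by
    have h1 : (u : C(Icc (0 : ℝ) 1, Fin K → ℝ) →L[ℝ] _) n = volterra zero_le_one e := by
      rw [hn, ← mul_apply_eq_comp, Units.mul_inv]; rfl
    rw [hu] at h1
    have h2 : n - volterra zero_le_one (mulOp A n) = volterra zero_le_one e := h1
    rw [map_add, ← h2]; abel
  have hAn := W.norm_coeffOp_le v γ
  have he1 : ‖e‖ ≤ 1 := (ContinuousMap.norm_le _ zero_le_one).2 fun t => by
    simp only [he, ContinuousMap.const_apply]
    refine (pi_norm_le_iff_of_nonneg zero_le_one).2 fun k => ?_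
    rw [Pi.single_apply]; split_ifs <;> simp
  have hvol : ∀ f : C(Icc (0 : ℝ) 1, Fin K → ℝ), ‖volterra zero_le_one f‖ ≤ ‖f‖ := fun f => by
    have := (volterra (X := Fin K → ℝ) zero_le_one).le_of_opNorm_le (LinearMap.mkContinuous_norm_le _ zero_le_one _) f
    simpa using this
  have hmul : ‖mulOp A n‖ ≤ (K ^ 2 * W.bound * ‖v‖) * ‖n‖ := by
    refine (ContinuousMap.norm_le _ (by have := W.bound_nonneg; positivity)).2 fun t => ?_
    refine ((A t).le_opNorm _).trans (mul_le_mul ((A.norm_coe_le_norm t).trans hAn)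
      (n.norm_coe_le_norm t) (norm_nonneg _) (by have := W.bound_nonneg; positivity))
  have hn2 : ‖n‖ ≤ 2 := by
    have h1 : ‖n‖ ≤ ‖e‖ + ‖mulOp A n‖ := by
      conv_lhs => rw [hneq]
      exact (hvol _).trans (norm_add_le _ _)
    have h2 : (K ^ 2 * W.bound * ‖v‖) * ‖n‖ ≤ 1 / 2 * ‖n‖ := mul_le_mul_of_nonneg_right hv (norm_nonneg n)
    linarith
  have hn0 : n ⟨0, left_mem_Icc.2 zero_le_one⟩ = 0 := by
    rw [hneq]; simp [volterra_apply]
  set ζ : C(Icc (0 : ℝ) 1, E₀) := ∑ k, (⟨fun t => n t k • W.V k (γ t), by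
    have := fun k => (W.contDiff_V k).continuous
    fun_prop⟩ : C(Icc (0 : ℝ) 1, E₀)) with hζ
  have hζt : ∀ t, ζ t = ∑ k, n t k • W.V k (γ t) := fun t => by simp [hζ]
  have hζeq : ζ = volterra zero_le_one ((W.VC j).comp γ + mulOp (W.DW v γ) ζ) := by
    have h := eq_volterra_of_hasDerivWithinAt zero_le_one (f := ζ) (g := (W.VC j).comp γ + mulOp (W.DW v γ) ζ) ?_
    · rw [hζt, hn0] at h
      simp only [Pi.zero_apply, zero_smul, Finset.sum_const_zero] at h
      conv_lhs => rw [h]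
      ext t; simp
    intro t
    have hnd := hasDerivWithinAt_of_eq_volterra zero_le_one (f := n) (g := e + mulOp A n) (x := 0)
      (by rw [show ContinuousMap.const (Icc (0 : ℝ) 1) (0 : Fin K → ℝ) = 0 from rfl, zero_add]; exact hneq) t
    have hγd := W.hasDerivWithinAt_curve v x t
    rw [← hγ] at hγd
    have hγt : IccExtend zero_le_one γ t = γ t := IccExtend_of_mem _ _ t.2
    have hd : HasDerivWithinAt (fun u => ∑ k, IccExtend zero_le_one n u k • W.V k
        (IccExtend zero_le_one γ u)) (∑ k, (IccExtend zero_le_one n t k • fderiv ℝ (W.V k) (γ t)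
          (W.field v (γ t)) + (e + mulOp A n) t k • W.V k (IccExtend zero_le_one γ t))) (Icc 0 1) t := by
      refine HasDerivWithinAt.fun_sum fun k _ => ?_
      refine (hasDerivWithinAt_pi.1 hnd k).smul ?_
      refine HasFDerivAt.comp_hasDerivWithinAt (t : ℝ) ?_ hγd
      rw [hγt]
      exact (W.differentiable_V k).differentiableAt.hasFDerivAt
    have hval : (∑ k, (IccExtend zero_le_one n t k • fderiv ℝ (W.V k) (γ t)
          (W.field v (γ t)) + (e + mulOp A n) t k • W.V k (IccExtend zero_le_one γ t))) =
        ((W.VC j).comp γ + mulOp (W.DW v γ) ζ) t := by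
      rw [hγt, IccExtend_of_mem _ _ t.2]
      have hbr : ∀ k, fderiv ℝ (W.V k) (γ t) (W.field v (γ t)) = fderiv ℝ (W.field v) (γ t) (W.V k (γ t)) +
            ∑ p, (∑ l, v l * W.c l k p (γ t)) • W.V p (γ t) := by
        intro k
        have h1 : ∑ p, (∑ l, v l * W.c l k p (γ t)) • W.V p (γ t) = ∑ l, v l • (fderiv ℝ (W.V k) (γ t) (W.V l (γ t)) -
              fderiv ℝ (W.V l) (γ t) (W.V k (γ t))) := by
          simp_rw [W.bracket, smul_sum, sum_smul, smul_smul]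
          exact sum_comm
        rw [h1, fderiv_field]
        simp only [field, map_sum, map_smul, smul_sub, sum_sub_distrib,
          _root_.sum_apply, smul_apply]
        abel
      simp_rw [hbr]
      simp only [ContinuousMap.add_apply, mulOp_apply, hζt, map_sum, map_smul, Pi.add_apply, add_smul,
        sum_add_distrib, smul_add, hA, coeffOp_apply]
      have h2 : ∑ k, e t k • W.V k (γ t) = (W.VC j).comp γ t := by
        rw [sum_eq_single j (fun i _ hi => by simp [he, hi]) (fun h => absurd (Finset.mem_univ _) h)]
        simp [he, VC]
      have h3 : ∑ k, n t k • ∑ p, (∑ l, v l * W.c l k p (γ t)) • W.V p (γ t) +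
          ∑ p, (-∑ k, n t k * ∑ l, v l * W.c l k p (γ t)) • W.V p (γ t) = 0 := by
        have aux : ∀ (m : Fin K → ℝ) (S : Fin K → Fin K → ℝ) (U : Fin K → E₀),
            ∑ k, m k • ∑ p, S k p • U p + ∑ p, (-∑ k, m k * S k p) • U p = 0 := by
          intro m S U
          simp_rw [neg_smul, Finset.sum_neg_distrib, smul_sum, sum_smul, smul_smul]
          rw [sum_comm, add_neg_cancel]
        exact aux (n t) (fun k p => ∑ l, v l * W.c l k p (γ t)) fun p => W.V p (γ t)
      have h4 : ∑ k, n t k • fderiv ℝ (W.field v) (γ t) (W.V k (γ t)) = ∑ k, n t k • W.DW v γ t (W.V k (γ t)) := rfl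
      rw [h2, h4]
      rw [eq_neg_of_add_eq_zero_left h3]
      abel
    rw [← hval]
    refine hd.congr (fun u hu => ?_) ?_
    · simp [IccExtend, hζt]
    · simp [IccExtend, hζt]
  have hηζ : fderiv ℝ W.curve (v, x) (single j 1, 0) = ζ := by
    have h1 := W.fderiv_curve_eq v x j
    have h2 : (1 - volterra zero_le_one ∘L mulOp (W.DW v γ)) ζ = volterra zero_le_one ((W.VC j).comp γ) := by
      have : ζ - volterra zero_le_one (mulOp (W.DW v γ) ζ) = volterra zero_le_one ((W.VC j).comp γ) := by
        have h5 := hζeq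
        rw [map_add] at h5
        rwa [sub_eq_iff_eq_add]
      exact this
    obtain ⟨w, hw⟩ := isUnit_one_sub_volterra (X := E₀) zero_le_one (W.DW v γ)
    rw [← hγ, ← h2, ← hw] at h1
    have h3 := congrArg (↑w⁻¹ : C(Icc (0 : ℝ) 1, E₀) →L[ℝ] C(Icc (0 : ℝ) 1, E₀)) h1
    rwa [← mul_apply_eq_comp, ← mul_apply_eq_comp, Units.inv_mul] at h3
  have hγ1 : W.flow v x = γ ⟨1, right_mem_Icc.2 zero_le_one⟩ := rfl
  refine ⟨n ⟨1, right_mem_Icc.2 zero_le_one⟩, ?_, fun k => ?_⟩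
  · have h1 : HasFDerivAt (fun v => W.flow v x) (evalL ⟨1, right_mem_Icc.2 zero_le_one⟩ ∘L (fderiv ℝ W.curve (v, x) ∘L .inl ℝ _ _)) v :=
      (evalL (E₀ := E₀) ⟨1, right_mem_Icc.2 zero_le_one⟩).hasFDerivAt.comp v
        (((W.contDiff_curve.differentiable (by simp)).differentiableAt.hasFDerivAt).comp v (hasFDerivAt_prodMk_left v x))
    rw [h1.fderiv, hγ1, ← hζt, ← hηζ]
    rfl
  · have h1 : n ⟨1, right_mem_Icc.2 zero_le_one⟩ - Pi.single j 1 = volterra zero_le_one (mulOp A n) ⟨1, right_mem_Icc.2 zero_le_one⟩ := by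
      have : volterra zero_le_one e ⟨1, right_mem_Icc.2 zero_le_one⟩ = Pi.single j (1 : ℝ) := by
        rw [volterra_apply]; simp [he, IccExtend]
      conv_lhs => rw [hneq, map_add, ContinuousMap.add_apply, this]
      abel
    have h2 : ‖n ⟨1, right_mem_Icc.2 zero_le_one⟩ - Pi.single j 1‖ ≤ 2 * (K ^ 2 * W.bound * ‖v‖) := by
      rw [h1]
      refine ((ContinuousMap.norm_coe_le_norm _ _).trans (hvol _)).trans (hmul.trans ?_)
      rw [mul_comm]
      exact mul_le_mul_of_nonneg_right hn2 (by have := W.bound_nonneg; positivity)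
    exact (norm_le_pi_norm (n ⟨1, right_mem_Icc.2 zero_le_one⟩ - Pi.single j 1) k).trans h2

lemma contDiff_flow_right (v : ℝ^K) : ContDiff ℝ ∞ (W.flow v) := W.contDiff_flow.comp (contDiff_const.prodMk contDiff_id)

lemma continuous_flow : Continuous fun p : ℝ^K × E₀ => W.flow p.1 p.2 := W.contDiff_flow.continuous

lemma flow_neg_flow (v : ℝ^K) (x : E₀) : W.flow (-v) (W.flow v x) = x := by
  have := W.flow_add v x 1 (-1)
  simp only [one_smul, neg_smul, add_neg_cancel, zero_smul, W.flow_zero] at this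
  exact this.symm

lemma flow_flow_neg (v : ℝ^K) (x : E₀) : W.flow v (W.flow (-v) x) = x := by
  simpa using W.flow_neg_flow (-v) x

/-- Functions that are almost invariant along the frame change little along flow lines. -/
lemma norm_sub_flow_le {G : Type*} [NormedAddCommGroup G] [NormedSpace ℝ G] {g : E₀ → G}
    (hg : Differentiable ℝ g) {B : ℝ} (hB : ∀ j x, ‖fderiv ℝ g x (W.V j x)‖ ≤ B)
    (v : ℝ^K) (x : E₀) : ‖g (W.flow v x) - g x‖ ≤ K * (‖v‖ * B) := by
  have hd : ∀ t : ℝ, HasDerivAt (fun t : ℝ => g (W.flow (t • v) x))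
      (fderiv ℝ g (W.flow (t • v) x) (W.field v (W.flow (t • v) x))) t := fun t =>
    (hg (W.flow (t • v) x)).hasFDerivAt.comp_hasDerivAt t (W.hasDerivAt_flow v x t)
  have hb : ∀ t : ℝ, ‖fderiv ℝ g (W.flow (t • v) x) (W.field v (W.flow (t • v) x))‖ ≤ K * (‖v‖ * B) := by
    intro t
    simp only [field, map_sum, map_smul]
    refine (norm_sum_le _ _).trans ((sum_le_sum (g := fun _ => ‖v‖ * B) fun j _ => ?_).trans (by simp))
    rw [norm_smul]
    exact mul_le_mul (abs_apply_le v j) (hB j _) (norm_nonneg _) (norm_nonneg _)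
  have := norm_image_sub_le_of_norm_deriv_le_segment_01' (f := fun t : ℝ => g (W.flow (t • v) x))
    (fun t _ => (hd t).hasDerivWithinAt) (fun t _ => hb t)
  simpa [W.flow_zero] using this

lemma hasDerivAt_comp_flow {G : Type*} [NormedAddCommGroup G] [NormedSpace ℝ G] {g : E₀ → G}
    (hg : Differentiable ℝ g) (v : ℝ^K) (x : E₀) (t : ℝ) :
    HasDerivAt (fun t : ℝ => g (W.flow (t • v) x)) (fderiv ℝ (fun y => g (W.flow (t • v) y)) x (W.field v x)) t := by
  have h1 : HasDerivAt (fun s : ℝ => g (W.flow (t • v) (W.flow (s • v) x)))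
      (fderiv ℝ (fun y => g (W.flow (t • v) y)) x (W.field v x)) 0 := by
    have h2 := W.hasDerivAt_flow v x 0
    rw [zero_smul, W.flow_zero] at h2
    have h3 : DifferentiableAt ℝ (fun y => g (W.flow (t • v) y)) (W.flow ((0 : ℝ) • v) x) :=
      (hg.comp ((W.contDiff_flow_right (t • v)).differentiable (by simp))).differentiableAt
    have := HasFDerivAt.comp_hasDerivAt (f := fun s : ℝ => W.flow (s • v) x) (0 : ℝ) h3.hasFDerivAt h2
    rw [zero_smul, W.flow_zero] at this
    exact this
  have h4 : (fun s : ℝ => g (W.flow (s • v) x)) = fun s => (fun s : ℝ => g (W.flow (t • v) (W.flow (s • v) x))) (s - t) := by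
    ext s
    simp only []
    rw [← W.flow_add]
    simp
  rw [h4]
  have h5 : HasDerivAt (fun s : ℝ => s - t) 1 t := (hasDerivAt_id t).sub_const t
  have := HasDerivAt.scomp (h := fun s : ℝ => s - t) t (by rw [sub_self]; exact h1) h5
  rw [one_smul] at this
  exact this

/-- The set of points that flow into a compact set is compact. -/
lemma isCompact_flow_mem {S : Set ℝ^K} (hS : IsCompact S) {C : Set E₀} (hC : IsCompact C) :
    IsCompact ((fun p : ℝ^K × E₀ => (p.1, W.flow (-p.1) p.2)) '' (S ×ˢ C)) :=
  (hS.prod hC).image (continuous_fst.prodMk (W.continuous_flow.comp (continuous_fst.neg.prodMk continuous_snd)))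

lemma mem_image_flow {S : Set ℝ^K} {C : Set E₀} {v : ℝ^K} (hv : v ∈ S) {x : E₀} (hx : W.flow v x ∈ C) :
    (v, x) ∈ (fun p : ℝ^K × E₀ => (p.1, W.flow (-p.1) p.2)) '' (S ×ˢ C) :=
  ⟨(v, W.flow v x), ⟨hv, hx⟩, by simp [W.flow_neg_flow]⟩

end Flow

section Average

variable {K : ℕ} {E₀ : Type} [NormedAddCommGroup E₀] [NormedSpace ℝ E₀] [FiniteDimensional ℝ E₀]
  [CompleteSpace E₀] [MeasurableSpace E₀] [BorelSpace E₀] (W : BoundedFrame K E₀)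
  (ν : Measure E₀) [IsFiniteMeasureOnCompacts ν]

/-- The frame has bounded divergence with regard to the measure `ν`. -/
def HasDivBound (D : ℝ) : Prop :=
  ∃ d : Fin K → E₀ → ℝ, (∀ j x, |d j x| ≤ D) ∧ (∀ j, Continuous (d j)) ∧
    ∀ h : E₀ → ℝ, ContDiff ℝ 1 h → HasCompactSupport h → ∀ j,
      ∫ x, fderiv ℝ h x (W.V j x) ∂ν = ∫ x, h x * d j x ∂ν

variable {W ν}

lemma hasCompactSupport_comp_flow {G : Type*} [Zero G] {h : E₀ → G} (hc : HasCompactSupport h) (v : ℝ^K) :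
    HasCompactSupport fun x => h (W.flow v x) := by
  refine HasCompactSupport.of_support_subset_isCompact (hc.image (W.contDiff_flow_right (-v)).continuous) fun x hx => ?_
  exact ⟨W.flow v x, subset_tsupport _ hx, W.flow_neg_flow v x⟩

lemma hasDerivAt_integral_comp_flow {d : Fin K → E₀ → ℝ} (hdc : ∀ j, Continuous (d j))
    (hdiv : ∀ h : E₀ → ℝ, ContDiff ℝ 1 h → HasCompactSupport h → ∀ j, ∫ x, fderiv ℝ h x (W.V j x) ∂ν = ∫ x, h x * d j x ∂ν)
    {h : E₀ → ℝ} (hs : ContDiff ℝ 1 h) (hc : HasCompactSupport h)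
    (v : ℝ^K) (t : ℝ) :
    HasDerivAt (fun t : ℝ => ∫ x, h (W.flow (t • v) x) ∂ν) (∫ x, h (W.flow (t • v) x) * ∑ j, v j * d j x ∂ν) t := by
  have hs' : ∀ t : ℝ, ContDiff ℝ 1 fun x => h (W.flow (t • v) x) := fun t => hs.comp ((W.contDiff_flow_right _).of_le (by simp))
  have hdd : ∀ (t : ℝ) x, HasDerivAt (fun t : ℝ => h (W.flow (t • v) x))
      (fderiv ℝ h (W.flow (t • v) x) (W.field v (W.flow (t • v) x))) t := fun t x =>
    ((hs.differentiable (by simp)) (W.flow (t • v) x)).hasFDerivAt.comp_hasDerivAt t (W.hasDerivAt_flow v x t)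
  have heq : ∀ (t : ℝ) x, fderiv ℝ h (W.flow (t • v) x) (W.field v (W.flow (t • v) x)) =
      ∑ j, v j * fderiv ℝ (fun y => h (W.flow (t • v) y)) x (W.V j x) := by
    intro t x
    rw [(hdd t x).unique (W.hasDerivAt_comp_flow (hs.differentiable (by simp)) v x t)]
    simp [field]
  -- a common bound and support of the derivatives
  set C₁ := Prod.snd '' ((fun p : ℝ^K × E₀ => (p.1, W.flow (-p.1) p.2)) ''
    (((fun s : ℝ => s • v) '' Icc (t - 1) (t + 1)) ×ˢ tsupport h)) with hC₁
  have hC₁c : IsCompact C₁ := (W.isCompact_flow_mem (isCompact_Icc.image (by fun_prop)) hc).image continuous_snd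
  have hcont : Continuous fun z => fderiv ℝ h z (W.field v z) := (hs.continuous_fderiv (by simp)).clm_apply (W.contDiff_field v).continuous
  have hcs : HasCompactSupport fun z => fderiv ℝ h z (W.field v z) := (hc.fderiv (𝕜 := ℝ)).mono fun z hz => by
      intro h0; exact hz (by simp [h0])
  obtain ⟨B, hB⟩ := hcs.exists_bound_of_continuous hcont
  have hfl : ∀ t : ℝ, Continuous fun x => W.flow (t • v) x := fun t => (W.contDiff_flow_right (t • v)).continuous
  have key := hasDerivAt_integral_of_dominated_loc_of_deriv_le (μ := ν) (x₀ := t) (s := Ioo (t - 1) (t + 1))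
    (F := fun t x => h (W.flow (t • v) x))
    (F' := fun t x => fderiv ℝ h (W.flow (t • v) x) (W.field v (W.flow (t • v) x)))
    (bound := C₁.indicator fun _ => B) (Ioo_mem_nhds (by linarith) (by linarith))
    (.of_forall fun s => (hs' s).continuous.aestronglyMeasurable)
    ((hs' t).continuous.integrable_of_hasCompactSupport (hasCompactSupport_comp_flow hc _))
    ((hcont.comp (hfl t)).aestronglyMeasurable)
    (.of_forall fun x s hsm => by
      by_cases hx : x ∈ C₁
      · rw [indicator_of_mem hx]; exact hB _
      · rw [indicator_of_notMem hx]
        have : W.flow (s • v) x ∉ tsupport h := fun hm => hx ⟨_, W.mem_image_flow (mem_image_of_mem _ (Ioo_subset_Icc_self hsm)) hm, rfl⟩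
        have h0 : fderiv ℝ h (W.flow (s • v) x) = 0 := image_eq_zero_of_notMem_tsupport fun h' => this (tsupport_fderiv_subset ℝ h')
        simp [h0])
    ((integrable_indicator_iff hC₁c.measurableSet).2 (integrableOn_const hC₁c.measure_lt_top.ne))
    (.of_forall fun x s _ => hdd s x)
  suffices hE : ∫ x, fderiv ℝ h (W.flow (t • v) x) (W.field v (W.flow (t • v) x)) ∂ν = ∫ x, h (W.flow (t • v) x) * ∑ j, v j * d j x ∂ν by
    rw [← hE]
    exact key.2
  rw [integral_congr_ae (.of_forall fun x => heq t x)]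
  have hI1 : ∀ j, Integrable (fun x => v j * fderiv ℝ (fun y => h (W.flow (t • v) y)) x (W.V j x)) ν := by
    intro j
    refine Continuous.integrable_of_hasCompactSupport (continuous_const.mul
      (((hs' t).continuous_fderiv (by simp)).clm_apply (W.contDiff_V j).continuous)) ?_
    refine ((hasCompactSupport_comp_flow (W := W) hc (t • v)).fderiv (𝕜 := ℝ)).mono fun z hz => ?_
    intro h0; exact hz (by simp [h0])
  have hI2 : ∀ j, Integrable (fun x => v j * (h (W.flow (t • v) x) * d j x)) ν := fun j =>
    Continuous.integrable_of_hasCompactSupport (continuous_const.mul ((hs' t).continuous.mul (hdc j)))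
      ((hasCompactSupport_comp_flow (W := W) hc (t • v)).mono fun z hz => by
        intro h0; exact hz (by simp [h0]))
  rw [integral_finsetSum _ fun j _ => hI1 j]
  simp_rw [integral_const_mul, hdiv _ (hs' t) (hasCompactSupport_comp_flow hc _), ← integral_const_mul]
  rw [← integral_finsetSum _ fun j _ => hI2 j]
  congr 1
  ext x
  rw [mul_sum]
  exact sum_congr rfl fun j _ => by ring

/-- Integrals along the flow of a frame with bounded divergence. -/
theorem integral_comp_flow_le {D : ℝ} (hD : W.HasDivBound ν D) {h : E₀ → ℝ} (hs : ContDiff ℝ 1 h)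
    (hc : HasCompactSupport h) (h0 : ∀ x, 0 ≤ h x) (v : ℝ^K) :
    ∫ x, h (W.flow v x) ∂ν ≤ exp (K * (‖v‖ * D)) * ∫ x, h x ∂ν := by
  obtain ⟨d, hd, hdc, hdiv⟩ := hD
  have hder := hasDerivAt_integral_comp_flow hdc hdiv hs hc v
  have hnn : ∀ t : ℝ, 0 ≤ ∫ x, h (W.flow (t • v) x) ∂ν := fun t => integral_nonneg fun x => h0 _
  have hint : ∀ t : ℝ, Integrable (fun x => h (W.flow (t • v) x)) ν := fun t =>
    (hs.continuous.comp (W.contDiff_flow_right _).continuous).integrable_of_hasCompactSupport (hasCompactSupport_comp_flow hc _)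
  have hb : ∀ x, |∑ j, v j * d j x| ≤ K * (‖v‖ * D) := fun x => by
    refine (Finset.abs_sum_le_sum_abs _ _).trans ((sum_le_sum (g := fun _ => ‖v‖ * D) fun j _ => ?_).trans (by simp))
    rw [abs_mul]
    exact mul_le_mul (abs_apply_le v j) (hd j _) (abs_nonneg _) (norm_nonneg _)
  have := norm_le_gronwallBound_of_norm_deriv_right_le (f := fun t : ℝ => ∫ x, h (W.flow (t • v) x) ∂ν) (a := 0) (b := 1) (ε := 0)
    (K := K * (‖v‖ * D)) (δ := ∫ x, h x ∂ν)
    (continuousOn_of_forall_continuousAt fun t _ => (hder t).continuousAt)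
    (fun t _ => (hder t).hasDerivWithinAt)
    (by
      simp only [zero_smul, W.flow_zero]
      rw [Real.norm_of_nonneg (integral_nonneg h0)])
    (fun t _ => by
      rw [add_zero, Real.norm_of_nonneg (hnn t), ← integral_const_mul]
      refine (norm_integral_le_integral_norm _).trans ?_
      refine integral_mono_of_nonneg (.of_forall fun x => norm_nonneg _) ((hint t).const_mul _) (.of_forall fun x => ?_)
      simp only [norm_mul, Real.norm_eq_abs, abs_of_nonneg (h0 _)]
      rw [mul_comm]
      exact mul_le_mul_of_nonneg_right (hb x) (h0 _))
    1 (right_mem_Icc.2 zero_le_one)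
  rw [gronwallBound_ε0, Real.norm_of_nonneg (hnn 1)] at this
  simpa [mul_comm] using this

theorem le_integral_comp_flow {D : ℝ} (hD : W.HasDivBound ν D) {h : E₀ → ℝ} (hs : ContDiff ℝ 1 h)
    (hc : HasCompactSupport h) (h0 : ∀ x, 0 ≤ h x) (v : ℝ^K) :
    ∫ x, h x ∂ν ≤ exp (K * (‖v‖ * D)) * ∫ x, h (W.flow v x) ∂ν := by
  have := integral_comp_flow_le hD (h := fun x => h (W.flow v x))
    (hs.comp ((W.contDiff_flow_right _).of_le (by simp))) (hasCompactSupport_comp_flow hc _)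
    (fun x => h0 _) (-v)
  simpa [W.flow_flow_neg] using this

variable (W) in
/-- The average of a function over the flows with small parameters. -/
def average (χ : ℝ^K → ℝ) (h : E₀ → ℝ) (y : E₀) : ℝ :=
  ∫ v, χ v * h (W.flow v y)

lemma continuous_average_integrand {χ : ℝ^K → ℝ} (hχ : Continuous χ) {h : E₀ → ℝ} (hs : Continuous h) :
    Continuous fun p : E₀ × ℝ^K => χ p.2 * h (W.flow p.2 p.1) :=
  (hχ.comp continuous_snd).mul (hs.comp (W.continuous_flow.comp continuous_swap))

lemma hasCompactSupport_average_integrand {χ : ℝ^K → ℝ} (hχc : HasCompactSupport χ) {h : E₀ → ℝ} (hc : HasCompactSupport h) :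
    HasCompactSupport fun p : E₀ × ℝ^K => χ p.2 * h (W.flow p.2 p.1) := by
  refine HasCompactSupport.of_support_subset_isCompact ((W.isCompact_flow_mem hχc hc).image continuous_swap) fun p hp => ?_
  have h1 : χ p.2 ≠ 0 := fun h0 => hp (by simp [h0])
  have h2 : h (W.flow p.2 p.1) ≠ 0 := fun h0 => hp (by simp [h0])
  exact ⟨(p.2, p.1), W.mem_image_flow (subset_tsupport _ h1) (subset_tsupport _ h2), rfl⟩

lemma integrable_average {χ : ℝ^K → ℝ} (hχ : Continuous χ)
    (hχc : HasCompactSupport χ) {h : E₀ → ℝ} (hs : Continuous h) (hc : HasCompactSupport h) :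
    Integrable (W.average χ h) ν := by
  obtain ⟨S, hS⟩ : ∃ S : Set E₀, S = Prod.fst '' tsupport fun p : E₀ × ℝ^K => χ p.2 * h (W.flow p.2 p.1) := ⟨_, rfl⟩
  have hSc : IsCompact S := hS ▸ (hasCompactSupport_average_integrand (W := W) hχc hc).image continuous_fst
  refine Continuous.integrable_of_hasCompactSupport ?_ (HasCompactSupport.of_support_subset_isCompact hSc fun y hy => ?_)
  · refine continuous_parametric_integral_of_continuous (f := fun y v => χ v * h (W.flow v y))
      (μ := volume) (continuous_average_integrand hχ hs) (s := tsupport χ) hχc |>.congr fun y => ?_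
    refine setIntegral_eq_integral_of_forall_compl_eq_zero fun v hv => ?_
    rw [image_eq_zero_of_notMem_tsupport hv, zero_mul]
  · by_contra hyS
    refine hy ?_
    simp only [average]
    have : ∀ v, χ v * h (W.flow v y) = 0 := fun v => by
      by_contra hne
      exact hyS (hS ▸ ⟨(y, v), subset_tsupport _ hne, rfl⟩)
    simp [this]

lemma integral_average {χ : ℝ^K → ℝ} (hχ : Continuous χ)
    (hχc : HasCompactSupport χ) {h : E₀ → ℝ} (hs : Continuous h) (hc : HasCompactSupport h) :
    ∫ y, W.average χ h y ∂ν = ∫ v, χ v * ∫ y, h (W.flow v y) ∂ν := by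
  simp only [average]
  rw [integral_integral_swap_of_hasCompactSupport (f := fun y v => χ v * h (W.flow v y))
    (continuous_average_integrand hχ hs) (hasCompactSupport_average_integrand hχc hc)]
  simp_rw [integral_const_mul]

lemma integrable_swapped {χ : ℝ^K → ℝ} (hχ : Continuous χ)
    (hχc : HasCompactSupport χ) {h : E₀ → ℝ} (hs : Continuous h) (hc : HasCompactSupport h) :
    Integrable fun v => χ v * ∫ y, h (W.flow v y) ∂ν := by
  obtain ⟨S, hS⟩ : ∃ S : Set E₀, S = Prod.snd '' ((fun p : ℝ^K × E₀ => (p.1, W.flow (-p.1) p.2)) '' (tsupport χ ×ˢ tsupport h)) := ⟨_, rfl⟩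
  have hSc : IsCompact S := hS ▸ (W.isCompact_flow_mem hχc hc).image continuous_snd
  have heq : (fun v => χ v * ∫ y, h (W.flow v y) ∂ν) = fun v => ∫ y in S, χ v * h (W.flow v y) ∂ν := by
    ext v
    rw [← integral_const_mul]
    refine (setIntegral_eq_integral_of_forall_compl_eq_zero fun y hy => ?_).symm
    by_contra hne
    have h1 : χ v ≠ 0 := fun h0 => hne (by simp [h0])
    have h2 : h (W.flow v y) ≠ 0 := fun h0 => hne (by simp [h0])
    exact hy (hS ▸ ⟨(v, y), W.mem_image_flow (subset_tsupport _ h1) (subset_tsupport _ h2), rfl⟩)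
  refine Continuous.integrable_of_hasCompactSupport ?_ (hχc.mul_right)
  rw [heq]
  exact continuous_parametric_integral_of_continuous (f := fun v y => χ v * h (W.flow v y))
    ((hχ.comp continuous_fst).mul (hs.comp W.continuous_flow)) hSc

variable {χ : ℝ^K → ℝ} (hχ : Continuous χ)
  (hχ0 : ∀ v, 0 ≤ χ v) {r : ℝ} (hχr : ∀ v, χ v ≠ 0 → ‖v‖ ≤ r)

include hχ hχ0 hχr

lemma integral_average_le {D : ℝ} (hD0 : 0 ≤ D) (hD : W.HasDivBound ν D) {h : E₀ → ℝ} (hs : ContDiff ℝ 1 h)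
    (hc : HasCompactSupport h) (h0 : ∀ x, 0 ≤ h x) :
    ∫ y, W.average χ h y ∂ν ≤ exp (K * (r * D)) * (∫ v, χ v) * ∫ x, h x ∂ν := by
  have hχc : HasCompactSupport χ := HasCompactSupport.of_support_subset_isCompact
    (isCompact_closedBall (0 : ℝ^K) r) fun v hv => by simpa using hχr v hv
  rw [integral_average hχ hχc hs.continuous hc, mul_right_comm, ← integral_const_mul]
  refine integral_mono (integrable_swapped hχ hχc hs.continuous hc) ((hχ.integrable_of_hasCompactSupport hχc).const_mul _) fun v => ?_
  by_cases hv : χ v = 0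
  · simp [hv]
  simp only []
  rw [mul_comm _ (χ v)]
  refine mul_le_mul_of_nonneg_left ((integral_comp_flow_le hD hs hc h0 v).trans ?_) (hχ0 v)
  refine mul_le_mul_of_nonneg_right (Real.exp_le_exp.2 ?_) (integral_nonneg h0)
  have := hχr v hv
  gcongr

lemma le_integral_average {D : ℝ} (hD0 : 0 ≤ D) (hD : W.HasDivBound ν D) {h : E₀ → ℝ} (hs : ContDiff ℝ 1 h)
    (hc : HasCompactSupport h) (h0 : ∀ x, 0 ≤ h x) :
    (∫ v, χ v) * ∫ x, h x ∂ν ≤ exp (K * (r * D)) * ∫ y, W.average χ h y ∂ν := by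
  have hχc : HasCompactSupport χ := HasCompactSupport.of_support_subset_isCompact
    (isCompact_closedBall (0 : ℝ^K) r) fun v hv => by simpa using hχr v hv
  rw [integral_average hχ hχc hs.continuous hc, ← integral_mul_const, ← integral_const_mul]
  refine integral_mono ((hχ.integrable_of_hasCompactSupport hχc).mul_const _)
    ((integrable_swapped hχ hχc hs.continuous hc).const_mul _) fun v => ?_
  by_cases hv : χ v = 0
  · simp [hv]
  simp only []
  rw [mul_left_comm]
  refine mul_le_mul_of_nonneg_left ((le_integral_comp_flow hD hs hc h0 v).trans ?_) (hχ0 v)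
  refine mul_le_mul_of_nonneg_right (Real.exp_le_exp.2 ?_) (integral_nonneg fun x => h0 _)
  have := hχr v hv
  gcongr

end Average

variable {K : ℕ} {E₀ : Type} [NormedAddCommGroup E₀] [NormedSpace ℝ E₀]

/-- Coefficients of an operator `∑ⱼ aⱼ Vⱼ` that is elliptic along the frame `V`. The frame may be
redundant: `P` is a matrix with `∑ⱼ Pₖⱼ Vⱼ = Vₖ` in the region of interest. -/
structure EllipticCoeff (W : BoundedFrame K E₀) (H H' : Type) [NormedAddCommGroup H]
    [InnerProductSpace ℂ H] [NormedAddCommGroup H'] [InnerProductSpace ℂ H'] where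
  a : Fin K → E₀ → H →L[ℂ] H'
  P : Fin K → Fin K → E₀ → ℝ
  B : ℝ
  contDiff_a : ∀ j, ContDiff ℝ ∞ (a j)
  contDiff_P : ∀ k j, ContDiff ℝ ∞ (P k j)
  norm_a_le : ∀ j x, ‖a j x‖ ≤ B
  abs_P_le : ∀ k j x, |P k j x| ≤ B
  norm_fderiv_a_le : ∀ j i x, ‖fderiv ℝ (a j) x (W.V i x)‖ ≤ B
  norm_fderiv_P_le : ∀ k j i x, ‖fderiv ℝ (P k j) x (W.V i x)‖ ≤ B
  c : ℝ
  c_pos : 0 < c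
  elliptic : ∀ x (η : ℝ^K) (w : H),
    c * (∑ k, (∑ j, P k j x * η j) ^ 2) * ‖w‖ ^ 2 ≤ ‖∑ j, (η j : ℂ) • a j x w‖ ^ 2

variable [FiniteDimensional ℝ E₀] [CompleteSpace E₀] {W : BoundedFrame K E₀}
  {H H' : Type} [NormedAddCommGroup H]
  [InnerProductSpace ℂ H] [CompleteSpace H] [NormedAddCommGroup H'] [InnerProductSpace ℂ H']
  [CompleteSpace H']

namespace EllipticCoeff

variable (S : W.EllipticCoeff H H')

/-- The derivative of `F` along the `j`-th vector field of the frame. -/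
def _root_.LieMfd.BoundedFrame.D (W : BoundedFrame K E₀) (F : E₀ → H) (j : Fin K) (x : E₀) : H :=
  fderiv ℝ F x (W.V j x)

/-- The operator `∑ⱼ aⱼ Vⱼ`. -/
def op (F : E₀ → H) (x : E₀) : H' := ∑ j, S.a j x (W.D F j x)

/-- The squared length of the gradient along the frame. -/
def _root_.LieMfd.BoundedFrame.gradSq (W : BoundedFrame K E₀) (F : E₀ → H) (x : E₀) : ℝ :=
  ∑ k, ‖W.D F k x‖ ^ 2

lemma sq_add_three_le (a b c : ℝ) : (a + b + c) ^ 2 ≤ 3 * (a ^ 2 + b ^ 2 + c ^ 2) := by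
  nlinarith [sq_nonneg (a - b), sq_nonneg (b - c), sq_nonneg (a - c)]

lemma sum_norm_sq_le (F : E₀ → H) (x : E₀) : (∑ k, ‖W.D F k x‖) ^ 2 ≤ K * W.gradSq F x := by
  simpa [gradSq] using sq_sum_le_card_mul_sum_sq (s := Finset.univ) (f := fun k => ‖W.D F k x‖)

section Pointwise

variable (χ : ℝ^K → ℝ) (F : E₀ → H) (y : E₀)

variable (W) in
/-- A cut-off of `F`, pulled back by the flow. -/
def localized (v : ℝ^K) : H := χ v • F (W.flow v y)

variable {χ F y}

lemma contDiff_flow_left (y : E₀) : ContDiff ℝ ∞ fun v => W.flow v y := W.contDiff_flow.comp (contDiff_id.prodMk contDiff_const)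

lemma contDiff_localized (hχ : ContDiff ℝ ∞ χ) (hF : ContDiff ℝ ∞ F) : ContDiff ℝ ∞ (localized W χ F y) :=
  hχ.smul (hF.comp (contDiff_flow_left y))

lemma hasCompactSupport_localized (hχ : HasCompactSupport χ) : HasCompactSupport (localized W χ F y) := hχ.smul_right

lemma fderiv_localized (hχ : ContDiff ℝ ∞ χ) (hF : ContDiff ℝ ∞ F) (v : ℝ^K) (j : Fin K) : fderiv ℝ (localized W χ F y) v (single j 1) =
      χ v • fderiv ℝ F (W.flow v y) (fderiv ℝ (fun v => W.flow v y) v (single j 1)) + fderiv ℝ χ v (single j 1) • F (W.flow v y) := by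
  have h1 : HasFDerivAt (fun v => F (W.flow v y)) ((fderiv ℝ F (W.flow v y)).comp (fderiv ℝ (fun v => W.flow v y) v)) v :=
    HasFDerivAt.comp v ((hF.differentiable (by simp)) _).hasFDerivAt (((contDiff_flow_left y).differentiable (by simp)) v).hasFDerivAt
  have h2 := ((hχ.differentiable (by simp)) v).hasFDerivAt.smul h1
  have h3 : fderiv ℝ (localized W χ F y) v = _ := h2.fderiv
  rw [h3]
  simp

lemma norm_fderiv_localized_sub_le (hχ : ContDiff ℝ ∞ χ) (hF : ContDiff ℝ ∞ F) {ε β : ℝ}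
    (hε : K ^ 2 * W.bound * ε ≤ 1 / 2) (hχ0 : ∀ v, 0 ≤ χ v) (hβ : ∀ v, ‖fderiv ℝ χ v‖ ≤ β)
    {v : ℝ^K} (hv : ‖v‖ ≤ ε) (j : Fin K) :
    ‖fderiv ℝ (localized W χ F y) v (single j 1) - χ v • W.D F j (W.flow v y)‖ ≤
      2 * (K ^ 2 * W.bound * ε) * (χ v * ∑ k, ‖W.D F k (W.flow v y)‖) + β * ‖F (W.flow v y)‖ := by
  have hb := W.bound_nonneg
  obtain ⟨n, hn, hnd⟩ := W.exists_fderiv_flow_eq v y j ((by gcongr : _ ≤ K ^ 2 * W.bound * ε).trans hε)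
  have h1 : fderiv ℝ (localized W χ F y) v (single j 1) - χ v • W.D F j (W.flow v y) =
      χ v • (∑ k, (n k - (Pi.single j (1 : ℝ) : Fin K → ℝ) k) • W.D F k (W.flow v y)) + fderiv ℝ χ v (single j 1) • F (W.flow v y) := by
    rw [fderiv_localized hχ hF, hn]
    simp only [map_sum, map_smul, sub_smul, sum_sub_distrib, smul_sub]
    have : ∑ k, (Pi.single j (1 : ℝ) : Fin K → ℝ) k • W.D F k (W.flow v y) = W.D F j (W.flow v y) := by
      rw [sum_eq_single j (fun k _ hk => by simp [hk]) (by simp)]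
      simp
    rw [this]
    simp only [D]
    abel
  rw [h1]
  refine (norm_add_le _ _).trans (add_le_add ?_ ?_)
  · rw [norm_smul, Real.norm_of_nonneg (hχ0 v), mul_left_comm]
    refine mul_le_mul_of_nonneg_left ?_ (hχ0 v)
    rw [mul_sum]
    refine norm_sum_le_of_le _ fun k _ => ?_
    rw [norm_smul]
    refine mul_le_mul_of_nonneg_right ((hnd k).trans ?_) (norm_nonneg _)
    gcongr
  · rw [norm_smul]
    refine mul_le_mul_of_nonneg_right (((fderiv ℝ χ v).le_opNorm _).trans ?_) (norm_nonneg _)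
    simpa using hβ v

/-- The constant in the pointwise error estimates. -/
def errConst : ℝ := K * (K * |S.B|) + K * |S.B| * (2 * (K ^ 2 * W.bound))

lemma errConst_nonneg : 0 ≤ S.errConst := by
  have := W.bound_nonneg
  unfold errConst
  positivity

/-- An operator with coefficients frozen at `y`, applied to a localized function. -/
lemma norm_frozen_sub_le {G : Type} [NormedAddCommGroup G] [NormedSpace ℝ G] (q : Fin K → E₀ → H →L[ℝ] G) (hq : ∀ j, Differentiable ℝ (q j))
    (hq1 : ∀ j x, ‖q j x‖ ≤ S.B) (hq2 : ∀ j i x, ‖fderiv ℝ (q j) x (W.V i x)‖ ≤ S.B)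
    (hχ : ContDiff ℝ ∞ χ) (hF : ContDiff ℝ ∞ F) {ε β : ℝ} (hε0 : 0 ≤ ε)
    (hε : K ^ 2 * W.bound * ε ≤ 1 / 2) (hχ0 : ∀ v, 0 ≤ χ v) (hβ : ∀ v, ‖fderiv ℝ χ v‖ ≤ β)
    {v : ℝ^K} (hv : ‖v‖ ≤ ε) :
    ‖∑ j, q j y (fderiv ℝ (localized W χ F y) v (single j 1)) - χ v • ∑ j, q j (W.flow v y) (W.D F j (W.flow v y))‖ ≤
      S.errConst * ε * (χ v * ∑ k, ‖W.D F k (W.flow v y)‖) + K * |S.B| * β * ‖F (W.flow v y)‖ := by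
  have hb := W.bound_nonneg
  have hβ0 : 0 ≤ β := (norm_nonneg _).trans (hβ 0)
  set X := χ v * ∑ k, ‖W.D F k (W.flow v y)‖ with hX
  have hX0 : 0 ≤ X := mul_nonneg (hχ0 v) (sum_nonneg fun _ _ => norm_nonneg _)
  have h1 : ∑ j, q j y (fderiv ℝ (localized W χ F y) v (single j 1)) - χ v • ∑ j, q j (W.flow v y) (W.D F j (W.flow v y)) =
      ∑ j, (q j y (fderiv ℝ (localized W χ F y) v (single j 1) - χ v • W.D F j (W.flow v y))) -
      ∑ j, χ v • (q j (W.flow v y) - q j y) (W.D F j (W.flow v y)) := by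
    simp only [map_sub, map_smul, FunLike.coe_sub, Pi.sub_apply, smul_sub, smul_sum, sum_sub_distrib]
    abel
  rw [h1]
  have h2 : ‖∑ j, (q j y (fderiv ℝ (localized W χ F y) v (single j 1) -
        χ v • W.D F j (W.flow v y)))‖ ≤ K * (|S.B| * (2 * (K ^ 2 * W.bound * ε) * X + β * ‖F (W.flow v y)‖)) := by
    refine (norm_sum_le _ _).trans ((sum_le_sum (g := fun _ => |S.B| *
      (2 * (K ^ 2 * W.bound * ε) * X + β * ‖F (W.flow v y)‖)) fun j _ => ?_).trans (by simp))
    refine ((q j y).le_opNorm _).trans (mul_le_mul ((hq1 j y).trans (le_abs_self _))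
      (norm_fderiv_localized_sub_le hχ hF hε hχ0 hβ hv j) (norm_nonneg _) (abs_nonneg _))
  have h3 : ‖∑ j, χ v • (q j (W.flow v y) - q j y) (W.D F j (W.flow v y))‖ ≤ K * (ε * |S.B|) * X := by
    rw [hX, mul_left_comm, mul_sum, mul_sum]
    refine norm_sum_le_of_le _ fun j _ => ?_
    rw [norm_smul, Real.norm_of_nonneg (hχ0 v)]
    refine mul_le_mul_of_nonneg_left ((ContinuousLinearMap.le_opNorm _ _).trans
      (mul_le_mul_of_nonneg_right ((W.norm_sub_flow_le (hq j) (hq2 j) v y).trans ?_) (norm_nonneg _))) (hχ0 v)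
    exact mul_le_mul_of_nonneg_left ((mul_le_mul_of_nonneg_left (le_abs_self S.B)
      (norm_nonneg v)).trans (mul_le_mul_of_nonneg_right hv (abs_nonneg _))) (Nat.cast_nonneg K)
  refine (norm_sub_le _ _).trans ((add_le_add h2 h3).trans ?_)
  have h4 : K * (ε * |S.B|) * X ≤ K * (K * (ε * |S.B|)) * X := by
    refine mul_le_mul_of_nonneg_right ?_ hX0
    rcases Nat.eq_zero_or_pos K with h | h
    · simp [h]
    · refine le_mul_of_one_le_left (by positivity) ?_
      exact_mod_cast h
  unfold errConst
  nlinarith [h4]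

end Pointwise

end EllipticCoeff

lemma contDiff_D {F : E₀ → H} (hF : ContDiff ℝ ∞ F) (j : Fin K) : ContDiff ℝ ∞ (W.D F j) :=
  (hF.fderiv_right (by simp)).clm_apply (W.contDiff_V j)

lemma D_eq_zero {F : E₀ → H} {x : E₀} (hx : x ∉ tsupport F) (j : Fin K) : W.D F j x = 0 := by
  have h0 : fderiv ℝ F x = 0 := image_eq_zero_of_notMem_tsupport fun h' => hx (tsupport_fderiv_subset ℝ h')
  simp [D, h0]

lemma contDiff_gradSq {F : E₀ → H} (hF : ContDiff ℝ ∞ F) : ContDiff ℝ ∞ (W.gradSq F) := ContDiff.sum fun k _ => (contDiff_D hF k).norm_sq ℂ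

lemma hasCompactSupport_gradSq {F : E₀ → H} (hc : HasCompactSupport F) : HasCompactSupport (W.gradSq F) := hc.mono' fun x hx => by
    by_contra h
    exact hx (by simp [gradSq, D_eq_zero h])

lemma gradSq_nonneg (F : E₀ → H) (x : E₀) : 0 ≤ W.gradSq F x := sum_nonneg fun _ _ => sq_nonneg _

lemma integral_three_mul_add {X : Type*} [MeasurableSpace X] {μ : Measure X} {f g h : X → ℝ}
    (hf : Integrable f μ) (hg : Integrable g μ) (hh : Integrable h μ) (e b : ℝ) :
    ∫ x, 3 * (f x + e * g x + b * h x) ∂μ = 3 * (∫ x, f x ∂μ + e * ∫ x, g x ∂μ + b * ∫ x, h x ∂μ) := by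
  have h1 : Integrable (fun x => f x + e * g x) μ := hf.add (hg.const_mul e)
  rw [integral_const_mul, integral_add h1 (hh.const_mul b), integral_add hf (hg.const_mul e), integral_const_mul, integral_const_mul]

namespace EllipticCoeff

variable (S : W.EllipticCoeff H H')

lemma contDiff_op {F : E₀ → H} (hF : ContDiff ℝ ∞ F) : ContDiff ℝ ∞ (S.op F) :=
  ContDiff.sum fun j _ => ((restrictScalarsL ℂ H H' ℝ ℝ).contDiff.comp (S.contDiff_a j)).clm_apply (contDiff_D hF j)

lemma hasCompactSupport_op {F : E₀ → H} (hc : HasCompactSupport F) : HasCompactSupport (S.op F) := hc.mono' fun x hx => by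
    by_contra h
    exact hx (by simp [op, D_eq_zero h])

section Pointwise

variable {χ N : ℝ^K → ℝ} {F : E₀ → H} {ε β : ℝ}
  (hχ : ContDiff ℝ ∞ χ) (hF : ContDiff ℝ ∞ F) (hε0 : 0 ≤ ε)
  (hε : K ^ 2 * W.bound * ε ≤ 1 / 2) (hχ0 : ∀ v, 0 ≤ χ v) (hβ : ∀ v, ‖fderiv ℝ χ v‖ ≤ β)
  (hχs : tsupport χ ⊆ Metric.closedBall 0 ε) (hN0 : ∀ v, 0 ≤ N v) (hN1 : ∀ v, ‖v‖ ≤ ε → N v = 1)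

include hχ hF hε0 hε hχ0 hβ hχs hN0 hN1

lemma sq_norm_frozen_le (y : E₀) (v : ℝ^K) : ‖∑ j, S.a j y (fderiv ℝ (localized W χ F y) v (single j 1))‖ ^ 2 ≤
      3 * (χ v ^ 2 * ‖S.op F (W.flow v y)‖ ^ 2 + S.errConst ^ 2 * ε ^ 2 * K * (χ v ^ 2 * W.gradSq F (W.flow v y)) +
        (K * |S.B| * β) ^ 2 * (N v * ‖F (W.flow v y)‖ ^ 2)) ∧
    ∀ k, (∀ x, ∑ j, S.P k j x • W.D F j x = W.D F k x) → χ v ^ 2 * ‖W.D F k (W.flow v y)‖ ^ 2 ≤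
      3 * (‖∑ j, S.P k j y • fderiv ℝ (localized W χ F y) v (single j 1)‖ ^ 2 +
        S.errConst ^ 2 * ε ^ 2 * K * (χ v ^ 2 * W.gradSq F (W.flow v y)) +
        (K * |S.B| * β) ^ 2 * (N v * ‖F (W.flow v y)‖ ^ 2)) := by
  have hG := gradSq_nonneg (W := W) F (W.flow v y)
  have hN := hN0 v
  by_cases hv : ‖v‖ ≤ ε
  · rw [hN1 v hv, one_mul]
    set X := ∑ k, ‖W.D F k (W.flow v y)‖ with hX
    have hX2 : X ^ 2 ≤ K * W.gradSq F (W.flow v y) := sum_norm_sq_le F _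
    have h3 : (S.errConst * ε * (χ v * X)) ^ 2 ≤ S.errConst ^ 2 * ε ^ 2 * K * (χ v ^ 2 * W.gradSq F (W.flow v y)) := by
      calc _ = (S.errConst ^ 2 * ε ^ 2 * χ v ^ 2) * X ^ 2 := by ring
        _ ≤ (S.errConst ^ 2 * ε ^ 2 * χ v ^ 2) * (K * W.gradSq F (W.flow v y)) := by gcongr
        _ = _ := by ring
    have h4 : (K * |S.B| * β * ‖F (W.flow v y)‖) ^ 2 = (K * |S.B| * β) ^ 2 * ‖F (W.flow v y)‖ ^ 2 := by
      ring
    have hX0 : 0 ≤ S.errConst * ε * (χ v * X) := mul_nonneg (mul_nonneg S.errConst_nonneg hε0)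
      (mul_nonneg (hχ0 v) (sum_nonneg fun _ _ => norm_nonneg _))
    have hβ0 : 0 ≤ β := (norm_nonneg _).trans (hβ 0)
    have hF0 : 0 ≤ K * |S.B| * β * ‖F (W.flow v y)‖ := by positivity
    constructor
    · have h1 := norm_frozen_sub_le S (fun j x => (S.a j x).restrictScalars ℝ)
        (fun j => (restrictScalarsL ℂ H H' ℝ ℝ).differentiable.comp ((S.contDiff_a j).differentiable (by simp)))
        (fun j x => by rw [ContinuousLinearMap.norm_restrictScalars]; exact S.norm_a_le j x)
        (fun j i x => by
          have : HasFDerivAt (fun x => (S.a j x).restrictScalars ℝ)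
              ((restrictScalarsL ℂ H H' ℝ ℝ).comp (fderiv ℝ (S.a j) x)) x :=
            (restrictScalarsL ℂ H H' ℝ ℝ).hasFDerivAt.comp x ((S.contDiff_a j).differentiable (by simp) x).hasFDerivAt
          rw [this.fderiv]
          simpa using S.norm_fderiv_a_le j i x)
        (y := y) hχ hF hε0 hε hχ0 hβ hv
      simp only [ContinuousLinearMap.coe_restrictScalars'] at h1
      have h2 := norm_sub_norm_le (∑ j, S.a j y (fderiv ℝ (localized W χ F y) v
        (single j 1))) (χ v • ∑ j, S.a j (W.flow v y) (W.D F j (W.flow v y)))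
      have h5 : ‖∑ j, S.a j y (fderiv ℝ (localized W χ F y) v (single j 1))‖ ≤ χ v * ‖S.op F (W.flow v y)‖ + S.errConst * ε * (χ v * X) +
            K * |S.B| * β * ‖F (W.flow v y)‖ := by
        rw [norm_smul, Real.norm_of_nonneg (hχ0 v)] at h2
        have : S.op F (W.flow v y) = ∑ j, S.a j (W.flow v y) (W.D F j (W.flow v y)) := rfl
        rw [this]
        linarith
      refine (pow_le_pow_left₀ (norm_nonneg _) h5 2).trans ((sq_add_three_le _ _ _).trans ?_)
      rw [mul_pow (χ v), h4]
      linarith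
    · intro k hk
      have h1 := norm_frozen_sub_le S (fun j x => S.P k j x • ContinuousLinearMap.id ℝ H)
        (fun j => ((S.contDiff_P k j).differentiable (by simp)).smul_const _)
        (fun j x => by
          rw [norm_smul]
          exact (mul_le_of_le_one_right (norm_nonneg _) ContinuousLinearMap.norm_id_le).trans (S.abs_P_le k j x))
        (fun j i x => by
          rw [(((S.contDiff_P k j).differentiable (by simp) x).hasFDerivAt.smul_const (ContinuousLinearMap.id ℝ H)).fderiv]
          simp only [ContinuousLinearMap.smulRight_apply, norm_smul]
          exact (mul_le_of_le_one_right (norm_nonneg _) ContinuousLinearMap.norm_id_le).trans (S.norm_fderiv_P_le k j i x))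
        (y := y) hχ hF hε0 hε hχ0 hβ hv
      simp only [FunLike.coe_smul, Pi.smul_apply, ContinuousLinearMap.id_apply, hk] at h1
      have h2 := norm_sub_norm_le (χ v • W.D F k (W.flow v y)) (∑ j, S.P k j y • fderiv ℝ (localized W χ F y) v (single j 1))
      rw [norm_sub_rev] at h1
      have h5 : χ v * ‖W.D F k (W.flow v y)‖ ≤ ‖∑ j, S.P k j y • fderiv ℝ (localized W χ F y) v (single j 1)‖ +
            S.errConst * ε * (χ v * X) + K * |S.B| * β * ‖F (W.flow v y)‖ := by
        rw [norm_smul, Real.norm_of_nonneg (hχ0 v)] at h2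
        linarith
      rw [← mul_pow]
      refine (pow_le_pow_left₀ (mul_nonneg (hχ0 v) (norm_nonneg _)) h5 2).trans ((sq_add_three_le _ _ _).trans ?_)
      rw [h4]
      linarith
  · have hvt : v ∉ tsupport χ := fun h => hv (by simpa using hχs h)
    have h0 : χ v = 0 := image_eq_zero_of_notMem_tsupport hvt
    have h1 : fderiv ℝ (localized W χ F y) v = 0 := by
      refine image_eq_zero_of_notMem_tsupport fun h' => hvt ?_
      exact tsupport_smul_subset_left _ _ (tsupport_fderiv_subset ℝ h')
    refine ⟨?_, fun k _ => ?_⟩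
    · have h2 : ‖∑ j, S.a j y (fderiv ℝ (localized W χ F y) v (single j 1))‖ ^ 2 = 0 := by simp [h1]
      rw [h2]
      positivity
    · have h2 : χ v ^ 2 * ‖W.D F k (W.flow v y)‖ ^ 2 = 0 := by simp [h0]
      rw [h2]
      positivity

lemma average_gradSq_le (hNc : Continuous N) (hNs : HasCompactSupport N) (hP : ∀ k x, ∑ j, S.P k j x • W.D F j x = W.D F k x)
    (hε1 : (9 * K / S.c + 3 * K ^ 2) * S.errConst ^ 2 * ε ^ 2 ≤ 1 / 2) (y : E₀) :
    W.average (fun v => χ v ^ 2) (W.gradSq F) y ≤ 18 / S.c * W.average (fun v => χ v ^ 2) (fun x => ‖S.op F x‖ ^ 2) y +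
      2 * (9 / S.c + 3 * K) * (K * |S.B| * β) ^ 2 * W.average N (fun x => ‖F x‖ ^ 2) y := by
  have hχc : HasCompactSupport χ := HasCompactSupport.of_support_subset_isCompact
    (isCompact_closedBall (0 : ℝ^K) ε) ((subset_tsupport _).trans hχs)
  have hχ2c : HasCompactSupport fun v => χ v ^ 2 := hχc.mono fun v hv h0 => hv (by simp [h0])
  have hfl : Continuous fun v => W.flow v y := (contDiff_flow_left y).continuous
  have hint : ∀ {χ : ℝ^K → ℝ} {h : E₀ → ℝ}, Continuous χ → Continuous h →
      HasCompactSupport χ → Integrable fun v => χ v * h (W.flow v y) := fun h1 h2 h3 =>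
    (h1.mul (h2.comp hfl)).integrable_of_hasCompactSupport h3.mul_right
  have i1 := hint (hχ.continuous.pow 2) (contDiff_gradSq (W := W) hF).continuous hχ2c
  have i2 := hint (hχ.continuous.pow 2) ((S.contDiff_op hF).norm_sq ℂ).continuous hχ2c
  have i3 := hint hNc (hF.norm_sq ℂ).continuous hNs
  have i4 : ∀ k, Integrable fun v => χ v ^ 2 * ‖W.D F k (W.flow v y)‖ ^ 2 := fun k =>
    hint (h := fun x => ‖W.D F k x‖ ^ 2) (hχ.continuous.pow 2) ((contDiff_D hF k).norm_sq ℂ).continuous hχ2c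
  have hls := contDiff_localized (W := W) (y := y) hχ hF
  have hlc := hasCompactSupport_localized (W := W) (F := F) (y := y) hχc
  have hu : ∀ j, Continuous fun v => fderiv ℝ (localized W χ F y) v (single j 1) :=
    fun j => (hls.continuous_fderiv (by simp)).clm_apply continuous_const
  have hu0 : ∀ v, v ∉ tsupport χ → fderiv ℝ (localized W χ F y) v = 0 := fun v hv => image_eq_zero_of_notMem_tsupport fun h' =>
      hv (tsupport_smul_subset_left _ _ (tsupport_fderiv_subset ℝ h'))
  have i5 : ∀ k, Integrable fun v => ‖∑ j, S.P k j y • fderiv ℝ (localized W χ F y) v (single j 1)‖ ^ 2 := fun k => by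
    refine Continuous.integrable_of_hasCompactSupport (((continuous_finsetSum _ fun j _ =>
      (hu j).const_smul _).norm).pow 2) (hχc.mono' fun v hv => ?_)
    by_contra h
    exact hv (by simp [hu0 v h])
  have i6 : Integrable fun v => ‖∑ j, S.a j y (fderiv ℝ (localized W χ F y) v (single j 1))‖ ^ 2 := by
    refine Continuous.integrable_of_hasCompactSupport (((continuous_finsetSum _ fun j _ =>
      (S.a j y).continuous.comp (hu j)).norm).pow 2) (hχc.mono' fun v hv => ?_)
    by_contra h
    exact hv (by simp [hu0 v h])
  set e := S.errConst ^ 2 * ε ^ 2 * K with he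
  set b := (K * |S.B| * β) ^ 2 with hb
  set I1 := W.average (fun v => χ v ^ 2) (W.gradSq F) y with hI1
  set I2 := W.average (fun v => χ v ^ 2) (fun x => ‖S.op F x‖ ^ 2) y with hI2
  set I3 := W.average N (fun x => ‖F x‖ ^ 2) y with hI3
  set J := ∑ k, ∫ v, ‖∑ j, S.P k j y • fderiv ℝ (localized W χ F y) v (single j 1)‖ ^ 2 with hJ
  have key := fun v => sq_norm_frozen_le S hχ hF hε0 hε hχ0 hβ hχs hN0 hN1 y v
  have e1 : S.c * J ≤ 3 * (I2 + e * I1 + b * I3) := by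
    refine (constCoeff_estimate (fun j => S.a j y) (fun k j => S.P k j y) S.c (S.elliptic y)
      _ hls hlc).trans ?_
    refine (integral_mono i6 (((i2.add (i1.const_mul e)).add (i3.const_mul b)).const_mul 3) fun v => (key v).1).trans (le_of_eq ?_)
    exact integral_three_mul_add i2 i1 i3 e b
  have e2 : I1 ≤ 3 * (J + K * (e * I1) + K * (b * I3)) := by
    have h1 : I1 = ∑ k, ∫ v, χ v ^ 2 * ‖W.D F k (W.flow v y)‖ ^ 2 := by
      rw [← integral_finsetSum _ fun k _ => i4 k]
      simp only [hI1, average, gradSq, mul_sum]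
    have h2 : ∀ k, ∫ v, χ v ^ 2 * ‖W.D F k (W.flow v y)‖ ^ 2 ≤ 3 * ((∫ v, ‖∑ j, S.P k j y •
      fderiv ℝ (localized W χ F y) v (single j 1)‖ ^ 2) + e * I1 + b * I3) := by
      intro k
      refine (integral_mono (i4 k) ((((i5 k).add (i1.const_mul e)).add (i3.const_mul b)).const_mul 3)
        fun v => (key v).2 k (hP k)).trans (le_of_eq ?_)
      exact integral_three_mul_add (i5 k) i1 i3 e b
    rw [h1]
    refine (sum_le_sum fun k _ => h2 k).trans (le_of_eq ?_)
    rw [← mul_sum]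
    simp only [sum_add_distrib, sum_const, card_univ, Fintype.card_fin, nsmul_eq_mul, ← hJ, ← h1]
  have hc0 := S.c_pos
  have hI10 : 0 ≤ I1 := integral_nonneg fun v => mul_nonneg (sq_nonneg _) (gradSq_nonneg F _)
  have e3 : J ≤ 3 / S.c * (I2 + e * I1 + b * I3) := by
    rw [div_mul_eq_mul_div, le_div_iff₀ hc0, mul_comm]
    exact e1
  have e4 : (9 / S.c + 3 * K) * e * I1 ≤ 1 / 2 * I1 := by
    refine mul_le_mul_of_nonneg_right (le_trans (le_of_eq ?_) hε1) hI10
    rw [he]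
    ring
  have e5 : 3 * J ≤ 9 / S.c * (I2 + e * I1 + b * I3) := by
    calc 3 * J ≤ 3 * (3 / S.c * (I2 + e * I1 + b * I3)) := by linarith
      _ = _ := by ring
  have e6 : 18 / S.c * I2 = 2 * (9 / S.c * I2) := by ring
  rw [e6]
  nlinarith

end Pointwise

section Global

variable [MeasurableSpace E₀] [BorelSpace E₀]
  {ν : Measure E₀} [IsFiniteMeasureOnCompacts ν]

/-- The elliptic estimate along a bounded frame with bounded divergence. -/
theorem integral_gradSq_le {D₀ : ℝ} (hD0 : 0 ≤ D₀) (hD : W.HasDivBound ν D₀) : ∃ C : ℝ, ∀ F : E₀ → H, ContDiff ℝ ∞ F → HasCompactSupport F →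
      (∀ k x, ∑ j, S.P k j x • W.D F j x = W.D F k x) →
      ∫ x, W.gradSq F x ∂ν ≤ C * (∫ x, ‖S.op F x‖ ^ 2 ∂ν + ∫ x, ‖F x‖ ^ 2 ∂ν) := by
  have hb := W.bound_nonneg
  have hc0 := S.c_pos
  set M := (9 * K / S.c + 3 * K ^ 2) * S.errConst ^ 2 with hM
  have hM0 : 0 ≤ M := by positivity
  obtain ⟨ε, hεdef⟩ : ∃ ε : ℝ, ε = 1 / (2 * (K ^ 2 * W.bound + M + 1)) := ⟨_, rfl⟩
  have hden : 0 < 2 * (K ^ 2 * W.bound + M + 1) := by positivity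
  have hε0 : 0 < ε := by rw [hεdef]; positivity
  have hεm : ε * (2 * (K ^ 2 * W.bound + M + 1)) = 1 := by rw [hεdef]; field_simp
  have hKb : 0 ≤ (K : ℝ) ^ 2 * W.bound := by positivity
  have hε1 : K ^ 2 * W.bound * ε ≤ 1 / 2 := by nlinarith [mul_nonneg hM0 hε0.le]
  have hεl : ε ≤ 1 := by nlinarith [mul_nonneg hM0 hε0.le, mul_nonneg hKb hε0.le]
  have hε2 : M * ε ^ 2 ≤ 1 / 2 := by
    have : M * ε ≤ 1 / 2 := by nlinarith [mul_nonneg hKb hε0.le]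
    nlinarith [mul_nonneg hM0 hε0.le]
  let χ : ContDiffBump (0 : ℝ^K) := ⟨ε / 2, ε, by linarith, by linarith⟩
  let N : ContDiffBump (0 : ℝ^K) := ⟨ε, 2 * ε, by linarith, by linarith⟩
  have hχs : ContDiff ℝ ∞ χ := χ.contDiff
  have hχsup : tsupport χ ⊆ Metric.closedBall 0 ε := by rw [χ.tsupport_eq]
  obtain ⟨β, hβ⟩ := (χ.hasCompactSupport.fderiv (𝕜 := ℝ)).exists_bound_of_continuous (hχs.continuous_fderiv (by simp))
  have hχr : ∀ v, χ v ^ 2 ≠ 0 → ‖v‖ ≤ ε := fun v hv => by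
    have : v ∈ tsupport χ := subset_tsupport _ fun h0 => hv (by simp [h0])
    simpa using hχsup this
  have hNr : ∀ v, N v ≠ 0 → ‖v‖ ≤ 2 * ε := fun v hv => by
    have : v ∈ tsupport N := subset_tsupport _ hv
    rw [N.tsupport_eq] at this
    simpa using this
  have hχ2c : HasCompactSupport fun v => χ v ^ 2 := χ.hasCompactSupport.mono fun v hv h0 => hv (by simp [h0])
  have hI : 0 < ∫ v, χ v ^ 2 := by
    refine (hχs.continuous.pow 2).integral_pos_of_hasCompactSupport_nonneg_nonzero hχ2c (fun v => sq_nonneg _) (x := 0) ?_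
    rw [χ.one_of_mem_closedBall (Metric.mem_closedBall_self χ.rIn_pos.le)]
    norm_num
  set I := ∫ v, χ v ^ 2 with hIdef
  set X := exp (K * (ε * D₀)) with hX
  set X' := exp (K * (2 * ε * D₀)) with hX'
  set C₁ := 18 / S.c with hC₁
  set C₂ := 2 * (9 / S.c + 3 * K) * (K * |S.B| * β) ^ 2 with hC₂
  have hC₁0 : 0 ≤ C₁ := by positivity
  have hC₂0 : 0 ≤ C₂ := by positivity
  have hN0 : 0 ≤ ∫ v, N v := integral_nonneg fun v => N.nonneg
  refine ⟨I⁻¹ * (X * (C₁ * (X * I) + C₂ * (X' * ∫ v, N v))), fun F hF hc hP => ?_⟩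
  have hsq : ∀ {H : Type} [NormedAddCommGroup H] [InnerProductSpace ℂ H] {f : E₀ → H},
      ContDiff ℝ ∞ f → HasCompactSupport f → ContDiff ℝ 1 (fun x => ‖f x‖ ^ 2) ∧ HasCompactSupport fun x => ‖f x‖ ^ 2 := fun h1 h2 =>
    ⟨(h1.norm_sq ℂ).of_le (by simp), h2.mono fun v hv h0 => hv (by simp [h0])⟩
  have g1 : ContDiff ℝ 1 (W.gradSq F) := (contDiff_gradSq hF).of_le (by simp)
  have g2 := hasCompactSupport_gradSq (W := W) hc
  obtain ⟨o1, o2⟩ := hsq (S.contDiff_op hF) (S.hasCompactSupport_op hc)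
  obtain ⟨f1, f2⟩ := hsq hF hc
  have hχc2 : Continuous fun v => χ v ^ 2 := hχs.continuous.pow 2
  have hNc : Continuous fun v => N v := N.continuous
  have key := fun y => S.average_gradSq_le (N := N) hχs hF hε0.le hε1 (fun v => χ.nonneg) hβ hχsup
    (fun v => N.nonneg) (fun v hv => N.one_of_mem_closedBall (by simpa [N] using hv))
    hNc N.hasCompactSupport hP hε2 y
  have a1 := le_integral_average (W := W) (ν := ν) hχc2 (fun v => sq_nonneg _) hχr hD0 hD g1 g2 (gradSq_nonneg F)
  have a2 := integral_average_le (W := W) (ν := ν) hχc2 (fun v => sq_nonneg _) hχr hD0 hD o1 o2 (fun x => sq_nonneg _)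
  have a3 := integral_average_le (W := W) (ν := ν) hNc (fun v => N.nonneg) hNr hD0 hD f1 f2 (fun x => sq_nonneg _)
  have a4 : ∫ y, W.average (fun v => χ v ^ 2) (W.gradSq F) y ∂ν ≤ C₁ * ∫ y, W.average (fun v => χ v ^ 2) (fun x => ‖S.op F x‖ ^ 2) y ∂ν +
      C₂ * ∫ y, W.average N (fun x => ‖F x‖ ^ 2) y ∂ν := by
    have j2 := (integrable_average (W := W) (ν := ν) hχc2 hχ2c o1.continuous o2).const_mul C₁
    have j3 := (integrable_average (W := W) (ν := ν) hNc N.hasCompactSupport f1.continuous f2).const_mul C₂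
    rw [← integral_const_mul, ← integral_const_mul, ← integral_add j2 j3]
    exact integral_mono (integrable_average hχc2 hχ2c g1.continuous g2) (j2.add j3) key
  set O := ∫ x, ‖S.op F x‖ ^ 2 ∂ν with hO
  set f := ∫ x, ‖F x‖ ^ 2 ∂ν with hf
  have hO0 : 0 ≤ O := integral_nonneg fun x => sq_nonneg _
  have hf0 : 0 ≤ f := integral_nonneg fun x => sq_nonneg _
  have hX0 : 0 < X := Real.exp_pos _
  have hX'0 : 0 < X' := Real.exp_pos _
  rw [mul_assoc, ← div_eq_inv_mul, le_div_iff₀ hI, mul_comm]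
  refine a1.trans ?_
  rw [mul_assoc]
  refine mul_le_mul_of_nonneg_left (a4.trans ?_) hX0.le
  calc _ ≤ C₁ * (X * I * O) + C₂ * (X' * (∫ v, N v) * f) := by gcongr
    _ ≤ (C₁ * (X * I) + C₂ * (X' * ∫ v, N v)) * (O + f) := by
      have h1 : 0 ≤ C₁ * (X * I) * f := by positivity
      have h2 : 0 ≤ C₂ * (X' * ∫ v, N v) * O := by positivity
      nlinarith

end Global

end EllipticCoeff

end BoundedFrame

/-! ### Parseval frames of vector bundles -/

section Frames

variable {k : ℕ} {M : Type*} [TopologicalSpace M] [ChartedSpace ℝ₊^k M]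
  {F : Type*} [NormedAddCommGroup F] [NormedSpace ℝ F]
  {E : M → Type*} [TopologicalSpace (TotalSpace F E)]
  [∀ x, NormedAddCommGroup (E x)] [∀ x, InnerProductSpace ℝ (E x)] [FiberBundle F E]

/-- The inner product of smooth sections is smooth. -/
def IsSmoothMetric (k : ℕ) {M : Type*} [TopologicalSpace M] [ChartedSpace ℝ₊^k M]
    (F : Type*) [NormedAddCommGroup F] [NormedSpace ℝ F]
    (E : M → Type*) [TopologicalSpace (TotalSpace F E)]
    [∀ x, NormedAddCommGroup (E x)] [∀ x, InnerProductSpace ℝ (E x)] [FiberBundle F E] : Prop :=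
  ∀ s ∈ smoothSections k F E, ∀ s' ∈ smoothSections k F E,
    C∞(k, ℝ) fun x => ⟪s x; s' x⟫

/-- A finite family of smooth sections `gᵢ` with `v = ∑ ⟨gᵢ, v⟩ gᵢ`. -/
structure IsParseval (k : ℕ) {M : Type*} [TopologicalSpace M] [ChartedSpace ℝ₊^k M]
    (F : Type*) [NormedAddCommGroup F] [NormedSpace ℝ F]
    {E : M → Type*} [TopologicalSpace (TotalSpace F E)]
    [∀ x, NormedAddCommGroup (E x)] [∀ x, InnerProductSpace ℝ (E x)] [FiberBundle F E]
    {ι : Type*} [Fintype ι] (g : ι → ∀ x, E x) : Prop where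
  smooth : ∀ i, g i ∈ smoothSections k F E
  sum_eq : ∀ x v, ∑ i, ⟪g i x; v⟫ • g i x = v

lemma exists_bump [IsManifold (Q k) ∞ M] [T2Space M] {x : M} {U : Set M} (hU : U ∈ 𝓝 x) :
    ∃ χ : M → ℝ, C∞(k, ℝ) χ ∧ tsupport χ ⊆ U ∧ ∀ᶠ y in 𝓝 x, χ y = 1 := by
  obtain ⟨f, -, hf⟩ := (SmoothBumpFunction.nhds_basis_tsupport (I := Q k) x).mem_iff.1 hU
  exact ⟨f, f.contMDiff, hf, f.eventuallyEq_one⟩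

variable [VectorBundle ℝ F E] [ContMDiffVectorBundle ∞ F E (Q k)]

lemma mem_smoothSections_sub {s t : ∀ x, E x} (hs : s ∈ smoothSections k F E)
    (ht : t ∈ smoothSections k F E) : (fun x => s x - t x) ∈ smoothSections k F E :=
  ContMDiff.sub_section hs ht

lemma mem_smoothSections_smul {f : M → ℝ} {s : ∀ x, E x} (hf : C∞(k, ℝ) f)
    (hs : s ∈ smoothSections k F E) : (fun x => f x • s x) ∈ smoothSections k F E :=
  ContMDiff.smul_section hf hs

lemma mem_smoothSections_sum {ι : Type*} (t : Finset ι) {s : ι → ∀ x, E x}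
    (hs : ∀ i ∈ t, s i ∈ smoothSections k F E) : (fun x => ∑ i ∈ t, s i x) ∈ smoothSections k F E :=
  ContMDiff.sum_section hs

variable [IsManifold (Q k) ∞ M] [T2Space M]

/-- Near each point there are global smooth sections whose values form a basis. -/
lemma exists_local_basis (x₀ : M) {d : ℕ} (b : Module.Basis (Fin d) ℝ F) : ∃ (U : Set M) (e : Fin d → ∀ x, E x), U ∈ 𝓝 x₀ ∧ IsOpen U ∧
      U ⊆ (trivializationAt F E x₀).baseSet ∧ (∀ a, e a ∈ smoothSections k F E) ∧
      (∀ x ∈ U, LinearIndependent ℝ fun a => e a x) ∧ (∀ x ∈ U, ⊤ ≤ Submodule.span ℝ (range fun a => e a x)) ∧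
      (∀ x ∈ U, ∀ v : E x, v = ∑ a, b.repr (trivializationAt F E x₀ ⟨x, v⟩).2 a • e a x) := by
  set e := trivializationAt F E x₀ with he
  obtain ⟨χ, hχ, hsup, h1⟩ := exists_bump (k := k) (e.open_baseSet.mem_nhds
    (FiberBundle.mem_baseSet_trivializationAt' (F := F) (E := E) x₀))
  obtain ⟨U, hU1, hUo, hUx⟩ := eventually_nhds_iff.1 (h1.and (e.open_baseSet.mem_nhds
    (FiberBundle.mem_baseSet_trivializationAt' (F := F) (E := E) x₀)))
  have hval : ∀ x (hx : x ∈ U), (fun a => χ x • e.localFrame b a x) = e.basisAt b (hU1 x hx).2 := by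
    intro x hx
    ext a
    rw [e.localFrame_apply_of_mem_baseSet b (hU1 x hx).2]
    exact (congrArg (· • e.basisAt b (hU1 x hx).2 a) (hU1 x hx).1).trans (one_smul _ _)
  refine ⟨U, fun a x => χ x • e.localFrame b a x, hUo.mem_nhds hUx, hUo, fun x hx => (hU1 x hx).2,
    fun a => ?_, fun x hx => ?_, fun x hx => ?_, fun x hx v => ?_⟩
  · exact ContMDiffOn.smul_section_of_tsupport hχ.contMDiffOn e.open_baseSet hsup (e.contMDiffOn_localFrame_baseSet _ b a)
  · rw [hval x hx]
    exact (e.basisAt b (hU1 x hx).2).linearIndependent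
  · rw [hval x hx]
    exact (e.basisAt b (hU1 x hx).2).span_eq.ge
  · have h2 : ∀ a, χ x • e.localFrame b a x = e.basisAt b (hU1 x hx).2 a := fun a => congrFun (hval x hx) a
    simp_rw [h2]
    conv_lhs => rw [← (e.basisAt b (hU1 x hx).2).sum_repr v]
    refine sum_congr rfl fun a _ => ?_
    congr 1

lemma finiteDimensional_model [∀ x, FiniteDimensional ℝ (E x)] (x₀ : M) : FiniteDimensional ℝ F :=
  ((trivializationAt F E x₀).continuousLinearEquivAt ℝ x₀ (FiberBundle.mem_baseSet_trivializationAt' x₀)).toLinearEquiv.finiteDimensional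

/-- The Gram-Schmidt process preserves smoothness. -/
lemma contMDiffAt_gramSchmidt (hin : IsSmoothMetric k F E) {d : ℕ} {e : Fin d → ∀ x, E x} (he : ∀ a, e a ∈ smoothSections k F E) {x : M}
    (hx : LinearIndependent ℝ fun a => e a x) (a : Fin d) :
    ContMDiffAt (Q k) ((Q k).prod 𝓘(ℝ, F)) ∞ (fun x => (⟨x, gramSchmidt ℝ (fun a => e a x) a⟩ : TotalSpace F E)) x ∧
    ∀ s ∈ smoothSections k F E, ContMDiffAt (Q k) 𝓘(ℝ, ℝ) ∞ (fun x => (inner ℝ (gramSchmidt ℝ (fun a => e a x) a) (s x) : ℝ)) x := by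
  induction a using WellFoundedLT.induction with
  | ind a ih =>
    have hG : ∀ y, gramSchmidt ℝ (fun a => e a y) a = e a y - ∑ c ∈ Finset.Iio a, (⟪gramSchmidt ℝ (fun a => e a y) c; e a y⟫ /
          ⟪gramSchmidt ℝ (fun a => e a y) c; e c y⟫ : ℝ) •
          gramSchmidt ℝ (fun a => e a y) c := by
      intro y
      conv_lhs => rw [eq_sub_of_add_eq (InnerProductSpace.gramSchmidt_def'' ℝ (fun a => e a y) a).symm]
      congr 1
      refine sum_congr rfl fun c _ => ?_
      congr 2
      have h1 := InnerProductSpace.gramSchmidt_def'' ℝ (fun a => e a y) c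
      set G := gramSchmidt ℝ (fun a => e a y) with hGd
      rw [h1, inner_add_right, inner_sum, sum_eq_zero, add_zero, real_inner_self_eq_norm_sq]
      · rfl
      · intro i hi
        rw [inner_smul_right, gramSchmidt_orthogonal ℝ _ (Finset.mem_Iio.1 hi).ne', mul_zero]
    have hne : ∀ c, ⟪gramSchmidt ℝ (fun a => e a x) c; e c x⟫ ≠ 0 := by
      intro c
      have h1 := InnerProductSpace.gramSchmidt_def'' ℝ (fun a => e a x) c
      have h0 := InnerProductSpace.gramSchmidt_ne_zero (𝕜 := ℝ) c hx
      set G := gramSchmidt ℝ (fun a => e a x) with hGd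
      rw [h1, inner_add_right, inner_sum, sum_eq_zero, add_zero, real_inner_self_eq_norm_sq]
      · exact pow_ne_zero 2 (norm_ne_zero_iff.2 h0)
      · intro i hi
        rw [inner_smul_right, gramSchmidt_orthogonal ℝ _ (Finset.mem_Iio.1 hi).ne', mul_zero]
    have hcoef : ∀ c < a, ContMDiffAt (Q k) 𝓘(ℝ, ℝ) ∞ (fun y => (⟪gramSchmidt ℝ (fun a => e a y) c; e a y⟫ /
          ⟪gramSchmidt ℝ (fun a => e a y) c; e c y⟫ : ℝ)) x := fun c hc =>
      ((ih c hc).2 _ (he a)).div₀ ((ih c hc).2 _ (he c)) (hne c)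
    constructor
    · have h1 : ContMDiffAt (Q k) ((Q k).prod 𝓘(ℝ, F)) ∞ (fun y => (⟨y, e a y - ∑ c ∈ Finset.Iio a,
        (⟪gramSchmidt ℝ (fun a => e a y) c; e a y⟫ / ⟪gramSchmidt ℝ (fun a => e a y) c; e c y⟫ : ℝ) •
          gramSchmidt ℝ (fun a => e a y) c⟩ : TotalSpace F E)) x := by
        refine ContMDiffAt.sub_section (he a x) (ContMDiffAt.sum_section fun c hc => ?_)
        exact ContMDiffAt.smul_section (hcoef c (Finset.mem_Iio.1 hc)) (ih c (Finset.mem_Iio.1 hc)).1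
      refine h1.congr_of_eventuallyEq (.of_forall fun y => ?_)
      simp only []
      rw [hG y]
    · intro s hs
      have h1 : ContMDiffAt (Q k) 𝓘(ℝ, ℝ) ∞ (fun y => (⟪e a y; s y⟫ - ∑ c ∈ Finset.Iio a, (⟪gramSchmidt ℝ (fun a => e a y) c; e a y⟫ /
          ⟪gramSchmidt ℝ (fun a => e a y) c; e c y⟫ : ℝ) *
          ⟪gramSchmidt ℝ (fun a => e a y) c; s y⟫ : ℝ)) x :=
        (hin _ (he a) s hs x).sub (ContMDiffAt.sum fun c hc => (hcoef c (Finset.mem_Iio.1 hc)).mul ((ih c (Finset.mem_Iio.1 hc)).2 s hs))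
      refine h1.congr_of_eventuallyEq (.of_forall fun y => ?_)
      simp only []
      rw [hG y, inner_sub_left, sum_inner]
      congr 1
      refine sum_congr rfl fun c _ => ?_
      rw [real_inner_smul_left]

/-- Near each point there are smooth orthonormal frames. -/
lemma exists_local_orthonormal (hin : IsSmoothMetric k F E) [∀ x, FiniteDimensional ℝ (E x)] (x₀ : M) :
    ∃ (U : Set M) (d : ℕ) (e : Fin d → ∀ x, E x), x₀ ∈ U ∧ IsOpen U ∧
      (∀ a, ContMDiffOn (Q k) ((Q k).prod 𝓘(ℝ, F)) ∞ (fun x => (⟨x, e a x⟩ : TotalSpace F E)) U) ∧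
      ∀ x ∈ U, ∀ v, ∑ a, ⟪e a x; v⟫ • e a x = v := by
  have := finiteDimensional_model (F := F) (E := E) x₀
  obtain ⟨U, e, hUn, hUo, -, he, hli, hsp, -⟩ := exists_local_basis (k := k) (E := E) x₀ (Module.finBasis ℝ F)
  refine ⟨U, _, fun a x => InnerProductSpace.gramSchmidtNormed ℝ (fun a => e a x) a, mem_of_mem_nhds hUn,
    hUo, fun a x hx => ?_, fun x hx v => ?_⟩
  · have h1 := contMDiffAt_gramSchmidt hin he (hli x hx)
    have h2 : ∀ y, (‖gramSchmidt ℝ (fun a => e a y) a‖ : ℝ) = sqrt ⟪gramSchmidt ℝ (fun a => e a y) a; e a y⟫ := by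
      intro y
      have h1 := InnerProductSpace.gramSchmidt_def'' ℝ (fun a => e a y) a
      set G := gramSchmidt ℝ (fun a => e a y) with hGd
      rw [h1, inner_add_right, inner_sum, sum_eq_zero, add_zero, real_inner_self_eq_norm_sq, Real.sqrt_sq (norm_nonneg _)]
      intro i hi
      rw [inner_smul_right, gramSchmidt_orthogonal ℝ _ (Finset.mem_Iio.1 hi).ne', mul_zero]
    have h3 : ⟪gramSchmidt ℝ (fun a => e a x) a; e a x⟫ ≠ 0 := by
      intro h0
      have h4 := h2 x
      rw [h0, Real.sqrt_zero, norm_eq_zero] at h4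
      exact InnerProductSpace.gramSchmidt_ne_zero (𝕜 := ℝ) a (hli x hx) h4
    have h5 : ContMDiffAt (Q k) 𝓘(ℝ, ℝ) ∞ (fun y => (‖gramSchmidt ℝ (fun a => e a y) a‖ : ℝ)⁻¹) x := by
      simp_rw [h2]
      have h6 := (h1 a).2 _ (he a)
      have h7 : ContMDiffAt 𝓘(ℝ, ℝ) 𝓘(ℝ, ℝ) ∞ (fun t : ℝ => (sqrt t)⁻¹) ⟪gramSchmidt ℝ (fun a => e a x) a; e a x⟫ := by
        refine ContDiffAt.contMDiffAt (((Real.contDiffAt_sqrt h3).inv ?_))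
        rw [← h2]
        exact norm_ne_zero_iff.2 (InnerProductSpace.gramSchmidt_ne_zero (𝕜 := ℝ) a (hli x hx))
      exact ContMDiffAt.comp (g := fun t : ℝ => (sqrt t)⁻¹) x h7 h6
    exact (ContMDiffAt.smul_section h5 (h1 a).1).contMDiffWithinAt
  · have ho := InnerProductSpace.gramSchmidtNormed_orthonormal (𝕜 := ℝ) (hli x hx)
    have hs : ⊤ ≤ Submodule.span ℝ (range (InnerProductSpace.gramSchmidtNormed ℝ fun a => e a x)) := by
      rw [InnerProductSpace.span_gramSchmidtNormed_range, InnerProductSpace.span_gramSchmidt]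
      exact hsp x hx
    have h1 := (OrthonormalBasis.mk ho hs).sum_repr v
    simpa [OrthonormalBasis.repr_apply_apply] using h1

/-- Vector bundles over compact manifolds have Parseval frames. -/
theorem exists_parseval [CompactSpace M] (hin : IsSmoothMetric k F E) [∀ x, FiniteDimensional ℝ (E x)] :
    ∃ (K : ℕ) (g : Fin K → ∀ x, E x), IsParseval k F g := by
  choose U d e hxU hUo hes hsum using exists_local_orthonormal (k := k) (F := F) (E := E) hin
  obtain ⟨t, ht⟩ := isCompact_univ.elim_finite_subcover U hUo fun x _ => mem_iUnion.2 ⟨x, hxU x⟩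
  obtain ⟨f, hf⟩ := SmoothPartitionOfUnity.exists_isSubordinate (Q k) isClosed_univ (fun i : t => U i) (fun i => hUo i) (by
      intro x hx
      obtain ⟨i, hi, hx'⟩ := mem_iUnion₂.1 (ht hx)
      exact mem_iUnion.2 ⟨⟨i, hi⟩, hx'⟩)
  have hpos : ∀ x, 0 < ∑ i, f i x ^ 2 := by
    intro x
    have h1 : ∑ i, f i x = 1 := by
      rw [← finsum_eq_sum_of_fintype]; exact f.sum_eq_one (mem_univ x)
    obtain ⟨i, hi⟩ : ∃ i, f i x ≠ 0 := by
      by_contra! h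
      simp [h] at h1
    exact Finset.sum_pos' (fun _ _ => sq_nonneg _) ⟨i, Finset.mem_univ _, by positivity⟩
  let w : t → M → ℝ := fun i x => f i x * (sqrt (∑ j, f j x ^ 2))⁻¹
  have hw : ∀ i, C∞(k, ℝ) (w i) := by
    intro i x
    refine ((f i).contMDiff x).mul ?_
    have h7 : ContMDiffAt 𝓘(ℝ, ℝ) 𝓘(ℝ, ℝ) ∞ (fun t : ℝ => (sqrt t)⁻¹) (∑ j, f j x ^ 2) :=
      ContDiffAt.contMDiffAt ((Real.contDiffAt_sqrt (hpos x).ne').inv (Real.sqrt_pos.2 (hpos x)).ne')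
    have h8 : ContMDiffAt (Q k) 𝓘(ℝ, ℝ) ∞ (fun x => ∑ j, f j x ^ 2) x := ContMDiffAt.sum fun j _ => ((f j).contMDiff x).pow 2
    exact ContMDiffAt.comp (g := fun t : ℝ => (sqrt t)⁻¹) x h7 h8
  have hwsup : ∀ i : t, tsupport (w i) ⊆ U i := by
    intro i
    refine Subset.trans ?_ (hf i)
    exact closure_mono (Function.support_mul_subset_left _ _)
  have hwsum : ∀ x, ∑ i, w i x ^ 2 = 1 := by
    intro x
    simp only [w, mul_pow, inv_pow, Real.sq_sqrt (hpos x).le, ← sum_mul]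
    exact mul_inv_cancel₀ (hpos x).ne'
  let g : (Σ i : t, Fin (d i)) → ∀ x, E x := fun p x => w p.1 x • e p.1 p.2 x
  have hg1 : ∀ p, g p ∈ smoothSections k F E := fun p =>
    ContMDiffOn.smul_section_of_tsupport (hw p.1).contMDiffOn (hUo p.1) (hwsup p.1) (hes p.1 p.2)
  have hg2 : ∀ x v, ∑ p, ⟪g p x; v⟫ • g p x = v := by
    intro x v
    rw [Fintype.sum_sigma]
    have h1 : ∀ i : t, ∑ a, ⟪g ⟨i, a⟩ x; v⟫ • g ⟨i, a⟩ x = w i x ^ 2 • v := by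
      intro i
      by_cases hx : x ∈ U i
      · conv_rhs => rw [← hsum i x hx v]
        rw [smul_sum]
        refine sum_congr rfl fun a _ => ?_
        simp only [g, real_inner_smul_left, smul_smul]
        congr 1
        ring
      · have h0 : w i x = 0 := image_eq_zero_of_notMem_tsupport fun h => hx (hwsup i h)
        simp [g, h0]
    simp_rw [h1]
    rw [← sum_smul, hwsum, one_smul]
  let φ := Fintype.equivFin (Σ i : t, Fin (d i))
  refine ⟨_, fun i => g (φ.symm i), fun i => hg1 _, fun x v => ?_⟩
  rw [φ.symm.sum_comp fun p => ⟪g p x; v⟫ • g p x]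
  exact hg2 x v

section Along

variable {EX : Type*} [NormedAddCommGroup EX] [NormedSpace ℝ EX] {HX : Type*} [TopologicalSpace HX]
  {J : ModelWithCorners ℝ EX HX} {X : Type*} [TopologicalSpace X] [ChartedSpace HX X]
  {φ : X → M} {S : Set X} {p : X}

/-- Linear combinations of smooth sections, along a map, with smooth coefficients. -/
lemma contMDiffWithinAt_sum_smul {ι : Type*} [Fintype ι] {g : ι → ∀ x, E x}
    (hg : ∀ i, g i ∈ smoothSections k F E) (hφ : ContMDiffWithinAt J (Q k) ∞ φ S p) {c : ι → X → ℝ}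
    (hc : ∀ i, ContMDiffWithinAt J 𝓘(ℝ, ℝ) ∞ (c i) S p) :
    ContMDiffWithinAt J ((Q k).prod 𝓘(ℝ, F)) ∞ (fun q => (⟨φ q, ∑ i, c i q • g i (φ q)⟩ : TotalSpace F E)) S p := by
  rw [contMDiffWithinAt_totalSpace]
  refine ⟨hφ, ?_⟩
  set e := trivializationAt F E (φ p) with he
  have h1 : ∀ i, ContMDiffWithinAt J 𝓘(ℝ, F) ∞ (fun q => (e ⟨φ q, g i (φ q)⟩).2) S p := fun i =>
    (contMDiffWithinAt_totalSpace.1 ((hg i (φ p)).comp_contMDiffWithinAt p hφ)).2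
  have h2 : ContMDiffWithinAt J 𝓘(ℝ, F) ∞ (fun q => ∑ i, c i q • (e ⟨φ q, g i (φ q)⟩).2) S p :=
    ContMDiffWithinAt.sum fun i _ => (hc i).smul (h1 i)
  have hb : φ p ∈ e.baseSet := FiberBundle.mem_baseSet_trivializationAt' _
  have hlin : ∀ q, φ q ∈ e.baseSet → (e ⟨φ q, ∑ i, c i q • g i (φ q)⟩).2 = ∑ i, c i q • (e ⟨φ q, g i (φ q)⟩).2 := by
    intro q hq
    have := map_sum (e.linearEquivAt ℝ (φ q) hq) (fun i => c i q • g i (φ q)) Finset.univ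
    simpa only [map_smul, Trivialization.linearEquivAt_apply] using this
  refine h2.congr_of_eventuallyEq ?_ (hlin p hb)
  filter_upwards [hφ.continuousWithinAt.preimage_mem_nhdsWithin (e.open_baseSet.mem_nhds hb)] with q hq
  exact hlin q hq

/-- The inner product of a smooth section with a smooth section along a map is smooth. -/
lemma contMDiffWithinAt_inner (hin : IsSmoothMetric k F E) [∀ x, FiniteDimensional ℝ (E x)]
    {s : ∀ q, E (φ q)} (hs : ContMDiffWithinAt J ((Q k).prod 𝓘(ℝ, F)) ∞
      (fun q => (⟨φ q, s q⟩ : TotalSpace F E)) S p) {g : ∀ x, E x} (hg : g ∈ smoothSections k F E) :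
    ContMDiffWithinAt J 𝓘(ℝ, ℝ) ∞ (fun q => ⟪g (φ q); s q⟫) S p := by
  have := finiteDimensional_model (F := F) (E := E) (φ p)
  obtain ⟨U, e, hUn, hUo, -, he, -, -, hrep⟩ := exists_local_basis (k := k) (E := E) (φ p) (Module.finBasis ℝ F)
  obtain ⟨hφ, hs2⟩ := contMDiffWithinAt_totalSpace.1 hs
  have h1 : ∀ a, ContMDiffWithinAt J 𝓘(ℝ, ℝ) ∞ (fun q => (Module.finBasis ℝ F).repr
      (trivializationAt F E (φ p) ⟨φ q, s q⟩).2 a) S p := fun a =>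
    ((((Module.finBasis ℝ F).coord a).toContinuousLinearMap.contDiff (n := ∞)).contMDiff.contMDiffAt).comp_contMDiffWithinAt p hs2
  have h2 : ContMDiffWithinAt J 𝓘(ℝ, ℝ) ∞ (fun q => ∑ a, (Module.finBasis ℝ F).repr
      (trivializationAt F E (φ p) ⟨φ q, s q⟩).2 a * ⟪g (φ q); e a (φ q)⟫) S p :=
    ContMDiffWithinAt.sum fun a _ => (h1 a).mul ((hin g hg (e a) (he a) (φ p)).comp_contMDiffWithinAt p hφ)
  have h3 : ∀ q, φ q ∈ U → ⟪g (φ q); s q⟫ = ∑ a, (Module.finBasis ℝ F).repr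
      (trivializationAt F E (φ p) ⟨φ q, s q⟩).2 a * ⟪g (φ q); e a (φ q)⟫ := by
    intro q hq
    conv_lhs => rw [hrep (φ q) hq (s q)]
    rw [inner_sum]
    exact sum_congr rfl fun a _ => real_inner_smul_right _ _ _
  refine h2.congr_of_eventuallyEq ?_ (h3 p (mem_of_mem_nhds hUn))
  filter_upwards [hφ.continuousWithinAt.preimage_mem_nhdsWithin hUn] with q hq
  exact h3 q hq

end Along

end Frames

/-! ### Parseval frames of hermitian vector bundles -/

section CFrames

variable {k : ℕ} {M : Type*} [TopologicalSpace M] [ChartedSpace ℝ₊^k M]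
  {F : Type*} [NormedAddCommGroup F] [NormedSpace ℂ F]
  {E : M → Type*} [TopologicalSpace (TotalSpace F E)]
  [∀ x, NormedAddCommGroup (E x)] [∀ x, InnerProductSpace ℂ (E x)] [FiberBundle F E]

/-- A finite family of smooth sections `gᵢ` with `v = ∑ ⟨gᵢ, v⟩ gᵢ`. -/
structure IsCParseval (k : ℕ) {M : Type*} [TopologicalSpace M] [ChartedSpace ℝ₊^k M]
    (F : Type*) [NormedAddCommGroup F] [NormedSpace ℂ F]
    {E : M → Type*} [TopologicalSpace (TotalSpace F E)]
    [∀ x, NormedAddCommGroup (E x)] [∀ x, InnerProductSpace ℂ (E x)] [FiberBundle F E]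
    {ι : Type*} [Fintype ι] (g : ι → ∀ x, E x) : Prop where
  smooth : ∀ i, g i ∈ smoothSections k F E
  sum_eq : ∀ x v, ∑ i, ⟪g i x, v⟫ • g i x = v

variable [VectorBundle ℝ F E] [ContMDiffVectorBundle ∞ F E (Q k)]

attribute [local instance] InnerProductSpace.complexToReal

lemma IsSmoothHermitian.isSmoothMetric (hE : IsSmoothHermitian k F E) : IsSmoothMetric k F E := by
  intro s hs s' hs' x
  exact (Complex.reCLM.contDiff (n := ∞)).contMDiff.contMDiffAt.comp x (hE s hs s' hs' x)

variable [IsManifold (Q k) ∞ M] [T2Space M] [CompactSpace M] [∀ x, FiniteDimensional ℂ (E x)]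

lemma mem_smoothSections_I_smul (hE : IsSmoothHermitian k F E) {s : ∀ x, E x}
    (hs : s ∈ smoothSections k F E) : (fun x => Complex.I • s x) ∈ smoothSections k F E := by
  have : ∀ x, FiniteDimensional ℝ (E x) := fun x => FiniteDimensional.complexToReal (E x)
  obtain ⟨K, g, hg⟩ := exists_parseval hE.isSmoothMetric
  have h1 : ∀ i x, ⟪g i x; Complex.I • s x⟫ = -⟪g i x, s x⟫.im := by
    intro i x
    change ⟪g i x, Complex.I • s x⟫.re = _
    rw [inner_smul_right]
    simp
  intro x
  have h2 := contMDiffWithinAt_sum_smul (J := Q k) (φ := id) (S := univ) (p := x) hg.smooth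
    contMDiffWithinAt_id (c := fun i x => -⟪g i x, s x⟫.im) fun i => by
      have h3 := (Complex.imCLM.contDiff (n := ∞)).contMDiff.contMDiffAt.comp x (hE _ (hg.smooth i) _ hs x)
      exact h3.neg.contMDiffWithinAt
  have h4 : (fun q => (⟨id q, ∑ i, (-⟪g i q, s q⟫.im) • g i (id q)⟩ : TotalSpace F E)) = fun x => ⟨x, Complex.I • s x⟩ := by
    funext q
    simp_rw [← h1]
    exact congrArg (fun v => (⟨q, v⟩ : TotalSpace F E)) (hg.sum_eq q _)
  rw [h4] at h2
  exact h2.contMDiffAt univ_mem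

theorem exists_cparseval (hE : IsSmoothHermitian k F E) : ∃ (K : ℕ) (g : Fin K → ∀ x, E x), IsCParseval k F g := by
  have : ∀ x, FiniteDimensional ℝ (E x) := fun x => FiniteDimensional.complexToReal (E x)
  obtain ⟨K, g, hg⟩ := exists_parseval hE.isSmoothMetric
  refine ⟨K, fun i x => (sqrt 2)⁻¹ • g i x, fun i => mem_smoothSections_smul contMDiff_const (hg.smooth i), fun x v => ?_⟩
  have h1 : ∀ i, ⟪(sqrt 2)⁻¹ • g i x, v⟫ • (sqrt 2)⁻¹ • g i x =
      (2⁻¹ : ℂ) • (⟪g i x; v⟫ • g i x - Complex.I • ⟪g i x; Complex.I • v⟫ • g i x) := by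
    intro i
    have h2 : ⟪g i x, v⟫ = (⟪g i x; v⟫ : ℂ) - Complex.I * (⟪g i x; Complex.I • v⟫ : ℂ) := by
      change _ = ((⟪g i x, v⟫.re : ℝ) : ℂ) - Complex.I * ((⟪g i x, Complex.I • v⟫.re : ℝ) : ℂ)
      rw [inner_smul_right]
      apply Complex.ext <;> simp
    have h3 : ∀ (a : ℝ) (w : E x), a • w = (a : ℂ) • w := fun a w => (Complex.coe_smul a w).symm
    have h4 : ((sqrt 2 : ℝ) : ℂ)⁻¹ * ((sqrt 2 : ℝ) : ℂ)⁻¹ = 2⁻¹ := by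
      rw [← mul_inv, ← Complex.ofReal_mul, Real.mul_self_sqrt (by norm_num)]
      norm_num
    simp only [h3]
    rw [inner_smul_left, smul_smul, h2, smul_smul, ← sub_smul, smul_smul, ← h4]
    congr 1
    simp only [Complex.ofReal_inv, map_inv₀, Complex.conj_ofReal]
    ring
  simp_rw [h1]
  rw [← smul_sum, sum_sub_distrib, hg.sum_eq, ← smul_sum, hg.sum_eq, smul_smul,
    Complex.I_mul_I, neg_one_smul, sub_neg_eq_add, ← two_smul ℂ v, smul_smul]
  norm_num

variable {EX : Type*} [NormedAddCommGroup EX] [NormedSpace ℝ EX] {HX : Type*} [TopologicalSpace HX]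
  {J : ModelWithCorners ℝ EX HX} {X : Type*} [TopologicalSpace X] [ChartedSpace HX X]
  {φ : X → M} {S : Set X} {p : X}

lemma contMDiffWithinAt_csum_smul (hE : IsSmoothHermitian k F E) {ι : Type*} [Fintype ι] {g : ι → ∀ x, E x}
    (hg : ∀ i, g i ∈ smoothSections k F E) (hφ : ContMDiffWithinAt J (Q k) ∞ φ S p) {c : ι → X → ℂ}
    (hc : ∀ i, ContMDiffWithinAt J 𝓘(ℝ, ℂ) ∞ (c i) S p) :
    ContMDiffWithinAt J ((Q k).prod 𝓘(ℝ, F)) ∞ (fun q => (⟨φ q, ∑ i, c i q • g i (φ q)⟩ : TotalSpace F E)) S p := by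
  have h1 := contMDiffWithinAt_sum_smul (J := J) (S := S) (p := p) (ι := ι ⊕ ι) (g := Sum.elim g fun i x => Complex.I • g i x)
    (by rintro (i | i); exacts [hg i, mem_smoothSections_I_smul hE (hg i)]) hφ
    (c := Sum.elim (fun i q => (c i q).re) fun i q => (c i q).im)
    (by
      rintro (i | i)
      · exact (Complex.reCLM.contDiff (n := ∞)).contMDiff.contMDiffAt.comp_contMDiffWithinAt p (hc i)
      · exact (Complex.imCLM.contDiff (n := ∞)).contMDiff.contMDiffAt.comp_contMDiffWithinAt p (hc i))
  refine h1.congr_of_eventuallyEq (.of_forall fun q => ?_) ?_ <;>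
  · refine congrArg (fun v => (⟨φ _, v⟩ : TotalSpace F E)) ?_
    simp only [Fintype.sum_sum_type, Sum.elim_inl, Sum.elim_inr]
    rw [← sum_add_distrib]
    refine sum_congr rfl fun i _ => ?_
    rw [← Complex.coe_smul, ← Complex.coe_smul, smul_smul, ← add_smul, Complex.re_add_im]

lemma contMDiffWithinAt_cinner (hE : IsSmoothHermitian k F E) {s : ∀ q, E (φ q)} (hs : ContMDiffWithinAt J ((Q k).prod 𝓘(ℝ, F)) ∞
      (fun q => (⟨φ q, s q⟩ : TotalSpace F E)) S p) {g : ∀ x, E x} (hg : g ∈ smoothSections k F E) :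
    ContMDiffWithinAt J 𝓘(ℝ, ℂ) ∞ (fun q => ⟪g (φ q), s q⟫) S p := by
  have : ∀ x, FiniteDimensional ℝ (E x) := fun x => FiniteDimensional.complexToReal (E x)
  have h1 := contMDiffWithinAt_inner hE.isSmoothMetric hs hg
  have h2 := contMDiffWithinAt_inner hE.isSmoothMetric hs (mem_smoothSections_I_smul hE hg)
  have h3 := ((Complex.ofRealCLM.contDiff (n := ∞)).contMDiff.contMDiffAt.comp_contMDiffWithinAt p h1).add
    (((contDiff_const (c := Complex.I)).mul (Complex.ofRealCLM.contDiff (n := ∞))).contMDiff.contMDiffAt.comp_contMDiffWithinAt p h2)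
  refine h3.congr_of_eventuallyEq (.of_forall fun q => ?_) ?_ <;>
  · change _ = ((⟪_, _⟫.re : ℝ) : ℂ) + Complex.I * ((⟪Complex.I • _, _⟫.re : ℝ) : ℂ)
    rw [inner_smul_left]
    apply Complex.ext <;> simp

end CFrames

/-! ### The divergence of the vector fields of a frame in a chart -/

section Det

variable {n : ℕ} {X : Type*} [NormedAddCommGroup X] [NormedSpace ℝ X]

lemma differentiable_det : Differentiable ℝ fun A : Fin n → Fin n → ℝ => det (of A) := by
  simp only [Matrix.det_apply, Matrix.of_apply]
  fun_prop

lemma fderiv_det_one (M : Fin n → Fin n → ℝ) :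
    fderiv ℝ (fun A : Fin n → Fin n → ℝ => det (of A)) (1 : Matrix (Fin n) (Fin n) ℝ) M = trace (of M) := by
  have h1 : HasDerivAt (fun r : ℝ => (fun i j => (1 : Matrix (Fin n) (Fin n) ℝ) i j) + r • M) M 0 := by
    simpa using ((hasDerivAt_id (0 : ℝ)).smul_const M).const_add (fun i j => (1 : Matrix (Fin n) (Fin n) ℝ) i j)
  have h2 := HasFDerivAt.comp_hasDerivAt (0 : ℝ) (f := fun r : ℝ => (fun i j => (1 : Matrix (Fin n) (Fin n) ℝ) i j) + r • M)
    (by rw [zero_smul, add_zero]; exact (differentiable_det _).hasFDerivAt) h1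
  have h3 : HasDerivAt (fun r : ℝ => 1 + trace (of M) * r +
      (det (1 + (Polynomial.X : Polynomial ℝ) • (of M).map Polynomial.C)).divX.divX.eval r * r ^ 2)
      (trace (of M)) 0 := by
    have := (((hasDerivAt_id (0 : ℝ)).const_mul (trace (of M))).const_add 1).add
      (((det (1 + (Polynomial.X : Polynomial ℝ) • (of M).map Polynomial.C)).divX.divX.hasDerivAt 0).mul
        ((hasDerivAt_id (0 : ℝ)).pow 2))
    have h4 := this.congr_deriv (g' := trace (of M)) (by simp)
    exact h4
  refine h2.unique (h3.congr_of_eventuallyEq (.of_forall fun r => ?_))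
  exact Matrix.det_one_add_smul r (of M)

/-- Jacobi's formula. -/
lemma hasFDerivAt_det {H : X → Fin n → Fin n → ℝ} {z : X} {H' : X →L[ℝ] (Fin n → Fin n → ℝ)}
    (hH : HasFDerivAt H H' z) {G : Matrix (Fin n) (Fin n) ℝ} (hG : G * of (H z) = 1) :
    ∃ L : X →L[ℝ] ℝ, HasFDerivAt (fun x => det (of (H x))) L z ∧
      ∀ v, L v = det (of (H z)) * trace (G * of (H' v)) := by
  have hG' : of (H z) * G = 1 := mul_eq_one_comm.1 hG
  let T : (Fin n → Fin n → ℝ) →L[ℝ] (Fin n → Fin n → ℝ) := LinearMap.toContinuousLinearMap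
    { toFun := fun A => (G * of A : Matrix (Fin n) (Fin n) ℝ)
      map_add' := fun A B => Matrix.mul_add G (of A) (of B)
      map_smul' := fun r A => Matrix.mul_smul G r (of A) }
  have hT : ∀ A, T A = (G * of A : Matrix (Fin n) (Fin n) ℝ) := fun A => rfl
  have h1 : HasFDerivAt (fun x => T (H x)) (T ∘L H') z := T.hasFDerivAt.comp z hH
  have h2 : T (H z) = (1 : Matrix (Fin n) (Fin n) ℝ) := hG
  have h3 := HasFDerivAt.comp z (f := fun x => T (H x)) (by
    rw [h2]; exact (differentiable_det (1 : Matrix (Fin n) (Fin n) ℝ)).hasFDerivAt) h1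
  have h4 := h3.const_mul (det (of (H z)))
  refine ⟨_, h4.congr_of_eventuallyEq (.of_forall fun x => ?_), fun v => ?_⟩
  · change _ = det (of (H z)) * det (G * of (H x))
    rw [← Matrix.det_mul, ← mul_assoc, hG', one_mul]
  · change det (of (H z)) * (fderiv ℝ _ _ (T (H' v))) = _
    rw [fderiv_det_one]
    rfl

end Det

section Density

variable {n K : ℕ}

lemma sum_smul_single (v : ℝ^n) : ∑ a, v a • (single a 1 : ℝ^n) = v := by
  ext c
  simp [Finset.sum_apply, Pi.single_apply]

/-- The matrix `∑ⱼ Uⱼ ⊗ Uⱼ`, the inverse of the metric with Parseval frame `(Uⱼ)`. -/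
def cometric (U : Fin K → ℝ^n) : Fin n → Fin n → ℝ :=
  fun a b => ∑ j, U j a * U j b

/-- The density of the metric with Parseval frame `(Uⱼ)`. -/
def frameDensity (U : Fin K → ℝ^n) : ℝ :=
  (sqrt (det (of (cometric U))))⁻¹

lemma hasFDerivAt_frameDensity {U : Fin K → ℝ^n → ℝ^n} {z : ℝ^n} {C : Fin K → Fin K → Fin K → ℝ} (hU : ∀ j, DifferentiableAt ℝ (U j) z)
    (hbr : ∀ i j, fderiv ℝ (U j) z (U i z) - fderiv ℝ (U i) z (U j z) = ∑ k, C i j k • U k z)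
    {G : Matrix (Fin n) (Fin n) ℝ} (hG : G * of (cometric fun j => U j z) = 1)
    (hC : ∀ i j, ∑ k, C i j k * (∑ a, ∑ b, G a b * U k z a * U j z b) = C i j j)
    (hdet : 0 < det (of (cometric fun j => U j z))) (i : Fin K) :
    ∃ L : ℝ^n →L[ℝ] ℝ, HasFDerivAt (fun z => frameDensity fun j => U j z) L z ∧
      L (U i z) + frameDensity (fun j => U j z) * ∑ a, fderiv ℝ (U i) z (single a 1) a =
        - (frameDensity (fun j => U j z) * ∑ j, C i j j) := by
  have hUa : ∀ j a, HasFDerivAt (fun z => U j z a) ((proj a : ℝ^n →L[ℝ] ℝ) ∘L fderiv ℝ (U j) z) z := fun j a =>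
    (proj a : ℝ^n →L[ℝ] ℝ).hasFDerivAt.comp z (hU j).hasFDerivAt
  have hH := hasFDerivAt_pi.2 fun a => hasFDerivAt_pi.2 fun b => HasFDerivAt.fun_sum (u := Finset.univ) fun j _ =>
    (hUa j a).mul (hUa j b)
  obtain ⟨L, hL, hL2⟩ := hasFDerivAt_det (H := fun z => cometric fun j => U j z) hH hG
  set d := det (of (cometric fun j => U j z)) with hd
  have h1 := (hasDerivAt_inv (Real.sqrt_pos.2 hdet).ne').comp_hasFDerivAt z
    ((Real.hasDerivAt_sqrt hdet.ne').comp_hasFDerivAt z hL)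
  refine ⟨_, h1, ?_⟩
  have hGs : ∀ a b, G a b = G b a := fun a b => by
    have h3 : (of (cometric fun j => U j z)).transpose = of (cometric fun j => U j z) :=
      Matrix.ext fun a b => show ∑ j, U j z b * U j z a = ∑ j, U j z a * U j z b from sum_congr rfl fun j _ => mul_comm _ _
    rw [← Matrix.transpose_apply G, ← Matrix.inv_eq_left_inv hG, Matrix.transpose_nonsing_inv, h3]
  set D := fun c a => fderiv ℝ (U i) z (single c 1) a with hD
  have hGH : ∀ a c, ∑ b, G a b * ∑ j, U j z b * U j z c = if a = c then 1 else 0 := fun a c =>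
    congrFun (congrFun hG a) c
  have hexp : ∀ j b, fderiv ℝ (U j) z (U i z) b = ∑ c, U j z c * D c b + ∑ k, C i j k * U k z b := by
    intro j b
    have h4 : fderiv ℝ (U i) z (U j z) b = ∑ c, U j z c * D c b := by
      conv_lhs => rw [← sum_smul_single (U j z), map_sum]
      simp [Finset.sum_apply, hD]
    have h3 := congrArg (fun v : ℝ^n => v b) (hbr i j)
    simp only [PiLp.sub_apply, WithLp.ofLp_sum, Finset.sum_apply, PiLp.smul_apply, smul_eq_mul] at h3
    rw [← h4, ← h3]
    ring
  have htr : L (U i z) = d * (2 * (∑ a, D a a + ∑ j, C i j j)) := by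
    have h6 : L (U i z) = d * ∑ a, ∑ b, G a b * ∑ j, (U j z b * fderiv ℝ (U j) z (U i z) a + U j z a * fderiv ℝ (U j) z (U i z) b) := by
      rw [hL2]
      simp only [trace, Matrix.diag_apply, Matrix.mul_apply, Matrix.of_apply,
        ContinuousLinearMap.coe_pi', sum_apply, add_apply, smul_apply, ContinuousLinearMap.comp_apply, smul_eq_mul]
      rfl
    have h7 : ∑ a, ∑ b, G a b * ∑ j, U j z a * fderiv ℝ (U j) z (U i z) b =
        ∑ a, ∑ b, G a b * ∑ j, U j z b * fderiv ℝ (U j) z (U i z) a := by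
      rw [sum_comm]
      exact sum_congr rfl fun a _ => sum_congr rfl fun b _ => by rw [hGs b a]
    have h8 : ∀ a, ∑ b, G a b * ∑ j, U j z b * ∑ c, U j z c * D c a = D a a := by
      intro a
      trans ∑ c, (∑ b, G a b * ∑ j, U j z b * U j z c) * D c a
      · simp only [mul_sum, sum_mul]
        conv_lhs => enter [2, b]; rw [sum_comm]
        rw [sum_comm]
        exact sum_congr rfl fun c _ => sum_congr rfl fun b _ => sum_congr rfl fun j _ => by ring
      · simp [hGH]
    have h10 : ∑ a, ∑ b, G a b * ∑ j, U j z b * ∑ k, C i j k * U k z a = ∑ j, C i j j := by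
      simp_rw [← hC i, mul_sum]
      rw [sum_comm]
      conv_lhs => enter [2, b]; rw [sum_comm]
      rw [sum_comm]
      refine sum_congr rfl fun j _ => ?_
      conv_lhs => enter [2, b]; rw [sum_comm]
      rw [sum_comm]
      refine sum_congr rfl fun k _ => ?_
      rw [sum_comm]
      exact sum_congr rfl fun a _ => sum_congr rfl fun b _ => by ring
    rw [h6, ← h10, ← sum_congr rfl fun a _ => h8 a]
    simp only [hexp, sum_add_distrib, mul_add] at h7 ⊢
    linear_combination d * h7
  have hs : sqrt d ^ 2 = d := Real.sq_sqrt hdet.le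
  have hs0 : sqrt d ≠ 0 := (Real.sqrt_pos.2 hdet).ne'
  simp only [smul_apply, smul_eq_mul, htr, frameDensity, ← hd, hs]
  field_simp
  ring

end Density

/-! ### Smooth families of curves and linear differential equations -/

section Curry

variable {T : ℝ} {Z : Type} [NormedAddCommGroup Z] [NormedSpace ℝ Z]

/-- The curve `t ↦ g (t, z)`. -/
def curve {F : Type*} [TopologicalSpace F] [Zero F] {X : Type*} (T : ℝ) (g : ℝ × X → F) (z : X) : C(Icc 0 T, F) :=
  open Classical in if h : Continuous fun t : Icc 0 T => g (t, z) then ⟨_, h⟩ else 0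

lemma curve_apply {F : Type*} [TopologicalSpace F] [Zero F] {X : Type*} [TopologicalSpace X] {g : ℝ × X → F} {D : Set X}
    (hg : ContinuousOn g (Icc 0 T ×ˢ D)) {z : X} (hz : z ∈ D) (t : Icc 0 T) : curve T g z t = g (t, z) := by
  have h : Continuous fun t : Icc 0 T => g (t, z) := hg.comp_continuous (by fun_prop) fun t => ⟨t.2, hz⟩
  rw [curve, dif_pos h]
  rfl

lemma continuousOn_curve {F : Type*} [TopologicalSpace F] [Zero F] {X : Type*} [TopologicalSpace X] {g : ℝ × X → F} {D : Set X}
    (hg : ContinuousOn g (Icc 0 T ×ˢ D)) : ContinuousOn (curve T g) D := by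
  rw [continuousOn_iff_continuous_domRestrict]
  let G : C(D × Icc 0 T, F) := ⟨fun p => g (p.2, p.1), hg.comp_continuous (by fun_prop) fun p => ⟨p.2.2, p.1.2⟩⟩
  have : D.domRestrict (curve T g) = fun z => G.curry z := by
    funext z
    ext t
    exact curve_apply hg z.2 t
  rw [this]
  exact G.curry.continuous

variable {F : Type} [NormedAddCommGroup F] [NormedSpace ℝ F]

/-- A curve of linear maps as a linear map into curves. -/
def curveCLM : C(Icc 0 T, Z →L[ℝ] F) →L[ℝ] Z →L[ℝ] C(Icc 0 T, F) :=
  LinearMap.mkContinuous₂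
    (LinearMap.mk₂ ℝ (fun (a : C(Icc 0 T, Z →L[ℝ] F)) (v : Z) => (⟨fun t => a t v, a.continuous.clm_apply continuous_const⟩ :
        C(Icc 0 T, F)))
      (fun a b f => by ext t; simp) (fun c a f => by ext t; simp)
      (fun a f g => by ext t; simp) (fun c a f => by ext t; simp)) 1
    (fun a v => by
      rw [one_mul]
      refine (ContinuousMap.norm_le _ (by positivity)).2 fun t => ?_
      exact ((a t).le_opNorm v).trans (mul_le_mul_of_nonneg_right (a.norm_coe_le_norm t) (norm_nonneg _)))

lemma hasFDerivWithinAt_curve {D : Set Z} (hD : Convex ℝ D) {g : ℝ × Z → F} {g' : ℝ × Z → Z →L[ℝ] F}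
    (hg : ContinuousOn g (Icc 0 T ×ˢ D)) (hg' : ContinuousOn g' (Icc 0 T ×ˢ D))
    (h : ∀ t ∈ Icc 0 T, ∀ z ∈ D, HasFDerivWithinAt (fun z => g (t, z)) (g' (t, z)) D z) {z : Z} (hz : z ∈ D) :
    HasFDerivWithinAt (curve T g) (curveCLM (curve T g' z)) D z := by
  rw [hasFDerivWithinAt_iff_isLittleO, Asymptotics.isLittleO_iff]
  intro ε hε
  have h1 := continuousOn_curve hg' z hz
  obtain ⟨δ, hδ, h2⟩ := Metric.mem_nhdsWithin_iff.1 (Metric.tendstoUniformly_iff.1 (ContinuousMap.tendsto_iff_tendstoUniformly.1 h1) ε hε)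
  filter_upwards [inter_mem_nhdsWithin D (Metric.ball_mem_nhds z hδ)] with w hw
  refine (ContinuousMap.norm_le _ (by positivity)).2 fun t => ?_
  have h3 : (curve T g w - curve T g z - curveCLM (curve T g' z) (w - z)) t = g (t, w) - g (t, z) - g' (t, z) (w - z) := by
    change curve T g w t - curve T g z t - (curve T g' z t) (w - z) = _
    rw [curve_apply hg hw.1, curve_apply hg hz, curve_apply hg' hz]
  rw [h3]
  refine Convex.norm_image_sub_le_of_norm_hasFDerivWithin_le' (f := fun z => g (t, z)) (f' := fun z => g' (t, z))
    (s := D ∩ Metric.ball z δ) (fun x hx => (h t t.2 x hx.1).mono inter_subset_left) (fun x hx => ?_)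
    (hD.inter (convex_ball z δ)) ⟨hz, Metric.mem_ball_self hδ⟩ hw
  have h4 : dist (curve T g' z t) (curve T g' x t) < ε := h2 ⟨hx.2, hx.1⟩ t
  rw [dist_comm, dist_eq_norm, curve_apply hg' hx.1, curve_apply hg' hz] at h4
  exact h4.le

lemma contDiffOn_curve_nat {D : Set Z} (hD : Convex ℝ D) (hDu : UniqueDiffOn ℝ D) (hT : 0 < T) (n : ℕ) :
    ∀ {F : Type} [NormedAddCommGroup F] [NormedSpace ℝ F] {g : ℝ × Z → F},
    ContDiffOn ℝ ∞ g (Icc 0 T ×ˢ D) → ContDiffOn ℝ n (curve T g) D := by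
  have hu : UniqueDiffOn ℝ (Icc 0 T ×ˢ D) := (uniqueDiffOn_Icc hT).prod hDu
  induction n with
  | zero =>
    intro F _ _ g hg
    exact contDiffOn_zero.2 (continuousOn_curve hg.continuousOn)
  | succ n ih =>
    intro F _ _ g hg
    let g' : ℝ × Z → Z →L[ℝ] F := fun p => (fderivWithin ℝ g (Icc 0 T ×ˢ D) p).comp (ContinuousLinearMap.inr ℝ ℝ Z)
    have hg' : ContDiffOn ℝ ∞ g' (Icc 0 T ×ˢ D) := (hg.fderivWithin hu (m := ∞) (by simp)).clm_comp contDiffOn_const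
    have hd : ∀ z ∈ D, HasFDerivWithinAt (curve T g) (curveCLM (curve T g' z)) D z := fun z hz =>
      hasFDerivWithinAt_curve hD hg.continuousOn hg'.continuousOn (fun t ht z hz => by
        have h1 : HasFDerivWithinAt g (fderivWithin ℝ g (Icc 0 T ×ˢ D) (t, z)) (Icc 0 T ×ˢ D) (t, z) :=
          (hg.differentiableOn (by simp) (t, z) ⟨ht, hz⟩).hasFDerivWithinAt
        exact h1.comp z (hasFDerivAt_prodMk_right t z).hasFDerivWithinAt fun w hw => ⟨ht, hw⟩) hz
    push_cast
    rw [contDiffOn_succ_iff_fderivWithin hDu]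
    refine ⟨fun z hz => (hd z hz).differentiableWithinAt, by simp, ?_⟩
    exact (curveCLM.contDiff.comp_contDiffOn (ih hg')).congr fun z hz => by
      rw [(hd z hz).fderivWithin (hDu z hz), Function.comp_apply]

end Curry

lemma range_Q (n : ℕ) : range (Q n) = {y : ℝ^n | ∀ a, 0 ≤ y a} := range_euclideanQuadrant n

lemma interior_range_Q (n : ℕ) : interior (range (Q n)) = {y : ℝ^n | ∀ a, 0 < y a} := by
  rw [range_Q]; exact interior_euclideanQuadrant n 2 0

section ODE

variable {n : ℕ} {Y : Type*} [TopologicalSpace Y] [ChartedSpace ℝ₊^n Y]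
  [IsManifold (Q n) ∞ Y] {F : Type} [NormedAddCommGroup F] [NormedSpace ℝ F]

lemma contMDiff_curve {r T : ℝ} (hT : 0 < T) (hTr : T < r) {a : ℝ × Y → F}
    (ha : ContMDiffOn (𝓘(ℝ, ℝ).prod (Q n)) 𝓘(ℝ, F) ∞ a (Ico 0 r ×ˢ univ)) :
    ContMDiff (Q n) 𝓘(ℝ, C(Icc 0 T, F)) ∞ (curve T a) := by
  have hsub : Icc 0 T ×ˢ (univ : Set Y) ⊆ Ico 0 r ×ˢ univ := prod_mono (fun t ht => ⟨ht.1, ht.2.trans_lt hTr⟩) subset_rfl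
  intro y
  have hcont : Continuous (curve T a) := by
    rw [← continuousOn_univ]
    exact continuousOn_curve (ha.continuousOn.mono hsub)
  rw [contMDiffAt_iff]
  refine ⟨hcont.continuousAt, ?_⟩
  simp only [extChartAt_self_eq, Function.comp_def]
  set φ := κ n y with hφ
  obtain ⟨ε, hε, hball⟩ := Metric.mem_nhdsWithin_iff.1 (extChartAt_target_mem_nhdsWithin (I := Q n) y)
  set D := Metric.ball (φ y) ε ∩ range (Q n) with hDdef
  have hD : Convex ℝ D := by
    refine (convex_ball _ _).inter ?_
    rw [range_Q]
    exact fun x hx z hz s t hs ht _ i => add_nonneg (mul_nonneg hs (hx i)) (mul_nonneg ht (hz i))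
  have hDu : UniqueDiffOn ℝ D := by
    rw [hDdef, inter_comm]
    exact (Q n).uniqueDiffOn.inter Metric.isOpen_ball
  have hg : ContDiffOn ℝ ∞ (fun p : ℝ × ℝ^n => a (p.1, φ.symm p.2)) (Icc 0 T ×ˢ D) := by
    rw [← contMDiffOn_iff_contDiffOn]
    refine ha.comp (t := Ico 0 r ×ˢ univ) (f := fun p : ℝ × ℝ^n => (p.1, φ.symm p.2)) ?_
      fun p hp => ⟨⟨hp.1.1, hp.1.2.trans_lt hTr⟩, mem_univ _⟩
    refine ContMDiffOn.prodMk (contDiff_fst.contMDiff.contMDiffOn) ?_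
    exact (contMDiffOn_extChartAt_symm y).comp (contDiff_snd.contMDiff.contMDiffOn) fun p hp => hball hp.2
  have h1 : ContDiffOn ℝ ∞ (curve T fun p : ℝ × ℝ^n => a (p.1, φ.symm p.2)) D :=
    contDiffOn_infty.2 fun k => contDiffOn_curve_nat hD hDu hT k hg
  have hyD : φ y ∈ D := ⟨Metric.mem_ball_self hε, extChartAt_target_subset_range y (mem_extChartAt_target y)⟩
  have h2 : ContDiffWithinAt ℝ ∞ (curve T fun p : ℝ × ℝ^n => a (p.1, φ.symm p.2)) (range (Q n)) (φ y) :=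
    (h1 _ hyD).mono_of_mem_nhdsWithin (inter_mem (mem_nhdsWithin_of_mem_nhds (Metric.ball_mem_nhds _ hε)) self_mem_nhdsWithin)
  exact h2

variable [CompactSpace Y] [CompleteSpace F]

/-- The fundamental solution of a smooth family of linear differential equations. -/
theorem exists_fundamental_solution {r T : ℝ} (hT : 0 < T) (hTr : T < r) {a : ℝ × Y → F →L[ℝ] F}
    (ha : ContMDiffOn (𝓘(ℝ, ℝ).prod (Q n)) 𝓘(ℝ, F →L[ℝ] F) ∞ a (Ico 0 r ×ˢ univ)) :
    ∃ (S : ℝ → Y → F →L[ℝ] F) (B : ℝ), (∀ t, C∞(n, F →L[ℝ] F) (S t)) ∧ (∀ t ∈ Icc 0 T, ∀ y, ‖S t y - 1‖ ≤ B * t) ∧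
      ∀ y, ∀ w : ℝ → F, (∀ t ∈ Icc 0 T, HasDerivWithinAt w (a (t, y) (w t)) (Icc 0 T) t) → ∀ t ∈ Icc 0 T, w t = S t y (w 0) := by
  have hsub : Icc 0 T ×ˢ (univ : Set Y) ⊆ Ico 0 r ×ˢ univ := prod_mono (fun t ht => ⟨ht.1, ht.2.trans_lt hTr⟩) subset_rfl
  have hac : ContinuousOn a (Icc 0 T ×ˢ univ) := ha.continuousOn.mono hsub
  let V := volterra (X := F) hT.le
  let Θ : C(Icc 0 T, F →L[ℝ] F) → C(Icc 0 T, F) →L[ℝ] C(Icc 0 T, F) := fun b => Ring.inverse (1 - V ∘L mulOp b)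
  have hΘ : ContDiff ℝ ∞ Θ := by
    rw [contDiff_iff_contDiffAt]
    intro b
    obtain ⟨u, hu⟩ := isUnit_one_sub_volterra hT.le b
    have h1 : ContDiffAt ℝ ∞ Ring.inverse (1 - V ∘L mulOp b) := by
      rw [← hu]; exact contDiffAt_ringInverse ℝ u
    have h2 : ContDiff ℝ ∞ fun b : C(Icc 0 T, F →L[ℝ] F) => (1 : C(Icc 0 T, F) →L[ℝ] C(Icc 0 T, F)) - V ∘L mulOp b := by
      have h3 : ContDiff ℝ ∞ fun b : C(Icc 0 T, F →L[ℝ] F) => V ∘L mulOp b :=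
        let LL := (ContinuousLinearMap.compL ℝ C(Icc 0 T, F) C(Icc 0 T, F) C(Icc 0 T, F) V) ∘L (mulOp (T := T) (X := F) (Y := F))
        ContinuousLinearMap.contDiff (𝕜 := ℝ) (E := C(Icc 0 T, F →L[ℝ] F)) (F := C(Icc 0 T, F) →L[ℝ] C(Icc 0 T, F)) (n := ∞) LL
      exact contDiff_const.sub h3
    exact h1.comp b h2.contDiffAt
  let cst : F →L[ℝ] C(Icc 0 T, F) := curveCLM (ContinuousMap.const _ (ContinuousLinearMap.id ℝ F))
  have hcst : ∀ e, cst e = ContinuousMap.const _ e := fun e => rfl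
  let ev : ℝ → C(Icc 0 T, F) →L[ℝ] F := fun t => ContinuousMap.evalCLM ℝ (projIcc 0 T hT.le t)
  have hsol : ∀ b e, Θ b (cst e) = ContinuousMap.const _ e + V (mulOp b (Θ b (cst e))) := by
    intro b e
    have h1 := Ring.mul_inverse_cancel _ (isUnit_one_sub_volterra hT.le b)
    have h2 := congrArg (fun L : C(Icc 0 T, F) →L[ℝ] C(Icc 0 T, F) => L (cst e)) h1
    have h3 : Θ b (cst e) - V (mulOp b (Θ b (cst e))) = cst e := h2
    rw [← hcst]
    exact sub_eq_iff_eq_add.1 h3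
  have hsmooth := contMDiff_curve (n := n) hT hTr ha
  have hcont : Continuous fun y => ‖curve T a y‖ * ‖Θ (curve T a y)‖ :=
    hsmooth.continuous.norm.mul (hΘ.continuous.comp hsmooth.continuous).norm
  obtain ⟨B, hB⟩ := (isCompact_range hcont).bddAbove
  refine ⟨fun t y => ev t ∘L Θ (curve T a y) ∘L cst, B * ‖cst‖, fun t => ?_, ?_, ?_⟩
  · exact (contDiff_const.clm_comp (hΘ.clm_comp contDiff_const)).contMDiff.comp hsmooth
  · intro t ht y
    have hB0 : 0 ≤ B := le_trans (by positivity) (hB (mem_range_self y))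
    refine opNorm_le_bound _ (mul_nonneg (by positivity) ht.1) fun e => ?_
    have h1 : (ev t ∘L Θ (curve T a y) ∘L cst - 1) e = V (mulOp (curve T a y) (Θ (curve T a y) (cst e))) (projIcc 0 T hT.le t) := by
      change Θ (curve T a y) (cst e) (projIcc 0 T hT.le t) - e = _
      rw [hsol (curve T a y) e]
      simp only [ContinuousMap.add_apply, ContinuousMap.const_apply]
      rw [← hsol (curve T a y) e, add_sub_cancel_left]
    have h2 : ‖V (mulOp (curve T a y) (Θ (curve T a y) (cst e))) (projIcc 0 T hT.le t)‖ ≤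
        ‖mulOp (curve T a y) (Θ (curve T a y) (cst e))‖ * t := by
      rw [volterra_apply, projIcc_of_mem hT.le ht]
      have h3 := intervalIntegral.norm_integral_le_of_norm_le_const (a := 0) (b := t)
        (f := fun s => IccExtend hT.le (mulOp (curve T a y) (Θ (curve T a y) (cst e))) s)
        (C := ‖mulOp (curve T a y) (Θ (curve T a y) (cst e))‖) fun s _ => ContinuousMap.norm_coe_le_norm _ _
      rwa [sub_zero, abs_of_nonneg ht.1] at h3
    have h3 : ‖mulOp (curve T a y) (Θ (curve T a y) (cst e))‖ ≤ ‖curve T a y‖ * (‖Θ (curve T a y)‖ * (‖cst‖ * ‖e‖)) := by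
      refine (ContinuousMap.norm_le _ (by positivity)).2 fun s => ?_
      refine ((curve T a y s).le_opNorm _).trans (mul_le_mul ((curve T a y).norm_coe_le_norm s) ?_ (norm_nonneg _) (by positivity))
      refine ((Θ (curve T a y) (cst e)).norm_coe_le_norm s).trans ?_
      exact ((Θ (curve T a y)).le_opNorm _).trans (mul_le_mul_of_nonneg_left (cst.le_opNorm e) (norm_nonneg _))
    rw [h1]
    refine h2.trans ?_
    have h4 := hB (mem_range_self y)
    calc _ ≤ (‖curve T a y‖ * ‖Θ (curve T a y)‖) * (‖cst‖ * ‖e‖) * t :=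
          mul_le_mul_of_nonneg_right (h3.trans (by rw [mul_assoc])) ht.1
      _ ≤ B * (‖cst‖ * ‖e‖) * t := by
          gcongr
          exact ht.1
      _ = B * ‖cst‖ * t * ‖e‖ := by ring
  · intro y w hw t ht
    let wc : C(Icc 0 T, F) := ⟨fun s => w s, continuousOn_iff_continuous_domRestrict.1 fun s hs => (hw s hs).continuousWithinAt⟩
    have h0 : wc ⟨0, left_mem_Icc.2 hT.le⟩ = w 0 := rfl
    have h1 := eq_volterra_of_hasDerivWithinAt hT.le (f := wc) (g := mulOp (curve T a y) wc) fun s => by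
      have h2 : mulOp (curve T a y) wc s = a (s, y) (w s) := by
        rw [mulOp_apply, curve_apply hac (mem_univ y)]
        rfl
      rw [h2]
      refine (hw s s.2).congr (fun u hu => ?_) ?_
      · rw [IccExtend_of_mem hT.le _ hu]; rfl
      · rw [IccExtend_of_mem hT.le _ s.2]; rfl
    rw [h0] at h1
    have h3 : (1 - V ∘L mulOp (curve T a y)) wc = cst (w 0) := by
      change wc - V (mulOp (curve T a y) wc) = ContinuousMap.const _ (w 0)
      conv_lhs => enter [1]; rw [h1]
      rw [add_sub_cancel_right]
    have h4 := Ring.inverse_mul_cancel _ (isUnit_one_sub_volterra hT.le (curve T a y))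
    have h5 : Θ (curve T a y) (cst (w 0)) = wc := by
      rw [← h3]
      exact congrArg (fun L : C(Icc 0 T, F) →L[ℝ] C(Icc 0 T, F) => L wc) h4
    change w t = Θ (curve T a y) (cst (w 0)) (projIcc 0 T hT.le t)
    rw [h5, projIcc_of_mem hT.le ht]
    rfl

end ODE

section CMul

variable {EX : Type*} [NormedAddCommGroup EX] [NormedSpace ℝ EX] {HX : Type*} [TopologicalSpace HX]
  {J : ModelWithCorners ℝ EX HX} {X : Type*} [TopologicalSpace X] [ChartedSpace HX X]
  {S : Set X} {p : X} {f g : X → ℂ}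

lemma contMDiffWithinAt_cmul (hf : ContMDiffWithinAt J 𝓘(ℝ, ℂ) ∞ f S p) (hg : ContMDiffWithinAt J 𝓘(ℝ, ℂ) ∞ g S p) :
    ContMDiffWithinAt J 𝓘(ℝ, ℂ) ∞ (fun x => f x * g x) S p :=
  ((ContinuousLinearMap.mul ℝ ℂ).isBoundedBilinearMap.contDiff (n := ∞)).contMDiff.contMDiffAt.comp_contMDiffWithinAt p (hf.prodMk_space hg)

lemma contMDiff_cmul (hf : ContMDiff J 𝓘(ℝ, ℂ) ∞ f) (hg : ContMDiff J 𝓘(ℝ, ℂ) ∞ g) : ContMDiff J 𝓘(ℝ, ℂ) ∞ (fun x => f x * g x) := fun x =>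
  (contMDiffWithinAt_cmul (hf x).contMDiffWithinAt (hg x).contMDiffWithinAt).contMDiffAt univ_mem

end CMul

/-! ### Formal adjoints -/

open scoped ComplexOrder in
/-- The solutions of injective linear systems depend smoothly on the data. -/
lemma exists_smooth_solution (ι ϰ : Type) [Fintype ι] [Fintype ϰ] [DecidableEq ϰ] : ∃ Θ : (ι → ϰ → ℂ) × (ι → ℂ) → ϰ → ℂ,
    ∀ A : ι → ϰ → ℂ, (∀ x : ϰ → ℂ, (∀ p, ∑ i, A p i * x i = 0) → x = 0) → ∀ w, ContDiffAt ℝ ∞ Θ (A, w) ∧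
      ∀ x : ϰ → ℂ, (∀ p, ∑ i, A p i * x i = w p) → Θ (A, w) = x := by
  refine ⟨fun q => ((of q.1).conjTranspose * of q.1)⁻¹.mulVec ((of q.1).conjTranspose.mulVec q.2), fun A hA w => ?_⟩
  have hinj : Function.Injective (of A).mulVec := fun x y hxy => by
    refine sub_eq_zero.1 (hA _ fun p => ?_)
    have := congrFun hxy p
    simp only [Matrix.mulVec, dotProduct, Matrix.of_apply] at this
    simp only [Pi.sub_apply, mul_sub, sum_sub_distrib, this, sub_self]
  have hdet : IsUnit ((of A).conjTranspose * of A).det :=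
    (Matrix.isUnit_iff_isUnit_det _).1 (Matrix.PosDef.conjTranspose_mul_self _ hinj).isUnit
  have hconj : ContDiff ℝ ∞ (starRingEnd ℂ) := Complex.conjCLE.contDiff
  have hd : ContDiff ℝ ∞ fun B : ϰ → ϰ → ℂ => (of B).det := by
    simp only [Matrix.det_apply, Matrix.of_apply]
    fun_prop
  refine ⟨contDiffAt_pi.2 fun l => ?_, fun x hx => ?_⟩
  · simp only [Matrix.mulVec, dotProduct, Matrix.conjTranspose_apply, Matrix.of_apply, Matrix.inv_def, Matrix.adjugate_apply, Matrix.smul_apply, Ring.inverse_eq_inv', smul_eq_mul]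
    have h1 : ContDiff ℝ ∞ fun q : (ι → ϰ → ℂ) × (ι → ℂ) => fun i j => ((of q.1).conjTranspose * of q.1) i j := by
      refine contDiff_pi.2 fun i => contDiff_pi.2 fun j => ?_
      simp only [Matrix.mul_apply, Matrix.conjTranspose_apply, Matrix.of_apply]
      exact ContDiff.sum fun p _ => (hconj.comp (by fun_prop)).mul (by fun_prop)
    refine ContDiffAt.sum fun j _ => ContDiffAt.mul (ContDiffAt.mul ((hd.comp h1).contDiffAt.inv hdet.ne_zero) ?_) ?_
    · refine (hd.comp (contDiff_pi.2 fun i => contDiff_pi.2 fun k => ?_)).contDiffAt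
      rcases eq_or_ne i j with rfl | hij
      · convert contDiff_const (c := (Pi.single l 1 : ϰ → ℂ) k) using 2
        exact congrFun (Function.update_self ..) k
      · convert contDiff_pi.1 (contDiff_pi.1 h1 i) k using 2
        exact congrFun (Function.update_of_ne hij ..) k
    · refine ContDiff.contDiffAt (ContDiff.sum fun p _ => ContDiff.mul (hconj.comp ?_) (by fun_prop))
      fun_prop
  · have h1 : w = (of A).mulVec x := funext fun p => (hx p).symm
    simp only [h1]
    rw [Matrix.mulVec_mulVec, Matrix.mulVec_mulVec, Matrix.mul_assoc, Matrix.nonsing_inv_mul _ hdet, Matrix.one_mulVec]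

lemma sum_smul_comm {V : Type*} [AddCommGroup V] [Module ℂ V] {K r K' : ℕ} (β E D : Fin K → Fin r → ℂ) (x : Fin K' → Fin K → ℂ)
    (v : Fin K' → Fin r → ℂ) (s : Fin r → ℂ) (g : Fin r → V) :
    ∑ l, (∑ i, (∑ j, (∑ k, β k l * E k i * x j k) * v j i + (∑ k, β k l * D k i) * s i)) • g l =
      ∑ k, (∑ i, (E k i * ∑ j, x j k * v j i + D k i * s i)) • ∑ l, β k l • g l := by
  simp only [smul_sum]
  rw [sum_comm (s := Finset.univ (α := Fin K))]
  refine sum_congr rfl fun l _ => ?_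
  simp only [smul_smul, ← sum_smul]
  congr 1
  simp only [sum_mul, mul_sum, sum_add_distrib, add_mul]
  congr 1
  · rw [sum_comm (s := Finset.univ (α := Fin K))]
    refine sum_congr rfl fun i _ => ?_
    rw [sum_comm]
    exact sum_congr rfl fun k _ => sum_congr rfl fun j _ => by ring
  · rw [sum_comm]
    exact sum_congr rfl fun k _ => sum_congr rfl fun i _ => by ring

section NormL2

variable {N : Type*} [MeasurableSpace N] {ν : Measure N} {G : N → Type*} [∀ y, NormedAddCommGroup (G y)] [∀ y, InnerProductSpace ℂ (G y)]

lemma normL2_eq (h : ∀ y, G y) : normL2 ν h = (∫⁻ y, ENNReal.ofReal (‖h y‖ ^ 2) ∂ν) ^ (1 / 2 : ℝ) := by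
  rw [normL2, eLpNorm_eq_lintegral_rpow_enorm_toReal two_ne_zero ENNReal.ofNat_ne_top]
  simp [Real.enorm_eq_ofReal, ENNReal.ofReal_pow]

lemma ofReal_sqrt_integral {V : N → ℝ} (hV : Integrable V ν) (h0 : ∀ y, 0 ≤ V y) :
    ENNReal.ofReal (sqrt (∫ y, V y ∂ν)) = (∫⁻ y, ENNReal.ofReal (V y) ∂ν) ^ (1 / 2 : ℝ) := by
  rw [← ofReal_integral_eq_lintegral_ofReal hV (.of_forall h0), Real.sqrt_eq_rpow,
    ENNReal.ofReal_rpow_of_nonneg (integral_nonneg h0) (by norm_num)]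

lemma normL2_le_of_sq_le {R f a : ∀ y, G y} {V : N → ℝ} {D C t r : ℝ} (hD : 0 ≤ D) (hC : 0 ≤ C) (ht : 0 ≤ t) (htr : t ≤ r)
    (hV0 : ∀ y, 0 ≤ V y) (hV : Integrable V ν) (hf : Integrable (fun y => ‖f y‖ ^ 2) ν) (ha : Integrable (fun y => ‖a y‖ ^ 2) ν)
    (hle : ∀ y, ‖R y‖ ^ 2 ≤ D * (t ^ 2 * V y + ‖f y‖ ^ 2))
    (hVC : ∫ y, V y ∂ν ≤ C * (∫ y, ‖a y‖ ^ 2 ∂ν + ∫ y, ‖f y‖ ^ 2 ∂ν)) :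
    normL2 ν R ≤ ENNReal.ofReal (D + C + r ^ 2 * C + 1) * (ENNReal.ofReal t * normL2 ν a + normL2 ν f) := by
  have hi := ((hV.const_mul (t ^ 2)).add hf).const_mul D
  rw [normL2_eq R, normL2_eq f, normL2_eq a, ← ofReal_sqrt_integral hf fun _ => by positivity,
    ← ofReal_sqrt_integral ha fun _ => by positivity, ← ENNReal.ofReal_mul ht, ← ENNReal.ofReal_add (by positivity) (by positivity),
    ← ENNReal.ofReal_mul (by positivity)]
  refine (ENNReal.rpow_le_rpow (lintegral_mono fun y => ENNReal.ofReal_le_ofReal (hle y)) (by norm_num)).trans ?_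
  have h1 := ofReal_sqrt_integral hi fun y => mul_nonneg hD (add_nonneg (mul_nonneg (sq_nonneg t) (hV0 y)) (sq_nonneg _))
  refine (h1.symm.le).trans (ENNReal.ofReal_le_ofReal ?_)
  have h2 : ∫ y, D * (t ^ 2 * V y + ‖f y‖ ^ 2) ∂ν = D * (t ^ 2 * ∫ y, V y ∂ν + ∫ y, ‖f y‖ ^ 2 ∂ν) := by
    rw [integral_const_mul, integral_add (hV.const_mul _) hf, integral_const_mul]
  refine (Real.sqrt_le_sqrt h2.le).trans (Real.sqrt_le_iff.2 ⟨by positivity, ?_⟩)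
  have hα : 0 ≤ ∫ y, ‖a y‖ ^ 2 ∂ν := integral_nonneg fun _ => by positivity
  have hβ : 0 ≤ ∫ y, ‖f y‖ ^ 2 ∂ν := integral_nonneg fun _ => by positivity
  have h3 := Real.sq_sqrt hα
  have h4 := Real.sq_sqrt hβ
  set α := ∫ y, ‖a y‖ ^ 2 ∂ν
  set β := ∫ y, ‖f y‖ ^ 2 ∂ν
  have h5 : t ^ 2 * ∫ y, V y ∂ν ≤ t ^ 2 * C * α + r ^ 2 * C * β := by
    have h6 : t ^ 2 ≤ r ^ 2 := by gcongr
    nlinarith [mul_le_mul_of_nonneg_left hVC (sq_nonneg t), mul_le_mul_of_nonneg_right h6 (mul_nonneg hC hβ)]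
  have h7 : t ^ 2 * α + β ≤ (t * sqrt α + sqrt β) ^ 2 := by
    nlinarith [mul_nonneg (mul_nonneg ht (Real.sqrt_nonneg α)) (Real.sqrt_nonneg β)]
  have h8 : D * (t ^ 2 * C * α + r ^ 2 * C * β + β) ≤ (D + C + r ^ 2 * C + 1) ^ 2 * (t ^ 2 * α + β) := by
    have h9 : D * (t ^ 2 * C * α + r ^ 2 * C * β + β) ≤ D * (C + r ^ 2 * C + 1) * (t ^ 2 * α + β) := by
      rw [mul_assoc D]
      refine mul_le_mul_of_nonneg_left ?_ hD
      have := mul_nonneg (sq_nonneg t) hα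
      nlinarith [mul_nonneg hC hβ, mul_nonneg (mul_nonneg (sq_nonneg r) hC) this]
    refine h9.trans (mul_le_mul_of_nonneg_right ?_ (by positivity))
    have : 0 ≤ C + r ^ 2 * C + 1 := by positivity
    nlinarith
  rw [mul_pow]
  exact ((mul_le_mul_of_nonneg_left (add_le_add_left h5 β) hD).trans h8).trans (mul_le_mul_of_nonneg_left h7 (sq_nonneg _))

end NormL2

section Manifold

variable {n : ℕ} {N : Type*} [TopologicalSpace N] [ChartedSpace ℝ₊^n N] [IsManifold (Q n) ∞ N]
  {G : Type*} [NormedAddCommGroup G] [NormedSpace ℝ G]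

/-! ### Derivatives along vector fields -/

section VD

variable {G' : Type*} [NormedAddCommGroup G'] [NormedSpace ℝ G']

/-- The derivative of a function along a vector field. -/
def vd (V : ∀ y : N, TangentSpace (Q n) y) (f : N → G) (y : N) : G :=
  mfderiv (Q n) 𝓘(ℝ, G) f y (V y)

/-- Smooth vector fields. -/
def SmoothVF (V : ∀ y : N, TangentSpace (Q n) y) : Prop :=
  ContMDiff (Q n) (Q n).tangent ∞ fun y => (⟨y, V y⟩ : TangentBundle (Q n) N)

variable {V W : ∀ y : N, TangentSpace (Q n) y} {f g : N → G} {x : N}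

lemma lieDeriv_eq_vd (V : ∀ y : N, TangentSpace (Q n) y) (f : N → ℂ) : lieDeriv V f = vd V f := rfl

lemma vd_congr (h : f =ᶠ[𝓝 x] g) : vd V f x = vd V g x := by
  unfold vd
  rw [h.mfderiv_eq]
  rfl

lemma vd_congr_vf (h : V x = W x) : vd V f x = vd W f x := by
  unfold vd
  rw [h]

lemma vd_const (c : G) : vd V (fun _ => c) x = 0 := by
  unfold vd
  rw [mfderiv_const]
  rfl

lemma vd_add (hf : MD(n, G) f x) (hg : MD(n, G) g x) : vd V (fun y => f y + g y) x = vd V f x + vd V g x := by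
  unfold vd
  exact congrArg (fun L => L (V x)) (hf.hasMFDerivAt.add hg.hasMFDerivAt).mfderiv

lemma vd_clm (L : G →L[ℝ] G') (hf : MD(n, G) f x) : vd V (fun y => L (f y)) x = L (vd V f x) := by
  unfold vd
  exact congrArg (fun L => L (V x)) (HasMFDerivAt.comp x L.hasMFDerivAt hf.hasMFDerivAt).mfderiv

lemma vd_prodMk {g : N → G'} (hf : MD(n, G) f x) (hg : MD(n, G') g x) : vd V (fun y => (f y, g y)) x = (vd V f x, vd V g x) :=
  Prod.ext (vd_clm (ContinuousLinearMap.fst ℝ G G') (hf.prodMk_space hg)).symm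
    (vd_clm (ContinuousLinearMap.snd ℝ G G') (hf.prodMk_space hg)).symm

/-- The chain rule for a function on a normed space. -/
lemma vd_comp {φ : G → G'} (hφ : DifferentiableAt ℝ φ (f x)) (hf : MD(n, G) f x) :
    vd V (fun y => φ (f y)) x = fderiv ℝ φ (f x) (vd V f x) := by
  unfold vd
  exact congrArg (fun L => L (V x)) (HasMFDerivAt.comp x hφ.hasFDerivAt.hasMFDerivAt hf.hasMFDerivAt).mfderiv

lemma vd_bilin {G'' : Type*} [NormedAddCommGroup G''] [NormedSpace ℝ G''] (L : G →L[ℝ] G' →L[ℝ] G'') {g : N → G'} (hf : MD(n, G) f x)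
    (hg : MD(n, G') g x) :
    vd V (fun y => L (f y) (g y)) x = L (vd V f x) (g x) + L (f x) (vd V g x) := by
  have h1 : vd V (fun y => (fun p : G × G' => L p.1 p.2) (f y, g y)) x = _ :=
    vd_comp (V := V) (f := fun y => (f y, g y)) (φ := fun p : G × G' => L p.1 p.2) (L.isBoundedBilinearMap.differentiableAt (f x, g x))
      (hf.prodMk_space hg)
  rw [vd_prodMk hf hg, L.isBoundedBilinearMap.fderiv] at h1
  rw [h1]
  simp [IsBoundedBilinearMap.deriv_apply, add_comm]

lemma vd_smul {a : N → ℝ} (ha : MD(n, ℝ) a x) (hf : MD(n, G) f x) : vd V (fun y => a y • f y) x = vd V a x • f x + a x • vd V f x :=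
  vd_bilin (ContinuousLinearMap.lsmul ℝ ℝ) ha hf

lemma vd_mul {𝔸 : Type*} [NormedRing 𝔸] [NormedAlgebra ℝ 𝔸] {a b : N → 𝔸} (ha : MD(n, 𝔸) a x) (hb : MD(n, 𝔸) b x) :
    vd V (fun y => a y * b y) x = vd V a x * b x + a x * vd V b x :=
  vd_bilin (ContinuousLinearMap.mul ℝ 𝔸) ha hb

lemma vd_sum {ι : Type*} (t : Finset ι) {f : ι → N → G} (hf : ∀ i ∈ t, MD(n, G) (f i) x) :
    vd V (fun y => ∑ i ∈ t, f i y) x = ∑ i ∈ t, vd V (f i) x ∧ MD(n, G) (fun y => ∑ i ∈ t, f i y) x := by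
  classical
  induction t using Finset.induction_on with
  | empty => simp only [Finset.sum_empty]; exact ⟨vd_const 0, mdifferentiableAt_const⟩
  | insert a t ha ih =>
    simp only [Finset.sum_insert ha]
    obtain ⟨h1, h2⟩ := ih fun i hi => hf i (Finset.mem_insert_of_mem hi)
    have h3 := hf a (Finset.mem_insert_self a t)
    exact ⟨by rw [vd_add h3 h2, h1], h3.add h2⟩

lemma vd_sum' {ι : Type*} (t : Finset ι) {f : ι → N → G} (hf : ∀ i ∈ t, MD(n, G) (f i) x) :
    vd V (fun y => ∑ i ∈ t, f i y) x = ∑ i ∈ t, vd V (f i) x := (vd_sum t hf).1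

lemma vd_vf_sum {ι : Type*} (t : Finset ι) (a : ι → N → ℝ) (V : ι → ∀ y : N, TangentSpace (Q n) y) :
    vd (fun y => ∑ i ∈ t, a i y • V i y) f x = ∑ i ∈ t, a i x • vd (V i) f x := by
  simp only [vd]
  rw [map_sum]
  simp only [map_smul]
  rfl

/-- The derivative of a smooth function along a smooth vector field is smooth. -/
lemma contMDiffOn_vd {U : Set N} (hU : IsOpen U) (hV : SmoothVF V)
    (hf : ContMDiffOn (Q n) 𝓘(ℝ, G) ∞ f U) : ContMDiffOn (Q n) 𝓘(ℝ, G) ∞ (vd V f) U := by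
  have h1 := hf.contMDiffOn_tangentMapWithin (m := ∞) (by simp) hU.uniqueMDiffOn
  have h2 : ContMDiffOn (Q n) 𝓘(ℝ, G).tangent ∞ (fun y => tangentMapWithin (Q n) 𝓘(ℝ, G) f U (⟨y, V y⟩ : TangentBundle (Q n) N)) U :=
    h1.comp hV.contMDiffOn fun y hy => hy
  have h3 := (contMDiff_snd_tangentBundle_modelSpace G 𝓘(ℝ, G) (n := ∞)).comp_contMDiffOn h2
  refine h3.congr fun y hy => ?_
  exact (congrArg (fun L => L (V y)) (mfderivWithin_of_isOpen (I := Q n) (I' := 𝓘(ℝ, G)) (f := f) hU hy)).symm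

lemma contMDiff_vd (hV : SmoothVF V) (hf : C∞(n, G) f) : C∞(n, G) (vd V f) := by
  rw [← contMDiffOn_univ] at *
  exact contMDiffOn_vd isOpen_univ hV hf

/-- The representation of a vector field in the chart at `x`. -/
def chartVF (x : N) (V : ∀ y : N, TangentSpace (Q n) y) (z : ℝ^n) :
    ℝ^n :=
  VectorField.mpullbackWithin 𝓘(ℝ, ℝ^n) (Q n) (κ n x).symm V
    (range (Q n)) z

lemma fderivWithin_comp_extChartAt_symm (x : N) {z : ℝ^n} (hz : z ∈ (κ n x).target) (hf : MD(n, G) f ((κ n x).symm z)) (w : ℝ^n) :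
    fderivWithin ℝ (fun z => f ((κ n x).symm z)) (range (Q n)) z w = mfderiv (Q n) 𝓘(ℝ, G) f ((κ n x).symm z)
        (mfderivWithin 𝓘(ℝ, ℝ^n) (Q n) (κ n x).symm (range (Q n)) z w) := by
  have hzr : z ∈ range (Q n) := extChartAt_target_subset_range x hz
  have hd : MDifferentiableWithinAt 𝓘(ℝ, ℝ^n) (Q n) (κ n x).symm (range (Q n)) z :=
    (contMDiffWithinAt_extChartAt_symm_range (n := ∞) x hz).mdifferentiableWithinAt (by simp)
  have h1 : HasMFDerivWithinAt 𝓘(ℝ, ℝ^n) 𝓘(ℝ, G) (fun z => f ((κ n x).symm z)) (range (Q n)) z _ :=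
    HasMFDerivAt.comp_hasMFDerivWithinAt z hf.hasMFDerivAt hd.hasMFDerivWithinAt
  have h2 := h1.mfderivWithin ((Q n).uniqueMDiffOn z hzr)
  rw [mfderivWithin_eq_fderivWithin] at h2
  exact congrArg (fun L => L w) h2

lemma vd_eq_fderivWithin_chart (x : N) {z : ℝ^n} (hz : z ∈ (κ n x).target) (hf : MD(n, G) f ((κ n x).symm z)) : vd V f ((κ n x).symm z) =
      fderivWithin ℝ (fun z => f ((κ n x).symm z)) (range (Q n)) z (chartVF x V z) := by
  have hinv := isInvertible_mfderivWithin_extChartAt_symm (I := Q n) hz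
  rw [fderivWithin_comp_extChartAt_symm x hz hf]
  have h3 : (mfderivWithin 𝓘(ℝ, ℝ^n) (Q n) (κ n x).symm (range (Q n)) z) (chartVF x V z) = V ((κ n x).symm z) :=
    congrArg (fun L => L (V ((κ n x).symm z))) (hinv.self_comp_inverse)
  exact congrArg _ h3.symm

/-- Lie brackets of vector fields act as commutators. -/
theorem vd_mlieBracket {U : Set N} (hU : IsOpen U) (hx : x ∈ U) (hV : SmoothVF V) (hW : SmoothVF W) (hf : ContMDiffOn (Q n) 𝓘(ℝ, G) ∞ f U) :
    vd (VectorField.mlieBracket (Q n) V W) f x = vd V (vd W f) x - vd W (vd V f) x := by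
  set φ := κ n x with hφ
  have hxt : φ x ∈ φ.target := mem_extChartAt_target x
  have hxs : φ.symm (φ x) = x := extChartAt_to_inv x
  have hxr : φ x ∈ range (Q n) := extChartAt_target_subset_range x hxt
  have hnear : ∀ᶠ z in 𝓝[range (Q n)] (φ x), z ∈ φ.target ∧ φ.symm z ∈ U := by
    have h0 : ∀ᶠ z in 𝓝[range (Q n)] (φ x), z ∈ φ.target := extChartAt_target_mem_nhdsWithin x
    refine h0.and ?_
    have h1 : ContinuousWithinAt φ.symm (range (Q n)) (φ x) := (continuousAt_extChartAt_symm x).continuousWithinAt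
    exact h1.preimage_mem_nhdsWithin (by rw [hxs]; exact hU.mem_nhds hx)
  have hdiff : ∀ {f : N → G}, ContMDiffOn (Q n) 𝓘(ℝ, G) ∞ f U → ∀ y ∈ U, MD(n, G) f y := fun hf y hy =>
    (hf.contMDiffAt (hU.mem_nhds hy)).mdifferentiableAt (by simp)
  have key : ∀ {f : N → G} (V : ∀ y : N, TangentSpace (Q n) y), ContMDiffOn (Q n) 𝓘(ℝ, G) ∞ f U →
      (fun z => vd V f (φ.symm z)) =ᶠ[𝓝[range (Q n)] (φ x)]
      fun z => fderivWithin ℝ (fun z => f (φ.symm z)) (range (Q n)) z (chartVF x V z) := by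
    intro f V hf
    filter_upwards [hnear] with z hz
    exact vd_eq_fderivWithin_chart x hz.1 (hdiff hf _ hz.2)
  have key2 : ∀ {W' V' : ∀ y : N, TangentSpace (Q n) y}, SmoothVF V' →
      vd W' (vd V' f) x = fderivWithin ℝ (fun z => fderivWithin ℝ (fun z => f (φ.symm z))
        (range (Q n)) z (chartVF x V' z)) (range (Q n)) (φ x) (chartVF x W' (φ x)) := by
    intro W' V' hV'
    have h1 := (key W' (contMDiffOn_vd hU hV' hf)).self_of_nhdsWithin hxr
    simp only [hxs] at h1
    rw [h1, (key V' hf).fderivWithin_eq ((key V' hf).self_of_nhdsWithin hxr)]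
  have hcd : ContDiffWithinAt ℝ ∞ (fun z => f (φ.symm z)) (range (Q n)) (φ x) := by
    have h1 : ContMDiffAt (Q n) 𝓘(ℝ, G) ∞ f (φ.symm (φ x)) := by
      rw [hxs]; exact hf.contMDiffAt (hU.mem_nhds hx)
    have h2 := h1.comp_contMDiffWithinAt (φ x) (contMDiffWithinAt_extChartAt_symm_range (n := ∞) x hxt)
    exact h2.contDiffWithinAt
  have hVd : ∀ {V : ∀ y : N, TangentSpace (Q n) y}, SmoothVF V → DifferentiableWithinAt ℝ (chartVF x V) (range (Q n)) (φ x) := by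
    intro V hV
    have := MDifferentiableWithinAt.differentiableWithinAt_mpullbackWithin_vectorField
      (I := Q n) (V := V) (s := univ) (x := x) ((hV x).mdifferentiableAt (by simp)).mdifferentiableWithinAt
    simp only [preimage_univ, univ_inter] at this
    exact this
  have hbr := VectorField.fderivWithin_apply_lieBracket (𝕜 := ℝ) (f := fun z => f (φ.symm z)) (n := ∞) (s := range (Q n)) (x := φ x) hcd
    (by rw [minSmoothness_of_isRCLikeNormedField]; exact WithTop.coe_le_coe.2 (le_top : (2 : ℕ∞) ≤ ⊤)) (Q n).uniqueDiffOn
    ((Q n).range_subset_closure_interior hxr) hxr (hVd hW) (hVd hV)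
  rw [key2 hW, key2 hV, ← hbr]
  have h5 : vd (VectorField.mlieBracket (Q n) V W) f x = mfderiv (Q n) 𝓘(ℝ, G) f x ((mfderiv (Q n) 𝓘(ℝ, ℝ^n) φ x).inverse
        (VectorField.lieBracketWithin ℝ (chartVF x V) (chartVF x W) (range (Q n)) (φ x))) := by
    simp only [vd, VectorField.mlieBracket, VectorField.mlieBracketWithin_apply, preimage_univ, univ_inter]
    rfl
  rw [h5]
  set w := VectorField.lieBracketWithin ℝ (chartVF x V) (chartVF x W) (range (Q n)) (φ x) with hw
  have hinv := isInvertible_mfderivWithin_extChartAt_symm (I := Q n) hxt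
  have hfd : MD(n, G) f (φ.symm (φ x)) := by
    rw [hxs]; exact hdiff hf x hx
  have h6 := VectorField.mfderiv_extChartAt_inverse_comp_mfderivWithin_extChartAT_symm (I := Q n) (x := x)
    (mfderivWithin 𝓘(ℝ, ℝ^n) (Q n) φ.symm (range (Q n)) (φ x) w)
  have h7 : (mfderivWithin 𝓘(ℝ, ℝ^n) (Q n) φ.symm (range (Q n)) (φ x)).inverse
      (mfderivWithin 𝓘(ℝ, ℝ^n) (Q n) φ.symm (range (Q n)) (φ x) w) = w :=
    congrArg (fun L => L w) (hinv.inverse_comp_self)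
  have h8 : (mfderiv (Q n) 𝓘(ℝ, ℝ^n) φ x).inverse w = mfderivWithin 𝓘(ℝ, ℝ^n) (Q n) φ.symm (range (Q n)) (φ x) w := by
    refine Eq.trans ?_ h6
    exact congrArg _ h7.symm
  refine Eq.trans (congrArg (mfderiv (Q n) 𝓘(ℝ,G) f x) h8) ?_
  have h9 : fderivWithin ℝ (fun z => f (φ.symm z)) (range (Q n)) (φ x) w =
      mfderiv (Q n) 𝓘(ℝ, G) f (φ.symm (φ x)) (mfderivWithin 𝓘(ℝ, ℝ^n) (Q n)
        φ.symm (range (Q n)) (φ x) w) := fderivWithin_comp_extChartAt_symm x hxt hfd w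
  refine Eq.trans ?_ h9.symm
  have h10 : ∀ (a b : N) (hab : a = b) (w : ℝ^n), (mfderiv (Q n) 𝓘(ℝ, G) f a : ℝ^n → G) w = (mfderiv (Q n) 𝓘(ℝ, G) f b : ℝ^n → G) w := by
    rintro a b rfl w; rfl
  exact h10 x _ hxs.symm _

end VD

/-! ### Interior charts -/

variable (n) in
/-- The part of the domain of the chart at `q` in the interior of the manifold. -/
def innerChart (q : N) : Set N := (chartAt ℝ₊^n q).source ∩ (Q n).interior N

variable (n) in
/-- The image of `innerChart q` in the chart at `q`. -/
def innerTarget (q : N) : Set ℝ^n :=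
  (κ n q).target ∩ {z | ∀ a, 0 < z a}

lemma isOpen_interior_Q : IsOpen ((Q n).interior N) := ModelWithCorners.isOpen_interior (n := ∞) (by simp)

lemma isOpen_innerChart (q : N) : IsOpen (innerChart n q) := (chartAt _ q).open_source.inter isOpen_interior_Q

lemma isOpen_innerTarget (q : N) : IsOpen (innerTarget n q) := by
  have h1 : IsOpen {z : ℝ^n | ∀ a, 0 < z a} := by
    rw [← interior_range_Q]; exact isOpen_interior
  have h2 := extChartAt_target (Q n) q
  have h3 : innerTarget n q = ((Q n).symm ⁻¹' (chartAt _ q).target) ∩ {z | ∀ a, 0 < z a} := by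
    rw [innerTarget, h2, inter_assoc]
    congr 1
    refine inter_eq_right.2 ?_
    rw [← interior_range_Q]; exact interior_subset
  rw [h3]
  exact ((chartAt _ q).open_target.preimage (Q n).continuous_symm).inter h1

lemma mem_interior_iff {q x : N} (hx : x ∈ (chartAt ℝ₊^n q).source) : x ∈ (Q n).interior N ↔ ∀ a, 0 < κ n q x a := by
  have h1 := (Q n).isInteriorPoint_iff_of_mem_atlas (n := ∞) (by simp) (chart_mem_atlas _ q) hx
  have h2 : x ∈ (Q n).interior N ↔ κ n q x ∈ interior (κ n q).target := h1
  rw [h2]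
  constructor
  · intro h
    have := interior_mono (extChartAt_target_subset_range (I := Q n) q) h
    rw [interior_range_Q] at this
    exact this
  · intro h
    rw [mem_interior_iff_mem_nhds]
    have h3 : κ n q x ∈ innerTarget n q := ⟨(κ n q).map_source (by rwa [extChartAt_source]), h⟩
    exact mem_of_superset ((isOpen_innerTarget q).mem_nhds h3) inter_subset_left

lemma mapsTo_innerChart (q : N) : MapsTo (κ n q) (innerChart n q) (innerTarget n q) := fun x hx =>
  ⟨(κ n q).map_source (by rw [extChartAt_source]; exact hx.1), (mem_interior_iff hx.1).1 hx.2⟩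

lemma mapsTo_innerTarget (q : N) : MapsTo (κ n q).symm (innerTarget n q) (innerChart n q) := by
  intro z hz
  have h1 : (κ n q).symm z ∈ (chartAt ℝ₊^n q).source := by
    rw [← extChartAt_source (Q n)]; exact (κ n q).map_target hz.1
  refine ⟨h1, (mem_interior_iff h1).2 ?_⟩
  rw [(κ n q).right_inv hz.1]
  exact hz.2

lemma image_innerChart_inter (q : N) (S : Set N) : κ n q '' (S ∩ innerChart n q) = innerTarget n q ∩ (κ n q).symm ⁻¹' S := by
  ext z
  constructor
  · rintro ⟨x, ⟨hxS, hx⟩, rfl⟩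
    refine ⟨mapsTo_innerChart q hx, ?_⟩
    rw [mem_preimage, (κ n q).left_inv (by rw [extChartAt_source]; exact hx.1)]
    exact hxS
  · rintro ⟨hz, hzS⟩
    exact ⟨_, ⟨hzS, mapsTo_innerTarget q hz⟩, (κ n q).right_inv hz.1⟩

lemma contMDiffOn_extChartAt_source (q : N) : ContMDiffOn (Q n) 𝓘(ℝ, ℝ^n) ∞ (κ n q) (chartAt ℝ₊^n q).source := contMDiffOn_extChartAt

lemma mdifferentiableAt_extChartAt_of_mem {q x : N} (hx : x ∈ (chartAt ℝ₊^n q).source) : MD(n, ℝ^n) (κ n q) x :=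
  (contMDiffAt_extChartAt' (n := ∞) hx).mdifferentiableAt (by simp)

lemma contDiffOn_comp_symm {r : ℕ∞ω} (hr : r ≤ (∞ : ℕ∞ω)) (q : N) {f : N → G} {S : Set N} (hf : ContMDiffOn (Q n) 𝓘(ℝ, G) r f S) :
    ContDiffOn ℝ r (fun z => f ((κ n q).symm z)) ((κ n q).target ∩ (κ n q).symm ⁻¹' S) := by
  rw [← contMDiffOn_iff_contDiffOn]
  exact hf.comp ((contMDiffOn_extChartAt_symm (n := ∞) q).of_le hr |>.mono inter_subset_left) fun z hz => hz.2

/-- The derivative along a vector field in terms of its components in the chart at `q`. -/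
lemma vd_eq_fderivWithin (q : N) {V : ∀ y : N, TangentSpace (Q n) y} {f : N → G} {z : ℝ^n} (hz : z ∈ (κ n q).target)
    (hf : MD(n, G) f ((κ n q).symm z)) :
    vd V f ((κ n q).symm z) = fderivWithin ℝ (fun z => f ((κ n q).symm z)) (range (Q n)) z (vd V (κ n q) ((κ n q).symm z)) := by
  have hs : (κ n q).symm z ∈ (chartAt ℝ₊^n q).source := by
    rw [← extChartAt_source (Q n)]; exact (κ n q).map_target hz
  rw [vd_eq_fderivWithin_chart q hz hf, vd_eq_fderivWithin_chart q hz (mdifferentiableAt_extChartAt_of_mem hs)]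
  have hzr : z ∈ range (Q n) := extChartAt_target_subset_range q hz
  have h1 : fderivWithin ℝ (fun z => κ n q ((κ n q).symm z)) (range (Q n)) z = ContinuousLinearMap.id ℝ _ := by
    have h2 : (fun z => κ n q ((κ n q).symm z)) =ᶠ[𝓝[range (Q n)] z] id := by
      filter_upwards [extChartAt_target_mem_nhdsWithin_of_mem hz] with w hw
      exact (κ n q).right_inv hw
    rw [h2.fderivWithin_eq (h2.self_of_nhdsWithin hzr), fderivWithin_id ((Q n).uniqueDiffOn z hzr)]
  rw [h1]
  rfl

lemma innerTarget_range_mem_nhds {q : N} {z : ℝ^n} (hz : z ∈ innerTarget n q) : range (Q n) ∈ 𝓝 z :=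
  mem_of_superset ((isOpen_innerTarget q).mem_nhds hz) fun _ hw => extChartAt_target_subset_range q hw.1

lemma vd_eq_fderiv (q : N) {V : ∀ y : N, TangentSpace (Q n) y} {f : N → G} {z : ℝ^n} (hz : z ∈ innerTarget n q)
    (hf : MD(n, G) f ((κ n q).symm z)) :
    vd V f ((κ n q).symm z) = fderiv ℝ (fun z => f ((κ n q).symm z)) z (vd V (κ n q) ((κ n q).symm z)) := by
  rw [vd_eq_fderivWithin q hz.1 hf, fderivWithin_of_mem_nhds (innerTarget_range_mem_nhds hz)]

/-! ### The divergence theorem -/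

lemma integral_divergence_eq_zero {n : ℕ} {w : ℝ^n → ℝ^n} (hw : ContDiff ℝ 1 w) (hc : HasCompactSupport w) :
    ∫ z, ∑ a, fderiv ℝ w z (single a 1) a = 0 := by
  have hwa : ∀ a, ContDiff ℝ 1 fun z => w z a := fun a => (proj a : ℝ^n →L[ℝ] ℝ).contDiff.comp hw
  have hca : ∀ a, HasCompactSupport fun z => w z a := fun a => hc.comp_left (g := fun v : ℝ^n => v a) rfl
  have heq : ∀ a z, fderiv ℝ w z (single a 1) a = fderiv ℝ (fun z => w z a) z (single a 1) := by
    intro a z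
    have := ((proj a : ℝ^n →L[ℝ] ℝ).hasFDerivAt.comp z (hw.differentiable (by simp) z).hasFDerivAt).fderiv
    exact (congrArg (fun L => L (single a 1)) this).symm
  have hcont : ∀ a, Continuous fun z => fderiv ℝ (fun z => w z a) z (single a 1) := fun a =>
    ((hwa a).continuous_fderiv (by simp)).clm_apply continuous_const
  have hint : ∀ a, Integrable fun z => fderiv ℝ (fun z => w z a) z (single a 1) := fun a =>
    (hcont a).integrable_of_hasCompactSupport ((hca a).fderiv_apply ℝ _)
  simp_rw [heq]
  rw [integral_finsetSum _ fun a _ => hint a]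
  refine sum_eq_zero fun a _ => ?_
  have h1 := integral_bilinear_hasLineDerivAt_right_eq_neg_left_of_integrable (μ := volume)
    (f := fun _ : ℝ^n => (1 : ℝ)) (f' := fun _ => 0) (g := fun z => w z a)
    (g' := fun z => fderiv ℝ (fun z => w z a) z (single a 1))
    (v := single a 1) (B := ContinuousLinearMap.mul ℝ ℝ) (by simp)
    (by simpa using hint a)
    (by simpa using ((hwa a).continuous).integrable_of_hasCompactSupport (hca a))
    (fun z _ => by simp [HasLineDerivAt, hasDerivAt_const])
    (fun z _ => ((hwa a).differentiable (by simp) z).hasFDerivAt.hasLineDerivAt _)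
  simpa using h1

lemma continuous_vd {V : ∀ y : N, TangentSpace (Q n) y} {f : N → G} (hV : SmoothVF V)
    (hf : ContMDiff (Q n) 𝓘(ℝ, G) 1 f) : Continuous (vd V f) := by
  have h1 := (hf.continuous_tangentMap (by simp)).comp hV.continuous
  exact ((contMDiff_snd_tangentBundle_modelSpace G 𝓘(ℝ, G) (n := ∞)).continuous).comp h1

section Partition

variable [T2Space N] [CompactSpace N]

/-- Finite smooth partitions of unity. -/
lemma exists_finite_partition {S : Set N} (hS : IsClosed S) {V : N → Set N} (hV : ∀ x ∈ S, V x ∈ 𝓝 x) :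
    ∃ (t : Finset N) (ψ : t → N → ℝ), (∀ i : t, (i : N) ∈ S) ∧ (∀ i, C∞(n, ℝ) (ψ i)) ∧
      (∀ i : t, tsupport (ψ i) ⊆ V i) ∧ ∀ x ∈ S, ∑ i, ψ i x = 1 := by
  obtain ⟨t, ht, ht2⟩ := hS.isCompact.elim_nhds_subcover (fun x => interior (V x)) fun x hx => interior_mem_nhds.2 (hV x hx)
  obtain ⟨f, hf⟩ := SmoothPartitionOfUnity.exists_isSubordinate (Q n) hS (fun i : t => interior (V i)) (fun i => isOpen_interior) (by
      intro x hx
      obtain ⟨i, hi, hx'⟩ := mem_iUnion₂.1 (ht2 hx)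
      exact mem_iUnion.2 ⟨⟨i, hi⟩, hx'⟩)
  refine ⟨t, fun i => f i, fun i => ht _ i.2, fun i => (f i).contMDiff, fun i => (hf i).trans interior_subset, fun x hx => ?_⟩
  rw [← finsum_eq_sum_of_fintype]
  exact f.sum_eq_one hx

end Partition

lemma exists_mem_interior (x : N) : ∃ x₀ : N, x₀ ∈ (Q n).interior N := by
  have h1 : κ n x x ∈ closure (interior (range (Q n))) :=
    (Q n).range_subset_closure_interior (extChartAt_target_subset_range x (mem_extChartAt_target x))
  obtain ⟨V, hV, hV2⟩ := mem_nhdsWithin_iff_exists_mem_nhds_inter.1 (extChartAt_target_mem_nhdsWithin (I := Q n) x)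
  obtain ⟨z, hzV, hz⟩ := mem_closure_iff_nhds.1 h1 V hV
  have hz2 : z ∈ innerTarget n x := ⟨hV2 ⟨hzV, interior_subset hz⟩, by rw [interior_range_Q] at hz; exact hz⟩
  exact ⟨_, (mapsTo_innerTarget x hz2).2⟩

/-- A smooth cutoff function. -/
lemma exists_cutoff {r₁ r₂ : ℝ} (h : r₁ < r₂) : ∃ ϰ : ℝ → ℝ, ContDiff ℝ ∞ ϰ ∧ (∀ t ≤ r₁, ϰ t = 1) ∧ ∀ t ≥ r₂, ϰ t = 0 := by
  have h0 : 0 < r₂ - r₁ := sub_pos.2 h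
  refine ⟨fun t => Real.smoothTransition ((r₂ - t) / (r₂ - r₁)),
    Real.smoothTransition.contDiff.comp (by fun_prop), fun t ht => ?_, fun t ht => ?_⟩
  · exact Real.smoothTransition.one_of_one_le (by rw [le_div_iff₀ h0]; linarith)
  · exact Real.smoothTransition.zero_of_nonpos (div_nonpos_of_nonpos_of_nonneg (by linarith) h0.le)

lemma hasFDerivWithinAt_comp_symm {h : N → G} {x : N} (hh : MD(n, G) h x) : HasFDerivWithinAt (fun z => h ((κ n x).symm z))
      (mfderiv (Q n) 𝓘(ℝ, G) h x : ℝ^n →L[ℝ] G) (range (Q n)) (κ n x x) := by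
  exact hh.hasMFDerivAt.2

/-- A nonnegative function is stationary, at a zero, in the directions tangent to all the faces. -/
lemma mfderiv_eq_zero_of_nonneg {h : N → ℝ} {x : N} (hh : MD(n, ℝ) h x) (h0 : h x = 0) (hpos : ∀ᶠ z in 𝓝 x, 0 ≤ h z) (v : ℝ^n)
    (hv : ∀ i, κ n x x i = 0 → v i = 0) : (mfderiv (Q n) 𝓘(ℝ, ℝ) h x : ℝ^n →L[ℝ] ℝ) v = 0 := by
  set φ := κ n x with hφ
  have hxr : φ x ∈ range (Q n) := extChartAt_target_subset_range x (mem_extChartAt_target x)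
  have hline : Continuous fun s : ℝ => φ x + s • v := by fun_prop
  have hR : ∀ᶠ s in 𝓝 (0 : ℝ), φ x + s • v ∈ range (Q n) := by
    rw [range_Q]
    simp only [mem_ofPred_eq]
    rw [eventually_all]
    intro i
    have hxi : 0 ≤ φ x i := by
      rw [range_Q] at hxr; exact hxr i
    rcases hxi.eq_or_lt with h1 | h1
    · refine .of_forall fun s => ?_
      simp [hv i h1.symm, ← h1]
    · have h2 : ContinuousAt (fun s : ℝ => (φ x + s • v) i) 0 := by
        simp only [PiLp.add_apply, PiLp.smul_apply]
        fun_prop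
      have h3 := h2.eventually (lt_mem_nhds (a := 0) (by simpa using h1))
      exact h3.mono fun s hs => hs.le
  have h1 : HasDerivWithinAt (fun s : ℝ => φ x + s • v) v {s | φ x + s • v ∈ range (Q n)} 0 := by
    have h2 := ((hasDerivAt_id (0 : ℝ)).smul_const v).const_add (φ x)
    rw [one_smul] at h2
    exact h2.hasDerivWithinAt
  have h2 : HasDerivWithinAt (fun s : ℝ => h (φ.symm (φ x + s • v)))
      ((mfderiv (Q n) 𝓘(ℝ, ℝ) h x : ℝ^n →L[ℝ] ℝ) v) {s | φ x + s • v ∈ range (Q n)} 0 := by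
    have h3 := hasFDerivWithinAt_comp_symm hh
    rw [← hφ, show φ x = φ x + (0 : ℝ) • v by simp] at h3
    exact h3.comp_hasDerivWithinAt (0 : ℝ) h1 fun s hs => hs
  have h3 := h2.hasDerivAt hR
  refine IsLocalMin.hasDerivAt_eq_zero ?_ h3
  have h4 : Tendsto (fun s : ℝ => φ.symm (φ x + s • v)) (𝓝 0) (𝓝 x) := by
    have h5 : Tendsto (fun s : ℝ => φ x + s • v) (𝓝 0) (𝓝[range (Q n)] (φ x)) := by
      refine tendsto_nhdsWithin_iff.2 ⟨?_, hR⟩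
      have := hline.tendsto 0
      rwa [zero_smul, add_zero] at this
    have h6 := (continuousAt_extChartAt_symm (I := Q n) x).tendsto.comp (h5.mono_right nhdsWithin_le_nhds)
    rwa [← hφ, extChartAt_to_inv] at h6
  have h7 := h4.eventually hpos
  filter_upwards [h7] with s hs
  rw [zero_smul, add_zero, hφ, extChartAt_to_inv, h0]
  exact hs

/-! ### Logarithmic coordinates -/

section Quadrant

variable {n : ℕ}

lemma norm_le_sum_abs (v : ℝ^n) : ‖v‖ ≤ ∑ a, |v a| := by
  conv_lhs => rw [← sum_smul_single v]
  refine (norm_sum_le _ _).trans (sum_le_sum fun a _ => ?_)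
  rw [norm_smul, EuclideanSpace.norm_single, norm_one, mul_one, Real.norm_eq_abs]

lemma convex_range_Q : Convex ℝ (range (Q n)) := by
  rw [range_Q]
  exact fun x hx z hz s t hs ht _ i => add_nonneg (mul_nonneg hs (hx i)) (mul_nonneg ht (hz i))

lemma exists_fderivWithin_bound {F : Type*} [NormedAddCommGroup F] [NormedSpace ℝ F] {G : ℝ^n → F}
    (hG : ContDiffOn ℝ ∞ G (range (Q n))) {B : Set ℝ^n} (hB : IsCompact B)
    (h0 : ∀ z ∈ range (Q n), z ∉ B → G z = 0) :
    ContDiffOn ℝ ∞ (fderivWithin ℝ G (range (Q n))) (range (Q n)) ∧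
    (∀ z ∈ range (Q n), z ∉ B → fderivWithin ℝ G (range (Q n)) z = 0) ∧
    ∃ C, 0 ≤ C ∧ ∀ z ∈ range (Q n), ‖fderivWithin ℝ G (range (Q n)) z‖ ≤ C := by
  have h1 := hG.fderivWithin (Q n).uniqueDiffOn (m := ∞) (by simp)
  have h2 : ∀ z ∈ range (Q n), z ∉ B → fderivWithin ℝ G (range (Q n)) z = 0 := by
    intro z hz hzB
    have h3 : G =ᶠ[𝓝[range (Q n)] z] fun _ => 0 := by
      filter_upwards [self_mem_nhdsWithin, mem_nhdsWithin_of_mem_nhds (hB.isClosed.isOpen_compl.mem_nhds hzB)] with w hw hwB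
      exact h0 w hw hwB
    rw [h3.fderivWithin_eq (h0 z hz hzB)]
    exact (hasFDerivWithinAt_const (0 : F) z _).fderivWithin ((Q n).uniqueDiffOn z hz)
  refine ⟨h1, h2, ?_⟩
  obtain ⟨C, hC⟩ := (hB.inter_right (Q n).isClosed_range).exists_bound_of_continuousOn (h1.continuousOn.mono inter_subset_right)
  refine ⟨max C 0, le_max_right _ _, fun z hz => ?_⟩
  by_cases hzB : z ∈ B
  · exact (hC z ⟨hzB, hz⟩).trans (le_max_left _ _)
  · rw [h2 z hz hzB, norm_zero]
    exact le_max_right _ _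

/-- Functions on the quadrant that vanish on a face. -/
lemma quadrant_bound {G : ℝ^n → ℝ} (hG : ContDiffOn ℝ ∞ G (range (Q n))) {B : Set ℝ^n} (hB : IsCompact B)
    (h0 : ∀ z ∈ range (Q n), z ∉ B → G z = 0) (a : Fin n) (ha : ∀ z ∈ range (Q n), z a = 0 → G z = 0) :
    ∃ C, 0 ≤ C ∧ ∀ z ∈ range (Q n), |G z| ≤ C * z a ∧ ∀ b, z b * |fderivWithin ℝ G (range (Q n)) z (single b 1)| ≤ C * z a := by
  obtain ⟨h1, h2, C₁, hC₁, hb1⟩ := exists_fderivWithin_bound hG hB h0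
  obtain ⟨-, -, C₂, hC₂, hb2⟩ := exists_fderivWithin_bound h1 hB h2
  obtain ⟨R, hR⟩ := hB.exists_bound_of_continuousOn (f := id) continuousOn_id
  have hC : C₁ ≤ C₁ + |R| * C₂ := le_add_of_nonneg_right (by positivity)
  have hC' : |R| * C₂ ≤ C₁ + |R| * C₂ := le_add_of_nonneg_left hC₁
  refine ⟨C₁ + |R| * C₂, by positivity, fun z hz => ?_⟩
  have hz0 : ∀ i, 0 ≤ z i := by rw [range_Q] at hz; exact hz
  set z' := z - z a • single a (1 : ℝ) with hz'
  have hz'i : ∀ i, z' i = if i = a then 0 else z i := by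
    intro i
    by_cases hi : i = a
    · subst hi; simp [hz']
    · simp [hz', hi]
  have hz'a : z' a = 0 := by rw [hz'i, if_pos rfl]
  have hz'R : z' ∈ range (Q n) := by
    rw [range_Q]
    intro i
    rw [hz'i]
    split_ifs
    exacts [le_rfl, hz0 i]
  have hnorm : ‖z - z'‖ = z a := by
    rw [hz', sub_sub_cancel, norm_smul, EuclideanSpace.norm_single, norm_one, mul_one, Real.norm_eq_abs, abs_of_nonneg (hz0 a)]
  have hmv : ∀ {F : Type} [NormedAddCommGroup F] [NormedSpace ℝ F] {f : ℝ^n → F} {C : ℝ},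
      ContDiffOn ℝ ∞ f (range (Q n)) → (∀ z ∈ range (Q n), ‖fderivWithin ℝ f (range (Q n)) z‖ ≤ C) → ‖f z - f z'‖ ≤ C * z a := by
    intro F _ _ f C hf hfC
    rw [← hnorm]
    exact convex_range_Q.norm_image_sub_le_of_norm_fderivWithin_le (hf.differentiableOn (by simp)) hfC hz'R hz
  refine ⟨?_, fun b => ?_⟩
  · have h3 := hmv hG hb1
    rw [ha z' hz'R hz'a, sub_zero, Real.norm_eq_abs] at h3
    exact h3.trans (mul_le_mul_of_nonneg_right hC (hz0 a))
  · by_cases hba : b = a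
    · subst hba
      rw [mul_comm]
      refine mul_le_mul_of_nonneg_right (le_trans ?_ hC) (hz0 b)
      have h3 := (fderivWithin ℝ G (range (Q n)) z).le_of_opNorm_le (hb1 z hz) (single b 1)
      rwa [EuclideanSpace.norm_single, norm_one, mul_one, Real.norm_eq_abs] at h3
    by_cases hzB : z ∈ B
    · have h3 : fderivWithin ℝ G (range (Q n)) z' (single b 1) = 0 := by
        have h4 := (hG.differentiableOn (by simp) z' hz'R).hasFDerivWithinAt
        have hin : ∀ s ∈ Ici (0 : ℝ), z' + s • single b (1 : ℝ) ∈ range (Q n) ∧ (z' + s • single b (1 : ℝ)) a = 0 := by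
          intro s hs
          have hs0 : (0 : ℝ) ≤ s := hs
          refine ⟨?_, by simp [hz'a, Ne.symm hba]⟩
          rw [range_Q] at hz'R ⊢
          intro i
          refine add_nonneg (hz'R i) ?_
          by_cases hi : i = b <;> simp [hi, hs0]
        have h5 : HasDerivWithinAt (fun s : ℝ => z' + s • single b (1 : ℝ)) (single b (1 : ℝ)) (Ici 0) 0 := by
          have h6 := ((hasDerivAt_id (0 : ℝ)).smul_const (single b (1 : ℝ))).const_add z'
          rw [one_smul] at h6
          exact h6.hasDerivWithinAt
        rw [show z' = z' + (0 : ℝ) • single b (1 : ℝ) by simp] at h4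
        have h7 := h4.comp_hasDerivWithinAt (0 : ℝ) h5 fun s hs => (hin s hs).1
        have h8 : HasDerivWithinAt (G ∘ fun s : ℝ => z' + s • single b (1 : ℝ)) 0 (Ici 0) 0 :=
          (hasDerivWithinAt_const (0 : ℝ) (Ici 0) (0 : ℝ)).congr (fun s hs => ha _ (hin s hs).1 (hin s hs).2)
            (ha _ (hin 0 self_mem_Ici).1 (hin 0 self_mem_Ici).2)
        have h9 := (uniqueDiffOn_Ici (0 : ℝ) 0 self_mem_Ici).eq_deriv _ h7 h8
        simpa using h9
      have h4 := hmv h1 hb2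
      have h5 := (fderivWithin ℝ G (range (Q n)) z - fderivWithin ℝ G (range (Q n)) z').le_of_opNorm_le h4 (single b 1)
      rw [_root_.sub_apply, h3, sub_zero, EuclideanSpace.norm_single, norm_one, mul_one, Real.norm_eq_abs] at h5
      have h6 : z b ≤ |R| := by
        have h7 := (PiLp.norm_apply_le z b).trans (hR z hzB)
        exact ((le_abs_self _).trans h7).trans (le_abs_self R)
      calc _ ≤ |R| * (C₂ * z a) := mul_le_mul h6 h5 (abs_nonneg _) (abs_nonneg _)
        _ = |R| * C₂ * z a := by ring
        _ ≤ _ := mul_le_mul_of_nonneg_right hC' (hz0 a)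
    · rw [h2 z hz hzB, zero_apply, abs_zero, mul_zero]
      exact mul_nonneg (by positivity) (hz0 a)

/-- The exponential map from `ℝⁿ` to the open quadrant. -/
def expV (s : ℝ^n) : ℝ^n := WithLp.toLp 2 fun a => exp (s a)

/-- The logarithm, inverse to `expV`. -/
def logV (z : ℝ^n) : ℝ^n := WithLp.toLp 2 fun a => Real.log (z a)

lemma expV_pos (s : ℝ^n) (a : Fin n) : 0 < expV s a := Real.exp_pos _

lemma expV_mem (s : ℝ^n) : expV s ∈ range (Q n) := by
  rw [range_Q]; exact fun a => (expV_pos s a).le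

lemma expV_logV {z : ℝ^n} (hz : ∀ a, 0 < z a) : expV (logV z) = z := by
  ext a; exact Real.exp_log (hz a)

lemma logV_expV (s : ℝ^n) : logV (expV s) = s := by
  ext a; exact Real.log_exp _

lemma contDiff_expV : ContDiff ℝ ∞ (expV (n := n)) := by
  rw [contDiff_euclidean]
  intro a
  exact Real.contDiff_exp.comp (proj (𝕜 := ℝ) a : ℝ^n →L[ℝ] ℝ).contDiff

lemma contDiffOn_logV : ContDiffOn ℝ ∞ (logV (n := n)) {z | ∀ a, 0 < z a} := by
  rw [contDiffOn_euclidean]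
  intro a
  exact ((proj (𝕜 := ℝ) a : ℝ^n →L[ℝ] ℝ).contDiff.contDiffOn).log fun z hz => (hz a).ne'

lemma hasFDerivAt_expV_apply (s v : ℝ^n) (a : Fin n) : (fderiv ℝ expV s v) a = exp (s a) * v a := by
  let p : ℝ^n →L[ℝ] ℝ := proj a
  have h1 := p.hasFDerivAt.comp s ((contDiff_expV (n := n)).differentiable (by simp) s).hasFDerivAt
  have h2 : HasFDerivAt (p ∘ expV) (exp (s a) • p) s := p.hasFDerivAt.exp
  have h3 := congrArg (fun T : ℝ^n →L[ℝ] ℝ => T v) (h1.unique h2)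
  exact h3

end Quadrant

section LogPull

/-- The extension by zero of a function in a chart. -/
def chartExt (q : N) (g : N → G) (z : ℝ^n) : G :=
  open Classical in if z ∈ (κ n q).target then g ((κ n q).symm z) else 0

/-- A function in logarithmic coordinates. -/
def logPull (q : N) (g : N → G) (s : ℝ^n) : G := chartExt q g (expV s)

/-- The logarithmic chart. -/
def logChart (q : N) (x : N) : ℝ^n := logV (κ n q x)

lemma isCompact_image_chart [CompactSpace N] {q : N} {S : Set N} (hS : IsClosed S)
    (hSq : S ⊆ (chartAt ℝ₊^n q).source) : IsCompact (κ n q '' S) :=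
  hS.isCompact.image_of_continuousOn ((continuousOn_extChartAt q).mono (by rwa [extChartAt_source]))

lemma chartExt_eq_zero {q : N} {g : N → G} {S : Set N} (hg : ∀ x ∉ S, g x = 0) {z : ℝ^n} (hz : z ∉ κ n q '' S) : chartExt q g z = 0 := by
  rw [chartExt]
  split_ifs with h
  · exact hg _ fun hx => hz ⟨_, hx, (κ n q).right_inv h⟩
  · rfl

lemma norm_logPull_le {q : N} {g : N → G} {C : ℝ} (hg : ∀ x, ‖g x‖ ≤ C) (s : ℝ^n) : ‖logPull (n := n) q g s‖ ≤ C := by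
  rw [logPull, chartExt]
  split_ifs
  · exact hg _
  · rw [norm_zero]; exact (norm_nonneg _).trans (hg q)

lemma logPull_logChart {q : N} (g : N → G) {x : N} (hx : x ∈ innerChart n q) : logPull q g (logChart (n := n) q x) = g x := by
  have h1 := mapsTo_innerChart q hx
  rw [logPull, logChart, expV_logV h1.2, chartExt, if_pos h1.1, (κ n q).left_inv (by rw [extChartAt_source]; exact hx.1)]

/-- Identities between functions in logarithmic coordinates can be checked on the manifold. -/
lemma mem_innerTarget_expV {q : N} {s : ℝ^n} (h : expV s ∈ (κ n q).target) : expV s ∈ innerTarget n q := ⟨h, expV_pos s⟩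

lemma logPull_of_mem {q : N} (g : N → G) {s : ℝ^n} (h : expV s ∈ (κ n q).target) : logPull q g s = g ((κ n q).symm (expV s)) := if_pos h

lemma logPull_of_notMem {q : N} (g : N → G) {s : ℝ^n} (h : expV s ∉ (κ n q).target) : logPull q g s = 0 := if_neg h

variable [CompactSpace N]

lemma contDiffOn_chartExt {q : N} {g : N → G} (hg : ContMDiffOn (Q n) 𝓘(ℝ, G) ∞ g (chartAt ℝ₊^n q).source)
    {S : Set N} (hS : IsClosed S) (hSq : S ⊆ (chartAt ℝ₊^n q).source) (h0 : ∀ x ∉ S, g x = 0) :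
    ContDiffOn ℝ ∞ (chartExt q g) (range (Q n)) := by
  intro z hz
  by_cases hzS : z ∈ κ n q '' S
  · obtain ⟨x, hx, rfl⟩ := hzS
    have hxs : x ∈ (κ n q).source := by rw [extChartAt_source]; exact hSq hx
    have hzt := (κ n q).map_source hxs
    have h1 := contDiffOn_comp_symm le_rfl q hg
    have h2 : ContDiffOn ℝ ∞ (fun z => g ((κ n q).symm z)) (κ n q).target :=
      h1.mono fun w hw => ⟨hw, by rw [mem_preimage, ← extChartAt_source (Q n)]; exact (κ n q).map_target hw⟩
    have h3 := (h2 _ hzt).mono_of_mem_nhdsWithin (extChartAt_target_mem_nhdsWithin_of_mem hzt)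
    refine h3.congr_of_eventuallyEq ?_ (if_pos hzt)
    filter_upwards [extChartAt_target_mem_nhdsWithin_of_mem hzt] with w hw using if_pos hw
  · refine (contDiffWithinAt_const (c := (0 : G))).congr_of_eventuallyEq ?_ (chartExt_eq_zero h0 hzS)
    filter_upwards [mem_nhdsWithin_of_mem_nhds ((isCompact_image_chart hS hSq).isClosed.isOpen_compl.mem_nhds hzS)] with w hw
    exact chartExt_eq_zero h0 hw

lemma contDiff_logPull {q : N} {g : N → G} (hg : ContMDiffOn (Q n) 𝓘(ℝ, G) ∞ g (chartAt ℝ₊^n q).source)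
    {S : Set N} (hS : IsClosed S) (hSq : S ⊆ (chartAt ℝ₊^n q).source) (h0 : ∀ x ∉ S, g x = 0) :
    ContDiff ℝ ∞ (logPull (n := n) q g) :=
  (contDiffOn_chartExt hg hS hSq h0).comp_contDiff contDiff_expV expV_mem

/-- The derivative in logarithmic coordinates along a multiple of a vector field. -/
lemma fderiv_logPull {q : N} {g : N → G} (hg : ContMDiffOn (Q n) 𝓘(ℝ, G) ∞ g (chartAt ℝ₊^n q).source)
    {V : ∀ x : N, TangentSpace (Q n) x} {χ : N → ℝ} {s v : ℝ^n}
    (hv : ∀ a, v a = exp (-s a) * logPull q (fun x => χ x * vd V (fun x => κ n q x a) x) s) :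
    fderiv ℝ (logPull q g) s v = logPull q (fun x => χ x • vd V g x) s := by
  by_cases h : expV s ∈ (κ n q).target
  · have hin := mem_innerTarget_expV h
    set x := (κ n q).symm (expV s) with hx
    have hxs := (mapsTo_innerTarget q hin).1
    have hgd : MD(n, G) g x := (hg.contMDiffAt ((chartAt _ q).open_source.mem_nhds hxs)).mdifferentiableAt (by simp)
    have h1 : logPull q g =ᶠ[𝓝 s] (fun z => g ((κ n q).symm z)) ∘ expV := by
      filter_upwards [(contDiff_expV (n := n)).continuous.continuousAt.preimage_mem_nhds ((isOpen_innerTarget q).mem_nhds hin)] with w hw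
      exact if_pos hw.1
    have h2 : DifferentiableAt ℝ (fun z => g ((κ n q).symm z)) (expV s) := by
      have h3 := contDiffOn_comp_symm le_rfl q hg
      refine (h3.contDiffAt (mem_of_superset ((isOpen_innerTarget q).mem_nhds hin) fun w hw => ⟨hw.1, ?_⟩)).differentiableAt (by simp)
      exact (mapsTo_innerTarget q hw).1
    rw [h1.fderiv_eq, fderiv_comp s h2 ((contDiff_expV (n := n)).differentiable (by simp) s), ContinuousLinearMap.comp_apply,
      logPull_of_mem _ h, vd_eq_fderiv q hin hgd, ← map_smul]
    congr 1
    ext a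
    rw [hasFDerivAt_expV_apply, hv, logPull_of_mem _ h, ← mul_assoc, ← Real.exp_add, add_neg_cancel, Real.exp_zero, one_mul]
    refine congrArg (χ x * ·) ?_
    exact vd_clm (proj a : ℝ^n →L[ℝ] ℝ) (mdifferentiableAt_extChartAt_of_mem hxs)
  · have h1 : v = 0 := by
      ext a
      rw [hv, logPull_of_notMem _ h, mul_zero]; rfl
    rw [h1, map_zero, logPull_of_notMem _ h]

end LogPull

variable {𝔸 : N → Type*} [∀ y, NormedAddCommGroup (𝔸 y)] [∀ y, InnerProductSpace ℝ (𝔸 y)]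

/-! ### Lie frames -/

/-- A Parseval frame of a Lie algebroid with anchor `ρ`, with its structure functions. -/
structure LieFrame (ρ : ∀ y, 𝔸 y →ₗ[ℝ] TangentSpace (Q n) y) (K : ℕ) where
  Z : Fin K → ∀ y, 𝔸 y
  parseval : ∀ y v, ∑ j, ⟪Z j y; v⟫ • Z j y = v
  smooth_vf : ∀ j, SmoothVF fun y => ρ y (Z j y)
  smooth_gram : ∀ i j, C∞(n, ℝ) fun y => ⟪Z i y; Z j y⟫
  C : Fin K → Fin K → Fin K → N → ℝ
  smooth_C : ∀ i j k, C∞(n, ℝ) (C i j k)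
  bracket : ∀ (V : Set N), IsOpen V → ∀ f : N → ℝ, ContMDiffOn (Q n) 𝓘(ℝ, ℝ) ∞ f V → ∀ y ∈ V, ∀ i j,
    vd (fun y => ρ y (Z i y)) (vd (fun y => ρ y (Z j y)) f) y -
      vd (fun y => ρ y (Z j y)) (vd (fun y => ρ y (Z i y)) f) y =
    ∑ k, C i j k y * vd (fun y => ρ y (Z k y)) f y
  C_proj : ∀ i j l y, ∑ k, C i j k y * ⟪Z k y; Z l y⟫ = C i j l y

variable {ρ : ∀ y, 𝔸 y →ₗ[ℝ] TangentSpace (Q n) y} {K : ℕ} (W : LieFrame ρ K)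

namespace LieFrame

/-- The vector fields of a Lie frame. -/
def U (j : Fin K) (y : N) : TangentSpace (Q n) y := ρ y (W.Z j y)

/-- The divergence of the vector fields of a Lie frame is `-W.div`. -/
def div (i : Fin K) (y : N) : ℝ := ∑ j, W.C i j j y

lemma smooth_div (i : Fin K) : C∞(n, ℝ) (W.div i) := ContMDiff.sum fun j _ => W.smooth_C i j j

/-- The components of the vector fields in the chart at `q`. -/
def comp (q : N) (j : Fin K) (z : ℝ^n) : ℝ^n :=
  vd (W.U j) (κ n q) ((κ n q).symm z)

lemma contMDiffOn_vd_chart (q : N) (j : Fin K) : ContMDiffOn (Q n) 𝓘(ℝ, ℝ^n) ∞ (vd (W.U j) (κ n q)) (chartAt ℝ₊^n q).source :=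
  contMDiffOn_vd (chartAt _ q).open_source (W.smooth_vf j) (contMDiffOn_extChartAt_source q)

lemma contDiffOn_comp (q : N) (j : Fin K) : ContDiffOn ℝ ∞ (W.comp q j) (κ n q).target :=
  (contDiffOn_comp_symm le_rfl q (W.contMDiffOn_vd_chart q j)).mono fun z hz =>
    ⟨hz, by rw [mem_preimage, ← extChartAt_source (Q n)]; exact (κ n q).map_target hz⟩

lemma bracket_comp (q : N) {z : ℝ^n} (hz : z ∈ innerTarget n q) (i j : Fin K) :
    fderiv ℝ (W.comp q j) z (W.comp q i z) - fderiv ℝ (W.comp q i) z (W.comp q j z) = ∑ k, W.C i j k ((κ n q).symm z) • W.comp q k z := by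
  have hs := (mapsTo_innerTarget q hz).1
  have ho := (chartAt ℝ₊^n q).open_source
  have hd : ∀ j, MD(n, ℝ^n) (vd (W.U j) (κ n q)) ((κ n q).symm z) := fun j =>
    ((W.contMDiffOn_vd_chart q j).contMDiffAt (ho.mem_nhds hs)).mdifferentiableAt (by simp)
  have h1 : ∀ i j, fderiv ℝ (W.comp q j) z (W.comp q i z) = vd (W.U i) (vd (W.U j) (κ n q)) ((κ n q).symm z) := fun i j =>
    (vd_eq_fderiv q hz (hd j)).symm
  rw [h1, h1]
  ext a
  have hpr : ∀ j, ∀ x ∈ (chartAt ℝ₊^n q).source, vd (W.U j) (fun y => κ n q y a) x = vd (W.U j) (κ n q) x a := fun j x hx =>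
    vd_clm (proj a : ℝ^n →L[ℝ] ℝ) (mdifferentiableAt_extChartAt_of_mem hx)
  have hpr2 : ∀ i j, vd (W.U i) (vd (W.U j) (fun y => κ n q y a)) ((κ n q).symm z) =
      vd (W.U i) (vd (W.U j) (κ n q)) ((κ n q).symm z) a := by
    intro i j
    rw [vd_congr (g := fun x => (proj a : ℝ^n →L[ℝ] ℝ) (vd (W.U j) (κ n q) x))]
    · exact vd_clm (proj a : ℝ^n →L[ℝ] ℝ) (hd j)
    · filter_upwards [ho.mem_nhds hs] with x hx
      exact hpr j x hx
  have h2 := W.bracket _ ho (fun y => κ n q y a) (((proj a : ℝ^n →L[ℝ] ℝ).contDiff (n := ∞)).contMDiff.comp_contMDiffOn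
      (contMDiffOn_extChartAt_source q)) _ hs i j
  simp only [PiLp.sub_apply, WithLp.ofLp_sum, Finset.sum_apply, PiLp.smul_apply, smul_eq_mul]
  rw [← hpr2, ← hpr2]
  refine h2.trans (sum_congr rfl fun k _ => ?_)
  exact congrArg _ (hpr k _ hs)

/-- The Gram matrix of the coordinate vector fields of the chart at `q`. -/
def gram (_ : LieFrame ρ K) (q : N) (z : ℝ^n) : Matrix (Fin n) (Fin n) ℝ :=
  Matrix.gram ℝ fun i : Fin n => Function.invFun (ρ ((κ n q).symm z))
    (mfderivWithin 𝓘(ℝ, ℝ^n) (Q n) (κ n q).symm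
      (range (Q n)) z (single i 1 : ℝ^n))

variable (hρ : ∀ x ∈ (Q n).interior N, Function.Bijective (ρ x))
include hρ

lemma gram_spec (q : N) {z : ℝ^n} (hz : z ∈ innerTarget n q) : W.gram q z * of (cometric fun j => W.comp q j z) = 1 ∧
    (∀ k j, ∑ a, ∑ b, W.gram q z a b * W.comp q k z a * W.comp q j z b = ⟪W.Z k ((κ n q).symm z); W.Z j ((κ n q).symm z)⟫) := by
  set x := (κ n q).symm z with hx
  have hxi := mapsTo_innerTarget q hz
  have hbij := hρ x hxi.2
  let t : ℝ^n →L[ℝ] TangentSpace (Q n) x := mfderivWithin 𝓘(ℝ, ℝ^n) (Q n) (κ n q).symm (range (Q n)) z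
  let φ' : TangentSpace (Q n) x →L[ℝ] ℝ^n := mfderiv (Q n) 𝓘(ℝ, ℝ^n) (κ n q) x
  let v : Fin n → 𝔸 x := fun a => Function.invFun (ρ x) (t (single a 1))
  have hv : ∀ a, ρ x (v a) = t (single a 1) := fun a => Function.rightInverse_invFun hbij.2 _
  have hG : ∀ a b, W.gram q z a b = ⟪v a; v b⟫ := fun a b => rfl
  have hcomp : ∀ j, W.comp q j z = φ' (W.U j x) := fun j => rfl
  have hinv := isInvertible_mfderivWithin_extChartAt_symm (I := Q n) hz.1
  have hφt : ∀ w, φ' (t w) = w := by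
    intro w
    have h1 := fderivWithin_comp_extChartAt_symm (f := κ n q) q hz.1 (mdifferentiableAt_extChartAt_of_mem hxi.1) w
    have hzr : z ∈ range (Q n) := extChartAt_target_subset_range q hz.1
    have h2 : (fun z => κ n q ((κ n q).symm z)) =ᶠ[𝓝[range (Q n)] z] id := by
      filter_upwards [extChartAt_target_mem_nhdsWithin_of_mem hz.1] with w hw
      exact (κ n q).right_inv hw
    rw [h2.fderivWithin_eq (h2.self_of_nhdsWithin hzr), fderivWithin_id ((Q n).uniqueDiffOn z hzr)] at h1
    exact h1.symm
  have htφ : ∀ u, t (φ' u) = u := by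
    intro u
    obtain ⟨w, rfl⟩ : ∃ w, t w = u := ⟨_, congrArg (fun L => L u) hinv.self_comp_inverse⟩
    rw [hφt]
  have hsum : ∀ w : ℝ^n, w = ∑ a, w a • (single a 1 : ℝ^n) := by
    intro w
    ext c
    simp [Finset.sum_apply, Pi.single_apply]
  have hZ : ∀ j, W.Z j x = ∑ a, W.comp q j z a • v a := by
    intro j
    apply hbij.1
    rw [map_sum]
    simp only [map_smul, hv]
    have h1 : W.U j x = t (W.comp q j z) := by rw [hcomp, htφ]
    refine h1.trans ?_
    conv_lhs => rw [hsum (W.comp q j z), map_sum]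
    simp only [map_smul]
  have hd : ∀ a, ∑ j, ⟪W.Z j x; v a⟫ • W.comp q j z = single a 1 := by
    intro a
    have h1 := congrArg (ρ x) (W.parseval x (v a))
    rw [map_sum, hv] at h1
    simp only [map_smul] at h1
    have h2 := congrArg φ' h1
    rw [hφt, map_sum] at h2
    simp only [map_smul] at h2
    exact h2
  constructor
  · ext a b
    rw [Matrix.mul_apply]
    have h1 : ∑ c, W.gram q z a c * of (cometric fun j => W.comp q j z) c b = ∑ j, ⟪W.Z j x; v a⟫ * W.comp q j z b := by
      have h2 : ∀ j, ⟪W.Z j x; v a⟫ = ∑ c, W.gram q z a c * W.comp q j z c := by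
        intro j
        rw [real_inner_comm, hZ j, inner_sum]
        refine sum_congr rfl fun c _ => ?_
        rw [real_inner_smul_right, hG, mul_comm]
      simp only [h2, Matrix.of_apply, cometric, mul_sum, sum_mul]
      rw [sum_comm]
      refine sum_congr rfl fun j _ => sum_congr rfl fun c _ => ?_
      ring
    rw [h1]
    have h3 := congrArg (fun w : ℝ^n => w b) (hd a)
    simp only [WithLp.ofLp_sum, Finset.sum_apply, PiLp.smul_apply, smul_eq_mul] at h3
    rw [h3, Matrix.one_apply]
    simp [eq_comm]
  · intro k j
    rw [hZ k, hZ j, sum_inner]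
    refine sum_congr rfl fun a _ => ?_
    rw [inner_sum]
    refine sum_congr rfl fun b _ => ?_
    rw [real_inner_smul_left, real_inner_smul_right, hG]
    ring

lemma det_cometric_pos (q : N) {z : ℝ^n} (hz : z ∈ innerTarget n q) : 0 < det (of (cometric fun j => W.comp q j z)) ∧
    sqrt (W.gram q z).det = frameDensity fun j => W.comp q j z := by
  have h1 := congrArg det (W.gram_spec hρ q hz).1
  rw [Matrix.det_mul, Matrix.det_one] at h1
  have h2 : 0 ≤ (W.gram q z).det := (Matrix.posSemidef_gram ℝ _).det_nonneg
  have h3 : 0 < det (of (cometric fun j => W.comp q j z)) := by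
    by_contra! h
    have := mul_nonpos_of_nonneg_of_nonpos h2 h
    linarith
  refine ⟨h3, ?_⟩
  rw [frameDensity, ← Real.sqrt_inv, eq_inv_of_mul_eq_one_left h1]

end LieFrame

namespace LieFrame

variable (hρ : ∀ x ∈ (Q n).interior N, Function.Bijective (ρ x))
  [MeasurableSpace N] [BorelSpace N] {μ : Measure N} (hμ : IsVolume ρ μ)
include hρ

lemma contDiffOn_frameDensity (q : N) : ContDiffOn ℝ ∞ (fun z => frameDensity fun j => W.comp q j z) (innerTarget n q) := by
  have h1 : ∀ j, ContDiffOn ℝ ∞ (W.comp q j) (innerTarget n q) := fun j => (W.contDiffOn_comp q j).mono inter_subset_left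
  have h2 : ∀ j a, ContDiffOn ℝ ∞ (fun z => W.comp q j z a) (innerTarget n q) := fun j a =>
    (proj a : ℝ^n →L[ℝ] ℝ).contDiff.comp_contDiffOn (h1 j)
  have h3 : ∀ a b, ContDiffOn ℝ ∞ (fun z => cometric (fun j => W.comp q j z) a b) (innerTarget n q) :=
    fun a b => ContDiffOn.sum fun j _ => (h2 j a).mul (h2 j b)
  have h4 : ContDiffOn ℝ ∞ (fun z => det (of (cometric fun j => W.comp q j z))) (innerTarget n q) := by
    simp only [Matrix.det_apply, Matrix.of_apply]
    exact ContDiffOn.sum fun σ _ => (contDiffOn_prod fun a _ => h3 _ _).const_smul _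
  intro z hz
  have h5 := (W.det_cometric_pos hρ q hz).1
  exact ((h4 z hz).sqrt h5.ne').inv (Real.sqrt_pos.2 h5).ne'

include hμ

/-- The volume measure in a chart. -/
lemma restrict_eq_map (q : N) : μ.restrict (innerChart n q) = ((volume.restrict (innerTarget n q)).withDensity
      fun z => ENNReal.ofReal (frameDensity fun j => W.comp q j z)).map (κ n q).symm := by
  have hmeas : AEMeasurable (κ n q).symm (volume.restrict (innerTarget n q)) :=
    ((continuousOn_extChartAt_symm q).mono inter_subset_left).aemeasurable (isOpen_innerTarget q).measurableSet
  have hmeas2 := hmeas.mono_ac (withDensity_absolutelyContinuous (volume.restrict (innerTarget n q))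
    fun z => ENNReal.ofReal (frameDensity fun j => W.comp q j z))
  ext S hS
  rw [Measure.restrict_apply hS, Measure.map_apply_of_aemeasurable hmeas2 hS,
    hμ.2 q _ (hS.inter (isOpen_innerChart q).measurableSet) inter_subset_right,
    image_innerChart_inter]
  have hnull : NullMeasurableSet ((κ n q).symm ⁻¹' S) (volume.restrict (innerTarget n q)) := hmeas.nullMeasurable hS
  rw [withDensity_apply', Measure.restrict_restrict₀ hnull, inter_comm]
  refine lintegral_congr_ae ?_
  filter_upwards [ae_mono (Measure.restrict_mono inter_subset_right le_rfl)
    (ae_restrict_mem (isOpen_innerTarget q).measurableSet)] with z hz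
  exact congrArg ENNReal.ofReal (W.det_cometric_pos hρ q hz).2

lemma integral_chart (q : N) {g : N → ℝ} (hg : ContinuousOn g (innerChart n q)) (hg0 : ∀ x ∉ innerChart n q, g x = 0) :
    ∫ x, g x ∂μ = ∫ z in innerTarget n q, g ((κ n q).symm z) * frameDensity fun j => W.comp q j z := by
  have hmeas : AEMeasurable (κ n q).symm (volume.restrict (innerTarget n q)) :=
    ((continuousOn_extChartAt_symm q).mono inter_subset_left).aemeasurable (isOpen_innerTarget q).measurableSet
  have hd : AEMeasurable (fun z => ENNReal.ofReal (frameDensity fun j => W.comp q j z)) (volume.restrict (innerTarget n q)) :=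
    ((W.contDiffOn_frameDensity hρ q).continuousOn.aemeasurable (isOpen_innerTarget q).measurableSet).ennreal_ofReal
  have h1 := W.restrict_eq_map hρ hμ q
  rw [← setIntegral_eq_integral_of_forall_compl_eq_zero hg0, h1, integral_map (hmeas.mono_ac (withDensity_absolutelyContinuous _ _)) (by
      rw [← h1]
      exact hg.aestronglyMeasurable (isOpen_innerChart q).measurableSet),
    integral_withDensity_eq_integral_toReal_smul₀ hd (.of_forall fun _ => ENNReal.ofReal_lt_top)]
  refine integral_congr_ae (.of_forall fun z => ?_)
  simp only [smul_eq_mul]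
  have h2 : 0 ≤ frameDensity fun j => W.comp q j z := inv_nonneg.2 (Real.sqrt_nonneg _)
  rw [ENNReal.toReal_ofReal h2, mul_comm]

omit hμ in
lemma divergence_comp (q : N) {z : ℝ^n} (hz : z ∈ innerTarget n q) {h : N → ℝ} (hh : MD(n, ℝ) h ((κ n q).symm z))
    (hh2 : DifferentiableAt ℝ (fun z => h ((κ n q).symm z)) z) (i : Fin K) :
    ∑ a, fderiv ℝ (fun z => (h ((κ n q).symm z) * frameDensity fun j => W.comp q j z) • W.comp q i z) z (single a 1) a =
    vd (W.U i) h ((κ n q).symm z) * (frameDensity fun j => W.comp q j z) - (h ((κ n q).symm z) * W.div i ((κ n q).symm z)) *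
        frameDensity fun j => W.comp q j z := by
  have hO := (isOpen_innerTarget q).mem_nhds hz
  have hU : ∀ j, DifferentiableAt ℝ (W.comp q j) z := fun j =>
    (((W.contDiffOn_comp q j).mono inter_subset_left).contDiffAt hO).differentiableAt (by simp)
  obtain ⟨hG, hP⟩ := W.gram_spec hρ q hz
  obtain ⟨L, hL, hL2⟩ := hasFDerivAt_frameDensity hU (W.bracket_comp q hz) hG (fun i j => by
    simp only [hP]
    exact W.C_proj i j j _) (W.det_cometric_pos hρ q hz).1 i
  have h1 := ((hh2.hasFDerivAt.mul hL).smul (hU i).hasFDerivAt).fderiv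
  have h2 := vd_eq_fderiv (V := W.U i) q hz hh
  have h3 : ∀ M : ℝ^n →L[ℝ] ℝ, ∑ a, M (single a 1) * W.comp q i z a = M (W.comp q i z) := by
    intro M
    have h4 : W.comp q i z = ∑ c, W.comp q i z c • (single c 1 : ℝ^n) := by
      ext c
      simp [Finset.sum_apply, Pi.single_apply]
    conv_rhs => rw [h4, map_sum]
    simp only [map_smul, smul_eq_mul]
    exact sum_congr rfl fun a _ => mul_comm _ _
  have h5 : ∀ a, fderiv ℝ (fun z => (h ((κ n q).symm z) * frameDensity fun j => W.comp q j z) • W.comp q i z) z (single a 1) a =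
      (h ((κ n q).symm z) * frameDensity fun j => W.comp q j z) * fderiv ℝ (W.comp q i) z (single a 1) a +
      (h ((κ n q).symm z) • L + (frameDensity fun j => W.comp q j z) •
        fderiv ℝ (fun z => h ((κ n q).symm z)) z) (single a 1) * W.comp q i z a := by
    intro a
    exact congrArg (fun T : ℝ^n →L[ℝ] ℝ^n => T (single a 1) a) h1
  simp_rw [h5]
  rw [sum_add_distrib, h3, ← mul_sum]
  simp only [add_apply, smul_apply, smul_eq_mul]
  rw [h2]
  change _ = fderiv ℝ _ z (W.comp q i z) * _ - _
  have h6 : W.div i ((κ n q).symm z) = ∑ j, W.C i j j ((κ n q).symm z) := rfl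
  rw [h6]
  linear_combination h ((κ n q).symm z) * hL2

/-- The divergence theorem in a chart. -/
lemma integral_vd_chart (q : N) {h : N → ℝ} (hh : ContMDiff (Q n) 𝓘(ℝ, ℝ) 1 h) {S : Set N} (hS : IsCompact S)
    (hSq : S ⊆ innerChart n q) (hhS : ∀ x ∉ S, h x = 0) (hSc : IsClosed S) (i : Fin K) :
    ∫ x, vd (W.U i) h x ∂μ = ∫ x, h x * W.div i x ∂μ := by
  set O := innerTarget n q with hOdef
  have hO : IsOpen O := isOpen_innerTarget q
  set ψ := (κ n q).symm with hψ
  set δ : ℝ^n → ℝ := fun z => frameDensity fun j => W.comp q j z with hδdef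
  have hδ : ContDiffOn ℝ ∞ δ O := W.contDiffOn_frameDensity hρ q
  set B := κ n q '' S with hB
  have hBc : IsCompact B := hS.image_of_continuousOn
    ((continuousOn_extChartAt q).mono fun x hx => by rw [extChartAt_source]; exact (hSq hx).1)
  have hBO : B ⊆ O := by
    rintro _ ⟨x, hx, rfl⟩
    exact mapsTo_innerChart q (hSq hx)
  have hB0 : ∀ z ∈ O, z ∉ B → ψ z ∉ S := by
    intro z hz hzB hx
    exact hzB ⟨ψ z, hx, (κ n q).right_inv hz.1⟩
  have hhd : ∀ x, MD(n, ℝ) h x := fun x => (hh x).mdifferentiableAt (by simp)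
  have hvd0 : ∀ x ∉ S, vd (W.U i) h x = 0 := by
    intro x hx
    rw [vd_congr (g := fun _ => (0 : ℝ)), vd_const]
    filter_upwards [hSc.isOpen_compl.mem_nhds hx] with y hy using hhS y hy
  have hψm : ∀ z ∈ O, ψ z ∈ innerChart n q := fun z hz => mapsTo_innerTarget q hz
  have hhψ : ContDiffOn ℝ 1 (fun z => h (ψ z)) O :=
    (contDiffOn_comp_symm (r := 1) (WithTop.coe_le_coe.2 le_top) q (S := univ) hh.contMDiffOn).mono fun z hz => ⟨hz.1, mem_univ _⟩
  have hcomp : ContDiffOn ℝ 1 (W.comp q i) O := ((W.contDiffOn_comp q i).mono inter_subset_left).of_le (WithTop.coe_le_coe.2 le_top)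
  let w : ℝ^n → ℝ^n := O.indicator fun z => (h (ψ z) * δ z) • W.comp q i z
  have hwB : ∀ z ∉ B, w z = 0 := by
    intro z hz
    by_cases hzO : z ∈ O
    · refine (indicator_of_mem hzO _).trans ?_
      rw [hhS _ (hB0 z hzO hz), zero_mul, zero_smul]
    · exact indicator_of_notMem hzO _
  have hw0 : ∀ z ∉ B, w =ᶠ[𝓝 z] 0 := fun z hz => by
    filter_upwards [hBc.isClosed.isOpen_compl.mem_nhds hz] with y hy using hwB y hy
  have hwO : ∀ z ∈ O, w =ᶠ[𝓝 z] fun z => (h (ψ z) * δ z) • W.comp q i z := fun z hz => by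
    filter_upwards [hO.mem_nhds hz] with y hy using indicator_of_mem hy _
  have hwc : ContDiff ℝ 1 w := by
    rw [contDiff_iff_contDiffAt]
    intro z
    by_cases hz : z ∈ O
    · refine ContDiffAt.congr_of_eventuallyEq ?_ (hwO z hz)
      exact ((hhψ.mul (hδ.of_le (WithTop.coe_le_coe.2 le_top))).smul hcomp).contDiffAt (hO.mem_nhds hz)
    · exact contDiffAt_const.congr_of_eventuallyEq (hw0 z fun h => hz (hBO h))
  have hws : HasCompactSupport w := HasCompactSupport.intro hBc hwB
  have hz1 := integral_divergence_eq_zero hwc hws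
  have hcd : Continuous fun z => ∑ a, fderiv ℝ w z (single a 1) a :=
    continuous_finsetSum _ fun a _ => (proj a : ℝ^n →L[ℝ] ℝ).continuous.comp ((hwc.continuous_fderiv (by simp)).clm_apply continuous_const)
  have hd0 : ∀ z ∉ B, ∑ a, fderiv ℝ w z (single a 1) a = 0 := by
    intro z hz
    rw [(hw0 z hz).fderiv_eq]
    simp
  have hcdi : Integrable fun z => ∑ a, fderiv ℝ w z (single a 1) a := hcd.integrable_of_hasCompactSupport (HasCompactSupport.intro hBc hd0)
  have hpt : ∀ z ∈ O, vd (W.U i) h (ψ z) * δ z = ∑ a, fderiv ℝ w z (single a 1) a + h (ψ z) * W.div i (ψ z) * δ z := by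
    intro z hz
    rw [(hwO z hz).fderiv_eq]
    have := W.divergence_comp hρ q hz (hhd _) ((hhψ.contDiffAt (hO.mem_nhds hz)).differentiableAt (by simp)) i
    rw [this]
    ring
  have hi2 : IntegrableOn (fun z => h (ψ z) * W.div i (ψ z) * δ z) O := by
    have hc : ContinuousOn (fun z => h (ψ z) * W.div i (ψ z) * δ z) O :=
      (hhψ.continuousOn.mul ((W.smooth_div i).continuous.comp_continuousOn
        ((continuousOn_extChartAt_symm q).mono inter_subset_left))).mul hδ.continuousOn
    refine ((hc.mono hBO).integrableOn_compact hBc).of_forall_sdiff_eq_zero hO.measurableSet fun z hz => ?_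
    rw [hhS _ (hB0 z hz.1 hz.2)]
    ring
  have hcont1 : ContinuousOn (vd (W.U i) h) (innerChart n q) := (continuous_vd (W.smooth_vf i) hh).continuousOn
  rw [W.integral_chart hρ hμ q hcont1 fun x hx => hvd0 x fun h => hx (hSq h), W.integral_chart hρ hμ q (g := fun x => h x * W.div i x)
      (hh.continuous.mul (W.smooth_div i).continuous).continuousOn fun x hx => by
        rw [hhS x fun h => hx (hSq h), zero_mul],
    setIntegral_congr_fun hO.measurableSet hpt, integral_add hcdi.integrableOn hi2,
    setIntegral_eq_integral_of_forall_compl_eq_zero fun z hz => hd0 z fun h => hz (hBO h), hz1, zero_add]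

include W in
/-- The volume measure is locally finite in the interior. -/
lemma exists_nhds_measure_lt_top {x : N} (hx : x ∈ (Q n).interior N) : ∃ V ∈ 𝓝 x, μ V < ⊤ := by
  have hxq : x ∈ innerChart n x := ⟨mem_chart_source _ x, hx⟩
  obtain ⟨B, hB, hBO, hBc⟩ := local_compact_nhds ((isOpen_innerTarget x).mem_nhds (mapsTo_innerChart x hxq))
  refine ⟨innerChart n x ∩ κ n x ⁻¹' B, inter_mem ((isOpen_innerChart x).mem_nhds hxq)
    ((continuousAt_extChartAt x).preimage_mem_nhds hB), ?_⟩
  have hd : IntegrableOn (fun z => frameDensity fun j => W.comp x j z) B :=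
    ((W.contDiffOn_frameDensity hρ x).continuousOn.mono hBO).integrableOn_compact hBc
  have h1 : μ (innerChart n x ∩ κ n x ⁻¹' B) = μ.restrict (innerChart n x) (innerChart n x ∩ κ n x ⁻¹' B) := by
    rw [Measure.restrict_eq_self _ inter_subset_left]
  have hop : MeasurableSet (innerChart n x ∩ κ n x ⁻¹' B) := by
    obtain ⟨u, hu, hu2⟩ := (continuousOn_iff_isClosed.1 (show ContinuousOn (κ n x) (innerChart n x) from
      (continuousOn_extChartAt (I := Q n) x).mono fun y hy => by rw [extChartAt_source]; exact hy.1)) B hBc.isClosed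
    rw [inter_comm, hu2]
    exact hu.measurableSet.inter (isOpen_innerChart x).measurableSet
  rw [h1, W.restrict_eq_map hρ hμ, Measure.map_apply_of_aemeasurable _ hop, withDensity_apply']
  · have hsub : (volume.restrict (innerTarget n x)).restrict ((κ n x).symm ⁻¹' (innerChart n x ∩ κ n x ⁻¹' B)) ≤ volume.restrict B := by
      rw [Measure.restrict_restrict₀]
      · refine Measure.restrict_mono ?_ le_rfl
        rintro z ⟨hz1, hz2⟩
        have : κ n x ((κ n x).symm z) = z := (κ n x).right_inv hz2.1
        have h3 := hz1.2
        rwa [mem_preimage, this] at h3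
      · exact (((continuousOn_extChartAt_symm x).mono inter_subset_left).aemeasurable
          (isOpen_innerTarget x).measurableSet).nullMeasurable hop
    refine (lintegral_mono' hsub le_rfl).trans_lt ?_
    exact (lintegral_mono fun z => Real.ofReal_le_enorm _).trans_lt hd.2
  · exact (((continuousOn_extChartAt_symm x).mono inter_subset_left).aemeasurable
          (isOpen_innerTarget x).measurableSet).mono_ac (withDensity_absolutelyContinuous _ _)

include W in
lemma measure_lt_top {S : Set N} (hS : IsCompact S) (hSi : S ⊆ (Q n).interior N) : μ S < ⊤ := hS.measure_lt_top_of_nhdsWithin fun x hx => by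
    obtain ⟨V, hV, hVt⟩ := W.exists_nhds_measure_lt_top hρ hμ (hSi hx)
    exact ⟨V, mem_nhdsWithin_of_mem_nhds hV, hVt⟩

include W in
lemma integrable_of_compact {G : Type*} [NormedAddCommGroup G] [SecondCountableTopologyEither N G] {g : N → G}
    (hg : Continuous g) {S : Set N} (hS : IsCompact S) (hSc : IsClosed S)
    (hSi : S ⊆ (Q n).interior N) (h0 : ∀ x ∉ S, g x = 0) : Integrable g μ := by
  obtain ⟨B, hB⟩ := hS.exists_bound_of_continuousOn hg.continuousOn
  have h1 : IntegrableOn g S μ := IntegrableOn.of_bound (W.measure_lt_top hρ hμ hS hSi) (hg.aestronglyMeasurable.restrict) B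
      ((ae_restrict_iff' hSc.measurableSet).2 (.of_forall hB))
  rw [← integrableOn_univ]
  exact h1.of_forall_sdiff_eq_zero MeasurableSet.univ fun x hx => h0 x hx.2

variable [T2Space N] [CompactSpace N]

/-- The divergence theorem. -/
theorem integral_vd {h : N → ℝ} (hh : ContMDiff (Q n) 𝓘(ℝ, ℝ) 1 h) {S : Set N} (hSc : IsClosed S)
    (hSi : S ⊆ (Q n).interior N) (hhS : ∀ x ∉ S, h x = 0) (i : Fin K) :
    ∫ x, vd (W.U i) h x ∂μ = ∫ x, h x * W.div i x ∂μ := by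
  obtain ⟨t, ψ, htS, hψ, hψs, hsum⟩ := exists_finite_partition (n := n) hSc (V := fun x => innerChart n x)
    fun x hx => (isOpen_innerChart x).mem_nhds ⟨mem_chart_source _ x, hSi hx⟩
  have hle : (1 : ℕ∞ω) ≤ (∞ : ℕ∞ω) := WithTop.coe_le_coe.2 le_top
  have hψh : ∀ i : t, ContMDiff (Q n) 𝓘(ℝ, ℝ) 1 fun x => ψ i x * h x := fun i => ((hψ i).of_le hle).mul hh
  have hsumh : ∀ x, ∑ i : t, ψ i x * h x = h x := by
    intro x
    rw [← sum_mul]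
    by_cases hx : x ∈ S
    · rw [hsum x hx, one_mul]
    · rw [hhS x hx, mul_zero]
  have hloc : ∀ k : t, ∫ x, vd (W.U i) (fun x => ψ k x * h x) x ∂μ = ∫ x, (ψ k x * h x) * W.div i x ∂μ := by
    intro k
    refine W.integral_vd_chart hρ hμ (k : N) (hψh k) (S := tsupport (ψ k) ∩ S)
      ((isClosed_tsupport _).inter hSc).isCompact (fun x hx => hψs k hx.1) (fun x hx => ?_)
      ((isClosed_tsupport _).inter hSc) i
    by_cases hxS : x ∈ S
    · rw [image_eq_zero_of_notMem_tsupport fun h => hx ⟨h, hxS⟩, zero_mul]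
    · rw [hhS x hxS, mul_zero]
  have hv0 : ∀ k : t, ∀ x ∉ S, vd (W.U i) (fun x => ψ k x * h x) x = 0 := by
    intro k x hx
    rw [vd_congr (g := fun _ => (0 : ℝ)), vd_const]
    filter_upwards [hSc.isOpen_compl.mem_nhds hx] with y hy
    rw [hhS y hy, mul_zero]
  have hvc : ∀ k : t, Continuous (vd (W.U i) fun x => ψ k x * h x) := by
    exact fun k => continuous_vd (W.smooth_vf i) (hψh k)
  have h1 : ∀ x, vd (W.U i) h x = ∑ k : t, vd (W.U i) (fun x => ψ k x * h x) x := by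
    intro x
    rw [← vd_sum' _ fun k _ => ((hψh k) x).mdifferentiableAt (by simp)]
    simp_rw [hsumh]
  simp_rw [h1]
  rw [integral_finsetSum _ fun k _ => W.integrable_of_compact hρ hμ (hvc k) hSc.isCompact hSc hSi (hv0 k)]
  simp_rw [hloc]
  rw [← integral_finsetSum (f := fun k x => ψ k x * h x * W.div i x) _ fun k _ => W.integrable_of_compact hρ hμ
    ((hψh k).continuous.mul (W.smooth_div i).continuous) hSc.isCompact hSc hSi fun x hx => by
      rw [hhS x hx, mul_zero, zero_mul]]
  refine integral_congr_ae (.of_forall fun x => ?_)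
  simp only
  rw [← sum_mul, hsumh]

end LieFrame

namespace LieFrame

lemma vd_anchor {G : Type*} [NormedAddCommGroup G] [NormedSpace ℝ G] (X : ∀ y, 𝔸 y) (f : N → G) (y : N) :
    vd (fun y => ρ y (X y)) f y = ∑ j, ⟪W.Z j y; X y⟫ • vd (W.U j) f y := by
  rw [← vd_vf_sum Finset.univ (fun j y => ⟪W.Z j y; X y⟫) W.U]
  refine vd_congr_vf ?_
  conv_lhs => rw [← W.parseval y (X y), map_sum]
  simp only [map_smul]
  rfl

/-- The function `d` with `∫ X h = ∫ h d`. -/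
def divX (X : ∀ y, 𝔸 y) (y : N) : ℝ :=
  ∑ j, (⟪W.Z j y; X y⟫ * W.div j y - vd (W.U j) (fun y => ⟪W.Z j y; X y⟫) y)

variable {X : ∀ y, 𝔸 y} (hX : ∀ j, C∞(n, ℝ) fun y => ⟪W.Z j y; X y⟫)
include hX

lemma smooth_divX : C∞(n, ℝ) (W.divX X) := ContMDiff.sum fun j _ => ((hX j).mul (W.smooth_div j)).sub (contMDiff_vd (W.smooth_vf j) (hX j))

lemma contMDiff_vd_anchor {G : Type*} [NormedAddCommGroup G] [NormedSpace ℝ G] {f : N → G}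
    (hf : C∞(n, G) f) : C∞(n, G) (vd (fun y => ρ y (X y)) f) := by
  have h1 : vd (fun y => ρ y (X y)) f = fun y => ∑ j, ⟪W.Z j y; X y⟫ • vd (W.U j) f y :=
    funext fun y => W.vd_anchor X f y
  rw [h1]
  exact ContMDiff.sum fun j _ => (hX j).smul (contMDiff_vd (W.smooth_vf j) hf)

variable [T2Space N] [CompactSpace N]
  (hρ : ∀ x ∈ (Q n).interior N, Function.Bijective (ρ x))
  [MeasurableSpace N] [BorelSpace N] {μ : Measure N} (hμ : IsVolume ρ μ)
include hρ hμ

lemma integral_vd_anchor_real {h : N → ℝ} (hh : C∞(n, ℝ) h) {S : Set N} (hSc : IsClosed S)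
    (hSi : S ⊆ (Q n).interior N) (hhS : ∀ x ∉ S, h x = 0) :
    ∫ y, vd (fun y => ρ y (X y)) h y ∂μ = ∫ y, h y * W.divX X y ∂μ := by
  have hd : ∀ {f : N → ℝ}, C∞(n, ℝ) f → ∀ y, MD(n, ℝ) f y := fun hf y => (hf y).mdifferentiableAt (by simp)
  have hxh : ∀ j, C∞(n, ℝ) fun y => ⟪W.Z j y; X y⟫ * h y := fun j => (hX j).mul hh
  have h0 : ∀ j, ∀ y ∉ S, vd (W.U j) (fun y => ⟪W.Z j y; X y⟫ * h y) y = 0 := by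
    intro j y hy
    rw [vd_congr (g := fun _ => (0 : ℝ)), vd_const]
    filter_upwards [hSc.isOpen_compl.mem_nhds hy] with y hy
    rw [hhS y hy, mul_zero]
  have h1 : ∀ y, vd (fun y => ρ y (X y)) h y = ∑ j, (vd (W.U j) (fun y => ⟪W.Z j y; X y⟫ * h y) y -
      vd (W.U j) (fun y => ⟪W.Z j y; X y⟫) y * h y) := by
    intro y
    rw [W.vd_anchor]
    refine sum_congr rfl fun j _ => ?_
    rw [vd_mul (hd (hX j) y) (hd hh y), smul_eq_mul]
    ring
  have hi1 : ∀ j, Integrable (vd (W.U j) (fun y => ⟪W.Z j y; X y⟫ * h y)) μ := fun j =>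
    W.integrable_of_compact hρ hμ (contMDiff_vd (W.smooth_vf j) (hxh j)).continuous hSc.isCompact hSc hSi (h0 j)
  have hi2 : ∀ j, Integrable (fun y => vd (W.U j) (fun y => ⟪W.Z j y; X y⟫) y * h y) μ := fun j =>
    W.integrable_of_compact hρ hμ ((contMDiff_vd (W.smooth_vf j) (hX j)).continuous.mul hh.continuous)
      hSc.isCompact hSc hSi fun y hy => by rw [hhS y hy, mul_zero]
  have hi3 : ∀ j, Integrable (fun y => ⟪W.Z j y; X y⟫ * h y * W.div j y) μ := fun j =>
    W.integrable_of_compact hρ hμ ((hxh j).continuous.mul (W.smooth_div j).continuous)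
      hSc.isCompact hSc hSi fun y hy => by rw [hhS y hy, mul_zero, zero_mul]
  simp_rw [h1]
  rw [integral_finsetSum (f := fun j y => vd (W.U j) (fun y => ⟪W.Z j y; X y⟫ * h y) y -
      vd (W.U j) (fun y => ⟪W.Z j y; X y⟫) y * h y) _ fun j _ => (hi1 j).sub (hi2 j)]
  have h2 : ∀ j, ∫ y, (vd (W.U j) (fun y => ⟪W.Z j y; X y⟫ * h y) y - vd (W.U j) (fun y => ⟪W.Z j y; X y⟫) y * h y) ∂μ =
      ∫ y, (⟪W.Z j y; X y⟫ * h y * W.div j y -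
      vd (W.U j) (fun y => ⟪W.Z j y; X y⟫) y * h y) ∂μ := by
    intro j
    rw [integral_sub (hi1 j) (hi2 j), integral_sub (hi3 j) (hi2 j),
      W.integral_vd hρ hμ ((hxh j).of_le (WithTop.coe_le_coe.2 le_top)) hSc hSi (fun y hy => by rw [hhS y hy, mul_zero])]
  simp_rw [h2]
  rw [← integral_finsetSum (f := fun j y => ⟪W.Z j y; X y⟫ * h y * W.div j y -
      vd (W.U j) (fun y => ⟪W.Z j y; X y⟫) y * h y) _ fun j _ => (hi3 j).sub (hi2 j)]
  refine integral_congr_ae (.of_forall fun y => ?_)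
  simp only [divX, mul_sum]
  exact sum_congr rfl fun j _ => by ring

lemma integral_vd_anchor {h : N → ℂ} (hh : C∞(n, ℂ) h) {S : Set N} (hSc : IsClosed S)
    (hSi : S ⊆ (Q n).interior N) (hhS : ∀ x ∉ S, h x = 0) :
    ∫ y, vd (fun y => ρ y (X y)) h y ∂μ = ∫ y, h y * W.divX X y ∂μ := by
  have hd : ∀ y, MD(n, ℂ) h y := fun y => (hh y).mdifferentiableAt (by simp)
  have h0 : ∀ y ∉ S, vd (fun y => ρ y (X y)) h y = 0 := by
    intro y hy
    rw [vd_congr (g := fun _ => (0 : ℂ)), vd_const]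
    filter_upwards [hSc.isOpen_compl.mem_nhds hy] with y hy using hhS y hy
  have hi1 : Integrable (vd (fun y => ρ y (X y)) h) μ :=
    W.integrable_of_compact hρ hμ (W.contMDiff_vd_anchor hX hh).continuous hSc.isCompact hSc hSi h0
  have hi2 : Integrable (fun y => h y * (W.divX X y : ℂ)) μ :=
    W.integrable_of_compact hρ hμ (hh.continuous.mul (Complex.continuous_ofReal.comp (W.smooth_divX hX).continuous))
      hSc.isCompact hSc hSi fun y hy => by rw [hhS y hy, zero_mul]
  have key : ∀ L : ℂ →L[ℝ] ℝ, (∀ (a : ℂ) (r : ℝ), L (a * r) = L a * r) →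
      L (∫ y, vd (fun y => ρ y (X y)) h y ∂μ) = L (∫ y, h y * W.divX X y ∂μ) := by
    intro L hL
    rw [← L.integral_comp_comm hi1, ← L.integral_comp_comm hi2]
    simp_rw [hL, ← vd_clm L (hd _)]
    exact W.integral_vd_anchor_real hX hρ hμ (L.contDiff.contMDiff.comp hh) hSc hSi fun y hy => by rw [hhS y hy, map_zero]
  apply Complex.ext
  · exact key Complex.reCLM fun a r => by simp
  · exact key Complex.imCLM fun a r => by simp

omit hX

variable {G H : N → Type*}
  [∀ y, NormedAddCommGroup (G y)] [∀ y, InnerProductSpace ℂ (G y)]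
  [∀ y, NormedAddCommGroup (H y)] [∀ y, InnerProductSpace ℂ (H y)]
  {ΓA : Set (∀ y, 𝔸 y)} {ΓG : Set (∀ y, G y)} {ΓH : Set (∀ y, H y)}

/-- First order differential operators have formal adjoints, whose symbol is `-σ^*`. -/
theorem exists_formalAdjoint (hA : ∀ X ∈ ΓA, ∀ j, C∞(n, ℝ) fun y => ⟪W.Z j y; X y⟫) (hA' : ∀ X ∈ ΓA, (fun y => - X y) ∈ ΓA)
    (hG : ∀ e ∈ ΓG, ∀ s ∈ ΓG, C∞(n, ℂ) fun y => ⟪e y, s y⟫)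
    (hH : ∀ e ∈ ΓH, ∀ s ∈ ΓH, C∞(n, ℂ) fun y => ⟪e y, s y⟫)
    {P : (∀ y, G y) → ∀ y, H y} {σ : ∀ y, Module.Dual ℝ (𝔸 y) → G y →ₗ[ℂ] H y}
    (hP : HasSymbol ρ ΓA ΓG ΓH P σ) :
    ∃ (P' : (∀ y, H y) → ∀ y, G y) (σ' : ∀ y, Module.Dual ℝ (𝔸 y) → H y →ₗ[ℂ] G y),
      HasSymbol ρ ΓA ΓH ΓG P' σ' ∧ IsFormalAdjoint n μ ΓG ΓH P P' ∧
      ∀ y ξ v w, ⟪σ' y ξ w, v⟫ = - ⟪w, σ y ξ v⟫ := by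
  obtain ⟨k, X, c, e, b, hX, hc, he, hb, hPs, hσ⟩ := hP
  let c' : Fin k → N → ℂ := fun i y => (W.divX (X i) y : ℂ) + starRingEnd ℂ (c i y)
  have hc' : ∀ i, C∞(n, ℂ) (c' i) := fun i => ((Complex.ofRealCLM.contDiff (n := ∞)).contMDiff.comp (W.smooth_divX (hA _ (hX i)))).add
      (((Complex.conjCLE : ℂ →L[ℝ] ℂ).contDiff (n := ∞)).contMDiff.comp (hc i))
  let P' : (∀ y, H y) → ∀ y, G y := fun w y => ∑ i, (lieDeriv (fun z => ρ z (-X i z))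
    (fun z => ⟪b i z, w z⟫) y + c' i y * ⟪b i y, w y⟫) • e i y
  let σ' : ∀ y, Module.Dual ℝ (𝔸 y) → H y →ₗ[ℂ] G y := fun y ξ =>
    { toFun := fun w => ∑ i, ((ξ (-X i y) : ℂ) * ⟪b i y, w⟫) • e i y
      map_add' := fun w w' => by
        simp only [inner_add_right, mul_add, add_smul, sum_add_distrib]
      map_smul' := fun a w => by
        simp only [inner_smul_right, RingHom.id_apply, smul_sum, smul_smul]
        exact sum_congr rfl fun i _ => by congr 1; ring }
  refine ⟨P', σ', ⟨k, fun i y => -X i y, c', b, e, fun i => hA' _ (hX i), hc', hb, he, fun w _ y => rfl, fun y ξ v => rfl⟩, ?_, ?_⟩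
  · rintro s ⟨hs, hsc, hsi⟩ w ⟨hw, hwc, hwi⟩
    set S := closure {y | s y ≠ 0} with hS
    have hSc : IsClosed S := isClosed_closure
    have hs0 : ∀ y ∉ S, s y = 0 := fun y hy => by
      by_contra h
      exact hy (subset_closure h)
    have hu : ∀ i, C∞(n, ℂ) fun y => ⟪e i y, s y⟫ := fun i => hG _ (he i) _ hs
    have hv : ∀ i, C∞(n, ℂ) fun y => ⟪b i y, w y⟫ := fun i => hH _ (hb i) _ hw
    have hv' : ∀ i, C∞(n, ℂ) fun y => ⟪w y, b i y⟫ := fun i => hH _ hw _ (hb i)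
    have hd : ∀ {f : N → ℂ}, C∞(n, ℂ) f → ∀ y, MD(n, ℂ) f y := fun hf y => (hf y).mdifferentiableAt (by simp)
    have hu0 : ∀ i, ∀ y ∉ S, ⟪e i y, s y⟫ = 0 := fun i y hy => by rw [hs0 y hy, inner_zero_right]
    have hvd0 : ∀ i, ∀ y ∉ S, vd (fun z => ρ z (X i z)) (fun z => ⟪e i z, s z⟫) y = 0 := by
      intro i y hy
      rw [vd_congr (g := fun _ => (0 : ℂ)), vd_const]
      filter_upwards [hSc.isOpen_compl.mem_nhds hy] with y hy using hu0 i y hy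
    have h1 : ∀ y, ⟪w y, P s y⟫ = ∑ i, (vd (fun z => ρ z (X i z)) (fun z => ⟪e i z, s z⟫) y + c i y * ⟪e i y, s y⟫) * ⟪w y, b i y⟫ := by
      intro y
      rw [hPs s hs, inner_sum]
      exact sum_congr rfl fun i _ => inner_smul_right _ _ _
    have h2 : ∀ y, ⟪P' w y, s y⟫ = ∑ i, ⟪e i y, s y⟫ * (-vd (fun z => ρ z (X i z)) (fun z => ⟪w z, b i z⟫) y
        + ((W.divX (X i) y : ℂ) + c i y) * ⟪w y, b i y⟫) := by
      intro y
      rw [sum_inner]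
      refine sum_congr rfl fun i _ => ?_
      rw [inner_smul_left, mul_comm]
      congr 1
      have h3 : vd (fun z => ρ z (X i z)) (fun z => ⟪w z, b i z⟫) y =
          starRingEnd ℂ (vd (fun z => ρ z (X i z)) (fun z => ⟪b i z, w z⟫) y) := by
        have := vd_clm (V := fun z => ρ z (X i z)) (Complex.conjCLE : ℂ →L[ℝ] ℂ) (hd (hv i) y)
        rw [← Complex.conjCLE_apply]
        refine Eq.trans ?_ this
        congr 1
        funext z
        exact (inner_conj_symm (w z) (b i z)).symm
      have h4 : lieDeriv (fun z => ρ z (-X i z)) (fun z => ⟪b i z, w z⟫) y = - vd (fun z => ρ z (X i z)) (fun z => ⟪b i z, w z⟫) y := by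
        simp only [lieDeriv_eq_vd, vd, map_neg]
        rfl
      rw [h4, h3]
      simp only [map_add, map_mul, map_neg, Complex.conj_ofReal, inner_conj_symm, c', RingHomCompTriple.comp_apply, RingHom.id_apply]
    simp_rw [h1, h2]
    have hcv : ∀ i, Continuous fun y => (vd (fun z => ρ z (X i z)) (fun z => ⟪e i z, s z⟫) y
        + c i y * ⟪e i y, s y⟫) * ⟪w y, b i y⟫ := fun i =>
      ((W.contMDiff_vd_anchor (hA _ (hX i)) (hu i)).continuous.add ((hc i).continuous.mul (hu i).continuous)).mul (hv' i).continuous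
    have hcv2 : ∀ i, Continuous fun y => ⟪e i y, s y⟫ * (-vd (fun z => ρ z (X i z)) (fun z => ⟪w z, b i z⟫) y
        + ((W.divX (X i) y : ℂ) + c i y) * ⟪w y, b i y⟫) := fun i =>
      (hu i).continuous.mul ((W.contMDiff_vd_anchor (hA _ (hX i)) (hv' i)).continuous.neg.add
        (((Complex.continuous_ofReal.comp (W.smooth_divX (hA _ (hX i))).continuous).add (hc i).continuous).mul (hv' i).continuous))
    have hi1 := fun i => W.integrable_of_compact hρ hμ (hcv i) hSc.isCompact hSc hsi fun y hy => by
      rw [hvd0 i y hy, hu0 i y hy, mul_zero, add_zero, zero_mul]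
    have hi2 := fun i => W.integrable_of_compact hρ hμ (hcv2 i) hSc.isCompact hSc hsi fun y hy => by
      rw [hu0 i y hy, zero_mul]
    rw [integral_finsetSum _ fun i _ => hi1 i, integral_finsetSum _ fun i _ => hi2 i]
    refine sum_congr rfl fun i _ => ?_
    have h5 := W.integral_vd_anchor (hA _ (hX i)) hρ hμ (contMDiff_cmul (hu i) (hv' i)) hSc hsi fun y hy => by rw [hu0 i y hy, zero_mul]
    have h6 : Integrable (vd (fun z => ρ z (X i z)) (fun y => ⟪e i y, s y⟫ * ⟪w y, b i y⟫)) μ :=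
      W.integrable_of_compact hρ hμ (W.contMDiff_vd_anchor (hA _ (hX i)) (contMDiff_cmul (hu i) (hv' i))).continuous hSc.isCompact hSc hsi
      fun y hy => by
        rw [vd_congr (g := fun _ => (0 : ℂ)), vd_const]
        filter_upwards [hSc.isOpen_compl.mem_nhds hy] with y hy
        rw [hu0 i y hy, zero_mul]
    have h7 : Integrable (fun y => ⟪e i y, s y⟫ * ⟪w y, b i y⟫ * W.divX (X i) y) μ :=
      W.integrable_of_compact hρ hμ (((hu i).continuous.mul (hv' i).continuous).mul
        (Complex.continuous_ofReal.comp (W.smooth_divX (hA _ (hX i))).continuous)) hSc.isCompact hSc hsi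
        fun y hy => by rw [hu0 i y hy, zero_mul, zero_mul]
    rw [← sub_eq_zero, ← integral_sub (hi1 i) (hi2 i)]
    rw [← sub_eq_zero, ← integral_sub h6 h7] at h5
    rw [← h5]
    refine integral_congr_ae (.of_forall fun y => ?_)
    have h8 : vd (fun z => ρ z (X i z)) (fun y => ⟪e i y, s y⟫ * ⟪w y, b i y⟫) y = _ := vd_mul (hd (hu i) y) (hd (hv' i) y)
    simp only
    rw [h8]
    ring
  · intro y ξ v w
    rw [hσ]
    change ⟪∑ i, ((ξ (-X i y) : ℂ) * ⟪b i y, w⟫) • e i y, v⟫ = _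
    rw [sum_inner, inner_sum, ← Finset.sum_neg_distrib]
    refine sum_congr rfl fun i _ => ?_
    rw [inner_smul_left, inner_smul_right, map_mul, Complex.conj_ofReal, inner_conj_symm, map_neg]
    push_cast
    ring

end LieFrame

lemma exists_forall_le_of_finite {ι : Type*} [Finite ι] (f : ι → ℝ) : ∃ C, 0 ≤ C ∧ ∀ i, f i ≤ C := by
  obtain ⟨C, hC⟩ := (Set.finite_range f).bddAbove
  exact ⟨max C 0, le_max_right _ _, fun i => (hC (mem_range_self i)).trans (le_max_left _ _)⟩

lemma exists_forall_norm_le {ι X : Type*} [Finite ι] [TopologicalSpace X] [CompactSpace X] {G : Type*} [NormedAddCommGroup G]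
    {f : ι → X → G} (hf : ∀ i, Continuous (f i)) : ∃ C, 0 ≤ C ∧ ∀ i x, ‖f i x‖ ≤ C := by
  have h1 : ∀ i, ∃ C, ∀ x, ‖f i x‖ ≤ C := fun i => by
    obtain ⟨C, hC⟩ := isCompact_univ.exists_bound_of_continuousOn (hf i).continuousOn
    exact ⟨C, fun x => hC x (mem_univ x)⟩
  choose C hC using h1
  obtain ⟨C', h0, hC'⟩ := exists_forall_le_of_finite C
  exact ⟨C', h0, fun i x => (hC i x).trans (hC' i)⟩

section Cut

variable {q : N} {χ : N → ℝ} (hχ : C∞(n, ℝ) χ)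
  (hχq : tsupport χ ⊆ (chartAt ℝ₊^n q).source)

include hχ hχq in
lemma contMDiff_cut {g : N → G} (hg : ContMDiffOn (Q n) 𝓘(ℝ, G) ∞ g (chartAt ℝ₊^n q).source) : C∞(n, G) fun x => χ x • g x := by
  refine contMDiff_of_tsupport fun x hx => ?_
  have h1 : x ∈ tsupport χ := closure_mono (Function.support_smul_subset_left χ g) hx
  exact (hχ x).smul (hg.contMDiffAt ((chartAt _ q).open_source.mem_nhds (hχq h1)))

lemma vd_eq_zero_of_forall_notMem {g : N → G} {S : Set N} (hS : IsClosed S) (h0 : ∀ x ∉ S, g x = 0)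
    {V : ∀ x : N, TangentSpace (Q n) x} : ∀ x ∉ S, vd V g x = 0 := by
  intro x hx
  rw [vd_congr (g := fun _ => 0), vd_const]
  filter_upwards [hS.isOpen_compl.mem_nhds hx] with z hz using h0 z hz

lemma contMDiffOn_chart_apply (q : N) (a : Fin n) : ContMDiffOn (Q n) 𝓘(ℝ, ℝ) ∞ (fun x => κ n q x a) (chartAt ℝ₊^n q).source :=
  ((proj a : ℝ^n →L[ℝ] ℝ).contDiff (n := ∞)).contMDiff.comp_contMDiffOn (contMDiffOn_extChartAt_source q)

variable [CompactSpace N]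
  (htan : ∀ (f : N → ℝ) (x : N), ContMDiffAt (Q n) 𝓘(ℝ, ℝ) ∞ f x → (∀ᶠ z in 𝓝 x, 0 ≤ f z) → f x = 0 → ∀ j, vd (W.U j) f x = 0)

include hχ hχq htan in
/-- A Lie frame in logarithmic coordinates is bounded. -/
theorem LieFrame.exists_boundedFrame : ∃ B : BoundedFrame K ℝ^n, ∀ j s a, B.V j s a =
    exp (-s a) * logPull q (fun x => χ x * vd (W.U j) (fun x => κ n q x a) x) s := by
  have ho := (chartAt ℝ₊^n q).open_source
  have hcl : IsClosed (tsupport χ) := isClosed_tsupport χ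
  have hχ0 : ∀ x ∉ tsupport χ, χ x = 0 := fun x hx => image_eq_zero_of_notMem_tsupport hx
  let w : Fin K → Fin n → N → ℝ := fun j a => vd (W.U j) (fun x => κ n q x a)
  have hw : ∀ j a, ContMDiffOn (Q n) 𝓘(ℝ, ℝ) ∞ (w j a) (chartAt ℝ₊^n q).source := fun j a =>
    contMDiffOn_vd ho (W.smooth_vf j) (contMDiffOn_chart_apply q a)
  let u : Fin K → Fin n → N → ℝ := fun j a x => χ x * w j a x
  have hu : ∀ j a, C∞(n, ℝ) (u j a) := fun j a => contMDiff_cut hχ hχq (hw j a)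
  have hu0 : ∀ j a, ∀ x ∉ tsupport χ, u j a x = 0 := fun j a x hx => by simp only [u, hχ0 x hx, zero_mul]
  have hgext : ∀ j a, ContDiffOn ℝ ∞ (chartExt q (u j a)) (range (Q n)) := fun j a =>
    contDiffOn_chartExt (hu j a).contMDiffOn hcl hχq (hu0 j a)
  have hbd : ∀ p : Fin K × Fin n, ∃ C, 0 ≤ C ∧ ∀ z ∈ range (Q n), |chartExt q (u p.1 p.2) z| ≤ C * z p.2 ∧
      ∀ b, z b * |fderivWithin ℝ (chartExt q (u p.1 p.2)) (range (Q n)) z (single b 1)| ≤ C * z p.2 := by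
    intro p
    refine quadrant_bound (hgext p.1 p.2) (isCompact_image_chart hcl hχq) (fun z _ hz => chartExt_eq_zero (hu0 _ _) hz) p.2 ?_
    intro z hz hza
    rw [chartExt]
    split_ifs with h
    · have hs := (κ n q).map_target h
      rw [extChartAt_source] at hs
      have h1 := htan (fun x => κ n q x p.2) _ ((contMDiffOn_chart_apply q p.2).contMDiffAt (ho.mem_nhds hs)) (by
        filter_upwards [ho.mem_nhds hs] with x hx
        have h2 := extChartAt_target_subset_range (I := Q n) q ((κ n q).map_source (by rwa [extChartAt_source]))
        rw [range_Q] at h2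
        exact h2 p.2) (by rw [(κ n q).right_inv h, hza]) p.1
      simp only [u, w, h1, mul_zero]
    · rfl
  choose C hC0 hC using hbd
  obtain ⟨M, hM0, hM⟩ := exists_forall_le_of_finite C
  let V : Fin K → ℝ^n → ℝ^n := fun j s => WithLp.toLp 2 fun a => exp (-s a) * logPull q (u j a) s
  have hpull : ∀ j a, ContDiff ℝ ∞ (logPull (n := n) q (u j a)) := fun j a => contDiff_logPull (hu j a).contMDiffOn hcl hχq (hu0 j a)
  let pr : Fin n → ℝ^n →L[ℝ] ℝ := fun a => proj a
  have hVa : ∀ j a, ContDiff ℝ ∞ fun s => V j s a := fun j a => (Real.contDiff_exp.comp (pr a).contDiff.neg).mul (hpull j a)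
  have hV : ∀ j, ContDiff ℝ ∞ (V j) := fun j => contDiff_euclidean.2 (hVa j)
  have hVfd : ∀ j a s v, fderiv ℝ (V j) s v a = fderiv ℝ (fun s => V j s a) s v := by
    intro j a s v
    exact (congrArg (fun T : ℝ^n →L[ℝ] ℝ => T v) ((pr a).hasFDerivAt.comp s ((hV j).differentiable (by simp) s).hasFDerivAt).fderiv).symm
  have hVfd2 : ∀ j a s v, fderiv ℝ (V j) s v a = -v a * V j s a + exp (-s a) * fderiv ℝ (logPull q (u j a)) s v := by
    intro j a s v
    rw [hVfd]
    have h1 : HasFDerivAt (fun s : ℝ^n => exp (-s a)) (exp (-s a) • -pr a) s := ((pr a).hasFDerivAt (x := s)).neg.exp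
    have h2 := h1.mul ((hpull j a).differentiable (by simp) s).hasFDerivAt
    have h3 := congrArg (fun T : ℝ^n →L[ℝ] ℝ => T v) h2.fderiv
    refine h3.trans ?_
    simp only [_root_.add_apply, _root_.smul_apply, smul_eq_mul, _root_.neg_apply]
    have h4 : pr a v = v a := rfl
    have h5 : V j s a = exp (-s a) * logPull q (u j a) s := rfl
    rw [h4, h5]
    ring
  have hVle : ∀ j s a, |V j s a| ≤ M := by
    intro j s a
    change |exp (-s a) * chartExt q (u j a) (expV s)| ≤ M
    rw [abs_mul, abs_of_pos (Real.exp_pos _)]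
    have h1 := (hC (j, a) _ (expV_mem s)).1
    calc _ ≤ exp (-s a) * (C (j, a) * exp (s a)) := mul_le_mul_of_nonneg_left h1 (Real.exp_pos _).le
      _ = C (j, a) * (exp (-s a) * exp (s a)) := by ring
      _ = C (j, a) := by rw [← Real.exp_add, neg_add_cancel, Real.exp_zero, mul_one]
      _ ≤ M := hM _
  have hpd : ∀ j a s v, exp (-s a) * |fderiv ℝ (logPull q (u j a)) s v| ≤ n * M * ‖v‖ := by
    intro j a s v
    have h1 : HasFDerivAt (chartExt q (u j a)) (fderivWithin ℝ (chartExt q (u j a)) (range (Q n)) (expV s)) (expV s) := by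
      have hmem : range (Q n) ∈ 𝓝 (expV s) := mem_interior_iff_mem_nhds.1 (by rw [interior_range_Q]; exact expV_pos s)
      exact ((hgext j a).differentiableOn (by simp) _ (expV_mem s)).hasFDerivWithinAt.hasFDerivAt hmem
    have h2 := h1.comp s ((contDiff_expV (n := n)).differentiable (by simp) s).hasFDerivAt
    have h3 : fderiv ℝ (logPull q (u j a)) s v = fderivWithin ℝ (chartExt q (u j a)) (range (Q n)) (expV s) (fderiv ℝ expV s v) :=
      congrArg (fun T : ℝ^n →L[ℝ] ℝ => T v) h2.fderiv
    rw [h3, ← sum_smul_single (fderiv ℝ expV s v), map_sum]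
    have h4 : ∀ b, |fderivWithin ℝ (chartExt q (u j a)) (range (Q n)) (expV s)
        ((fderiv ℝ expV s v) b • single b 1)| ≤ ‖v‖ * (M * exp (s a)) := by
      intro b
      rw [map_smul, smul_eq_mul, hasFDerivAt_expV_apply, abs_mul, abs_mul, abs_of_pos (Real.exp_pos _), mul_comm (exp _), mul_assoc]
      refine mul_le_mul (PiLp.norm_apply_le v b) (((hC (j, a) _ (expV_mem s)).2 b).trans ?_) (by positivity) (norm_nonneg _)
      exact mul_le_mul_of_nonneg_right (hM _) (Real.exp_pos _).le
    calc _ ≤ exp (-s a) * ∑ _b : Fin n, ‖v‖ * (M * exp (s a)) :=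
          mul_le_mul_of_nonneg_left ((Finset.abs_sum_le_sum_abs _ _).trans (sum_le_sum fun b _ => h4 b)) (Real.exp_pos _).le
      _ = n * M * ‖v‖ * (exp (-s a) * exp (s a)) := by
          rw [sum_const, card_univ, Fintype.card_fin, nsmul_eq_mul]; ring
      _ = n * M * ‖v‖ := by rw [← Real.exp_add, neg_add_cancel, Real.exp_zero, mul_one]
  let cc : Fin K → Fin K → Fin K → N → ℝ := fun i j k x => χ x * W.C i j k x +
    vd (W.U i) χ x * (if k = j then 1 else 0) - vd (W.U j) χ x * (if k = i then 1 else 0)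
  have hcc : ∀ i j k, C∞(n, ℝ) (cc i j k) := fun i j k =>
    ((hχ.mul (W.smooth_C i j k)).add ((contMDiff_vd (W.smooth_vf i) hχ).mul contMDiff_const)).sub
      ((contMDiff_vd (W.smooth_vf j) hχ).mul contMDiff_const)
  have hcc0 : ∀ i j k, ∀ x ∉ tsupport χ, cc i j k x = 0 := by
    intro i j k x hx
    simp only [cc, hχ0 x hx, vd_eq_zero_of_forall_notMem hcl hχ0 x hx]
    ring
  obtain ⟨Mc, hMc0, hMc⟩ := exists_forall_norm_le (ι := Fin K × Fin K × Fin K) (f := fun p => cc p.1 p.2.1 p.2.2)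
    fun p => (hcc p.1 p.2.1 p.2.2).continuous
  have hle1 : n * M ≤ n * ((n + 1) * M) + Mc := by nlinarith [mul_nonneg (Nat.cast_nonneg (α := ℝ) n) (mul_nonneg (Nat.cast_nonneg (α := ℝ) n) hM0)]
  refine ⟨⟨V, hV, n * ((n + 1) * M) + Mc, by positivity, fun j s => ?_, fun j s => ?_, fun i j k => logPull q (cc i j k),
    fun i j k => (contDiff_logPull (hcc i j k).contMDiffOn hcl hχq (hcc0 i j k)).continuous, fun i j k s => ?_, fun i j s => ?_⟩, fun j s a => rfl⟩
  · refine ((norm_le_sum_abs _).trans (sum_le_sum fun a _ => hVle j s a)).trans ?_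
    rw [sum_const, card_univ, Fintype.card_fin, nsmul_eq_mul]
    exact hle1
  · refine opNorm_le_bound _ (by positivity) fun v => ?_
    have h1 : ∀ a, |fderiv ℝ (V j) s v a| ≤ (n + 1) * M * ‖v‖ := by
      intro a
      rw [hVfd2]
      refine (abs_add_le _ _).trans ?_
      have h3 : |exp (-s a) * fderiv ℝ (logPull q (u j a)) s v| ≤ n * M * ‖v‖ := by
        rw [abs_mul, abs_of_pos (Real.exp_pos _)]
        exact hpd j a s v
      have h4 : |(-v a) * V j s a| = |v a| * |V j s a| := by rw [abs_mul, abs_neg]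
      have h2 : |v a| * |V j s a| ≤ ‖v‖ * M := mul_le_mul (PiLp.norm_apply_le v a) (hVle j s a) (abs_nonneg _) (norm_nonneg _)
      linarith
    refine ((norm_le_sum_abs _).trans (sum_le_sum fun a _ => h1 a)).trans ?_
    rw [sum_const, card_univ, Fintype.card_fin, nsmul_eq_mul]
    nlinarith [mul_nonneg hMc0 (norm_nonneg v)]
  · refine (norm_logPull_le (fun x => hMc (i, j, k) x) s).trans (le_add_of_nonneg_left (by positivity))
  · ext a
    rw [PiLp.sub_apply, hVfd2, hVfd2, WithLp.ofLp_sum, Finset.sum_apply]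
    have h1 : ∀ i j, fderiv ℝ (logPull q (u j a)) s (V i s) = logPull q (fun x => χ x • vd (W.U i) (u j a) x) s := fun i j =>
      fderiv_logPull (hu j a).contMDiffOn fun b => rfl
    rw [h1, h1]
    have h2 : ∀ k, (logPull q (cc i j k) s • V k s) a = logPull q (cc i j k) s * (exp (-s a) * logPull q (u k a) s) := fun k => rfl
    simp only [h2]
    by_cases h : expV s ∈ (κ n q).target
    · simp only [logPull_of_mem _ h]
      set x := (κ n q).symm (expV s)
      have hxs : x ∈ (chartAt ℝ₊^n q).source := (mapsTo_innerTarget q (mem_innerTarget_expV h)).1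
      have h3 : ∀ i j, vd (W.U i) (u j a) x = vd (W.U i) χ x * w j a x + χ x * vd (W.U i) (w j a) x := fun i j =>
        vd_mul ((hχ x).mdifferentiableAt (by simp)) (((hw j a).contMDiffAt (ho.mem_nhds hxs)).mdifferentiableAt (by simp))
      have h4 : vd (W.U i) (w j a) x - vd (W.U j) (w i a) x = ∑ k, W.C i j k x * w k a x :=
        W.bracket _ ho _ (contMDiffOn_chart_apply q a) x hxs i j
      have h5 : ∑ k, cc i j k x * (exp (-s a) * u k a x) = exp (-s a) * χ x *
          (χ x * ∑ k, W.C i j k x * w k a x + vd (W.U i) χ x * w j a x - vd (W.U j) χ x * w i a x) := by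
        have h6 : ∀ k, cc i j k x * (exp (-s a) * u k a x) = exp (-s a) * χ x * (χ x * (W.C i j k x * w k a x)) +
            exp (-s a) * χ x * ((if k = j then vd (W.U i) χ x * w k a x else 0)) -
            exp (-s a) * χ x * ((if k = i then vd (W.U j) χ x * w k a x else 0)) := by
          intro k
          simp only [cc, u]
          split_ifs <;> ring
        simp only [h6, sum_sub_distrib, sum_add_distrib, ← mul_sum, Finset.sum_ite_eq', Finset.mem_univ, if_true]
        ring
      rw [h5, ← h4, h3, h3, smul_eq_mul, smul_eq_mul]
      ring
    · simp only [logPull_of_notMem _ h]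
      simp
      ring

end Cut

section

variable [CompactSpace N] [T2Space N] {q : N}

section LogCut

variable {S : Set N} (hS : IsClosed S) (hSq : S ⊆ (chartAt ℝ₊^n q).source)
  {B : Set ℝ^n} (hB : IsCompact B)

/-- The points of `S` with logarithmic coordinates in `B`. -/
def logSet (q : N) (S : Set N) (B : Set ℝ^n) : Set N :=
  (κ n q).symm '' (expV '' B ∩ κ n q '' S)

include hSq in
lemma mem_logSet {x : N} : x ∈ logSet q S B ↔ x ∈ S ∩ innerChart n q ∧ logChart q x ∈ B := by
  constructor
  · rintro ⟨_, ⟨⟨s, hs, rfl⟩, x, hx, hxs⟩, rfl⟩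
    have h1 : (κ n q).symm (expV s) = x := by
      rw [← hxs, (κ n q).left_inv (by rw [extChartAt_source]; exact hSq hx)]
    have h2 : expV s ∈ innerTarget n q :=
      mem_innerTarget_expV (by rw [← hxs]; exact (κ n q).map_source (by rw [extChartAt_source]; exact hSq hx))
    refine ⟨⟨by rwa [h1], mapsTo_innerTarget q h2⟩, ?_⟩
    rwa [logChart, (κ n q).right_inv h2.1, logV_expV]
  · rintro ⟨⟨hxS, hx⟩, hxB⟩
    refine ⟨κ n q x, ⟨⟨_, hxB, ?_⟩, x, hxS, rfl⟩, (κ n q).left_inv (by rw [extChartAt_source]; exact hx.1)⟩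
    exact expV_logV (mapsTo_innerChart q hx).2

include hS hSq hB in
lemma isCompact_logSet : IsCompact (logSet q S B) := by
  refine ((hB.image (contDiff_expV (n := n)).continuous).inter_right (isCompact_image_chart hS hSq).isClosed).image_of_continuousOn ?_
  refine (continuousOn_extChartAt_symm q).mono ?_
  rintro _ ⟨-, x, hx, rfl⟩
  exact (κ n q).map_source (by rw [extChartAt_source]; exact hSq hx)

lemma contMDiffOn_logChart (q : N) : ContMDiffOn (Q n) 𝓘(ℝ, ℝ^n) ∞ (logChart (n := n) q) (innerChart n q) :=
  (contDiffOn_logV (n := n)).contMDiffOn.comp ((contMDiffOn_extChartAt_source q).mono inter_subset_left)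
    fun x hx => (mapsTo_innerChart q hx).2

/-- A function of the logarithmic coordinates as a function on the interior of the manifold. -/
def logPush (q : N) (h : ℝ^n → ℝ) (x : N) : ℝ :=
  open Classical in if x ∈ innerChart n q then h (logChart q x) else 0

include hSq in
lemma mul_logPush_eq_zero {ϰ : N → ℝ} (hϰ0 : ∀ x ∉ S, ϰ x = 0) (h : ℝ^n → ℝ) : ∀ x ∉ logSet q S (tsupport h), ϰ x * logPush q h x = 0 := by
  intro x hx
  rw [logPush]
  split_ifs with h1
  · by_cases h2 : x ∈ S
    · rw [image_eq_zero_of_notMem_tsupport (f := h) fun h3 => hx ((mem_logSet hSq).2 ⟨⟨h2, h1⟩, h3⟩), mul_zero]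
    · rw [hϰ0 x h2, zero_mul]
  · rw [mul_zero]

include hS hSq in
lemma contMDiff_mul_logPush {ϰ : N → ℝ} (hϰ : C∞(n, ℝ) ϰ) (hϰ0 : ∀ x ∉ S, ϰ x = 0)
    {h : ℝ^n → ℝ} (hh : ContDiff ℝ 1 h) (hc : HasCompactSupport h) :
    ContMDiff (Q n) 𝓘(ℝ, ℝ) 1 fun x => ϰ x * logPush q h x := by
  intro x
  by_cases hx : x ∈ innerChart n q
  · have ho := (isOpen_innerChart q).mem_nhds hx
    have h1 : ContMDiffAt (Q n) 𝓘(ℝ, ℝ) 1 (fun x => h (logChart q x)) x :=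
      hh.contMDiff.contMDiffAt.comp x (((contMDiffOn_logChart q).contMDiffAt ho).of_le (by simp))
    refine ((hϰ.of_le (WithTop.coe_le_coe.2 le_top)).contMDiffAt.mul h1).congr_of_eventuallyEq ?_
    filter_upwards [ho] with z hz
    rw [logPush, if_pos hz]
    rfl
  · refine (contMDiffAt_const (c := (0 : ℝ))).congr_of_eventuallyEq ?_
    filter_upwards [(isCompact_logSet hS hSq hc.isCompact).isClosed.isOpen_compl.mem_nhds
      fun h1 => hx ((mem_logSet hSq).1 h1).1.2] with z hz
    exact mul_logPush_eq_zero hSq hϰ0 h z hz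

end LogCut

variable (hρ : ∀ x ∈ (Q n).interior N, Function.Bijective (ρ x))
  [MeasurableSpace N] [BorelSpace N] {μ : Measure N} (hμ : IsVolume ρ μ)
  {χ : N → ℝ} (hχ : C∞(n, ℝ) χ) (hχq : tsupport χ ⊆ (chartAt ℝ₊^n q).source)

/-- The volume measure in logarithmic coordinates. -/
def logMeasure (q : N) (χ : N → ℝ) (μ : Measure N) : Measure ℝ^n :=
  (μ.restrict (tsupport χ ∩ (Q n).interior N)).map (logChart q)

include hχq in
lemma aemeasurable_logChart : AEMeasurable (logChart (n := n) q) (μ.restrict (tsupport χ ∩ (Q n).interior N)) :=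
  ((contMDiffOn_logChart q).continuousOn.mono fun _ hx => ⟨hχq hx.1, hx.2⟩).aemeasurable
    ((isClosed_tsupport χ).measurableSet.inter (isOpen_interior_Q (n := n)).measurableSet)

include hχq in
lemma integral_logMeasure {f : ℝ^n → ℝ} (hf : Continuous f) {k : N → ℝ} (hk : ∀ x ∈ tsupport χ ∩ (Q n).interior N, f (logChart q x) = k x)
    (h0 : ∀ x ∉ tsupport χ ∩ (Q n).interior N, k x = 0) : ∫ s, f s ∂(logMeasure q χ μ) = ∫ x, k x ∂μ := by
  have hm := (isClosed_tsupport χ).measurableSet.inter (isOpen_interior_Q (n := n) (N := N)).measurableSet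
  rw [logMeasure, integral_map (aemeasurable_logChart hχq) hf.aestronglyMeasurable, setIntegral_congr_fun hm hk,
    setIntegral_eq_integral_of_forall_compl_eq_zero h0]

include W hρ hμ hχq in
lemma isFiniteMeasureOnCompacts_logMeasure : IsFiniteMeasureOnCompacts (logMeasure (n := n) q χ μ) := by
  refine ⟨fun B hB => ?_⟩
  have hcl := isClosed_tsupport χ
  rw [logMeasure, Measure.map_apply_of_aemeasurable (aemeasurable_logChart hχq) hB.measurableSet,
    Measure.restrict_apply₀' (hcl.measurableSet.inter (isOpen_interior_Q (n := n)).measurableSet).nullMeasurableSet]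
  refine (measure_mono fun x hx => ?_).trans_lt
    (W.measure_lt_top hρ hμ (isCompact_logSet hcl hχq hB) fun x hx => ((mem_logSet hχq).1 hx).1.2.2)
  exact (mem_logSet hχq).2 ⟨⟨hx.2.1, hχq hx.2.1, hx.2.2⟩, hx.1⟩

include hρ hμ hχ hχq in
lemma hasDivBound_logMeasure (B : BoundedFrame K ℝ^n) (hB : ∀ j s a, B.V j s a =
    exp (-s a) * logPull q (fun x => χ x * vd (W.U j) (fun x => κ n q x a) x) s) :
    ∃ D, 0 ≤ D ∧ B.HasDivBound (logMeasure q χ μ) D := by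
  have hcl := isClosed_tsupport χ
  have hχ0 : ∀ x ∉ tsupport χ, χ x = 0 := fun x hx => image_eq_zero_of_notMem_tsupport hx
  have hχ0' : ∀ j, ∀ x ∉ tsupport χ, vd (W.U j) χ x = 0 := fun j => vd_eq_zero_of_forall_notMem hcl hχ0
  have hvχ : ∀ j, C∞(n, ℝ) (vd (W.U j) χ) := fun j => contMDiff_vd (W.smooth_vf j) hχ
  let d : Fin K → N → ℝ := fun j x => χ x * W.div j x - vd (W.U j) χ x
  have hd : ∀ j, C∞(n, ℝ) (d j) := fun j => (hχ.mul (W.smooth_div j)).sub (hvχ j)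
  have hd0 : ∀ j, ∀ x ∉ tsupport χ, d j x = 0 := fun j x hx => by simp only [d, hχ0 x hx, hχ0' j x hx]; ring
  obtain ⟨D, hD0, hD⟩ := exists_forall_norm_le fun j => (hd j).continuous
  refine ⟨D, hD0, fun j => logPull q (d j), fun j s => norm_logPull_le (hD j) s,
    fun j => (contDiff_logPull (hd j).contMDiffOn hcl hχq (hd0 j)).continuous, fun h hh hc j => ?_⟩
  have hSc := isCompact_logSet hcl hχq hc.isCompact
  have hSi : logSet q (tsupport χ) (tsupport h) ⊆ (Q n).interior N := fun x hx => ((mem_logSet hχq).1 hx).1.2.2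
  have hP1 := contMDiff_mul_logPush hcl hχq hχ hχ0 hh hc
  have hP10 := mul_logPush_eq_zero hχq hχ0 h
  have hP2 := contMDiff_mul_logPush hcl hχq (hvχ j) (hχ0' j) hh hc
  have hP20 := mul_logPush_eq_zero hχq (hχ0' j) h
  have hnot : ∀ x ∉ tsupport χ ∩ (Q n).interior N, x ∉ logSet q (tsupport χ) (tsupport h) := fun x hx hx' =>
    hx ⟨((mem_logSet hχq).1 hx').1.1, hSi hx'⟩
  have hvd0 := vd_eq_zero_of_forall_notMem (V := W.U j) hSc.isClosed hP10
  have hin : ∀ x ∈ tsupport χ ∩ (Q n).interior N, x ∈ innerChart n q := fun x hx => ⟨hχq hx.1, hx.2⟩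
  have e1 : ∫ s, fderiv ℝ h s (B.V j s) ∂(logMeasure q χ μ) =
      ∫ x, (vd (W.U j) (fun x => χ x * logPush q h x) x - vd (W.U j) χ x * logPush q h x) ∂μ := by
    refine integral_logMeasure hχq ((hh.continuous_fderiv (by simp)).clm_apply (B.contDiff_V j).continuous) (fun x hx => ?_)
      fun x hx => by rw [hvd0 x (hnot x hx), hP20 x (hnot x hx), sub_zero]
    have hxi := hin x hx
    have ho := (isOpen_innerChart q).mem_nhds hxi
    have hlog : MD(n, ℝ^n) (logChart q) x := ((contMDiffOn_logChart q).contMDiffAt ho).mdifferentiableAt (by simp)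
    have h1 : vd (W.U j) (fun x => χ x * logPush q h x) x = vd (W.U j) (fun x => χ x * h (logChart q x)) x := by
      apply vd_congr
      filter_upwards [ho] with z hz
      rw [logPush, if_pos hz]
    have h2 : MD(n, ℝ) (fun x => h (logChart q x)) x :=
      MDifferentiableAt.comp (g := h) x (hh.differentiable (by simp) _).mdifferentiableAt hlog
    rw [h1, vd_mul ((hχ x).mdifferentiableAt (by simp)) h2, vd_comp (hh.differentiable (by simp) _) hlog, logPush, if_pos hxi,
      add_sub_cancel_left]
    have h3 : B.V j (logChart q x) = χ x • vd (W.U j) (logChart q) x := by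
      ext a
      rw [hB, logPull_logChart _ hxi]
      have hpos := (mapsTo_innerChart q hxi).2 a
      have h4 : vd (W.U j) (logChart q) x a = (κ n q x a)⁻¹ * vd (W.U j) (fun x => κ n q x a) x := by
        have h5 : vd (W.U j) (logChart q) x a = vd (W.U j) (fun x => Real.log (κ n q x a)) x := (vd_clm (proj a : ℝ^n →L[ℝ] ℝ) hlog).symm
        rw [h5, vd_comp (φ := Real.log) (f := fun x => κ n q x a) (Real.differentiableAt_log hpos.ne')
          (((contMDiffOn_chart_apply q a).contMDiffAt ((chartAt _ q).open_source.mem_nhds hxi.1)).mdifferentiableAt (by simp))]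
        have h6 := (Real.hasDerivAt_log hpos.ne').hasFDerivAt.fderiv
        rw [h6]
        simp [mul_comm]
      rw [PiLp.smul_apply, h4, smul_eq_mul]
      have h7 : exp (-(logChart q x) a) = (κ n q x a)⁻¹ := by
        rw [Real.exp_neg]
        exact congrArg _ (Real.exp_log hpos)
      rw [h7]
      ring
    rw [h3, map_smul, smul_eq_mul]
  have e2 : ∫ s, h s * logPull q (d j) s ∂(logMeasure q χ μ) =
      ∫ x, ((χ x * logPush q h x) * W.div j x - vd (W.U j) χ x * logPush q h x) ∂μ := by
    refine integral_logMeasure hχq (hh.continuous.mul (contDiff_logPull (hd j).contMDiffOn hcl hχq (hd0 j)).continuous)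
      (fun x hx => ?_) fun x hx => by rw [hP10 x (hnot x hx), hP20 x (hnot x hx)]; ring
    have hxi := hin x hx
    rw [Pi.mul_apply, logPull_logChart _ hxi, logPush, if_pos hxi]
    simp only [d]
    ring
  have hint : ∀ {g : N → ℝ}, Continuous g → (∀ x ∉ logSet q (tsupport χ) (tsupport h), g x = 0) → Integrable g μ := fun hg hg0 =>
    W.integrable_of_compact hρ hμ hg hSc hSc.isClosed hSi hg0
  have i1 : Integrable (vd (W.U j) fun x => χ x * logPush q h x) μ := hint (continuous_vd (W.smooth_vf j) hP1) hvd0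
  have i2 : Integrable (fun x => χ x * logPush q h x * W.div j x) μ :=
    hint (hP1.continuous.mul (W.smooth_div j).continuous) fun x hx => by rw [hP10 x hx, zero_mul]
  rw [e1, e2, integral_sub i1 (hint hP2.continuous hP20), integral_sub i2 (hint hP2.continuous hP20), W.integral_vd hρ hμ hP1 hSc.isClosed hSi hP10 j]

variable {H H' : Type} [NormedAddCommGroup H] [InnerProductSpace ℂ H] [CompleteSpace H] [NormedAddCommGroup H']
  [InnerProductSpace ℂ H'] [CompleteSpace H']
  (htan : ∀ (f : N → ℝ) (x : N), ContMDiffAt (Q n) 𝓘(ℝ, ℝ) ∞ f x → (∀ᶠ z in 𝓝 x, 0 ≤ f z) → f x = 0 → ∀ j, vd (W.U j) f x = 0)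
  {a : Fin K → N → H →L[ℂ] H'} (ha : ∀ j, C∞(n, H →L[ℂ] H') (a j)) {c₀ : ℝ} (hc₀ : 0 < c₀)
  (hell : ∀ x (η : ℝ^K) (w : H),
    c₀ * (∑ k, (∑ j, ⟪W.Z k x; W.Z j x⟫ * η j) ^ 2) * ‖w‖ ^ 2 ≤ ‖∑ j, (η j : ℂ) • a j x w‖ ^ 2)

include hρ hμ hχ hχq htan ha hc₀ hell in
/-- The elliptic estimate for functions supported in a chart. -/
theorem LieFrame.local_estimate {S₀ : Set N} (hS₀ : ∀ x ∈ S₀, χ x = 1) : ∃ C, ∀ (g : N → H) (S : Set N), C∞(n, H) g →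
    IsClosed S → S ⊆ S₀ → S ⊆ (Q n).interior N → (∀ x ∉ S, g x = 0) →
    ∫ x, ∑ k, ‖vd (W.U k) g x‖ ^ 2 ∂μ ≤ C * (∫ x, ‖∑ j, a j x (vd (W.U j) g x)‖ ^ 2 ∂μ + ∫ x, ‖g x‖ ^ 2 ∂μ) := by
  obtain ⟨B, hB⟩ := W.exists_boundedFrame hχ hχq htan
  obtain ⟨D, hD0, hD⟩ := hasDivBound_logMeasure W hρ hμ hχ hχq B hB
  have := isFiniteMeasureOnCompacts_logMeasure W hρ hμ hχq
  have hcl := isClosed_tsupport χ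
  have hχ0 : ∀ x ∉ tsupport χ, χ x = 0 := fun x hx => image_eq_zero_of_notMem_tsupport hx
  have hcut0 : ∀ {G : Type} [NormedAddCommGroup G] [NormedSpace ℝ G] (g : N → G), ∀ x ∉ tsupport χ, χ x • g x = 0 :=
    fun g x hx => by rw [hχ0 x hx, zero_smul]
  have hfd : ∀ {G : Type} [NormedAddCommGroup G] [NormedSpace ℝ G] {g : N → G}, C∞(n, G) g → ∀ i s,
      fderiv ℝ (logPull q g) s (B.V i s) = logPull q (fun x => χ x • vd (W.U i) g x) s := fun hg i s =>
    fderiv_logPull hg.contMDiffOn fun a => hB i s a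
  let a' : Fin K → N → H →L[ℂ] H' := fun j x => χ x • a j x
  let P : Fin K → Fin K → N → ℝ := fun k j x => χ x • ⟪W.Z k x; W.Z j x⟫
  have ha' : ∀ j, C∞(n, H →L[ℂ] H') (a' j) := fun j => hχ.smul (ha j)
  have hP : ∀ k j, C∞(n, ℝ) (P k j) := fun k j => hχ.smul (W.smooth_gram k j)
  obtain ⟨B₁, hB₁0, hB₁⟩ := exists_forall_norm_le fun j => (ha' j).continuous
  obtain ⟨B₂, hB₂0, hB₂⟩ := exists_forall_norm_le (ι := Fin K × Fin K) (f := fun p => P p.1 p.2) fun p => (hP p.1 p.2).continuous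
  obtain ⟨B₃, hB₃0, hB₃⟩ := exists_forall_norm_le (ι := Fin K × Fin K) (f := fun p x => χ x • vd (W.U p.2) (a' p.1) x)
    fun p => (hχ.smul (contMDiff_vd (W.smooth_vf p.2) (ha' p.1))).continuous
  obtain ⟨B₄, hB₄0, hB₄⟩ := exists_forall_norm_le (ι := Fin K × Fin K × Fin K) (f := fun p x => χ x • vd (W.U p.2.2) (P p.1 p.2.1) x)
    fun p => (hχ.smul (contMDiff_vd (W.smooth_vf p.2.2) (hP p.1 p.2.1))).continuous
  let E : B.EllipticCoeff H H' :=
    { a := fun j => logPull q (a' j)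
      P := fun k j => logPull q (P k j)
      B := B₁ + B₂ + B₃ + B₄
      contDiff_a := fun j => contDiff_logPull (ha' j).contMDiffOn hcl hχq (hcut0 (a j))
      contDiff_P := fun k j => contDiff_logPull (hP k j).contMDiffOn hcl hχq (hcut0 _)
      norm_a_le := fun j s => (norm_logPull_le (hB₁ j) s).trans (by linarith)
      abs_P_le := fun k j s => (norm_logPull_le (fun x => hB₂ (k, j) x) s).trans (by linarith)
      norm_fderiv_a_le := fun j i s => by
        rw [hfd (ha' j)]
        exact (norm_logPull_le (fun x => hB₃ (j, i) x) s).trans (by linarith)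
      norm_fderiv_P_le := fun k j i s => by
        rw [hfd (hP k j)]
        exact (norm_logPull_le (fun x => hB₄ (k, j, i) x) s).trans (by linarith)
      c := c₀
      c_pos := hc₀
      elliptic := fun s η w => by
        by_cases h : expV s ∈ (κ n q).target
        · simp only [logPull_of_mem _ h]
          set x := (κ n q).symm (expV s)
          have h1 := mul_le_mul_of_nonneg_left (hell x η w) (sq_nonneg (χ x))
          have h2 : ∑ j, (η j : ℂ) • a' j x w = (χ x : ℂ) • ∑ j, (η j : ℂ) • a j x w := by
            rw [smul_sum]
            refine sum_congr rfl fun j _ => ?_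
            rw [smul_comm]
            rfl
          have h3 : ∀ k, (∑ j, P k j x * η j) ^ 2 = χ x ^ 2 * (∑ j, ⟪W.Z k x; W.Z j x⟫ * η j) ^ 2 := by
            intro k
            rw [← mul_pow, mul_sum]
            simp only [P, smul_eq_mul, mul_assoc]
          rw [h2, norm_smul, mul_pow, Complex.norm_real, Real.norm_eq_abs, sq_abs]
          simp only [h3, ← mul_sum]
          linarith
        · simp [logPull_of_notMem _ h] }
  obtain ⟨C, hC⟩ := E.integral_gradSq_le hD0 hD
  refine ⟨C, fun g S hg hSc hS hSi hg0 => ?_⟩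
  have hvg0 : ∀ k, ∀ x ∉ S, vd (W.U k) g x = 0 := fun k => vd_eq_zero_of_forall_notMem hSc hg0
  have hSχ : S ⊆ tsupport χ := fun x hx => subset_tsupport χ (by rw [Function.mem_support, hS₀ x (hS hx)]; exact one_ne_zero)
  have hSq := hSχ.trans hχq
  have hχ1 : ∀ {G : Type} [NormedAddCommGroup G] [NormedSpace ℝ G] {g : N → G}, (∀ x ∉ S, g x = 0) → ∀ x, χ x • g x = g x := by
    intro G _ _ g hg x
    by_cases hx : x ∈ S
    · rw [hS₀ x (hS hx), one_smul]
    · rw [hg x hx, smul_zero]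
  have hD' : ∀ k s, B.D (logPull q g) k s = logPull q (vd (W.U k) g) s := by
    intro k s
    rw [BoundedFrame.D, hfd hg]
    simp only [hχ1 (hvg0 k)]
  have hF : ContDiff ℝ ∞ (logPull (n := n) q g) := contDiff_logPull hg.contMDiffOn hSc hSq hg0
  have hFc : HasCompactSupport (logPull (n := n) q g) := by
    have h1 : IsCompact (logV '' (κ n q '' S)) := by
      refine (isCompact_image_chart hSc hSq).image_of_continuousOn ((contDiffOn_logV (n := n)).continuousOn.mono ?_)
      rintro _ ⟨x, hx, rfl⟩
      exact (mapsTo_innerChart q ⟨hSq hx, hSi hx⟩).2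
    refine HasCompactSupport.intro h1 fun s hs => ?_
    refine chartExt_eq_zero hg0 fun h2 => hs ⟨_, h2, logV_expV s⟩
  have hop : ∀ s, E.op (logPull q g) s = logPull q (fun x => ∑ j, a j x (vd (W.U j) g x)) s := by
    intro s
    rw [BoundedFrame.EllipticCoeff.op]
    simp only [hD']
    by_cases h : expV s ∈ (κ n q).target
    · simp only [logPull_of_mem _ h, E]
      refine sum_congr rfl fun j _ => ?_
      have h2 : ∀ x, χ x • a j x (vd (W.U j) g x) = a j x (vd (W.U j) g x) :=
        hχ1 (g := fun x => a j x (vd (W.U j) g x)) fun x hx => by rw [hvg0 j x hx, map_zero]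
      exact h2 _
    · simp [logPull_of_notMem _ h]
  have key := hC (logPull q g) hF hFc (fun k s => by
    simp only [hD']
    by_cases h : expV s ∈ (κ n q).target
    · simp only [logPull_of_mem _ h, E]
      set x := (κ n q).symm (expV s)
      have h1 := W.vd_anchor (W.Z k) g x
      have h2 : vd (W.U k) g x = ∑ j, ⟪W.Z k x; W.Z j x⟫ • vd (W.U j) g x := h1.trans (sum_congr rfl fun j _ => by rw [real_inner_comm])
      simp only [P, smul_eq_mul, mul_smul]
      rw [← smul_sum]
      rw [← h2, hχ1 (hvg0 k)]
    · simp [logPull_of_notMem _ h])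
  have hvgs : ∀ k, C∞(n, H) (vd (W.U k) g) := fun k => contMDiff_vd (W.smooth_vf k) hg
  have hout : ∀ x ∉ tsupport χ ∩ (Q n).interior N, x ∉ S := fun x hx hxS => hx ⟨hSχ hxS, hSi hxS⟩
  have hin : ∀ x ∈ tsupport χ ∩ (Q n).interior N, x ∈ innerChart n q := fun x hx => ⟨hχq hx.1, hx.2⟩
  have e1 : ∫ s, B.gradSq (logPull q g) s ∂(logMeasure q χ μ) = ∫ x, ∑ k, ‖vd (W.U k) g x‖ ^ 2 ∂μ := by
    simp only [BoundedFrame.gradSq, hD']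
    refine integral_logMeasure hχq (continuous_finsetSum _ fun k _ => ?_) (fun x hx => ?_) fun x hx => ?_
    · exact ((contDiff_logPull (hvgs k).contMDiffOn hSc hSq (hvg0 k)).continuous.norm).pow 2
    · simp only [logPull_logChart _ (hin x hx)]
    · simp [hvg0 _ x (hout x hx)]
  have hsum : C∞(n, H') fun x => ∑ j, a j x (vd (W.U j) g x) :=
    contMDiff_finsetSum fun j _ => ((restrictScalarsL ℂ H H' ℝ ℝ).contMDiff.comp (ha j)).clm_apply (hvgs j)
  have hsum0 : ∀ x ∉ S, ∑ j, a j x (vd (W.U j) g x) = 0 := fun x hx => by simp [hvg0 _ x hx]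
  have e2 : ∫ s, ‖E.op (logPull q g) s‖ ^ 2 ∂(logMeasure q χ μ) = ∫ x, ‖∑ j, a j x (vd (W.U j) g x)‖ ^ 2 ∂μ := by
    simp only [hop]
    refine integral_logMeasure (f := fun s => ‖logPull q (fun x => ∑ j, a j x (vd (W.U j) g x)) s‖ ^ 2) hχq
      ((contDiff_logPull hsum.contMDiffOn hSc hSq hsum0).continuous.norm.pow 2)
      (fun x hx => by rw [logPull_logChart _ (hin x hx)]) fun x hx => by rw [hsum0 x (hout x hx)]; simp
  have e3 : ∫ s, ‖logPull q g s‖ ^ 2 ∂(logMeasure q χ μ) = ∫ x, ‖g x‖ ^ 2 ∂μ :=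
    integral_logMeasure (f := fun s => ‖logPull q g s‖ ^ 2) hχq (hF.continuous.norm.pow 2)
      (fun x hx => by rw [logPull_logChart _ (hin x hx)]) fun x hx => by rw [hg0 x (hout x hx)]; simp
  rwa [e1, e2, e3] at key

lemma exists_smooth_cutoff {S O : Set N} (hS : IsClosed S) (hO : IsOpen O) (hSO : S ⊆ O) :
    ∃ χ : N → ℝ, C∞(n, ℝ) χ ∧ tsupport χ ⊆ O ∧ ∀ x ∈ S, χ x = 1 := by
  obtain ⟨u, hu, hSu, huO⟩ := normal_exists_closure_subset hS hO hSO
  obtain ⟨f, hf0, hf1, -⟩ := exists_contMDiffMap_zero_one_of_isClosed (n := ⊤) (Q n) hu.isClosed_compl hS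
    (disjoint_compl_left_iff_subset.2 hSu)
  refine ⟨f, f.contMDiff, (closure_mono fun x hx => ?_).trans huO, fun x hx => hf1 hx⟩
  by_contra h
  exact hx (hf0 h)

include hρ hμ htan ha hc₀ hell in
/-- The elliptic estimate for systems. -/
theorem LieFrame.elliptic_estimate : ∃ C, 0 ≤ C ∧ ∀ (F : N → H) (S : Set N), C∞(n, H) F →
    IsClosed S → S ⊆ (Q n).interior N → (∀ x ∉ S, F x = 0) →
    ∫ x, ∑ k, ‖vd (W.U k) F x‖ ^ 2 ∂μ ≤ C * (∫ x, ‖∑ j, a j x (vd (W.U j) F x)‖ ^ 2 ∂μ + ∫ x, ‖F x‖ ^ 2 ∂μ) := by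
  obtain ⟨t, ψ, -, hψ, hψq, hψ1⟩ := exists_finite_partition (n := n) (S := (univ : Set N)) isClosed_univ
    (V := fun x => (chartAt ℝ₊^n x).source) fun x _ => (chartAt _ x).open_source.mem_nhds (mem_chart_source _ x)
  have hloc : ∀ i : t, ∃ C, 0 ≤ C ∧ ∀ (g : N → H) (S : Set N), C∞(n, H) g →
      IsClosed S → S ⊆ tsupport (ψ i) → S ⊆ (Q n).interior N → (∀ x ∉ S, g x = 0) →
      ∫ x, ∑ k, ‖vd (W.U k) g x‖ ^ 2 ∂μ ≤ C * (∫ x, ‖∑ j, a j x (vd (W.U j) g x)‖ ^ 2 ∂μ + ∫ x, ‖g x‖ ^ 2 ∂μ) := by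
    intro i
    obtain ⟨χ, hχ, hχq, hχ1⟩ := exists_smooth_cutoff (n := n) (isClosed_tsupport (ψ i)) (chartAt _ (i : N)).open_source (hψq i)
    obtain ⟨C, hC⟩ := W.local_estimate hρ hμ hχ hχq htan ha hc₀ hell hχ1
    refine ⟨max C 0, le_max_right _ _, fun g S hg hS h1 h2 h3 => (hC g S hg hS h1 h2 h3).trans
      (mul_le_mul_of_nonneg_right (le_max_left _ _) ?_)⟩
    exact add_nonneg (integral_nonneg fun _ => by positivity) (integral_nonneg fun _ => by positivity)
  choose C hC0 hC using hloc
  have ha' : ∀ j, C∞(n, H →L[ℝ] H') fun x => (a j x).restrictScalars ℝ := fun j =>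
    (restrictScalarsL ℂ H H' ℝ ℝ).contMDiff.comp (ha j)
  obtain ⟨M₁, hM₁0, hM₁⟩ := exists_forall_norm_le fun i => (hψ i).continuous
  obtain ⟨M₂, hM₂0, hM₂⟩ := exists_forall_norm_le (f := fun (i : t) x => ∑ j, vd (W.U j) (ψ i) x • a j x) fun i =>
    continuous_finsetSum _ fun j _ => (contMDiff_vd (W.smooth_vf j) (hψ i)).continuous.smul (ha j).continuous
  refine ⟨t.card * ∑ i, C i * (2 * M₁ ^ 2 + 2 * M₂ ^ 2 + M₁ ^ 2), mul_nonneg (Nat.cast_nonneg _) (sum_nonneg fun i _ =>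
    mul_nonneg (hC0 i) (by positivity)), fun F S hF hS hSi hF0 => ?_⟩
  have hint : ∀ {g : N → ℝ}, Continuous g → (∀ x ∉ S, g x = 0) → Integrable g μ := fun hg h0 =>
    W.integrable_of_compact hρ hμ hg hS.isCompact hS hSi h0
  have hFi : ∀ i, C∞(n, H) fun x => ψ i x • F x := fun i => (hψ i).smul hF
  have hFi0 : ∀ i, ∀ x ∉ S, ψ i x • F x = 0 := fun i x hx => by rw [hF0 x hx, smul_zero]
  have hv0 : ∀ {g : N → H}, (∀ x ∉ S, g x = 0) → ∀ k, ∀ x ∉ S, vd (W.U k) g x = 0 := fun h0 k => vd_eq_zero_of_forall_notMem hS h0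
  have hgc : ∀ {g : N → H}, C∞(n, H) g → Continuous fun x => ∑ k, ‖vd (W.U k) g x‖ ^ 2 := fun hg =>
    continuous_finsetSum _ fun k _ => (contMDiff_vd (W.smooth_vf k) hg).continuous.norm.pow 2
  have hoc : ∀ {g : N → H}, C∞(n, H) g → Continuous fun x => ‖∑ j, a j x (vd (W.U j) g x)‖ ^ 2 := fun hg =>
    (continuous_finsetSum _ fun j _ => ((ha' j).continuous.clm_apply (contMDiff_vd (W.smooth_vf j) hg).continuous)).norm.pow 2
  have hop0 : ∀ {g : N → H}, (∀ x ∉ S, g x = 0) → ∀ x ∉ S, ‖∑ j, a j x (vd (W.U j) g x)‖ ^ 2 = 0 := fun h0 x hx => by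
    simp [hv0 h0 _ x hx]
  have iF : Integrable (fun x => ‖F x‖ ^ 2) μ := hint (hF.continuous.norm.pow 2) fun x hx => by simp [hF0 x hx]
  have iO : Integrable (fun x => ‖∑ j, a j x (vd (W.U j) F x)‖ ^ 2) μ := hint (hoc hF) (hop0 hF0)
  set IF := ∫ x, ‖F x‖ ^ 2 ∂μ
  set JO := ∫ x, ‖∑ j, a j x (vd (W.U j) F x)‖ ^ 2 ∂μ
  have h1 : ∀ i, ∫ x, ∑ k, ‖vd (W.U k) (fun x => ψ i x • F x) x‖ ^ 2 ∂μ ≤ C i * (2 * M₁ ^ 2 + 2 * M₂ ^ 2 + M₁ ^ 2) * (JO + IF) := by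
    intro i
    have h2 := hC i (fun x => ψ i x • F x) (S ∩ tsupport (ψ i)) (hFi i) (hS.inter (isClosed_tsupport _)) inter_subset_right
      (inter_subset_left.trans hSi) (fun x hx => by
        by_cases hxS : x ∈ S
        · rw [image_eq_zero_of_notMem_tsupport fun h => hx ⟨hxS, h⟩, zero_smul]
        · exact hFi0 i x hxS)
    have h3 : ∫ x, ‖ψ i x • F x‖ ^ 2 ∂μ ≤ M₁ ^ 2 * IF := by
      rw [← integral_const_mul]
      refine integral_mono (hint ((hFi i).continuous.norm.pow 2) fun x hx => by simp [hF0 x hx]) (iF.const_mul _) fun x => ?_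
      change ‖ψ i x • F x‖ ^ 2 ≤ M₁ ^ 2 * ‖F x‖ ^ 2
      rw [norm_smul, mul_pow]
      gcongr
      exact hM₁ i x
    have h4 : ∫ x, ‖∑ j, a j x (vd (W.U j) (fun x => ψ i x • F x) x)‖ ^ 2 ∂μ ≤ 2 * M₁ ^ 2 * JO + 2 * M₂ ^ 2 * IF := by
      rw [← integral_const_mul, ← integral_const_mul, ← integral_add (iO.const_mul _) (iF.const_mul _)]
      refine integral_mono (hint (hoc (hFi i)) (hop0 (hFi0 i))) ((iO.const_mul _).add (iF.const_mul _)) fun x => ?_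
      change ‖∑ j, a j x (vd (W.U j) (fun x => ψ i x • F x) x)‖ ^ 2 ≤ 2 * M₁ ^ 2 * ‖∑ j, a j x (vd (W.U j) F x)‖ ^ 2 + 2 * M₂ ^ 2 * ‖F x‖ ^ 2
      have h5 : ∑ j, a j x (vd (W.U j) (fun x => ψ i x • F x) x) =
          ψ i x • ∑ j, a j x (vd (W.U j) F x) + (∑ j, vd (W.U j) (ψ i) x • a j x) (F x) := by
        rw [_root_.sum_apply, smul_sum, ← sum_add_distrib]
        refine sum_congr rfl fun j _ => ?_
        rw [vd_smul ((hψ i x).mdifferentiableAt (by simp)) ((hF x).mdifferentiableAt (by simp)), map_add, add_comm]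
        exact congrArg₂ _ (((a j x).restrictScalars ℝ).map_smul _ _) (((a j x).restrictScalars ℝ).map_smul _ _)
      rw [h5]
      have h6 : ‖ψ i x • ∑ j, a j x (vd (W.U j) F x)‖ ≤ M₁ * ‖∑ j, a j x (vd (W.U j) F x)‖ := by
        rw [norm_smul]
        exact mul_le_mul_of_nonneg_right (hM₁ i x) (norm_nonneg _)
      have h7 : ‖(∑ j, vd (W.U j) (ψ i) x • a j x) (F x)‖ ≤ M₂ * ‖F x‖ := ContinuousLinearMap.le_of_opNorm_le _ (hM₂ i x) _
      have h8 := (norm_add_le (ψ i x • ∑ j, a j x (vd (W.U j) F x)) ((∑ j, vd (W.U j) (ψ i) x • a j x) (F x))).trans (add_le_add h6 h7)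
      refine (pow_le_pow_left₀ (norm_nonneg _) h8 2).trans ?_
      nlinarith [sq_nonneg (M₁ * ‖∑ j, a j x (vd (W.U j) F x)‖ - M₂ * ‖F x‖)]
    have hJO : 0 ≤ JO := integral_nonneg fun _ => by positivity
    have hIF : 0 ≤ IF := integral_nonneg fun _ => by positivity
    rw [mul_assoc]
    refine h2.trans (mul_le_mul_of_nonneg_left ?_ (hC0 i))
    nlinarith [mul_nonneg (sq_nonneg M₁) hJO, mul_nonneg (sq_nonneg M₁) hIF, mul_nonneg (sq_nonneg M₂) hJO]
  have hpt : ∀ x, ∑ k, ‖vd (W.U k) F x‖ ^ 2 ≤ t.card * ∑ i, ∑ k, ‖vd (W.U k) (fun x => ψ i x • F x) x‖ ^ 2 := by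
    intro x
    rw [sum_comm, mul_sum]
    refine sum_le_sum fun k _ => ?_
    have h2 : F = fun x => ∑ i, ψ i x • F x := by
      funext x
      rw [← sum_smul, hψ1 x (mem_univ x), one_smul]
    have h3 : vd (W.U k) F x = ∑ i, vd (W.U k) (fun x => ψ i x • F x) x := by
      conv_lhs => rw [h2]
      exact vd_sum' _ fun i _ => (hFi i x).mdifferentiableAt (by simp)
    rw [h3]
    refine (pow_le_pow_left₀ (norm_nonneg _) (norm_sum_le _ _) 2).trans ?_
    have h4 := sq_sum_le_card_mul_sum_sq (s := Finset.univ) (f := fun i : t => ‖vd (W.U k) (fun x => ψ i x • F x) x‖)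
    rwa [card_univ, Fintype.card_coe] at h4
  have iG : ∀ i, Integrable (fun x => ∑ k, ‖vd (W.U k) (fun x => ψ i x • F x) x‖ ^ 2) μ := fun i =>
    hint (hgc (hFi i)) fun x hx => by simp [hv0 (hFi0 i) _ x hx]
  have iS : Integrable (fun x => ∑ i, ∑ k, ‖vd (W.U k) (fun x => ψ i x • F x) x‖ ^ 2) μ := integrable_finsetSum _ fun i _ => iG i
  have iL : Integrable (fun x => ∑ k, ‖vd (W.U k) F x‖ ^ 2) μ := hint (hgc hF) fun x hx => by simp [hv0 hF0 _ x hx]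
  calc ∫ x, ∑ k, ‖vd (W.U k) F x‖ ^ 2 ∂μ ≤ ∫ x, t.card * ∑ i, ∑ k, ‖vd (W.U k) (fun x => ψ i x • F x) x‖ ^ 2 ∂μ :=
        integral_mono iL (iS.const_mul _) hpt
    _ = t.card * ∑ i, ∫ x, ∑ k, ‖vd (W.U k) (fun x => ψ i x • F x) x‖ ^ 2 ∂μ := by
        rw [integral_const_mul, integral_finsetSum _ fun i _ => iG i]
    _ ≤ t.card * ∑ i, C i * (2 * M₁ ^ 2 + 2 * M₂ ^ 2 + M₁ ^ 2) * (JO + IF) :=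
        mul_le_mul_of_nonneg_left (sum_le_sum fun i _ => h1 i) (Nat.cast_nonneg _)
    _ = _ := by rw [← sum_mul, mul_assoc]

end

/-- The operator of a complex matrix, as a function of the matrix. -/
def matrixOp (ι ϰ : Type) [Fintype ι] [Fintype ϰ] [DecidableEq ϰ] :
    (ι → ϰ → ℂ) →L[ℝ] (EuclideanSpace ℂ ϰ →L[ℂ] EuclideanSpace ℂ ι) :=
  LinearMap.toContinuousLinearMap
    { toFun := fun a => LinearMap.toContinuousLinearMap (Matrix.toEuclideanLin (of a))
      map_add' := fun a b => by ext; simp [add_mul, sum_add_distrib, Matrix.mulVec, dotProduct]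
      map_smul' := fun a b => by ext; simp [mul_sum, Matrix.mulVec, dotProduct, mul_assoc] }

lemma matrixOp_apply {ι ϰ : Type} [Fintype ι] [Fintype ϰ] [DecidableEq ϰ] (a : ι → ϰ → ℂ) (w : EuclideanSpace ℂ ϰ) (p : ι) :
    matrixOp ι ϰ a w p = ∑ i, a p i * w i := by
  simp [matrixOp, Matrix.mulVec, dotProduct]

lemma norm_sq_eq_sum_inner {G : Type*} [NormedAddCommGroup G] [InnerProductSpace ℂ G] {ι : Type*} [Fintype ι] {g : ι → G}
    (hg : ∀ v, ∑ i, ⟪g i, v⟫ • g i = v) (v : G) : ‖v‖ ^ 2 = ∑ i, ‖⟪g i, v⟫‖ ^ 2 := by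
  have h1 : ⟪v, v⟫ = ∑ i, ((‖⟪g i, v⟫‖ ^ 2 : ℝ) : ℂ) := by
    conv_lhs => rw [← hg v]
    rw [sum_inner]
    refine sum_congr rfl fun i _ => ?_
    rw [hg, inner_smul_left, Complex.conj_mul']
    push_cast
    rfl
  rw [inner_self_eq_norm_sq_to_K, ← Complex.ofReal_sum] at h1
  exact Complex.ofReal_injective (by simpa using h1)

/-- `ℝ`-linear expansion of an inner product in a Parseval frame. -/
lemma inner_eq_sum_inner {G : Type*} [NormedAddCommGroup G] [InnerProductSpace ℂ G] {ι : Type*} [Fintype ι] {g : ι → G}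
    (hg : ∀ v, ∑ i, ⟪g i, v⟫ • g i = v) (u v : G) :
    ⟪u, v⟫ = ∑ i, ⟪u, g i⟫ * ⟪g i, v⟫ := by
  conv_lhs => rw [← hg v]
  simp_rw [inner_sum, inner_smul_right, mul_comm]

section

variable {G : N → Type*} [∀ y, NormedAddCommGroup (G y)] [∀ y, InnerProductSpace ℂ (G y)]
  {r L : ℕ} (X : Fin L → ∀ y, 𝔸 y) (e b : Fin L → ∀ y, G y) (g : Fin r → ∀ y, G y)

/-- The symbol at the covector `⟨v, ·⟩` in a frame of `G`, augmented to be injective on the trivial bundle. -/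
def frameSymbol (x : N) (v : 𝔸 x) : Option (Fin K) × Fin r → Fin r → ℂ
  | (none, a), i => ∑ k, (⟪v; X k x⟫ : ℂ) * (⟪e k x, g i x⟫ * ⟪g a x, b k x⟫)
  | (some k, a), i => (⟪W.Z k x; v⟫ : ℂ) * ((if a = i then 1 else 0) - ⟪g a x, g i x⟫)

variable {X e b g} (hg : ∀ y v, ∑ i, ⟪g i y, v⟫ • g i y = v)

lemma LieFrame.sum_inner_sq {x : N} (v : 𝔸 x) : ∑ k, ⟪W.Z k x; v⟫ ^ 2 = ‖v‖ ^ 2 := by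
  conv_rhs => rw [← real_inner_self_eq_norm_sq, ← W.parseval x v, sum_inner]
  refine sum_congr rfl fun k _ => ?_
  rw [W.parseval, real_inner_smul_left, sq]

include hg in
lemma norm_sq_frameSymbol (x : N) (v : 𝔸 x) (w : EuclideanSpace ℂ (Fin r)) : ‖matrixOp _ _ (frameSymbol W X e b g x v) w‖ ^ 2 =
      ‖∑ k, ((⟪v; X k x⟫ : ℂ) * ⟪e k x, ∑ i, w i • g i x⟫) • b k x‖ ^ 2 +
      ‖v‖ ^ 2 * ∑ a, ‖w a - ⟪g a x, ∑ i, w i • g i x⟫‖ ^ 2 := by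
  rw [EuclideanSpace.norm_sq_eq, Fintype.sum_prod_type, Fintype.sum_option, norm_sq_eq_sum_inner (hg x), ← W.sum_inner_sq, sum_mul]
  congr 1
  · refine sum_congr rfl fun a _ => ?_
    rw [matrixOp_apply]
    simp only [frameSymbol, inner_sum, inner_smul_right, mul_sum, sum_mul]
    rw [sum_comm]
    refine congrArg (‖·‖ ^ 2) (sum_congr rfl fun k _ => sum_congr rfl fun i _ => ?_)
    ring
  · refine sum_congr rfl fun k _ => ?_
    rw [mul_sum]
    refine sum_congr rfl fun a _ => ?_
    rw [matrixOp_apply, ← sq_abs ⟪W.Z k x; v⟫, ← Real.norm_eq_abs, ← Complex.norm_real, ← mul_pow, ← norm_mul]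
    simp only [frameSymbol, inner_sum, inner_smul_right, mul_assoc, ← mul_sum, sub_mul, sum_sub_distrib,
      ite_mul, one_mul, zero_mul, sum_ite_eq, Finset.mem_univ, if_true]
    simp only [mul_comm]

lemma sum_smul_frameSymbol (x : N) (η : Fin K → ℝ) (w : EuclideanSpace ℂ (Fin r)) :
    ∑ j, (η j : ℂ) • matrixOp _ _ (frameSymbol W X e b g x (W.Z j x)) w =
      matrixOp _ _ (frameSymbol W X e b g x (∑ j, η j • W.Z j x)) w := by
  have h1 : frameSymbol W X e b g x (∑ j, η j • W.Z j x) = ∑ j, η j • frameSymbol W X e b g x (W.Z j x) := by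
    ext ⟨o, a⟩ i
    rw [Finset.sum_apply, Finset.sum_apply]
    cases o
    · simp only [frameSymbol, Pi.smul_apply, sum_inner, real_inner_smul_left, Complex.ofReal_sum, sum_mul, Complex.ofReal_mul,
        smul_sum, Complex.real_smul]
      rw [sum_comm]
      simp only [mul_assoc]
    · simp only [frameSymbol, Pi.smul_apply, inner_sum, real_inner_smul_right, Complex.ofReal_sum, sum_mul, Complex.ofReal_mul,
        Complex.real_smul, mul_assoc]
  rw [h1, map_sum, _root_.sum_apply]
  refine sum_congr rfl fun j _ => ?_
  rw [map_smul]
  exact Complex.coe_smul _ _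

variable [CompactSpace N] (hA : ∀ k j, C∞(n, ℝ) fun y => ⟪W.Z j y; X k y⟫)
  (he : ∀ k i, C∞(n, ℂ) fun y => ⟪e k y, g i y⟫)
  (hb : ∀ k i, C∞(n, ℂ) fun y => ⟪g i y, b k y⟫)
  (hgg : ∀ k i, C∞(n, ℂ) fun y => ⟪g k y, g i y⟫)

include hA he hb hgg in
lemma contMDiff_frameSymbol (j : Fin K) : ContMDiff (Q n) 𝓘(ℝ, EuclideanSpace ℂ (Fin r) →L[ℂ] EuclideanSpace ℂ (Option (Fin K) × Fin r)) ∞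
      fun y => matrixOp _ _ (frameSymbol W X e b g y (W.Z j y)) := by
  have h0 : ContDiff ℝ ∞ (matrixOp (Option (Fin K) × Fin r) (Fin r)) := by fun_prop
  refine h0.contMDiff.comp (contMDiff_pi_space.2 fun p => contMDiff_pi_space.2 fun i => ?_)
  have hof : ∀ {f : N → ℝ}, C∞(n, ℝ) f → C∞(n, ℂ) fun y => (f y : ℂ) := fun hf => Complex.ofRealCLM.contMDiff.comp hf
  obtain ⟨o, a⟩ := p
  cases o
  · exact ContMDiff.sum fun k _ => contMDiff_cmul (hof (hA k j)) (contMDiff_cmul (he k i) (hb k a))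
  · exact contMDiff_cmul (hof (W.smooth_gram _ j)) (contMDiff_const.sub (hgg a i))

include hg hA he hb hgg in
/-- Uniform ellipticity. -/
lemma exists_uniform_elliptic (hell : ∀ x (v : 𝔸 x) (u : G x), v ≠ 0 → u ≠ 0 → ∑ k, ((⟪v; X k x⟫ : ℂ) * ⟪e k x, u⟫) • b k x ≠ 0) :
    ∃ c₀ : ℝ, 0 < c₀ ∧ ∀ x (η : ℝ^K) (w : EuclideanSpace ℂ (Fin r)), c₀ * (∑ k, (∑ j, ⟪W.Z k x; W.Z j x⟫ * η j) ^ 2) * ‖w‖ ^ 2 ≤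
        ‖∑ j, (η j : ℂ) • matrixOp _ _ (frameSymbol W X e b g x (W.Z j x)) w‖ ^ 2 := by
  let Φ : N × ℝ^K × EuclideanSpace ℂ (Fin r) → ℝ := fun q =>
    ‖∑ j, (q.2.1 j : ℂ) • matrixOp _ _ (frameSymbol W X e b g q.1 (W.Z j q.1)) q.2.2‖ ^ 2 +
      (∑ k, (q.2.1 k - ∑ j, ⟪W.Z k q.1; W.Z j q.1⟫ * q.2.1 j) ^ 2) * ‖q.2.2‖ ^ 2
  have hv : ∀ x (η : ℝ^K) k, ∑ j, ⟪W.Z k x; W.Z j x⟫ * η j = ⟪W.Z k x; ∑ j, η j • W.Z j x⟫ := fun x η k => by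
    simp_rw [inner_sum, real_inner_smul_right, mul_comm]
  have hΦc : Continuous Φ := by
    have h1 : ∀ j : Fin K, Continuous fun q : N × ℝ^K × EuclideanSpace ℂ (Fin r) => (q.2.1 j : ℝ) := fun j => by fun_prop
    have h2 := fun j => ((contMDiff_frameSymbol W hA he hb hgg j).continuous.comp
      (continuous_fst (X := N) (Y := ℝ^K × EuclideanSpace ℂ (Fin r)))).clm_apply (continuous_snd.comp continuous_snd)
    have h3 := fun k j => (W.smooth_gram k j).continuous.comp (continuous_fst (X := N) (Y := ℝ^K × EuclideanSpace ℂ (Fin r)))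
    exact ((continuous_finsetSum _ fun j _ => (Complex.continuous_ofReal.comp (h1 j)).smul (h2 j)).norm.pow 2).add
      ((continuous_finsetSum _ fun k _ => ((h1 k).sub (continuous_finsetSum _ fun j _ => (h3 k j).mul (h1 j))).pow 2).mul (by fun_prop))
  obtain ⟨c₀, hc₀, hle⟩ := (isCompact_univ.prod ((isCompact_sphere (0 : ℝ^K) 1).prod
    (isCompact_sphere (0 : EuclideanSpace ℂ (Fin r)) 1))).exists_forall_le' (a := 0) hΦc.continuousOn (by
      rintro ⟨x, η, w⟩ ⟨-, hη, hw⟩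
      simp only [mem_sphere_zero_iff_norm] at hη hw
      refine lt_of_le_of_ne (by positivity) fun h0 => ?_
      simp only [Φ, sum_smul_frameSymbol, hv] at h0
      set v := ∑ j, η j • W.Z j x
      obtain ⟨h1, h2⟩ := (add_eq_zero_iff_of_nonneg (by positivity) (by positivity)).1 h0.symm
      rw [hw, one_pow, mul_one, Finset.sum_eq_zero_iff_of_nonneg fun _ _ => sq_nonneg _] at h2
      have hvn : ‖v‖ ^ 2 = 1 := by
        rw [← W.sum_inner_sq, ← one_pow 2, ← hη, EuclideanSpace.real_norm_sq_eq]
        refine sum_congr rfl fun k hk => ?_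
        rw [← sub_eq_zero.1 (pow_eq_zero_iff two_ne_zero |>.1 (h2 k hk))]
      rw [norm_sq_frameSymbol W hg, hvn, one_mul] at h1
      obtain ⟨h3, h4⟩ := (add_eq_zero_iff_of_nonneg (by positivity) (by positivity)).1 h1
      rw [Finset.sum_eq_zero_iff_of_nonneg fun _ _ => sq_nonneg _] at h4
      refine hell x v (∑ i, w i • g i x) (fun h => ?_) (fun h => ?_) (norm_eq_zero.1 (pow_eq_zero_iff two_ne_zero |>.1 h3))
      · rw [h, norm_zero] at hvn
        norm_num at hvn
      · have hw0 : w = 0 := by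
          ext a
          simpa [h] using h4 a (Finset.mem_univ a)
        rw [hw0, norm_zero] at hw
        norm_num at hw)
  refine ⟨c₀, hc₀, fun x η w => ?_⟩
  set v := ∑ j, η j • W.Z j x with hvdef
  let η' : ℝ^K := WithLp.toLp 2 fun k => ⟪W.Z k x; v⟫
  have hη' : ‖η'‖ ^ 2 = ‖v‖ ^ 2 := by
    rw [EuclideanSpace.real_norm_sq_eq, ← W.sum_inner_sq]
  have hv' : ∑ j, η' j • W.Z j x = v := W.parseval x v
  simp only [hv, sum_smul_frameSymbol, ← hvdef]
  rw [W.sum_inner_sq]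
  by_cases h0 : ‖η'‖ = 0
  · rw [← hη', h0]
    simp
  by_cases hw0 : ‖w‖ = 0
  · rw [hw0]
    simp
  have h1 := hle (x, ‖η'‖⁻¹ • η', ((‖w‖⁻¹ : ℝ) : ℂ) • w) ⟨mem_univ _, by simp [norm_smul, h0], by
    simp only [mem_sphere_zero_iff_norm, norm_smul, Complex.norm_real, norm_inv, norm_norm]; exact inv_mul_cancel₀ hw0⟩
  simp only [Φ, sum_smul_frameSymbol, hv] at h1
  have h2 : ∑ j, (‖η'‖⁻¹ • η') j • W.Z j x = ‖η'‖⁻¹ • v := by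
    rw [← hv', smul_sum]
    exact sum_congr rfl fun j _ => (smul_smul _ _ _).symm
  have h3 : frameSymbol W X e b g x (‖η'‖⁻¹ • v) = ‖η'‖⁻¹ • frameSymbol W X e b g x v := by
    ext ⟨o, a⟩ i
    cases o
    · simp only [frameSymbol, Pi.smul_apply, real_inner_smul_left, Complex.ofReal_mul, smul_sum, Complex.real_smul, mul_assoc]
    · simp only [frameSymbol, Pi.smul_apply, real_inner_smul_right, Complex.ofReal_mul, Complex.real_smul, mul_assoc]
  rw [h2, h3, map_smul, map_smul, _root_.smul_apply, norm_smul, norm_smul, Complex.norm_real] at h1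
  have h4 : ∑ k, ((‖η'‖⁻¹ • η') k - ⟪W.Z k x; ‖η'‖⁻¹ • v⟫) ^ 2 = 0 := sum_eq_zero fun k _ => by
      rw [real_inner_smul_right]
      exact pow_eq_zero_iff two_ne_zero |>.2 (sub_self _)
  rw [h4, zero_mul, add_zero, norm_inv, norm_inv, norm_norm, norm_norm] at h1
  rw [← hη']
  have h5 : c₀ * ‖η'‖ ^ 2 * ‖w‖ ^ 2 ≤ (‖w‖⁻¹ * (‖η'‖⁻¹ * ‖matrixOp _ _ (frameSymbol W X e b g x v) w‖)) ^ 2 * (‖η'‖ ^ 2 * ‖w‖ ^ 2) := by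
    rw [mul_assoc]
    exact mul_le_mul_of_nonneg_right h1 (by positivity)
  refine h5.trans_eq ?_
  field_simp

omit [CompactSpace N] in
lemma contMDiff_toLp {f : Fin r → N → ℂ} (hf : ∀ i, C∞(n, ℂ) (f i)) :
    ContMDiff (Q n) 𝓘(ℝ, EuclideanSpace ℂ (Fin r)) ∞ fun y => WithLp.toLp 2 fun i => f i y :=
  (PiLp.continuousLinearEquiv 2 ℝ fun _ : Fin r => ℂ).symm.contDiff.contMDiff.comp (contMDiff_pi_space.2 hf)

omit [CompactSpace N] in
lemma vd_apply {F : N → EuclideanSpace ℂ (Fin r)} (hF : ContMDiff (Q n) 𝓘(ℝ, EuclideanSpace ℂ (Fin r)) ∞ F)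
    (V : ∀ y : N, TangentSpace (Q n) y) (y : N) (i : Fin r) : vd V F y i = vd V (fun y => F y i) y :=
  (vd_clm ((proj i : EuclideanSpace ℂ (Fin r) →L[ℂ] ℂ).restrictScalars ℝ) ((hF y).mdifferentiableAt (by simp))).symm

variable [T2Space N] (hρ : ∀ x ∈ (Q n).interior N, Function.Bijective (ρ x))
  [MeasurableSpace N] [BorelSpace N] {μ : Measure N} (hμ : IsVolume ρ μ)
  (htan : ∀ (f : N → ℝ) (x : N), ContMDiffAt (Q n) 𝓘(ℝ, ℝ) ∞ f x → (∀ᶠ z in 𝓝 x, 0 ≤ f z) → f x = 0 → ∀ j, vd (W.U j) f x = 0)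
  {ΓA : Set (∀ y, 𝔸 y)} (hΓA : ∀ X ∈ ΓA, ∀ j, C∞(n, ℝ) fun y => ⟪W.Z j y; X y⟫)
  {ΓG : Set (∀ y, G y)} (hΓG : ∀ s ∈ ΓG, ∀ s' ∈ ΓG, C∞(n, ℂ) fun y => ⟪s y, s' y⟫)
  (hgΓ : ∀ i, g i ∈ ΓG) {P : (∀ y, G y) → ∀ y, G y} {σ : ∀ y, Module.Dual ℝ (𝔸 y) → G y →ₗ[ℂ] G y}
  (hP : HasSymbol ρ ΓA ΓG ΓG P σ) (hσ : IsEllipticSymbol σ)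

include hρ hμ htan hΓA hΓG hgΓ hg hP hσ in
/-- The elliptic estimate for operators between sections of bundles. -/
theorem LieFrame.operator_estimate : ∃ C, 0 ≤ C ∧ ∀ f ∈ compactlySupported n ΓG,
    Integrable (fun y => ‖P f y‖ ^ 2) μ ∧ Integrable (fun y => ‖f y‖ ^ 2) μ ∧
    Integrable (fun y => ∑ k, ∑ i, ‖vd (W.U k) (fun y => ⟪g i y, f y⟫) y‖ ^ 2) μ ∧
    ∫ y, ∑ k, ∑ i, ‖vd (W.U k) (fun y => ⟪g i y, f y⟫) y‖ ^ 2 ∂μ ≤ C * (∫ y, ‖P f y‖ ^ 2 ∂μ + ∫ y, ‖f y‖ ^ 2 ∂μ) := by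
  obtain ⟨L, X, c, e, b, hX, hc, he, hb, hPs, hσs⟩ := hP
  have hA := fun k => hΓA _ (hX k)
  have heg := fun k i => hΓG _ (he k) _ (hgΓ i)
  have hgb := fun k i => hΓG _ (hgΓ i) _ (hb k)
  have hgg := fun k i => hΓG _ (hgΓ k) _ (hgΓ i)
  obtain ⟨c₀, hc₀, hell⟩ := exists_uniform_elliptic W hg hA heg hgb hgg fun x v u hv hu h => by
    have h1 := (hσ x (innerₗ (𝔸 x) v) fun h => hv (inner_self_eq_zero (𝕜 := ℝ).1 (congrArg (· v) h))).1
    exact hu (h1 (((hσs x _ u).trans h).trans (map_zero _).symm))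
  have ha := contMDiff_frameSymbol W hA heg hgb hgg
  obtain ⟨C, hC0, hC⟩ := W.elliptic_estimate hρ hμ htan ha hc₀ hell
  let z : N → Option (Fin K) × Fin r → Fin r → ℂ := fun y p i => p.1.elim
    (∑ k, (vd (fun y => ρ y (X k y)) (fun y => ⟪e k y, g i y⟫) y + c k y * ⟪e k y, g i y⟫) *
      ⟪g p.2 y, b k y⟫) fun k => -vd (W.U k) (fun y => ⟪g p.2 y, g i y⟫) y
  have hz : Continuous fun y => matrixOp _ _ (z y) := by
    refine (matrixOp _ _).continuous.comp (continuous_pi fun p => continuous_pi fun i => ?_)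
    obtain ⟨_ | k, a⟩ := p
    · exact continuous_finsetSum _ fun k _ => ((W.contMDiff_vd_anchor (hA k) (heg k i)).continuous.add
        ((hc k).continuous.mul (heg k i).continuous)).mul (hgb k a).continuous
    · exact (contMDiff_vd (W.smooth_vf k) (hgg a i)).continuous.neg
  obtain ⟨B, hB0, hB⟩ := exists_forall_norm_le (ι := Unit) fun _ => hz
  refine ⟨C * (2 + 2 * B ^ 2 + 1), by positivity, fun f hf => ?_⟩
  obtain ⟨hfΓ, hSc, hSi⟩ := hf
  set S := closure {y | f y ≠ 0} with hS
  have hSc' : IsClosed S := isClosed_closure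
  have hf0 : ∀ x ∉ S, f x = 0 := fun x hx => by_contra fun h => hx (subset_closure h)
  have hfi := fun i => hΓG _ (hgΓ i) _ hfΓ
  set F : N → EuclideanSpace ℂ (Fin r) := fun y => WithLp.toLp 2 fun i => ⟪g i y, f y⟫ with hFdef
  have hF : ContMDiff (Q n) 𝓘(ℝ, EuclideanSpace ℂ (Fin r)) ∞ F := contMDiff_toLp hfi
  have hF0 : ∀ x ∉ S, F x = 0 := fun x hx => by
    ext i
    simp [F, hf0 x hx]
  have hFn : ∀ y, ‖F y‖ ^ 2 = ‖f y‖ ^ 2 := fun y => by rw [EuclideanSpace.norm_sq_eq, norm_sq_eq_sum_inner (hg y)]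
  have hFv : ∀ k y, ‖vd (W.U k) F y‖ ^ 2 = ∑ i, ‖vd (W.U k) (fun y => ⟪g i y, f y⟫) y‖ ^ 2 := fun k y => by
    rw [EuclideanSpace.norm_sq_eq]
    simp_rw [vd_apply hF]
    rfl
  let Y₀ := fun y => ∑ j, matrixOp _ _ (frameSymbol W X e b g y (W.Z j y)) (vd (W.U j) F y)
  have hvc := fun k => (contMDiff_vd (W.smooth_vf k) hF).continuous
  have hY₀c : Continuous Y₀ := continuous_finsetSum _ fun j _ => (ha j).continuous.clm_apply (hvc j)
  let Y := fun y => Y₀ y + matrixOp _ _ (z y) (F y)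
  have hYc : Continuous Y := hY₀c.add (hz.clm_apply hF.continuous)
  have hv0 : ∀ k, ∀ x ∉ S, vd (W.U k) F x = 0 := fun k => vd_eq_zero_of_forall_notMem hSc' hF0
  have hY₀0 : ∀ x ∉ S, Y₀ x = 0 := fun x hx => sum_eq_zero fun j _ => by rw [hv0 j x hx, map_zero]
  have hY0 : ∀ x ∉ S, Y x = 0 := fun x hx => by simp only [Y, hY₀0 x hx, hF0 x hx, map_zero, add_zero]
  have hd : ∀ {h : N → ℂ}, C∞(n, ℂ) h → ∀ y, MD(n, ℂ) h y := fun h y => (h y).mdifferentiableAt (by simp)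
  have hmul : ∀ {u : Fin r → N → ℂ} (V : ∀ y : N, TangentSpace (Q n) y) (w : N → ℂ) (_ : ∀ i, C∞(n, ℂ) (u i))
      (_ : ∀ y, w y = ∑ i, u i y * ⟪g i y, f y⟫) y, vd V w y =
      ∑ i, (vd V (u i) y * ⟪g i y, f y⟫ + u i y * vd V (fun y => ⟪g i y, f y⟫) y) := by
    intro u V w hu hw y
    rw [show w = fun y => ∑ i, u i y * ⟪g i y, f y⟫ from funext hw, vd_sum' _ fun i _ => hd (contMDiff_cmul (hu i) (hfi i)) y]
    exact sum_congr rfl fun i _ => vd_mul (hd (hu i) y) (hd (hfi i) y)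
  have hYn : ∀ y, ‖Y y‖ ^ 2 = ‖P f y‖ ^ 2 := by
    intro y
    rw [EuclideanSpace.norm_sq_eq, Fintype.sum_prod_type, Fintype.sum_option, norm_sq_eq_sum_inner (hg y)]
    have h1 : ∀ p, Y y p = ∑ i, ∑ j, frameSymbol W X e b g y (W.Z j y) p i * vd (W.U j) (fun y => ⟪g i y, f y⟫) y +
        ∑ i, z y p i * ⟪g i y, f y⟫ := by
      intro p
      simp only [Y, Y₀, PiLp.add_apply, WithLp.ofLp_sum, Finset.sum_apply, matrixOp_apply, vd_apply hF]
      rw [sum_comm]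
    have h2 : ∀ k a, Y y (some k, a) = 0 := by
      intro k a
      have h3 := hmul (W.U k) _ (hgg a) (fun y => inner_eq_sum_inner (hg y) (g a y) (f y)) y
      have h4 : ∀ i, vd (W.U k) (fun y => ⟪g i y, f y⟫) y = _ := fun i => W.vd_anchor (W.Z k) _ y
      have h6 : vd (W.U k) (fun y => ⟪g a y, f y⟫) y = ∑ i, if a = i then vd (W.U k) (fun y => ⟪g i y, f y⟫) y else 0 := by simp
      rw [h1, ← sum_add_distrib, ← sub_eq_zero.2 (h6.symm.trans h3)]
      rw [← sum_sub_distrib]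
      refine sum_congr rfl fun i _ => ?_
      have h5 : ∑ j, frameSymbol W X e b g y (W.Z j y) (some k, a) i * vd (W.U j) (fun y => ⟪g i y, f y⟫) y =
          ((if a = i then 1 else 0) - ⟪g a y, g i y⟫) * vd (W.U k) (fun y => ⟪g i y, f y⟫) y := by
        rw [h4, mul_sum]
        refine sum_congr rfl fun j _ => ?_
        simp only [frameSymbol, real_inner_comm (W.Z j y), Complex.real_smul]
        ring
      rw [h5]
      simp only [z, Option.elim]
      split_ifs <;> ring
    have h3 : ∀ a, Y y (none, a) = ⟪g a y, P f y⟫ := by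
      intro a
      rw [h1, hPs f hfΓ, inner_sum]
      simp only [inner_smul_right, lieDeriv_eq_vd]
      have h4 : ∀ k, vd (fun z => ρ z (X k z)) (fun z => ⟪e k z, f z⟫) y = _ := fun k =>
        hmul _ _ (heg k) (fun y => inner_eq_sum_inner (hg y) (e k y) (f y)) y
      simp only [h4, inner_eq_sum_inner (hg y) (e _ y) (f y), W.vd_anchor (X _) (fun y => ⟪g _ y, f y⟫), frameSymbol, z,
        Option.elim, mul_sum, sum_mul, Complex.real_smul, ← sum_add_distrib]
      conv_rhs => rw [sum_comm]
      refine sum_congr rfl fun i _ => ?_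
      rw [sum_comm, ← sum_add_distrib]
      refine sum_congr rfl fun k _ => ?_
      have h5 : ∑ j, (⟪W.Z j y; X k y⟫ : ℂ) * (⟪e k y, g i y⟫ * ⟪g a y, b k y⟫) *
          vd (W.U j) (fun y => ⟪g i y, f y⟫) y = (∑ j, ⟪e k y, g i y⟫ *
            ((⟪W.Z j y; X k y⟫ : ℂ) * vd (W.U j) (fun y => ⟪g i y, f y⟫) y)) * ⟪g a y, b k y⟫ := by
        rw [sum_mul]
        exact sum_congr rfl fun j _ => by ring
      rw [h5]
      ring
    simp only [h2, h3, norm_zero, ne_eq, OfNat.ofNat_ne_zero, not_false_eq_true, zero_pow, Finset.sum_const_zero, add_zero]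
  have hint : ∀ {h : N → ℝ}, Continuous h → (∀ x ∉ S, h x = 0) → Integrable h μ := fun hh h0 =>
    W.integrable_of_compact hρ hμ hh hSc hSc' hSi h0
  have hiP : Integrable (fun y => ‖Y y‖ ^ 2) μ := hint (hYc.norm.pow 2) fun x hx => by simp [hY0 x hx]
  have hif : Integrable (fun y => ‖F y‖ ^ 2) μ := hint (hF.continuous.norm.pow 2) fun x hx => by simp [hF0 x hx]
  have hi0 : Integrable (fun y => ‖Y₀ y‖ ^ 2) μ := hint (hY₀c.norm.pow 2) fun x hx => by simp [hY₀0 x hx]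
  have hiv : Integrable (fun y => ∑ k, ‖vd (W.U k) F y‖ ^ 2) μ :=
    hint (continuous_finsetSum _ fun k _ => (hvc k).norm.pow 2) fun x hx => by simp [hv0 _ x hx]
  have hm := hC F S hF hSc' hSi hF0
  simp only [← hYn, ← hFn, ← hFv]
  refine ⟨hiP, hif, hiv, hm.trans ?_⟩
  rw [mul_assoc]
  refine mul_le_mul_of_nonneg_left ?_ hC0
  have h1 : ∫ y, ‖Y₀ y‖ ^ 2 ∂μ ≤ ∫ y, (2 * ‖Y y‖ ^ 2 + 2 * B ^ 2 * ‖F y‖ ^ 2) ∂μ := by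
    refine integral_mono hi0 ((hiP.const_mul _).add (hif.const_mul _)) fun y => ?_
    have h2 : ‖Y₀ y‖ ≤ ‖Y y‖ + B * ‖F y‖ := by
      have h3 : Y₀ y = Y y - matrixOp _ _ (z y) (F y) := (add_sub_cancel_right _ _).symm
      rw [h3]
      exact (norm_sub_le _ _).trans (add_le_add_right ((ContinuousLinearMap.le_opNorm _ _).trans
        (mul_le_mul_of_nonneg_right (hB () y) (norm_nonneg _))) _)
    simp only
    nlinarith [norm_nonneg (Y₀ y), sq_nonneg (‖Y y‖ - B * ‖F y‖), mul_self_le_mul_self (norm_nonneg _) h2]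
  rw [integral_add (hiP.const_mul _) (hif.const_mul _), integral_const_mul, integral_const_mul] at h1
  have h2 : 0 ≤ ∫ y, ‖Y y‖ ^ 2 ∂μ := integral_nonneg fun _ => by positivity
  have h3 : 0 ≤ ∫ y, ‖F y‖ ^ 2 ∂μ := integral_nonneg fun _ => by positivity
  nlinarith [mul_nonneg (sq_nonneg B) h2]

end

end Manifold

section LieManifold

variable {m : ℕ}
  {M : Type*} [TopologicalSpace M] [ChartedSpace ℝ₊^(m+1) M]
  [IsManifold (Q (m+1)) ∞ M]
  {Y : Type*} [TopologicalSpace Y] [ChartedSpace ℝ₊^m Y]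
  {FA : Type*} [NormedAddCommGroup FA] [NormedSpace ℝ FA]
  {A : M → Type*} [TopologicalSpace (TotalSpace FA A)]
  [∀ x, NormedAddCommGroup (A x)] [∀ x, InnerProductSpace ℝ (A x)]
  [FiberBundle FA A] [VectorBundle ℝ FA A] [ContMDiffVectorBundle ∞ FA A (Q (m+1))]
  [IsContMDiffRiemannianBundle (Q (m+1)) ∞ FA A]

omit [IsManifold (Q (m+1)) ∞ M] [ContMDiffVectorBundle ∞ FA A (Q (m+1))] in
variable (FA A) in
lemma isSmoothMetric_of_riemannian : IsSmoothMetric (m+1) FA A := fun _ hs _ hs' => ContMDiff.inner_bundle hs hs'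

namespace LieManifoldWithBoundary

variable (L : LieManifoldWithBoundary m M Y FA A)

include L in
lemma finiteDimensional_fibre (x : M) : FiniteDimensional ℝ (A x) := by
  obtain ⟨x₀, hx₀⟩ := exists_mem_interior (n := m + 1) x
  have h0 : FiniteDimensional ℝ (TangentSpace (Q (m+1)) x₀) := inferInstanceAs (FiniteDimensional ℝ (ℝ^(m+1)))
  have h1 : FiniteDimensional ℝ (A x₀) := FiniteDimensional.of_injective (L.anchor x₀) (L.bijective_anchor x₀ hx₀).1
  let e₀ := (trivializationAt FA A x₀).linearEquivAt ℝ x₀ (FiberBundle.mem_baseSet_trivializationAt' x₀)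
  let e := (trivializationAt FA A x).linearEquivAt ℝ x (FiberBundle.mem_baseSet_trivializationAt' x)
  exact (e₀.trans e.symm).finiteDimensional

/-- The Lie frame of `𝒜` given by a Parseval frame of sections. -/
lemma exists_lieFrame [T2Space M] [CompactSpace M] : ∃ (K : ℕ) (W : LieFrame L.anchor K), ∀ j, W.Z j ∈ smoothSections (m+1) FA A := by
  have := L.finiteDimensional_fibre
  obtain ⟨K, g, hg⟩ := exists_parseval (isSmoothMetric_of_riemannian (m := m) FA A)
  choose X hX hXb using fun i j => L.bracket (g i) (hg.smooth i) (g j) (hg.smooth j)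
  have hmet := isSmoothMetric_of_riemannian (m := m) FA A
  refine ⟨K, LieFrame.mk g hg.sum_eq (fun j => L.contMDiff_anchor _ (hg.smooth j))
    (fun i j => hmet _ (hg.smooth i) _ (hg.smooth j)) (fun i j k x => ⟪X i j x; g k x⟫)
    (fun i j k => hmet _ (hX i j) _ (hg.smooth k)) ?_ ?_, hg.smooth⟩
  · intro V hV f hf y hy i j
    rw [← vd_mlieBracket hV hy (L.contMDiff_anchor _ (hg.smooth i)) (L.contMDiff_anchor _ (hg.smooth j)) hf,
      vd_congr_vf (V := VectorField.mlieBracket _ _ _) (W := fun x => ∑ k, ⟪X i j x; g k x⟫ • L.anchor x (g k x)),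
      vd_vf_sum]
    · rfl
    · rw [← hXb i j y]
      conv_lhs => rw [← hg.sum_eq y (X i j y), map_sum]
      simp only [map_smul, real_inner_comm]
  · intro i j l y
    conv_rhs => rw [← hg.sum_eq y (X i j y), sum_inner]
    refine sum_congr rfl fun k _ => ?_
    rw [real_inner_smul_left, real_inner_comm]

lemma contMDiff_inner_section {Z X : ∀ x, A x} (hZ : Z ∈ smoothSections (m+1) FA A)
    (hX : X ∈ smoothSections (m+1) FA A) : C∞(m + 1, ℝ) fun x => ⟪Z x; X x⟫ :=
  isSmoothMetric_of_riemannian (m := m) FA A _ hZ _ hX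

variable {L} (c : L.Tube)

namespace Tube

variable [IsManifold (Q m) ∞ Y]

/-- The projection of the tube to `Y`. -/
def proj (x : M) : Y := (c.Φ x).2

lemma contMDiffOn_proj : ContMDiffOn (Q (m+1)) (Q m) ∞ c.proj c.U := contMDiff_snd.comp_contMDiffOn c.contMDiffOn_Φ

lemma contMDiffOn_fst : ContMDiffOn (Q (m+1)) 𝓘(ℝ, ℝ) ∞ (fun x => (c.Φ x).1) c.U := contMDiff_fst.comp_contMDiffOn c.contMDiffOn_Φ

lemma mem_dom {t : ℝ} (ht : t ∈ Ico 0 c.r) (y : Y) : (t, y) ∈ Ico 0 c.r ×ˢ (univ : Set Y) := ⟨ht, mem_univ y⟩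

lemma zero_mem : (0 : ℝ) ∈ Ico 0 c.r := ⟨le_rfl, c.r_pos⟩

lemma Ψ_mem {t : ℝ} (ht : t ∈ Ico 0 c.r) (y : Y) : c.Ψ (t, y) ∈ c.U := c.mapsTo_Ψ (c.mem_dom ht y)

lemma Φ_Ψ {t : ℝ} (ht : t ∈ Ico 0 c.r) (y : Y) : c.Φ (c.Ψ (t, y)) = (t, y) := c.right_inv _ (c.mem_dom ht y)

lemma proj_Ψ {t : ℝ} (ht : t ∈ Ico 0 c.r) (y : Y) : c.proj (c.Ψ (t, y)) = y := congrArg Prod.snd (c.Φ_Ψ ht y)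

lemma incl_mem (y : Y) : L.incl y ∈ c.U := by rw [← c.Ψ_zero]; exact c.Ψ_mem c.zero_mem y

lemma proj_incl (y : Y) : c.proj (L.incl y) = y := by rw [← c.Ψ_zero]; exact c.proj_Ψ c.zero_mem y

/-- The derivative of a function along the curves `t ↦ Ψ(t, y)`. -/
lemma hasDerivWithinAt_curve {G : Type*} [NormedAddCommGroup G] [NormedSpace ℝ G] {h : M → G} {t : ℝ} (ht : t ∈ Ico 0 c.r) (y : Y)
    (hh : MD(m + 1, G) h (c.Ψ (t, y))) :
    HasDerivWithinAt (fun s => h (c.Ψ (s, y)))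
      (mfderiv (Q (m+1)) 𝓘(ℝ, G) h (c.Ψ (t, y)) (L.anchor (c.Ψ (t, y)) (c.T (t, y)))) (Ico 0 c.r) t := by
  have h1 : ContMDiffOn 𝓘(ℝ, ℝ) (Q (m+1)) ∞ (fun s => c.Ψ (s, y)) (Ico 0 c.r) :=
    c.contMDiffOn_Ψ.comp (contMDiff_id.prodMk contMDiff_const).contMDiffOn fun s hs => c.mem_dom hs y
  have h2 : MDifferentiableWithinAt 𝓘(ℝ, ℝ) (Q (m+1)) (fun s => c.Ψ (s, y)) (Ico 0 c.r) t := (h1 t ht).mdifferentiableWithinAt (by simp)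
  have h3 := HasMFDerivAt.comp_hasMFDerivWithinAt (g := h) (f := fun s => c.Ψ (s, y)) t hh.hasMFDerivAt h2.hasMFDerivWithinAt
  rw [c.anchor_T t ht y]
  exact HasFDerivWithinAt.hasDerivWithinAt (f := fun s => h (c.Ψ (s, y))) (hasMFDerivWithinAt_iff_hasFDerivWithinAt.1 h3)

variable [CompactSpace Y] [T2Space M]

/-- The extension by zero of a function on the tube, cut off by `ϰ`. -/
def extend {G : Type*} [AddCommGroup G] [Module ℝ G] (ϰ : ℝ → ℝ) (a : ℝ × Y → G) (x : M) : G :=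
  open Classical in if x ∈ c.U then ϰ (c.Φ x).1 • a (c.Φ x) else 0

lemma extend_Ψ {G : Type*} [AddCommGroup G] [Module ℝ G] (ϰ : ℝ → ℝ) (a : ℝ × Y → G) {t : ℝ} (ht : t ∈ Ico 0 c.r) (y : Y) :
    c.extend ϰ a (c.Ψ (t, y)) = ϰ t • a (t, y) := by
  rw [extend, if_pos (c.Ψ_mem ht y), c.Φ_Ψ ht y]

lemma contMDiff_extend {G : Type*} [NormedAddCommGroup G] [NormedSpace ℝ G] {ϰ : ℝ → ℝ} (hϰ : ContDiff ℝ ∞ ϰ) {r₂ : ℝ}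
    (hr : r₂ < c.r) (hϰ0 : ∀ t ≥ r₂, ϰ t = 0) {a : ℝ × Y → G}
    (ha : ContMDiffOn (𝓘(ℝ, ℝ).prod (Q m)) 𝓘(ℝ, G) ∞ a (Ico 0 c.r ×ˢ univ)) :
    C∞(m + 1, G) (c.extend ϰ a) := by
  have hK : IsCompact (c.Ψ '' (Icc 0 r₂ ×ˢ univ)) := (isCompact_Icc.prod isCompact_univ).image_of_continuousOn
      (c.contMDiffOn_Ψ.continuousOn.mono (prod_mono (fun t ht => ⟨ht.1, ht.2.trans_lt hr⟩) subset_rfl))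
  have hout : ∀ x ∉ c.Ψ '' (Icc 0 r₂ ×ˢ univ), c.extend ϰ a x = 0 := by
    intro x hx
    by_cases hxU : x ∈ c.U
    · have h1 : r₂ ≤ (c.Φ x).1 := by
        by_contra! h
        exact hx ⟨c.Φ x, ⟨⟨(c.mapsTo_Φ hxU).1.1, h.le⟩, mem_univ _⟩, c.left_inv x hxU⟩
      rw [extend, if_pos hxU, hϰ0 _ h1, zero_smul]
    · rw [extend, if_neg hxU]
  intro x
  by_cases hxU : x ∈ c.U
  · have h1 : ContMDiffOn (Q (m+1)) 𝓘(ℝ, G) ∞ (fun x => ϰ (c.Φ x).1 • a (c.Φ x)) c.U :=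
      ((hϰ.contMDiff.comp_contMDiffOn c.contMDiffOn_fst)).smul (ha.comp c.contMDiffOn_Φ c.mapsTo_Φ)
    refine (h1.contMDiffAt (c.isOpen_U.mem_nhds hxU)).congr_of_eventuallyEq ?_
    filter_upwards [c.isOpen_U.mem_nhds hxU] with z hz
    rw [extend, if_pos hz]
  · refine (contMDiffAt_const (c := (0 : G))).congr_of_eventuallyEq ?_
    have hx : x ∉ c.Ψ '' (Icc 0 r₂ ×ˢ univ) := by
      rintro ⟨⟨t, y⟩, ⟨ht, -⟩, rfl⟩
      exact hxU (c.Ψ_mem ⟨ht.1, ht.2.trans_lt hr⟩ y)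
    filter_upwards [hK.isClosed.isOpen_compl.mem_nhds hx] with z hz
    exact hout z hz

/-- There is a global smooth section of `𝒜` which represents `∂_u` on a smaller tube. -/
lemma exists_section_T [CompactSpace M] {r₁ : ℝ} (hr₁ : r₁ < c.r) : ∃ T' ∈ smoothSections (m+1) FA A,
    ∀ t ∈ Ico 0 c.r, t ≤ r₁ → ∀ y, T' (c.Ψ (t, y)) = c.T (t, y) := by
  have := L.finiteDimensional_fibre
  obtain ⟨K, g, hg⟩ := exists_parseval (isSmoothMetric_of_riemannian (m := m) FA A)
  obtain ⟨r₂, h12, h2⟩ := exists_between hr₁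
  obtain ⟨ϰ, hϰ, hϰ1, hϰ0⟩ := exists_cutoff h12
  have hτ : ∀ j, ContMDiffOn (𝓘(ℝ, ℝ).prod (Q m)) 𝓘(ℝ, ℝ) ∞ (fun p => ⟪g j (c.Ψ p); c.T p⟫) (Ico 0 c.r ×ˢ univ) := fun j p hp =>
    contMDiffWithinAt_inner (isSmoothMetric_of_riemannian (m := m) FA A) (c.smooth_T p hp) (hg.smooth j)
  refine ⟨fun x => ∑ j, c.extend ϰ (fun p => ⟪g j (c.Ψ p); c.T p⟫) x • g j x,
    mem_smoothSections_sum _ fun j _ => mem_smoothSections_smul (c.contMDiff_extend hϰ h2 hϰ0 (hτ j)) (hg.smooth j),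
    fun t ht htr y => ?_⟩
  simp only [c.extend_Ψ ϰ _ ht y, hϰ1 t htr, one_smul]
  exact hg.sum_eq _ _

end Tube

end LieManifoldWithBoundary

namespace LieManifoldWithBoundary

/-! ### The Lie frame of the boundary -/

variable {L : LieManifoldWithBoundary m M Y FA A}

lemma mfderiv_anchorB (y : Y) (b : L.B y) :
    mfderiv (Q m) (Q (m+1)) L.incl y (L.anchorB y b) = L.anchor (L.incl y) (b : A (L.incl y)) := by
  have h1 := congrArg Subtype.val ((LinearEquiv.ofInjective (mfderiv (Q m) (Q (m+1)) L.incl y).toLinearMap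
      (L.immersion_incl y)).apply_symm_apply (((L.anchor (L.incl y)).comp (L.B y).subtype).codRestrict _ (fun b => b.2) b))
  exact h1

lemma bijective_anchorB {y : Y} (hy : y ∈ (Q m).interior Y) : Function.Bijective (L.anchorB y) := by
  have hb := L.bijective_anchor_bdry y hy
  constructor
  · intro b b' h
    have h1 := congrArg (mfderiv (Q m) (Q (m+1)) L.incl y) h
    rw [mfderiv_anchorB, mfderiv_anchorB] at h1
    exact Subtype.ext (hb.1 h1)
  · intro v
    obtain ⟨a, ha⟩ := hb.2 (mfderiv (Q m) (Q (m+1)) L.incl y v)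
    refine ⟨⟨a, ⟨v, ha.symm⟩⟩, L.immersion_incl y ?_⟩
    rw [mfderiv_anchorB]
    exact ha

variable {nv : ∀ y, A (L.incl y)} (hnv : L.IsUnitNormal nv)
include hnv

lemma mem_B_of_inner_eq_zero {y : Y} {a : A (L.incl y)} (ha : ⟪nv y; a⟫ = 0) : a ∈ L.B y := by
  obtain ⟨hn1, hnB⟩ := hnv.2 y
  let R : Submodule ℝ (ℝ^(m+1)) := LinearMap.range (mfderiv (Q m) (Q (m+1)) L.incl y).toLinearMap
  let v₀ : ℝ^(m+1) := L.anchor (L.incl y) (nv y)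
  have hv₀R : v₀ ∉ R := by
    intro h
    have h1 := hnB (nv y) h
    rw [real_inner_self_eq_norm_sq, hn1] at h1
    norm_num at h1
  have hRf : Module.finrank ℝ R = m := by
    have h1 := LinearMap.finrank_range_of_inj (f := (mfderiv (Q m) (Q (m+1)) L.incl y).toLinearMap) (L.immersion_incl y)
    have h2 : Module.finrank ℝ ℝ^m = m := finrank_euclideanSpace_fin
    exact h1.trans h2
  have hlt : R < R ⊔ Submodule.span ℝ {v₀} := by
    refine lt_of_le_of_ne le_sup_left fun h => hv₀R ?_
    rw [h]
    exact Submodule.mem_sup_right (Submodule.mem_span_singleton_self v₀)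
  have htop : R ⊔ Submodule.span ℝ {v₀} = ⊤ := by
    apply Submodule.eq_top_of_finrank_eq
    have h1 := Submodule.finrank_lt_finrank_of_lt hlt
    have h2 := Submodule.finrank_le (R ⊔ Submodule.span ℝ {v₀})
    rw [hRf] at h1
    have h3 : Module.finrank ℝ (ℝ^(m+1)) = m + 1 := finrank_euclideanSpace_fin
    rw [h3] at h2 ⊢
    omega
  let a' : ℝ^(m+1) := L.anchor (L.incl y) a
  have hmem : a' ∈ R ⊔ Submodule.span ℝ {v₀} := by
    rw [htop]; trivial
  obtain ⟨w, hw, v, hv, hwv⟩ := Submodule.mem_sup.1 hmem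
  obtain ⟨s, rfl⟩ := Submodule.mem_span_singleton.1 hv
  have h1 : a - s • nv y ∈ L.B y := by
    have e1 := map_add (L.anchor (L.incl y)) (a - s • nv y) (s • nv y)
    have e2 := map_smul (L.anchor (L.incl y)) s (nv y)
    rw [e2, sub_add_cancel] at e1
    have e3 : (L.anchor (L.incl y) (a - s • nv y) : ℝ^(m+1)) = w := add_right_cancel (b := s • v₀) (e1.symm.trans hwv.symm)
    change (L.anchor (L.incl y) (a - s • nv y) : ℝ^(m+1)) ∈ R
    rw [e3]
    exact hw
  have h2 := hnB _ h1
  rw [inner_sub_right, ha, real_inner_smul_right, real_inner_self_eq_norm_sq, hn1] at h2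
  have h3 : s = 0 := by linarith
  rw [h3, zero_smul, sub_zero] at h1
  exact h1

/-- The orthogonal projection to `ℬ`. -/
def projB (y : Y) (a : A (L.incl y)) : L.B y :=
  ⟨a - ⟪nv y; a⟫ • nv y, mem_B_of_inner_eq_zero hnv (by
    rw [inner_sub_right, real_inner_smul_right, real_inner_self_eq_norm_sq, (hnv.2 y).1]; ring)⟩

lemma coe_projB (y : Y) (a : A (L.incl y)) : (projB hnv y a : A (L.incl y)) = a - ⟪nv y; a⟫ • nv y := rfl

lemma inner_projB (y : Y) (a : A (L.incl y)) (b : L.B y) : ⟪projB hnv y a; b⟫ = ⟪a; (b : A (L.incl y))⟫ := by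
  rw [Submodule.coe_inner, coe_projB, inner_sub_left, real_inner_smul_left, (hnv.2 y).2 b b.2, mul_zero, sub_zero]

lemma sum_inner_smul_projB {K : ℕ} {g : Fin K → ∀ x, A x} (hg : ∀ x v, ∑ j, ⟪g j x; v⟫ • g j x = v) (y : Y) (b : L.B y) :
    ∑ j, ⟪projB hnv y (g j (L.incl y)); b⟫ • projB hnv y (g j (L.incl y)) = b := by
  apply Subtype.ext
  rw [Submodule.coe_sum]
  simp only [inner_projB, Submodule.coe_smul, coe_projB, smul_sub, sum_sub_distrib]
  rw [hg]
  have h1 : ∑ j, ⟪g j (L.incl y); (b : A (L.incl y))⟫ • ⟪nv y; g j (L.incl y)⟫ • nv y = ⟪nv y; (b : A (L.incl y))⟫ • nv y := by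
    conv_rhs => rw [← hg (L.incl y) (b : A (L.incl y)), inner_sum, sum_smul]
    refine sum_congr rfl fun j _ => ?_
    rw [real_inner_smul_right, smul_smul]
  rw [h1, (hnv.2 y).2 b b.2, zero_smul, sub_zero]

lemma sum_inner_smul_projB' {K : ℕ} {g : Fin K → ∀ x, A x} (hg : ∀ x v, ∑ j, ⟪g j x; v⟫ • g j x = v) (y : Y) (a : A (L.incl y)) :
    ∑ j, ⟪(projB hnv y (g j (L.incl y)) : A (L.incl y)); a⟫ • projB hnv y (g j (L.incl y)) = projB hnv y a := by
  rw [← sum_inner_smul_projB hnv hg y (projB hnv y a)]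
  refine sum_congr rfl fun j _ => ?_
  congr 1
  rw [real_inner_comm, ← inner_projB hnv, real_inner_comm]

variable [IsManifold (Q m) ∞ Y] {c : L.Tube} (hc : c.IsNormal nv)

omit hnv

lemma Tube.mdifferentiableAt_proj {x : M} (hx : x ∈ c.U) : MDifferentiableAt (Q (m+1)) (Q m) c.proj x :=
  (c.contMDiffOn_proj.contMDiffAt (c.isOpen_U.mem_nhds hx)).mdifferentiableAt (by simp)

lemma mdifferentiableAt_incl (y : Y) : MDifferentiableAt (Q m) (Q (m+1)) L.incl y := (L.contMDiff_incl y).mdifferentiableAt (by simp)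

/-- A function on `Y`, lifted to the tube, has the same derivatives along `Y`. -/
lemma Tube.vd_comp_proj {G : Type*} [NormedAddCommGroup G] [NormedSpace ℝ G] {f : Y → G} {x : M} (hx : x ∈ c.U)
    (hf : MD(m, G) f (c.proj x)) (V : ∀ x : M, TangentSpace (Q (m+1)) x) :
    vd V (fun z => f (c.proj z)) x = mfderiv (Q m) 𝓘(ℝ, G) f (c.proj x) (mfderiv (Q (m+1)) (Q m) c.proj x (V x)) :=
  congrArg (fun T => T (V x)) (HasMFDerivAt.comp x hf.hasMFDerivAt (c.mdifferentiableAt_proj hx).hasMFDerivAt).mfderiv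

/-- The derivative of a function on `Y` along an element of `ℬ`. -/
lemma Tube.mfderiv_anchorB_eq {G : Type*} [NormedAddCommGroup G] [NormedSpace ℝ G] {f : Y → G} {y : Y}
    {h : M → G} (hh : MD(m + 1, G) h (L.incl y)) (hf : ∀ᶠ z in 𝓝 y, h (L.incl z) = f z)
    (b : L.B y) :
    mfderiv (Q m) 𝓘(ℝ, G) f y (L.anchorB y b) = mfderiv (Q (m+1)) 𝓘(ℝ, G) h (L.incl y) (L.anchor (L.incl y) (b : A (L.incl y))) := by
  rw [← mfderiv_anchorB y b]
  have h1 := (HasMFDerivAt.comp y hh.hasMFDerivAt (mdifferentiableAt_incl (L := L) y).hasMFDerivAt).mfderiv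
  have h2 : (fun z => h (L.incl z)) =ᶠ[𝓝 y] f := hf
  have h3 : mfderiv (Q m) 𝓘(ℝ, G) (h ∘ L.incl) y = mfderiv (Q m) 𝓘(ℝ, G) f y := by
    have := h2.mfderiv_eq (I := Q m) (I' := 𝓘(ℝ, G))
    exact this
  have h4 := congrArg (fun T : TangentSpace (Q m) y → G => T (L.anchorB y b)) (congrArg DFunLike.coe (h3.symm.trans h1))
  exact h4

lemma Tube.mfderiv_proj_anchorB (c : L.Tube) (y : Y) (b : L.B y) :
    (mfderiv (Q (m+1)) (Q m) c.proj (L.incl y) (L.anchor (L.incl y) (b : A (L.incl y))) : ℝ^m) = L.anchorB y b := by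
  rw [← mfderiv_anchorB y b]
  have h1 := (HasMFDerivAt.comp y (c.mdifferentiableAt_proj (c.incl_mem y)).hasMFDerivAt (mdifferentiableAt_incl (L := L) y).hasMFDerivAt)
  have h2 : c.proj ∘ L.incl = id := funext fun y => c.proj_incl y
  rw [h2] at h1
  have h3 := hasMFDerivAt_unique h1 (hasMFDerivAt_id y)
  exact congrArg (fun T : TangentSpace (Q m) y →L[ℝ] TangentSpace (Q m) y => T (L.anchorB y b)) h3

end LieManifoldWithBoundary

namespace LieManifoldWithBoundary

variable {L : LieManifoldWithBoundary m M Y FA A}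
  {nv : ∀ y, A (L.incl y)} (hnv : L.IsUnitNormal nv)
  [IsManifold (Q m) ∞ Y] {c : L.Tube} (hc : c.IsNormal nv)

include hc in
lemma Tube.eq_nv {T' : ∀ x, A x} {y : Y} (hT : T' (c.Ψ (0, y)) = c.T (0, y)) : T' (L.incl y) = nv y := by
  have h1 : (⟨c.Ψ (0, y), T' (c.Ψ (0, y))⟩ : TotalSpace FA A) = ⟨L.incl y, T' (L.incl y)⟩ := by
    rw [c.Ψ_zero]
  rw [hT, hc y] at h1
  exact (eq_of_heq (TotalSpace.mk.inj h1).2).symm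

/-- The projection of the tube to `Y` annihilates `∂_u`. -/
lemma Tube.mfderiv_proj_T (c : L.Tube) {t : ℝ} (ht : t ∈ Ico 0 c.r) (y : Y) :
    mfderiv (Q (m+1)) (Q m) c.proj (c.Ψ (t, y)) (L.anchor (c.Ψ (t, y)) (c.T (t, y))) = 0 := by
  have h1 : ContMDiffOn 𝓘(ℝ, ℝ) (Q (m+1)) ∞ (fun s => c.Ψ (s, y)) (Ico 0 c.r) :=
    c.contMDiffOn_Ψ.comp (contMDiff_id.prodMk contMDiff_const).contMDiffOn fun s hs => c.mem_dom hs y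
  have h2 : MDifferentiableWithinAt 𝓘(ℝ, ℝ) (Q (m+1)) (fun s => c.Ψ (s, y)) (Ico 0 c.r) t := (h1 t ht).mdifferentiableWithinAt (by simp)
  have h3 := HasMFDerivAt.comp_hasMFDerivWithinAt (g := c.proj) (f := fun s => c.Ψ (s, y)) t
    (c.mdifferentiableAt_proj (c.Ψ_mem ht y)).hasMFDerivAt h2.hasMFDerivWithinAt
  have hu : UniqueMDiffWithinAt 𝓘(ℝ, ℝ) (Ico 0 c.r) t := ((uniqueDiffOn_Ico 0 c.r).uniqueMDiffOn) t ht
  have h4 : HasMFDerivWithinAt 𝓘(ℝ, ℝ) (Q m) (fun _ : ℝ => y) (Ico 0 c.r) t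
      (0 : TangentSpace 𝓘(ℝ, ℝ) t →L[ℝ] TangentSpace (Q m) y) := hasMFDerivWithinAt_const _ _ _
  have h5 : HasMFDerivWithinAt 𝓘(ℝ, ℝ) (Q m) (c.proj ∘ fun s => c.Ψ (s, y)) (Ico 0 c.r) t
      (0 : TangentSpace 𝓘(ℝ, ℝ) t →L[ℝ] TangentSpace (Q m) y) :=
    h4.congr_of_eventuallyEq (by
      filter_upwards [self_mem_nhdsWithin] with s hs using c.proj_Ψ hs y) (c.proj_Ψ ht y)
  have h6 := h3.mfderivWithin hu
  have h7 := h5.mfderivWithin hu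
  rw [c.anchor_T t ht y]
  exact (congrArg (fun T : ℝ →L[ℝ] ℝ^m => T 1) (h6.symm.trans h7)).trans rfl

include hc in
lemma Tube.mfderiv_proj_nv (y : Y) : mfderiv (Q (m+1)) (Q m) c.proj (L.incl y) (L.anchor (L.incl y) (nv y)) = 0 := by
  have h1 := congrArg (fun p : TotalSpace FA A => (mfderiv (Q (m+1)) (Q m) c.proj p.1 (L.anchor p.1 p.2) : ℝ^m)) (hc y)
  have h2 := c.mfderiv_proj_T c.zero_mem y
  exact h1.symm.trans h2

include hc in
lemma Tube.mfderiv_proj_anchor (y : Y) (a : A (L.incl y)) : (mfderiv (Q (m+1)) (Q m) c.proj (L.incl y) (L.anchor (L.incl y) a) : ℝ^m) =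
      L.anchorB y (projB hnv y a) := by
  have h1 : a = (projB hnv y a : A (L.incl y)) + ⟪nv y; a⟫ • nv y := by
    rw [coe_projB, sub_add_cancel]
  rw [← c.mfderiv_proj_anchorB y (projB hnv y a)]
  conv_lhs => rw [h1, map_add, map_smul, map_add, map_smul, c.mfderiv_proj_nv hc, smul_zero, add_zero]

variable [T2Space M] [CompactSpace M] [CompactSpace Y]

include hc in
/-- The Lie frame of `ℬ` obtained by projecting a frame of `𝒜`. -/
theorem exists_lieFrameB {K : ℕ} (W : LieFrame L.anchor K) (hW : ∀ j, W.Z j ∈ smoothSections (m+1) FA A) :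
    ∃ WB : LieFrame L.anchorB K, (∀ j y, WB.Z j y = projB hnv y (W.Z j (L.incl y))) ∧ ∀ j, WB.Z j ∈ L.sectionsB := by
  have hmet := isSmoothMetric_of_riemannian (m := m) FA A
  obtain ⟨T', hT', hTeq⟩ := c.exists_section_T (r₁ := 0) c.r_pos
  have hTnv : ∀ y, T' (L.incl y) = nv y := fun y => Tube.eq_nv hc (hTeq 0 c.zero_mem le_rfl y)
  let Zh : Fin K → ∀ x, A x := fun j x => W.Z j x - ⟪T' x; W.Z j x⟫ • T' x
  have hZh : ∀ j, Zh j ∈ smoothSections (m+1) FA A := fun j =>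
    mem_smoothSections_sub (hW j) (mem_smoothSections_smul (hmet _ hT' _ (hW j)) hT')
  have hZi : ∀ j y, Zh j (L.incl y) = (projB hnv y (W.Z j (L.incl y)) : A (L.incl y)) := by
    intro j y
    rw [coe_projB, ← hTnv]
  choose X hX hXb using fun i j => L.bracket (Zh i) (hZh i) (Zh j) (hZh j)
  let Z : Fin K → ∀ y, L.B y := fun j y => projB hnv y (W.Z j (L.incl y))
  let V : Fin K → ∀ x, TangentSpace (Q (m+1)) x := fun j x => L.anchor x (Zh j x)
  have hV : ∀ j, SmoothVF (V j) := fun j => L.contMDiff_anchor _ (hZh j)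
  have hUV : ∀ j y, (mfderiv (Q (m+1)) (Q m) c.proj (L.incl y) (V j (L.incl y)) : ℝ^m) = L.anchorB y (Z j y) := by
    intro j y
    simp only [V, hZi]
    exact c.mfderiv_proj_anchorB y _
  have hsmooth : ∀ j, SmoothVF fun y => L.anchorB y (Z j y) := by
    intro j
    have h1 := c.contMDiffOn_proj.contMDiffOn_tangentMapWithin (m := ∞) (by simp) c.isOpen_U.uniqueMDiffOn
    have h2 : ContMDiff (Q m) (Q (m+1)).tangent ∞ (fun y => (⟨L.incl y, V j (L.incl y)⟩ : TangentBundle (Q (m+1)) M)) :=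
      (hV j).comp L.contMDiff_incl
    have h3 := h1.comp_contMDiff h2 fun y => c.incl_mem y
    have h4 : ∀ (y z : Y) (h : z = y) (v w : ℝ^m), v = w → (⟨z, v⟩ : TangentBundle (Q m) Y) = ⟨y, w⟩ := by
      rintro y _ rfl v _ rfl; rfl
    refine h3.congr fun y => ?_
    refine (h4 y (c.proj (L.incl y)) (c.proj_incl y) _ _ ?_).symm
    refine Eq.trans ?_ (hUV j y)
    exact congrArg (fun T : ℝ^(m+1) →L[ℝ] ℝ^m => T (V j (L.incl y)))
      (mfderivWithin_of_isOpen (I := Q (m+1)) (I' := Q m) (f := c.proj) c.isOpen_U (c.incl_mem y))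
  have hfirst : ∀ {O : Set Y}, IsOpen O → ∀ {f : Y → ℝ}, ContMDiffOn (Q m) 𝓘(ℝ, ℝ) ∞ f O → ∀ y ∈ O, ∀ (a : A (L.incl y))
      (U : ∀ x, TangentSpace (Q (m+1)) x), U (L.incl y) = L.anchor (L.incl y) a →
      vd U (fun x => f (c.proj x)) (L.incl y) = mfderiv (Q m) 𝓘(ℝ, ℝ) f y (L.anchorB y (projB hnv y a)) := by
    intro O hO f hf y hy a U hU
    have hfd : MD(m, ℝ) f (c.proj (L.incl y)) := by
      rw [c.proj_incl]
      exact (hf.contMDiffAt (hO.mem_nhds hy)).mdifferentiableAt (by simp)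
    rw [c.vd_comp_proj (c.incl_mem y) hfd U, hU]
    have h5 : ∀ (y z : Y) (h : z = y) (v w : ℝ^m), v = w → (mfderiv (Q m) 𝓘(ℝ, ℝ) f z v : ℝ) = mfderiv (Q m) 𝓘(ℝ, ℝ) f y w := by
      rintro y _ rfl v _ rfl; rfl
    exact h5 y _ (c.proj_incl y) _ _ (c.mfderiv_proj_anchor hnv hc y a)
  have hproj_idem : ∀ y (b : L.B y), projB hnv y (b : A (L.incl y)) = b := by
    intro y b
    apply Subtype.ext
    rw [coe_projB, (hnv.2 y).2 b b.2, zero_smul, sub_zero]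
  refine ⟨LieFrame.mk Z (fun y b => sum_inner_smul_projB hnv W.parseval y b) hsmooth ?_
    (fun i j k y => ⟪X i j (L.incl y); Zh k (L.incl y)⟫) ?_ ?_ ?_, fun j y => rfl, ?_⟩
  · intro i j
    refine ((hmet _ (hZh i) _ (hZh j)).comp L.contMDiff_incl).congr fun y => ?_
    simp only [Function.comp_apply, hZi]
    rfl
  · exact fun i j k => (hmet _ (hX i j) _ (hZh k)).comp L.contMDiff_incl
  · intro O hO f hf y hy i j
    have hOM : IsOpen (c.U ∩ c.proj ⁻¹' O) := c.contMDiffOn_proj.continuousOn.isOpen_inter_preimage c.isOpen_U hO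
    have hyM : L.incl y ∈ c.U ∩ c.proj ⁻¹' O := ⟨c.incl_mem y, by rw [mem_preimage, c.proj_incl]; exact hy⟩
    have hfM : ContMDiffOn (Q (m+1)) 𝓘(ℝ, ℝ) ∞ (fun x => f (c.proj x)) (c.U ∩ c.proj ⁻¹' O) :=
      hf.comp (c.contMDiffOn_proj.mono inter_subset_left) fun x hx => hx.2
    have hone : ∀ j, ∀ z ∈ O, vd (V j) (fun x => f (c.proj x)) (L.incl z) = vd (fun y => L.anchorB y (Z j y)) f z := by
      intro j z hz
      rw [hfirst hO hf z hz (Z j z : A (L.incl z)) (V j) (by simp only [V, hZi]; rfl), hproj_idem]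
      rfl
    have htwo : ∀ i j, vd (fun y => L.anchorB y (Z i y)) (vd (fun y => L.anchorB y (Z j y)) f) y =
        vd (V i) (vd (V j) (fun x => f (c.proj x))) (L.incl y) := by
      intro i j
      have h6 := contMDiffOn_vd hOM (hV j) hfM
      have h7 := Tube.mfderiv_anchorB_eq (f := vd (fun y => L.anchorB y (Z j y)) f) (y := y) (h := vd (V j) (fun x => f (c.proj x)))
        ((h6.contMDiffAt (hOM.mem_nhds hyM)).mdifferentiableAt (by simp))
        (by filter_upwards [hO.mem_nhds hy] with z hz using hone j z hz) (Z i y)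
      refine h7.trans ?_
      simp only [vd, V, hZi]
      rfl
    rw [htwo, htwo, ← vd_mlieBracket hOM hyM (hV i) (hV j) hfM,
      hfirst hO hf y hy (X i j (L.incl y)) _ (hXb i j (L.incl y)).symm, ← sum_inner_smul_projB' hnv W.parseval y (X i j (L.incl y)),
      map_sum, map_sum]
    refine sum_congr rfl fun k _ => ?_
    simp only [map_smul, smul_eq_mul, hZi]
    rw [real_inner_comm]
    rfl
  · intro i j l y
    have h8 := congrArg (fun b : L.B y => ⟪b; Z l y⟫) (sum_inner_smul_projB' hnv W.parseval y (X i j (L.incl y)))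
    simp only [sum_inner, real_inner_smul_left] at h8
    rw [inner_projB] at h8
    rw [hZi l]
    refine Eq.trans (sum_congr rfl fun k _ => ?_) h8
    rw [hZi k, real_inner_comm]
  · intro j
    have h9 : (fun y => (⟨L.incl y, (Z j y : A (L.incl y))⟩ : TotalSpace FA A)) = fun y => ⟨L.incl y, Zh j (L.incl y)⟩ := by
      funext y
      rw [hZi]
    change ContMDiff _ _ _ _
    rw [h9]
    exact ContMDiff.comp (hZh j) L.contMDiff_incl

end LieManifoldWithBoundary

namespace LieManifoldWithBoundary

variable {L : LieManifoldWithBoundary m M Y FA A}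
  {nv : ∀ y, A (L.incl y)} (hnv : L.IsUnitNormal nv)
  [IsManifold (Q m) ∞ Y] (c : L.Tube) (hc : c.IsNormal nv)

lemma coord_anchor_eq_zero (y : Y) (b : L.B y) (i : Fin (m+1)) (hi : κ (m+1) (L.incl y) (L.incl y) i = 0) :
    coord (L.anchor (L.incl y) (b : A (L.incl y))) i = 0 := by
  obtain ⟨i₀, hi₀, hnear⟩ := L.hyperface y
  set x := L.incl y with hx
  set φ := κ (m+1) x with hφ
  have hfst : ∀ j, MD(m + 1, ℝ) (fun z => φ z j) x ∧
      ∀ v : ℝ^(m+1), (mfderiv (Q (m+1)) 𝓘(ℝ, ℝ) (fun z => φ z j) x : ℝ^(m+1) →L[ℝ] ℝ) v = v j := by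
    intro j
    let pj : ℝ^(m+1) →L[ℝ] ℝ := proj j
    have h1 : ContMDiffAt (Q (m+1)) 𝓘(ℝ, ℝ^(m+1)) ∞ φ x := contMDiffAt_extChartAt
    have h2 : MD(m + 1, ℝ) (fun z => φ z j) x := (pj.contMDiff.contMDiffAt.comp x h1).mdifferentiableAt (by simp : (∞ : ℕ∞ω) ≠ 0)
    refine ⟨h2, fun v => ?_⟩
    let D : ℝ^(m+1) →L[ℝ] ℝ := mfderiv (Q (m+1)) 𝓘(ℝ, ℝ) (fun z => φ z j) x
    have h3 : HasFDerivWithinAt (fun z => φ (φ.symm z) j) D (range (Q (m+1))) (φ x) := hasFDerivWithinAt_comp_symm h2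
    have hxt : φ x ∈ φ.target := mem_extChartAt_target x
    have h4 : HasFDerivWithinAt (fun z => φ (φ.symm z) j) pj (range (Q (m+1))) (φ x) := by
      refine pj.hasFDerivWithinAt.congr_of_eventuallyEq ?_ ?_
      · filter_upwards [extChartAt_target_mem_nhdsWithin (I := Q (m+1)) x] with z hz
        rw [φ.right_inv hz]; rfl
      · rw [φ.right_inv hxt]; rfl
    have h5 := ((Q (m+1)).uniqueDiffOn _ (extChartAt_target_subset_range x hxt)).eq h3 h4
    exact congrArg (fun T : ℝ^(m+1) →L[ℝ] ℝ => T v) h5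
  by_cases hii : i = i₀
  · subst hii
    refine ((hfst i).2 _).symm.trans ?_
    rw [← Tube.mfderiv_anchorB_eq (f := fun _ => (0 : ℝ)) (hfst i).1 ?_ b, mfderiv_const]
    · rfl
    · filter_upwards [L.contMDiff_incl.continuous.continuousAt.eventually hnear] with z hz
      exact hz.1 (mem_range_self z)
  · refine L.tangent_singular x i hi (fun hall => ?_) _
    have hR : ∀ s : ℝ, 0 ≤ s → φ x + s • single i₀ (1 : ℝ) ∈ range (Q (m+1)) := by
      intro s hs
      have hxr : φ x ∈ range (Q (m+1)) := extChartAt_target_subset_range x (mem_extChartAt_target x)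
      rw [range_Q] at hxr ⊢
      intro k
      refine add_nonneg (hxr k) ?_
      by_cases hk : k = i₀ <;> simp [hk, hs]
    have ht : Tendsto (fun s : ℝ => φ x + s • single i₀ (1 : ℝ)) (𝓝[>] 0) (𝓝[range (Q (m+1))] (φ x)) := by
      refine tendsto_nhdsWithin_iff.2 ⟨?_, ?_⟩
      · have hcont : Continuous fun s : ℝ => φ x + s • single i₀ (1 : ℝ) := by fun_prop
        have := hcont.tendsto 0
        rw [zero_smul, add_zero] at this
        exact this.mono_left nhdsWithin_le_nhds
      · filter_upwards [self_mem_nhdsWithin] with s hs using hR s (le_of_lt hs)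
    have ht2 := (continuousAt_extChartAt_symm (I := Q (m+1)) x).tendsto.comp (ht.mono_right nhdsWithin_le_nhds)
    rw [extChartAt_to_inv] at ht2
    obtain ⟨s, ⟨h1, h2⟩, h3, hs⟩ := ((ht2.eventually (hall.and hnear)).and
      ((ht.eventually (extChartAt_target_mem_nhdsWithin (I := Q (m+1)) x)).and self_mem_nhdsWithin)).exists
    simp only [Function.comp_apply] at h1 h2
    rw [φ.right_inv h3] at h1 h2
    have h4 := h2.1 (h1 (by simp [hi, hii]))
    have h5 : (0 : ℝ) < s := hs
    rw [PiLp.add_apply, hi₀] at h4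
    simp at h4
    exact h5.ne' h4

include c in
/-- The vector fields in `𝒲` are tangent to all the faces of `Y`. -/
theorem mfderiv_anchorB_eq_zero {f : Y → ℝ} {y : Y} (hf : ContMDiffAt (Q m) 𝓘(ℝ, ℝ) ∞ f y) (hpos : ∀ᶠ z in 𝓝 y, 0 ≤ f z)
    (h0 : f y = 0) (b : L.B y) : mfderiv (Q m) 𝓘(ℝ, ℝ) f y (L.anchorB y b) = 0 := by
  have hp := c.contMDiffOn_proj.contMDiffAt (c.isOpen_U.mem_nhds (c.incl_mem y))
  have hh : ContMDiffAt (Q (m+1)) 𝓘(ℝ, ℝ) ∞ (fun x => f (c.proj x)) (L.incl y) :=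
    ContMDiffAt.comp (g := f) (L.incl y) (by rw [c.proj_incl]; exact hf) hp
  have hd := hh.mdifferentiableAt (by simp)
  rw [Tube.mfderiv_anchorB_eq hd (.of_forall fun z => by rw [c.proj_incl]) b]
  refine mfderiv_eq_zero_of_nonneg hd (by rw [c.proj_incl, h0]) ?_ _ (coord_anchor_eq_zero y b)
  have h2 := hp.continuousAt.tendsto
  rw [c.proj_incl] at h2
  exact h2.eventually hpos

variable [T2Space M] [CompactSpace M] [CompactSpace Y] {c}

include hnv hc in
lemma Tube.vd_comp_proj_incl {f : Y → ℝ} (hf : C∞(m, ℝ) f) (y : Y) (Z : ∀ x, A x) :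
    vd (fun x => L.anchor x (Z x)) (fun x => f (c.proj x)) (L.incl y) =
      mfderiv (Q m) 𝓘(ℝ, ℝ) f y (L.anchorB y (projB hnv y (Z (L.incl y)))) := by
  rw [c.vd_comp_proj (c.incl_mem y) ((hf _).mdifferentiableAt (by simp)) _]
  have h5 : ∀ (y z : Y) (h : z = y) (v w : ℝ^m), v = w → (mfderiv (Q m) 𝓘(ℝ, ℝ) f z v : ℝ) = mfderiv (Q m) 𝓘(ℝ, ℝ) f y w := by
    rintro y _ rfl v _ rfl; rfl
  exact h5 y _ (c.proj_incl y) _ _ (c.mfderiv_proj_anchor hnv hc y _)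

lemma Tube.vd_T_vd {K : ℕ} (W : LieFrame L.anchor K) {T' : ∀ x, A x} (hT' : T' ∈ smoothSections (m+1) FA A) {r₁ : ℝ}
    (hTeq : ∀ t ∈ Ico 0 c.r, t ≤ r₁ → ∀ y, T' (c.Ψ (t, y)) = c.T (t, y)) {X : ∀ x, A x} {j : Fin K}
    (hX : ∀ x, L.anchor x (X x) = VectorField.mlieBracket (Q (m+1)) (fun z => L.anchor z (T' z)) (fun z => L.anchor z (W.Z j z)) x)
    {f : Y → ℝ} (hf : C∞(m, ℝ) f) {s : ℝ} (hsr : s ∈ Ico 0 c.r) (hs : s < r₁) (y : Y) :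
    vd (fun x => L.anchor x (T' x)) (vd (W.U j) (fun x => f (c.proj x))) (c.Ψ (s, y)) =
      ∑ k, ⟪W.Z k (c.Ψ (s, y)); X (c.Ψ (s, y))⟫ • vd (W.U k) (fun x => f (c.proj x)) (c.Ψ (s, y)) := by
  have hfU : ContMDiffOn (Q (m+1)) 𝓘(ℝ, ℝ) ∞ (fun x => f (c.proj x)) c.U := hf.comp_contMDiffOn c.contMDiffOn_proj
  have hsU := c.Ψ_mem hsr y
  have hO : IsOpen (c.U ∩ (fun x => (c.Φ x).1) ⁻¹' Iio r₁) := c.contMDiffOn_fst.continuousOn.isOpen_inter_preimage c.isOpen_U isOpen_Iio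
  have hsO : c.Ψ (s, y) ∈ c.U ∩ (fun x => (c.Φ x).1) ⁻¹' Iio r₁ := by
    refine ⟨hsU, ?_⟩
    rw [mem_preimage, c.Φ_Ψ hsr]
    exact hs
  have h3 : vd (fun x => L.anchor x (T' x)) (fun x => f (c.proj x)) =ᶠ[𝓝 (c.Ψ (s, y))] fun _ => 0 := by
    filter_upwards [hO.mem_nhds hsO] with x hx
    rw [c.vd_comp_proj hx.1 ((hf _).mdifferentiableAt (by simp)) _]
    have h4 := c.left_inv x hx.1
    have h5 := (c.mapsTo_Φ hx.1).1
    have h6 : mfderiv (Q (m+1)) (Q m) c.proj x (L.anchor x (T' x)) = 0 := by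
      have h7 := c.mfderiv_proj_T h5 (c.Φ x).2
      rw [← hTeq _ h5 (le_of_lt hx.2) (c.Φ x).2] at h7
      have h8 : c.Ψ ((c.Φ x).1, (c.Φ x).2) = x := h4
      rwa [h8] at h7
    exact (congrArg _ h6).trans (map_zero _)
  have h4 := vd_mlieBracket hO hsO (L.contMDiff_anchor _ hT') (W.smooth_vf j) (hfU.mono inter_subset_left)
  rw [vd_congr h3, vd_const, sub_zero, vd_congr_vf (W := fun x => L.anchor x (X x)) (hX _).symm, W.vd_anchor] at h4
  exact h4.symm

include hc in
/-- The derivatives of functions lifted from `Y` along the fields of the frame of `𝒜` are smooth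
combinations of the derivatives along the fields of the frame of `ℬ`. -/
theorem Tube.exists_transport {K : ℕ} (W : LieFrame L.anchor K) (hW : ∀ j, W.Z j ∈ smoothSections (m+1) FA A)
    (WB : LieFrame L.anchorB K) (hWB : ∀ j y, WB.Z j y = projB hnv y (W.Z j (L.incl y))) {T : ℝ} (hT : 0 < T) (hTr : T < c.r) :
    ∃ (S : ℝ → Y → Fin K → Fin K → ℝ) (B : ℝ), (∀ t j k, C∞(m, ℝ) fun y => S t y j k) ∧
      (∀ t ∈ Icc 0 T, ∀ y j k, |S t y j k - (if j = k then 1 else 0)| ≤ B * t) ∧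
      ∀ f : Y → ℂ, C∞(m, ℂ) f → ∀ t ∈ Icc 0 T, ∀ y j,
        vd (W.U j) (fun x => f (c.proj x)) (c.Ψ (t, y)) = ∑ k, S t y j k • vd (WB.U k) f y := by
  obtain ⟨r₁, hr1, hr1'⟩ := exists_between hTr
  obtain ⟨T', hT', hTeq⟩ := c.exists_section_T hr1'
  choose X hX hXb using fun j => L.bracket T' hT' (W.Z j) (hW j)
  let e : Fin K → Fin K → (Fin K → ℝ) →L[ℝ] (Fin K → ℝ) := fun j k =>
    (ContinuousLinearMap.single ℝ (fun _ => ℝ) j) ∘L (ContinuousLinearMap.proj k)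
  let a : ℝ × Y → (Fin K → ℝ) →L[ℝ] (Fin K → ℝ) := fun p => ∑ j, ∑ k, ⟪W.Z k (c.Ψ p); X j (c.Ψ p)⟫ • e j k
  have ha : ContMDiffOn (𝓘(ℝ, ℝ).prod (Q m)) 𝓘(ℝ, (Fin K → ℝ) →L[ℝ] (Fin K → ℝ)) ∞ a (Ico 0 c.r ×ˢ univ) := by
    refine contMDiffOn_finsetSum fun j _ => contMDiffOn_finsetSum fun k _ => ?_
    exact ((contMDiff_inner_section (hW k) (hX j)).comp_contMDiffOn c.contMDiffOn_Ψ).smul contMDiffOn_const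
  have haw : ∀ p w j, a p w j = ∑ k, ⟪W.Z k (c.Ψ p); X j (c.Ψ p)⟫ * w k := by
    intro p w j
    simp only [a, e, _root_.sum_apply, Finset.sum_apply, _root_.smul_apply, Pi.smul_apply,
      ContinuousLinearMap.comp_apply, ContinuousLinearMap.single_apply, ContinuousLinearMap.proj_apply, smul_eq_mul]
    rw [sum_comm]
    refine sum_congr rfl fun k _ => ?_
    rw [sum_eq_single j]
    · simp
    · intro i _ hi
      simp [hi.symm]
    · simp
  obtain ⟨S, B, hS, hSB, hSsol⟩ := exists_fundamental_solution hT hTr ha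
  have hsub : Icc 0 T ⊆ Ico 0 c.r := fun u hu => ⟨hu.1, hu.2.trans_lt hTr⟩
  have hreal : ∀ f : Y → ℝ, C∞(m, ℝ) f → ∀ t ∈ Icc 0 T, ∀ y,
      (fun j => vd (W.U j) (fun x => f (c.proj x)) (c.Ψ (t, y))) = S t y fun j => vd (WB.U j) f y := by
    intro f hf t ht y
    have hfU : ContMDiffOn (Q (m+1)) 𝓘(ℝ, ℝ) ∞ (fun x => f (c.proj x)) c.U := hf.comp_contMDiffOn c.contMDiffOn_proj
    have h0 : (fun j => vd (WB.U j) f y) = fun j => vd (W.U j) (fun x => f (c.proj x)) (c.Ψ (0, y)) := by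
      funext j
      rw [c.Ψ_zero]
      refine Eq.trans ?_ (Tube.vd_comp_proj_incl hnv hc hf y (W.Z j)).symm
      rw [← hWB]
      rfl
    rw [h0]
    refine hSsol y (fun t j => vd (W.U j) (fun x => f (c.proj x)) (c.Ψ (t, y))) (fun s hs => ?_) t ht
    have hsr : s ∈ Ico 0 c.r := ⟨hs.1, hs.2.trans_lt hTr⟩
    have hsU := c.Ψ_mem hsr y
    rw [hasDerivWithinAt_pi]
    intro j
    have h1 := contMDiffOn_vd c.isOpen_U (W.smooth_vf j) hfU
    have h1' : MD(m + 1, ℝ) (vd (W.U j) fun x => f (c.proj x)) (c.Ψ (s, y)) :=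
      (h1.contMDiffAt (c.isOpen_U.mem_nhds hsU)).mdifferentiableAt (by simp)
    have h2 := (c.hasDerivWithinAt_curve hsr y h1').mono hsub
    have h4 := Tube.vd_T_vd (hX := hXb j) W hT' hTeq hf hsr (hs.2.trans_lt hr1) y
    rw [haw]
    refine h2.congr_deriv ?_
    rw [← hTeq s hsr (hs.2.trans hr1.le) y]
    exact h4
  refine ⟨fun t y j k => S t y (Pi.single k 1) j, B, fun t j k => ?_, fun t ht y j k => ?_, fun f hf t ht y j => ?_⟩
  · have h1 : C∞(m, Fin K → ℝ) fun y => S t y (Pi.single k 1) := (hS t).clm_apply contMDiff_const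
    exact (ContinuousLinearMap.proj (R := ℝ) (φ := fun _ : Fin K => ℝ) j).contMDiff.comp h1
  · have h1 := ((S t y - 1).le_opNorm (Pi.single k (1 : ℝ))).trans (mul_le_mul_of_nonneg_right (hSB t ht y) (norm_nonneg _))
    have h2 := (norm_le_pi_norm ((S t y - 1) (Pi.single k (1 : ℝ))) j).trans h1
    rw [Pi.norm_single, norm_one, mul_one] at h2
    rwa [_root_.sub_apply, Pi.sub_apply, ContinuousLinearMap.one_apply, Pi.single_apply, Real.norm_eq_abs] at h2
  · have hsol : ∀ f : Y → ℝ, C∞(m, ℝ) f → vd (W.U j) (fun x => f (c.proj x)) (c.Ψ (t, y)) =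
        ∑ k, S t y (Pi.single k 1) j * vd (WB.U k) f y := by
      intro f hf
      have h1 := congrFun (hreal f hf t ht y) j
      rw [h1, ← Finset.univ_sum_single (fun j => vd (WB.U j) f y), map_sum, Finset.sum_apply]
      refine sum_congr rfl fun k _ => ?_
      have h2 : (Pi.single k (vd (WB.U k) f y) : Fin K → ℝ) = vd (WB.U k) f y • Pi.single k 1 := by
        rw [← Pi.single_smul, smul_eq_mul, mul_one]
      rw [h2, map_smul, Pi.smul_apply, smul_eq_mul, mul_comm]
    have htr : t ∈ Ico 0 c.r := ⟨ht.1, ht.2.trans_lt hTr⟩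
    have hfU : MD(m + 1, ℂ) (fun x => f (c.proj x)) (c.Ψ (t, y)) :=
      ((hf.comp_contMDiffOn c.contMDiffOn_proj).contMDiffAt (c.isOpen_U.mem_nhds (c.Ψ_mem htr y))).mdifferentiableAt (by simp)
    have hfY : MD(m, ℂ) f y := (hf y).mdifferentiableAt (by simp)
    have hL : ∀ l : ℂ →L[ℝ] ℝ, l (vd (W.U j) (fun x => f (c.proj x)) (c.Ψ (t, y))) =
        l (∑ k, S t y (Pi.single k 1) j • vd (WB.U k) f y) := by
      intro l
      rw [← vd_clm l hfU, hsol (fun z => l (f z)) (l.contMDiff.comp hf), map_sum]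
      refine sum_congr rfl fun k _ => ?_
      rw [vd_clm l hfY, map_smul, smul_eq_mul]
    exact Complex.ext (hL Complex.reCLM) (hL Complex.imCLM)

end LieManifoldWithBoundary

namespace LieManifoldWithBoundary.Tube

variable {L : LieManifoldWithBoundary m M Y FA A} [IsManifold (Q m) ∞ Y] (c : L.Tube)
  {G : Type*} [NormedAddCommGroup G] [NormedSpace ℝ G]

/-- Smooth functions on `[0, r) × Y`. -/
def CollarSmooth (h : ℝ × Y → G) : Prop := ContMDiffOn (𝓘(ℝ, ℝ).prod (Q m)) 𝓘(ℝ, G) ∞ h (Ico 0 c.r ×ˢ univ)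

variable {c} {h : ℝ × Y → G}

lemma CollarSmooth.slice (hh : c.CollarSmooth h) {t : ℝ} (ht : t ∈ Ico 0 c.r) : C∞(m, G) fun y => h (t, y) := by
  rw [← contMDiffOn_univ]
  exact hh.comp (contMDiff_const.prodMk contMDiff_id).contMDiffOn fun y _ => c.mem_dom ht y

lemma CollarSmooth.lift (hh : c.CollarSmooth h) : ContMDiffOn (Q (m+1)) 𝓘(ℝ, G) ∞ (fun x => h (c.Φ x)) c.U :=
  hh.comp c.contMDiffOn_Φ c.mapsTo_Φ

lemma collarSmooth_comp {h : M → G} (hh : ContMDiffOn (Q (m+1)) 𝓘(ℝ, G) ∞ h c.U) : c.CollarSmooth fun p => h (c.Ψ p) :=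
  hh.comp c.contMDiffOn_Ψ c.mapsTo_Ψ

lemma collarSmooth_snd {h : Y → G} (hh : C∞(m, G) h) : c.CollarSmooth fun p => h p.2 := (hh.comp contMDiff_snd).contMDiffOn

lemma CollarSmooth.mul {f g : ℝ × Y → ℂ} (hf : c.CollarSmooth f) (hg : c.CollarSmooth g) : c.CollarSmooth fun p => f p * g p :=
  fun p hp => contMDiffWithinAt_cmul (hf p hp) (hg p hp)

lemma CollarSmooth.sum {ι : Type*} [Fintype ι] {f : ι → ℝ × Y → G} (hf : ∀ i, c.CollarSmooth (f i)) : c.CollarSmooth fun p => ∑ i, f i p :=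
  fun p hp => ContMDiffWithinAt.sum fun i _ => hf i p hp

lemma CollarSmooth.clm {G' : Type*} [NormedAddCommGroup G'] [NormedSpace ℝ G'] (hh : c.CollarSmooth h) (T : G →L[ℝ] G') :
    c.CollarSmooth fun p => T (h p) :=
  T.contDiff.contMDiff.comp_contMDiffOn hh

lemma CollarSmooth.hasDerivWithinAt (hh : c.CollarSmooth h) {t : ℝ} (ht : t ∈ Ico 0 c.r) (y : Y) :
    HasDerivWithinAt (fun u => h (u, y)) (derivWithin (fun u => h (u, y)) (Ico 0 c.r) t) (Ico 0 c.r) t := by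
  have h1 : ContMDiffOn 𝓘(ℝ, ℝ) 𝓘(ℝ, G) ∞ (fun u => h (u, y)) (Ico 0 c.r) :=
    hh.comp (contMDiff_id.prodMk contMDiff_const).contMDiffOn fun u hu => c.mem_dom hu y
  exact ((h1.contDiffOn t ht).differentiableWithinAt (by simp)).hasDerivWithinAt

/-- The chain rule in the coordinates of the tube. -/
lemma CollarSmooth.vd_lift (hh : c.CollarSmooth h) {t : ℝ} (ht : t ∈ Ico 0 c.r) (y : Y) (V : ∀ x : M, TangentSpace (Q (m+1)) x) :
    vd V (fun x => h (c.Φ x)) (c.Ψ (t, y)) = vd V (fun x => (c.Φ x).1) (c.Ψ (t, y)) • derivWithin (fun u => h (u, y)) (Ico 0 c.r) t +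
      vd V (fun x => h (t, c.proj x)) (c.Ψ (t, y)) := by
  set p := c.Ψ (t, y) with hp
  have hpU : p ∈ c.U := c.Ψ_mem ht y
  have hU := c.isOpen_U.mem_nhds hpU
  have hΦp : c.Φ p = (t, y) := c.Φ_Ψ ht y
  have hD := ((hh (t, y) (c.mem_dom ht y)).mdifferentiableWithinAt (by simp)).hasMFDerivWithinAt
  set D := mfderivWithin (𝓘(ℝ, ℝ).prod (Q m)) 𝓘(ℝ, G) h (Ico 0 c.r ×ˢ univ) (t, y)
  have hΦ := ((c.contMDiffOn_Φ p hpU).contMDiffAt hU).mdifferentiableAt (by simp) |>.hasMFDerivAt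
  set Φ' := mfderiv (Q (m+1)) (𝓘(ℝ, ℝ).prod (Q m)) c.Φ p
  have key : ∀ (φ : M → ℝ × Y) (φ' : ℝ^(m+1) →L[ℝ] ℝ × ℝ^m),
      HasMFDerivAt (Q (m+1)) (𝓘(ℝ, ℝ).prod (Q m)) φ p φ' → φ p = (t, y) → MapsTo φ c.U (Ico 0 c.r ×ˢ univ) →
      vd V (fun x => h (φ x)) p = D (φ' (V p)) := by
    intro φ φ' hφ e hm
    rw [← e] at hD
    exact congrArg (fun T => T (V p)) ((hD.comp p hφ.hasMFDerivWithinAt hm).hasMFDerivAt hU).mfderiv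
  have h2 : HasMFDerivAt (Q (m+1)) 𝓘(ℝ, ℝ) (fun x => (c.Φ x).1) p ((ContinuousLinearMap.fst ℝ ℝ ℝ^m).comp Φ') :=
    (hasMFDerivAt_fst (c.Φ p)).comp p hΦ
  have h3 : HasMFDerivAt (Q (m+1)) (Q m) c.proj p ((ContinuousLinearMap.snd ℝ ℝ ℝ^m).comp Φ') := (hasMFDerivAt_snd (c.Φ p)).comp p hΦ
  have h4 : vd V (fun x => (c.Φ x).1) p = (Φ' (V p)).1 := congrArg (fun T => T (V p)) h2.mfderiv
  have h5 : HasMFDerivWithinAt 𝓘(ℝ, ℝ) (𝓘(ℝ, ℝ).prod (Q m)) (fun u => (u, y)) (Ico 0 c.r) t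
      ((ContinuousLinearMap.id ℝ ℝ).prod (0 : ℝ →L[ℝ] ℝ^m)) :=
    (hasMFDerivWithinAt_id (I := 𝓘(ℝ, ℝ)) (Ico 0 c.r) t).prodMk (hasMFDerivWithinAt_const y _ t)
  let D' : ℝ × ℝ^m →L[ℝ] G := D
  have h6 : HasFDerivWithinAt (fun u => h (u, y)) (D'.comp ((ContinuousLinearMap.id ℝ ℝ).prod 0)) (Ico 0 c.r) t :=
    hasMFDerivWithinAt_iff_hasFDerivWithinAt.1 (hD.comp t h5 fun u hu => c.mem_dom hu y)
  have h7 : D' (1, 0) = derivWithin (fun u => h (u, y)) (Ico 0 c.r) t :=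
    (h6.hasDerivWithinAt.derivWithin (uniqueDiffOn_Ico 0 c.r t ht)).symm
  rw [key c.Φ Φ' hΦ hΦp c.mapsTo_Φ, key (fun x => (t, c.proj x)) _ ((hasMFDerivAt_const t p).prodMk h3)
    (Prod.ext rfl (c.proj_Ψ ht y)) fun x _ => c.mem_dom ht _, h4, ← h7]
  let w : ℝ × ℝ^m := Φ' (V p)
  have h8 : w = w.1 • (1, 0) + (0, w.2) := by ext <;> simp
  exact (congrArg D' h8).trans (by rw [map_add, map_smul]; rfl)

/-- Collar functions are bounded and Lipschitz in the normal variable over smaller tubes. -/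
lemma CollarSmooth.exists_lipschitz [CompactSpace M] [T2Space M] [CompactSpace Y] (hh : c.CollarSmooth h) {T : ℝ} (hT : T < c.r) :
    ∃ C, 0 ≤ C ∧ ∀ t ∈ Icc 0 T, ∀ y, ‖h (t, y)‖ ≤ C ∧ ‖h (t, y) - h (0, y)‖ ≤ C * t := by
  obtain ⟨r₂, h12, h2⟩ := exists_between hT
  obtain ⟨ϰ, hϰ, hϰ1, hϰ0⟩ := exists_cutoff h12
  obtain ⟨T', hT', hTeq⟩ := c.exists_section_T hT
  have he := c.contMDiff_extend hϰ h2 hϰ0 hh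
  obtain ⟨C, hC0, hC⟩ := exists_forall_norm_le (ι := Bool) (f := fun b x => cond b (c.extend ϰ h x)
    (vd (fun x => L.anchor x (T' x)) (c.extend ϰ h) x)) (by
      rintro (_ | _)
      exacts [(contMDiff_vd (L.contMDiff_anchor T' hT') he).continuous, he.continuous])
  have hr : ∀ t ∈ Icc 0 T, t ∈ Ico 0 c.r := fun t ht => ⟨ht.1, ht.2.trans_lt hT⟩
  have heq : ∀ t ∈ Icc 0 T, ∀ y, c.extend ϰ h (c.Ψ (t, y)) = h (t, y) := fun t ht y => by
    rw [c.extend_Ψ ϰ h (hr t ht) y, hϰ1 t ht.2, one_smul]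
  refine ⟨C, hC0, fun t ht y => ⟨heq t ht y ▸ hC true _, ?_⟩⟩
  have h0 : (0 : ℝ) ∈ Icc 0 T := ⟨le_rfl, ht.1.trans ht.2⟩
  have h3 := (convex_Icc 0 T).norm_image_sub_le_of_norm_hasDerivWithin_le (C := C)
    (fun u hu => (c.hasDerivWithinAt_curve (hr u hu) y ((he _).mdifferentiableAt (by simp))).mono fun u hu => hr u hu)
    (fun u hu => ?_) h0 ht
  · rw [heq t ht, heq 0 h0, sub_zero, Real.norm_of_nonneg ht.1] at h3
    exact h3
  · rw [← hTeq u (hr u hu) hu.2 y]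
    exact hC false _

end LieManifoldWithBoundary.Tube

variable [CompactSpace M] [T2Space M] [IsManifold (Q m) ∞ Y]
  {FE : Type*} [NormedAddCommGroup FE] [NormedSpace ℂ FE]
  {E : M → Type*} [TopologicalSpace (TotalSpace FE E)]
  [∀ x, NormedAddCommGroup (E x)] [∀ x, InnerProductSpace ℂ (E x)] [∀ x, FiniteDimensional ℂ (E x)]
  [FiberBundle FE E] [VectorBundle ℂ FE E] [VectorBundle ℝ FE E] [ContMDiffVectorBundle ∞ FE E (Q (m+1))]
  (hE : IsSmoothHermitian (m+1) FE E)
  {FF : Type*} [NormedAddCommGroup FF] [NormedSpace ℂ FF]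
  {F : M → Type*} [TopologicalSpace (TotalSpace FF F)]
  [∀ x, NormedAddCommGroup (F x)] [∀ x, InnerProductSpace ℂ (F x)] [∀ x, FiniteDimensional ℂ (F x)]
  [FiberBundle FF F] [VectorBundle ℂ FF F] [VectorBundle ℝ FF F] [ContMDiffVectorBundle ∞ FF F (Q (m+1))]
  (hF : IsSmoothHermitian (m+1) FF F)

namespace LieManifoldWithBoundary.Tube

variable {L : LieManifoldWithBoundary m M Y FA A} {c : L.Tube} (θE : c.Ident FE E) (θF : c.Ident FF F)

variable {θE} in
lemma Ident.inner_slice (s : ∀ x, E x) (t : ℝ) (y : Y) (v : E (L.incl y)) : ⟪θE.slice s t y, v⟫ = ⟪s (c.Ψ (t, y)), θE.map t y v⟫ := by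
  rw [← (θE.map t y).inner_map_map, Ident.slice, LinearIsometryEquiv.apply_symm_apply]

include hE in
lemma collarSmooth_inner_slice {s : ∀ x, E x} (hs : s ∈ smoothSections (m+1) FE E) {f : ∀ y, E (L.incl y)}
    (hf : f ∈ smoothSectionsAlong (m+1) FE E m L.incl) :
    c.CollarSmooth (fun p => ⟪θE.slice s p.1 p.2, f p.2⟫) ∧ c.CollarSmooth (fun p => ⟪f p.2, θE.slice s p.1 p.2⟫) := by
  have h1 : c.CollarSmooth (fun p => ⟪θE.slice s p.1 p.2, f p.2⟫) := fun p hp =>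
    (contMDiffWithinAt_cinner hE (θE.smooth_map f hf p hp) hs).congr_of_eventuallyEq
      (.of_forall fun p => Ident.inner_slice ..) (Ident.inner_slice ..)
  refine ⟨h1, ?_⟩
  simpa using CollarSmooth.clm h1 (Complex.conjCLE : ℂ →L[ℝ] ℂ)

lemma Ident.normalDeriv_eq {r : ℕ} {g : Fin r → ∀ x, E x} (hg : IsCParseval (m+1) FE g) (hE : IsSmoothHermitian (m+1) FE E)
    {s : ∀ x, E x} (hs : s ∈ smoothSections (m+1) FE E) {t : ℝ} (ht : t ∈ Ico 0 c.r) (y : Y) :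
    θE.normalDeriv s t y = ∑ i, derivWithin (fun u => ⟪g i (L.incl y), θE.slice s u y⟫) (Ico 0 c.r) t • g i (L.incl y) := by
  have h1 := HasDerivWithinAt.fun_sum (u := Finset.univ) fun i _ => ((collarSmooth_inner_slice hE θE hs
    ((hg.smooth i).comp L.contMDiff_incl)).2.hasDerivWithinAt ht y).smul_const (g i (L.incl y))
  rw [← h1.derivWithin (uniqueDiffOn_Ico 0 c.r t ht)]
  simp only [hg.sum_eq]
  rfl

lemma du_T {t : ℝ} (ht : t ∈ Ico 0 c.r) (y : Y) : c.du (c.Ψ (t, y)) (c.T (t, y)) = 1 := by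
  have h1 := c.hasDerivWithinAt_curve ht y ((c.contMDiffOn_fst.contMDiffAt (c.isOpen_U.mem_nhds (c.Ψ_mem ht y))).mdifferentiableAt (by simp))
  have h2 := (hasDerivWithinAt_id t (Ico 0 c.r)).congr (f₁ := fun s => (c.Φ (c.Ψ (s, y))).1)
    (fun s hs => by rw [c.Φ_Ψ hs, id]) (by rw [c.Φ_Ψ ht, id])
  exact (uniqueDiffOn_Ico 0 c.r t ht).eq_deriv _ h1 h2

variable {K : ℕ} (W : LieFrame L.anchor K) (hW : ∀ j, W.Z j ∈ smoothSections (m+1) FA A)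
  {r r' : ℕ} {g : Fin r → ∀ x, E x} (hg : IsCParseval (m+1) FE g) {g' : Fin r' → ∀ x, F x} (hg' : IsCParseval (m+1) FF g')
  {P : (∀ x, E x) → ∀ x, F x} {σ : ∀ x, Module.Dual ℝ (A x) → E x →ₗ[ℂ] F x}
  (hP : L.HasSymbolV FE E FF F P σ) (hσ : IsEllipticSymbol σ)

include hσ in
lemma bijective_symbolSlice {t : ℝ} (ht : t ∈ Ico 0 c.r) (y : Y) : Function.Bijective (c.symbolSlice θE θF σ t y) :=
  (θF.map t y).symm.bijective.comp ((hσ _ _ fun h => one_ne_zero ((du_T ht y).symm.trans (congrArg (· (c.T (t, y))) h))).comp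
    (θE.map t y).bijective)

include hE hF hW hg hg' hP hσ in
/-- An elliptic operator over the tube is `σ_t (∂_t + B_t)`, with an operator `B_t` on `Y` whose coefficients are smooth in `t`. -/
theorem exists_collar_form : ∃ (q : Fin r → Fin r → Fin K → ℝ × Y → ℂ) (q₀ : Fin r → Fin r → ℝ × Y → ℂ),
    (∀ l i j, c.CollarSmooth (q l i j)) ∧ (∀ l i, c.CollarSmooth (q₀ l i)) ∧
    (∀ s ∈ smoothSections (m+1) FE E, ∀ t ∈ Ico 0 c.r, ∀ y, θF.slice (P s) t y = c.symbolSlice θE θF σ t y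
      (θE.normalDeriv s t y + ∑ l, (∑ i, (∑ j, q l i j (t, y) *
        vd (W.U j) (fun x => ⟪g i (L.incl (c.proj x)), θE.slice s t (c.proj x)⟫) (c.Ψ (t, y)) +
        q₀ l i (t, y) * ⟪g i (L.incl y), θE.slice s t y⟫)) • g l (L.incl y))) ∧
    ∀ t ∈ Ico 0 c.r, ∀ y (z : Fin K → ℝ) v, θF.map t y (c.symbolSlice θE θF σ t y
      (∑ l, (∑ i, ∑ j, q l i j (t, y) * (z j * ⟪g i (L.incl y), v⟫)) • g l (L.incl y))) =
      σ (c.Ψ (t, y)) (innerₗ _ (∑ j, z j • W.Z j (c.Ψ (t, y)))) (θE.map t y v) := by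
  obtain ⟨K₀, X, cc, e, b, hX, hcc, he, hb, hPs, hσs⟩ := hP
  have hgi := fun i => (hg.smooth i).comp L.contMDiff_incl
  let α : Fin K₀ → ℝ × Y → ℝ := fun k p => vd (fun x => L.anchor x (X k x)) (fun x => (c.Φ x).1) (c.Ψ p)
  let e' : Fin K₀ → Fin r → ℝ × Y → ℂ := fun k i p => ⟪θE.slice (e k) p.1 p.2, g i (L.incl p.2)⟫
  let b' : Fin r' → Fin K₀ → ℝ × Y → ℂ := fun a k p => ⟪g' a (L.incl p.2), θF.slice (b k) p.1 p.2⟫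
  let d : Fin K₀ → Fin r → ℝ × Y → ℂ := fun k i p => vd (fun x => L.anchor x (X k x)) (fun x => e' k i (c.Φ x)) (c.Ψ p) +
    cc k (c.Ψ p) * e' k i p
  let x' : Fin K → Fin K₀ → ℝ × Y → ℂ := fun j k p => (⟪W.Z j (c.Ψ p); X k (c.Ψ p)⟫ : ℂ)
  have hα : ∀ k, c.CollarSmooth fun p => (α k p : ℂ) := fun k => (collarSmooth_comp
    (contMDiffOn_vd c.isOpen_U (L.contMDiff_anchor _ (hX k)) c.contMDiffOn_fst)).clm Complex.ofRealCLM
  have he' : ∀ k i, c.CollarSmooth (e' k i) := fun k i => (collarSmooth_inner_slice hE θE (he k) (hgi i)).1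
  have hb' : ∀ a k, c.CollarSmooth (b' a k) := fun a k => (collarSmooth_inner_slice hF θF (hb k) ((hg'.smooth a).comp L.contMDiff_incl)).2
  have hd : ∀ k i, c.CollarSmooth (d k i) := fun k i => ContMDiffOn.add
    (collarSmooth_comp (contMDiffOn_vd c.isOpen_U (L.contMDiff_anchor _ (hX k)) (he' k i).lift))
    (CollarSmooth.mul (collarSmooth_comp (hcc k).contMDiffOn) (he' k i))
  have hx' : ∀ j k, c.CollarSmooth (x' j k) := fun j k =>
    (collarSmooth_comp (contMDiff_inner_section (hW j) (hX k)).contMDiffOn).clm Complex.ofRealCLM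
  have hσt : ∀ t y v, c.symbolSlice θE θF σ t y v = ∑ k, ((α k (t, y) : ℂ) * ⟪θE.slice (e k) t y, v⟫) • θF.slice (b k) t y := by
    intro t y v
    refine (congrArg (θF.map t y).symm (hσs _ _ _)).trans ?_
    simp only [map_sum, map_smul, Ident.inner_slice]
    rfl
  let S : ℝ × Y → Fin r' ⊕ Fin r → Fin r → ℂ := fun p => Sum.elim (fun a i => ∑ k, (α k p * e' k i p) * b' a k p)
    fun l i => (if l = i then 1 else 0) - ⟪g l (L.incl p.2), g i (L.incl p.2)⟫
  let w : Fin K₀ → ℝ × Y → Fin r' ⊕ Fin r → ℂ := fun k p => Sum.elim (fun a => b' a k p) 0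
  have hS : c.CollarSmooth S := contMDiffOn_pi_space.2 fun a => contMDiffOn_pi_space.2 fun i => by
    obtain a | l := a
    · exact CollarSmooth.sum fun k => ((hα k).mul (he' k i)).mul (hb' a k)
    · exact contMDiffOn_const.sub (collarSmooth_snd ((hE _ (hg.smooth l) _ (hg.smooth i)).comp L.contMDiff_incl))
  have hw : ∀ k, c.CollarSmooth (w k) := fun k => contMDiffOn_pi_space.2 fun a => by
    obtain a | l := a
    · exact hb' a k
    · exact contMDiffOn_const
  have hSl : ∀ t y a (x : Fin r → ℂ), ∑ i, S (t, y) (Sum.inl a) i * x i =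
      ⟪g' a (L.incl y), c.symbolSlice θE θF σ t y (∑ i, x i • g i (L.incl y))⟫ := by
    intro t y a x
    simp only [S, Sum.elim_inl, hσt, inner_sum, inner_smul_right, sum_mul, mul_sum]
    rw [sum_comm]
    exact sum_congr rfl fun k _ => sum_congr rfl fun i _ => by simp only [e', b']; ring
  have hSr : ∀ t y l (x : Fin r → ℂ), ∑ i, S (t, y) (Sum.inr l) i * x i = x l - ⟪g l (L.incl y), ∑ i, x i • g i (L.incl y)⟫ := by
    intro t y l x
    simp only [S, Sum.elim_inr, inner_sum, inner_smul_right, sub_mul, sum_sub_distrib, ite_mul, one_mul, zero_mul,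
      sum_ite_eq, Finset.mem_univ, if_true, mul_comm (x _)]
  obtain ⟨Θ, hΘ⟩ := exists_smooth_solution (Fin r' ⊕ Fin r) (Fin r)
  have hinj : ∀ p ∈ Ico 0 c.r ×ˢ (univ : Set Y), ∀ x : Fin r → ℂ, (∀ a, ∑ i, S p a i * x i = 0) → x = 0 := by
    rintro ⟨t, y⟩ ⟨ht, -⟩ x hx
    have h1 : c.symbolSlice θE θF σ t y (∑ i, x i • g i (L.incl y)) = 0 := by
      rw [← hg'.sum_eq _ (c.symbolSlice θE θF σ t y _)]
      exact sum_eq_zero fun a _ => by rw [← hSl, hx, zero_smul]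
    have h2 := (bijective_symbolSlice θE θF hσ ht y).1 (h1.trans (map_zero _).symm)
    ext l
    have h3 := hSr t y l x
    rw [hx, h2, inner_zero_right, sub_zero] at h3
    exact h3.symm
  let β : Fin K₀ → Fin r → ℝ × Y → ℂ := fun k l p => Θ (S p, w k p) l
  have hβ : ∀ k l, c.CollarSmooth (β k l) := fun k l p hp =>
    (contDiffAt_pi.1 (hΘ (S p) (hinj p hp) (w k p)).1 l).contMDiffAt.comp_contMDiffWithinAt p ((hS p hp).prodMk_space (hw k p hp))
  have hβb : ∀ k, ∀ t ∈ Ico 0 c.r, ∀ y, c.symbolSlice θE θF σ t y (∑ l, β k l (t, y) • g l (L.incl y)) = θF.slice (b k) t y := by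
    intro k t ht y
    obtain ⟨v, hv⟩ := (bijective_symbolSlice θE θF hσ ht y).2 (θF.slice (b k) t y)
    have h1 : Θ (S (t, y), w k (t, y)) = fun i => ⟪g i (L.incl y), v⟫ := by
      refine (hΘ _ (hinj _ (c.mem_dom ht y)) _).2 _ fun a => ?_
      obtain a | l := a
      · rw [hSl, hg.sum_eq, hv]
        rfl
      · rw [hSr, hg.sum_eq, sub_self]
        rfl
    simp only [β, h1, hg.sum_eq, hv]
  refine ⟨fun l i j p => ∑ k, β k l p * e' k i p * x' j k p, fun l i p => ∑ k, β k l p * d k i p,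
    fun l i j => CollarSmooth.sum fun k => ((hβ k l).mul (he' k i)).mul (hx' j k),
    fun l i => CollarSmooth.sum fun k => (hβ k l).mul (hd k i), fun s hs t ht y => ?_, fun t ht y z v => ?_⟩
  · rw [sum_smul_comm (fun k l => β k l (t, y)) (fun k i => e' k i (t, y)) (fun k i => d k i (t, y)) (fun j k => x' j k (t, y))
        (fun j i => vd (W.U j) (fun x => ⟪g i (L.incl (c.proj x)), θE.slice s t (c.proj x)⟫) (c.Ψ (t, y)))
        (fun i => ⟪g i (L.incl y), θE.slice s t y⟫),
      map_add, map_sum]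
    simp only [map_smul, hβb _ t ht y]
    rw [hσt, ← sum_add_distrib, θE.normalDeriv_eq hg hE hs ht]
    refine (congrArg (θF.map t y).symm (hPs s hs _)).trans ?_
    rw [map_sum]
    refine sum_congr rfl fun k _ => ?_
    rw [map_smul, ← add_smul]
    refine congrArg (· • θF.slice (b k) t y) ?_
    let s' : Fin r → ℝ × Y → ℂ := fun i p => ⟪g i (L.incl p.2), θE.slice s p.1 p.2⟫
    have hs' : ∀ i, c.CollarSmooth (s' i) := fun i => (collarSmooth_inner_slice hE θE hs (hgi i)).2
    have h1 : ∀ p : ℝ × Y, ⟪e k (c.Ψ p), s (c.Ψ p)⟫ = ∑ i, e' k i p * s' i p := fun p => by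
      rw [← inner_eq_sum_inner (hg.sum_eq (L.incl p.2)), Ident.inner_slice, Ident.slice, LinearIsometryEquiv.apply_symm_apply]
    have hU := c.isOpen_U.mem_nhds (c.Ψ_mem ht y)
    have hm : ∀ {h : ℝ × Y → ℂ}, c.CollarSmooth h → MD(m + 1, ℂ) (fun x => h (c.Φ x)) (c.Ψ (t, y)) :=
      fun hh => (hh.lift.contMDiffAt hU).mdifferentiableAt (by simp)
    rw [lieDeriv_eq_vd, vd_congr (g := fun x => ∑ i, e' k i (c.Φ x) * s' i (c.Φ x)) (by
      filter_upwards [hU] with x hx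
      rw [← h1, c.left_inv x hx]), vd_sum' _ fun i _ => hm ((he' k i).mul (hs' i)), h1, mul_sum, inner_sum, mul_sum,
      ← sum_add_distrib, ← sum_add_distrib]
    refine sum_congr rfl fun i _ => ?_
    rw [vd_mul (hm (he' k i)) (hm (hs' i)), (hs' i).vd_lift ht, c.Φ_Ψ ht, inner_smul_right]
    have h2 : vd (fun x => L.anchor x (X k x)) (fun x => s' i (t, c.proj x)) (c.Ψ (t, y)) = ∑ j, x' j k (t, y) *
        vd (W.U j) (fun x => s' i (t, c.proj x)) (c.Ψ (t, y)) := by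
      rw [W.vd_anchor]
      exact sum_congr rfl fun j _ => Complex.real_smul
    rw [h2, Complex.real_smul]
    simp only [d, s', α, e']
    ring
  · have h1 := sum_smul_comm (fun k l => β k l (t, y)) (fun k i => e' k i (t, y)) 0 (fun j k => x' j k (t, y))
      (fun j i => (z j * ⟪g i (L.incl y), v⟫ : ℂ)) 0 fun l => g l (L.incl y)
    simp only [Pi.zero_apply, mul_zero, add_zero] at h1
    rw [h1, map_sum]
    simp only [map_smul, hβb _ t ht y]
    rw [hσs, map_sum]
    refine sum_congr rfl fun k _ => ?_
    rw [map_smul, Ident.slice, LinearIsometryEquiv.apply_symm_apply]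
    refine congrArg (· • b k (c.Ψ (t, y))) ?_
    rw [← Ident.inner_slice, inner_eq_sum_inner (hg.sum_eq (L.incl y)), innerₗ_apply_apply, sum_inner, mul_sum]
    refine sum_congr rfl fun i _ => ?_
    simp only [real_inner_smul_left, Complex.ofReal_sum, Complex.ofReal_mul, sum_mul, mul_sum, e', x']
    exact sum_congr rfl fun j _ => by ring

end LieManifoldWithBoundary.Tube

namespace LieManifoldWithBoundary

variable {L : LieManifoldWithBoundary m M Y FA A} {r K : ℕ} {g : Fin r → ∀ x, E x} (hg : IsCParseval (m+1) FE g)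

include hE hg in
lemma contMDiff_inner_along {s s' : ∀ y, E (L.incl y)} (hs : s ∈ smoothSectionsAlong (m+1) FE E m L.incl)
    (hs' : s' ∈ smoothSectionsAlong (m+1) FE E m L.incl) : C∞(m, ℂ) fun y => ⟪s y, s' y⟫ := by
  have h1 : ∀ {s : ∀ y, E (L.incl y)}, s ∈ smoothSectionsAlong (m+1) FE E m L.incl → ∀ i,
      C∞(m, ℂ) fun y => ⟪g i (L.incl y), s y⟫ := fun hs i y =>
    (contMDiffWithinAt_cinner hE (hs y).contMDiffWithinAt (hg.smooth i)).contMDiffAt univ_mem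
  refine (ContMDiff.sum (t := Finset.univ) fun i _ => contMDiff_cmul ((Complex.conjCLE : ℂ →L[ℝ] ℂ).contDiff.contMDiff.comp (h1 hs i)) (h1 hs' i)).congr
    fun y => ?_
  rw [inner_eq_sum_inner (hg.sum_eq (L.incl y))]
  simp

variable {WB : LieFrame L.anchorB K} (hWs : ∀ j, WB.Z j ∈ L.sectionsB)

include hE hg hWs in
lemma hasSymbol_frame {q : Fin r → Fin r → Fin K → Y → ℂ} {q₀ : Fin r → Fin r → Y → ℂ} (hq : ∀ l i p, C∞(m, ℂ) (q l i p))
    (hq₀ : ∀ l i, C∞(m, ℂ) (q₀ l i)) {P : (∀ y, E (L.incl y)) → ∀ y, E (L.incl y)}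
    (hP : ∀ f ∈ smoothSectionsAlong (m+1) FE E m L.incl, ∀ y, P f y = ∑ l, (∑ i, (∑ p, q l i p y *
      vd (n := m) (WB.U p) (fun y => ⟪g i (L.incl y), f y⟫) y + q₀ l i y * ⟪g i (L.incl y), f y⟫)) • g l (L.incl y)) :
    ∃ σ, HasSymbol L.anchorB L.sectionsB (smoothSectionsAlong (m+1) FE E m L.incl) (smoothSectionsAlong (m+1) FE E m L.incl) P σ ∧
      ∀ y ξ v, σ y ξ v = ∑ l, (∑ i, ∑ p, q l i p y * ((ξ (WB.Z p y) : ℝ) * ⟪g i (L.incl y), v⟫)) • g l (L.incl y) := by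
  let ι := Fin r × Fin r × Option (Fin K)
  let X : ι → ∀ y, L.B y := fun k y => k.2.2.elim 0 fun p => WB.Z p y
  let b : ι → ∀ y, E (L.incl y) := fun k y => k.2.2.elim (q₀ k.1 k.2.1 y) (fun p => q k.1 k.2.1 p y) • g k.1 (L.incl y)
  let ε := (Fintype.equivFin ι).symm
  refine ⟨fun y ξ => ∑ k : ι, LinearMap.smulRight (((ξ (X k y) : ℝ) : ℂ) • innerₛₗ ℂ (g k.2.1 (L.incl y))) (b k y),
    ⟨_, fun k => X (ε k), fun k _ => (ε k).2.2.elim 1 0, fun k y => g (ε k).2.1 (L.incl y), fun k => b (ε k), fun k => ?_,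
      fun k => contMDiff_const, fun k => (hg.smooth _).comp L.contMDiff_incl, fun k => ?_, fun f hf y => ?_, fun y ξ v => ?_⟩,
    fun y ξ v => ?_⟩
  · have h1 : ∀ k, X k ∈ L.sectionsB := by
      rintro ⟨l, i, _ | p⟩
      exacts [(contMDiff_zeroSection (IB := Q (m+1)) ℝ A).comp L.contMDiff_incl, hWs p]
    exact h1 _
  · have h1 : C∞(m, ℂ) fun y => (ε k).2.2.elim (q₀ (ε k).1 (ε k).2.1 y) (fun p => q (ε k).1 (ε k).2.1 p y) := by
      obtain ⟨l, i, _ | p⟩ := ε k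
      exacts [hq₀ l i, hq l i p]
    intro y
    have h2 := contMDiffWithinAt_csum_smul hE (S := univ) (ι := Unit) (g := fun _ => g (ε k).1) (fun _ => hg.smooth _)
      (L.contMDiff_incl y).contMDiffWithinAt (c := fun _ => _) fun _ => (h1 y).contMDiffWithinAt
    simpa using h2.contMDiffAt univ_mem
  · rw [hP f hf, ε.sum_comp fun k : ι => (lieDeriv (fun z => L.anchorB z (X k z)) (fun z => ⟪g k.2.1 (L.incl z), f z⟫) y
      + k.2.2.elim 1 0 * ⟪g k.2.1 (L.incl y), f y⟫) • b k y]
    simp only [ι, Fintype.sum_prod_type, Fintype.sum_option, X, b, Option.elim, sum_smul, smul_smul, lieDeriv_eq_vd, add_smul]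
    refine sum_congr rfl fun l _ => sum_congr rfl fun i _ => ?_
    have h0 : vd (fun z => L.anchorB z 0) (fun z => ⟪g i (L.incl z), f z⟫) y = 0 := by
      simp only [vd, map_zero]
      rfl
    rw [h0, zero_add, one_mul, add_comm, mul_comm (q₀ l i y)]
    refine congrArg _ (sum_congr rfl fun p _ => ?_)
    rw [Pi.zero_apply, zero_mul, add_zero, mul_comm (q l i p y)]
    rfl
  · rw [ε.sum_comp fun k : ι => (((ξ (X k y) : ℝ) : ℂ) * ⟪g k.2.1 (L.incl y), v⟫) • b k y]
    simp
  · simp only [ι, Fintype.sum_prod_type, Fintype.sum_option, X, b, Option.elim, map_zero, Complex.ofReal_zero, zero_smul,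
      LinearMap.zero_smulRight, zero_add, LinearMap.sum_apply, LinearMap.smulRight_apply, LinearMap.smul_apply, innerₛₗ_apply_apply,
      smul_smul, sum_smul, smul_eq_mul, mul_comm]

variable [CompactSpace Y] [T2Space Y] [MeasurableSpace Y] [BorelSpace Y] {ν : Measure Y} (hν : IsVolume L.anchorB ν)
  {nv : ∀ y, A (L.incl y)} (hnv : L.IsUnitNormal nv) {c : L.Tube} (hc : c.IsNormal nv)
  (θE : c.Ident FE E) (θF : c.Ident FF F)
  {P : (∀ x, E x) → ∀ x, F x} {σ : ∀ x, Module.Dual ℝ (A x) → E x →ₗ[ℂ] F x}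
  (hP : L.HasSymbolV FE E FF F P σ) (hσ : IsEllipticSymbol σ)

lemma norm_le_one_of_parseval {V ι : Type*} [NormedAddCommGroup V] [InnerProductSpace ℂ V] [Fintype ι] {g : ι → V}
    (hg : ∀ v, ∑ i, ⟪g i, v⟫ • g i = v) (l : ι) : ‖g l‖ ≤ 1 := by
  have h1 := norm_sq_eq_sum_inner hg (g l)
  have h2 := Finset.single_le_sum (f := fun i => ‖⟪g i, g l⟫‖ ^ 2) (fun _ _ => sq_nonneg _) (Finset.mem_univ l)
  rw [← h1, inner_self_eq_norm_sq_to_K] at h2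
  simp only [norm_pow, RCLike.norm_ofReal, abs_norm] at h2
  by_contra! h
  nlinarith [one_lt_pow₀ h two_ne_zero]

lemma norm_sq_sum_smul_le {V : Type*} [NormedAddCommGroup V] [InnerProductSpace ℂ V] {g : Fin r → V}
    (hg : ∀ v, ∑ i, ⟪g i, v⟫ • g i = v) {a : Fin r → Fin r → Fin K → ℂ} {b : Fin r → Fin r → ℂ} (u : Fin K → Fin r → ℂ) (v : V)
    {t C : ℝ} (ht : 0 ≤ t) (hC : 0 ≤ C) (ha : ∀ l i p, ‖a l i p‖ ≤ C * t) (hb : ∀ l i, ‖b l i‖ ≤ C) :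
    ‖∑ l, (∑ i, (∑ p, a l i p * u p i + b l i * ⟪g i, v⟫)) • g l‖ ^ 2 ≤
      2 * (r * C) ^ 2 * (K * r + r) * (t ^ 2 * ∑ p, ∑ i, ‖u p i‖ ^ 2 + ‖v‖ ^ 2) := by
  have h1 : ‖∑ l, (∑ i, (∑ p, a l i p * u p i + b l i * ⟪g i, v⟫)) • g l‖ ≤ r * C * (t * (∑ p, ∑ i, ‖u p i‖) + ∑ i, ‖⟪g i, v⟫‖) := by
    have h2 : ∀ l, ‖(∑ i, (∑ p, a l i p * u p i + b l i * ⟪g i, v⟫)) • g l‖ ≤ C * (t * (∑ p, ∑ i, ‖u p i‖) + ∑ i, ‖⟪g i, v⟫‖) := by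
      intro l
      rw [norm_smul, sum_comm, mul_sum, ← sum_add_distrib, mul_sum]
      refine (mul_le_of_le_one_right (norm_nonneg _) (norm_le_one_of_parseval hg l)).trans ((norm_sum_le _ _).trans
        (sum_le_sum fun i _ => (norm_add_le _ _).trans ?_))
      rw [mul_add, mul_sum, mul_sum, norm_mul]
      refine add_le_add ((norm_sum_le _ _).trans (sum_le_sum fun p _ => ?_)) (mul_le_mul_of_nonneg_right (hb l i) (norm_nonneg _))
      rw [norm_mul, ← mul_assoc]
      exact mul_le_mul_of_nonneg_right (ha l i p) (norm_nonneg _)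
    refine ((norm_sum_le _ _).trans (sum_le_sum fun l _ => h2 l)).trans_eq ?_
    rw [sum_const, card_univ, Fintype.card_fin, nsmul_eq_mul, mul_assoc]
  have h3 : (∑ p, ∑ i, ‖u p i‖) ^ 2 ≤ K * r * ∑ p, ∑ i, ‖u p i‖ ^ 2 := by
    refine sq_sum_le_card_mul_sum_sq.trans ?_
    rw [card_univ, Fintype.card_fin, mul_assoc, mul_sum _ _ (r : ℝ)]
    refine mul_le_mul_of_nonneg_left (sum_le_sum fun p _ => sq_sum_le_card_mul_sum_sq.trans_eq ?_) (Nat.cast_nonneg _)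
    rw [card_univ, Fintype.card_fin]
  have h4 : (∑ i, ‖⟪g i, v⟫‖) ^ 2 ≤ r * ‖v‖ ^ 2 := by
    refine sq_sum_le_card_mul_sum_sq.trans_eq ?_
    rw [card_univ, Fintype.card_fin, norm_sq_eq_sum_inner hg]
  have hV : 0 ≤ ∑ p, ∑ i, ‖u p i‖ ^ 2 := by positivity
  set x := ∑ p, ∑ i, ‖u p i‖
  set V := ∑ p, ∑ i, ‖u p i‖ ^ 2
  set z := ∑ i, ‖⟪g i, v⟫‖
  have hz : 0 ≤ z := by positivity
  have hx : 0 ≤ x := by positivity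
  refine (pow_le_pow_left₀ (norm_nonneg _) h1 2).trans ?_
  rw [mul_pow, mul_comm 2, mul_assoc, mul_assoc]
  refine mul_le_mul_of_nonneg_left ?_ (sq_nonneg _)
  have h5 : t ^ 2 * x ^ 2 ≤ t ^ 2 * (K * r * V) := mul_le_mul_of_nonneg_left h3 (sq_nonneg t)
  have h6 : (0 : ℝ) ≤ r * (t ^ 2 * V) := by positivity
  have h7 : (0 : ℝ) ≤ K * r * ‖v‖ ^ 2 := by positivity
  nlinarith [sq_nonneg (t * x - z)]

include hE hF hν hnv hc hP hσ in
/-- An elliptic operator in a tubular neighbourhood of the boundary. -/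
theorem exists_boundary_form : ∃ (A₀ : (∀ y, E (L.incl y)) → ∀ y, E (L.incl y)) (R : ℝ → (∀ y, E (L.incl y)) → ∀ y, E (L.incl y)),
    L.IsEllipticOpW FE E A₀ ∧ (∀ t ∈ Ico 0 c.r, L.IsDiffOpW FE E (R t)) ∧
    (∀ s ∈ smoothSections (m+1) FE E, ∀ t ∈ Ico 0 c.r, ∀ y, θF.slice (P s) t y = c.symbolSlice θE θF σ t y
      (θE.normalDeriv s t y + A₀ (θE.slice s t) y + R t (θE.slice s t) y)) ∧
    ∀ r' < c.r, ∃ C : ℝ, ∀ t ∈ Ico 0 r', ∀ f ∈ compactlySupported m (smoothSectionsAlong (m+1) FE E m L.incl),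
      normL2 ν (R t f) ≤ ENNReal.ofReal C * (ENNReal.ofReal t * normL2 ν (A₀ f) + normL2 ν f) := by
  obtain ⟨K, W, hW⟩ := L.exists_lieFrame
  obtain ⟨WB, hWB, hWs⟩ := exists_lieFrameB hnv hc W hW
  obtain ⟨r, g, hg⟩ := exists_cparseval hE
  obtain ⟨_, g', hg'⟩ := exists_cparseval hF
  obtain ⟨q, q₀, hq, hq₀, hform, hsymb⟩ := Tube.exists_collar_form hE hF θE θF W hW hg hg' hP hσ
  have hgi : ∀ i, (fun y => g i (L.incl y)) ∈ smoothSectionsAlong (m+1) FE E m L.incl := fun i => (hg.smooth i).comp L.contMDiff_incl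
  have hfi : ∀ f ∈ smoothSectionsAlong (m+1) FE E m L.incl, ∀ i, C∞(m, ℂ) fun y => ⟪g i (L.incl y), f y⟫ :=
    fun f hf i => contMDiff_inner_along hE hg (hgi i) hf
  let B : ℝ → (∀ y, E (L.incl y)) → ∀ y, E (L.incl y) := fun t f y => ∑ l, (∑ i, (∑ j, q l i j (t, y) *
    vd (W.U j) (fun x => ⟪g i (L.incl (c.proj x)), f (c.proj x)⟫) (c.Ψ (t, y)) +
    q₀ l i (t, y) * ⟪g i (L.incl y), f y⟫)) • g l (L.incl y)
  have hT₀ : 0 < c.r / 2 ∧ c.r / 2 < c.r := ⟨by linarith [c.r_pos], by linarith [c.r_pos]⟩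
  have hB0 : ∀ f ∈ smoothSectionsAlong (m+1) FE E m L.incl, ∀ y, B 0 f y = ∑ l, (∑ i, (∑ p, q l i p (0, y) *
      vd (WB.U p) (fun y => ⟪g i (L.incl y), f y⟫) y + q₀ l i (0, y) * ⟪g i (L.incl y), f y⟫)) • g l (L.incl y) := by
    intro f hf y
    obtain ⟨S, b, -, hSb, hS⟩ := Tube.exists_transport hnv hc W hW WB hWB hT₀.1 hT₀.2
    have h0 : (0 : ℝ) ∈ Icc 0 (c.r / 2) := ⟨le_rfl, hT₀.1.le⟩
    have h1 : ∀ j k, S 0 y j k = if j = k then 1 else 0 := fun j k =>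
      sub_eq_zero.1 (abs_nonpos_iff.1 ((hSb 0 h0 y j k).trans_eq (mul_zero b)))
    simp only [B, hS _ (hfi f hf _) 0 h0 y, h1, ite_smul, one_smul, zero_smul, sum_ite_eq, Finset.mem_univ, if_true]
  have hR : ∀ (S : ℝ → Y → Fin K → Fin K → ℝ) (T : ℝ), (∀ f : Y → ℂ, C∞(m, ℂ) f → ∀ t ∈ Icc 0 T, ∀ y j,
        vd (W.U j) (fun x => f (c.proj x)) (c.Ψ (t, y)) = ∑ k, S t y j k • vd (WB.U k) f y) →
      ∀ t ∈ Icc 0 T, ∀ f ∈ smoothSectionsAlong (m+1) FE E m L.incl, ∀ y, B t f y - B 0 f y = ∑ l, (∑ i,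
        (∑ p, (∑ j, q l i j (t, y) * (S t y j p : ℂ) - q l i p (0, y)) * vd (WB.U p) (fun y => ⟪g i (L.incl y), f y⟫) y +
          (q₀ l i (t, y) - q₀ l i (0, y)) * ⟪g i (L.incl y), f y⟫)) • g l (L.incl y) := by
    intro S T hS t ht f hf y
    rw [hB0 f hf, ← sum_sub_distrib]
    refine sum_congr rfl fun l _ => ?_
    rw [← sub_smul, ← sum_sub_distrib]
    refine congrArg (· • g l (L.incl y)) (sum_congr rfl fun i _ => ?_)
    simp only [hS _ (hfi f hf i) t ht y, sub_mul, sum_sub_distrib, sum_mul, mul_sum, Complex.real_smul]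
    rw [sum_comm]
    simp only [mul_assoc]
    ring
  obtain ⟨σB, hσB, hσB'⟩ := hasSymbol_frame hE hg hWs (fun l i p => (hq l i p).slice c.zero_mem) (fun l i => (hq₀ l i).slice c.zero_mem) hB0
  have hell : IsEllipticSymbol σB := by
    intro y ξ hξ
    let z : Fin K → ℝ := fun j => ξ (WB.Z j y)
    have h1 : ∀ x, x = L.incl y → ∑ j, z j • W.Z j x ≠ 0 := by
      rintro _ rfl h
      refine hξ (LinearMap.ext fun b => ?_)
      rw [← WB.parseval y b, map_sum, LinearMap.zero_apply, ← inner_zero_left (𝕜 := ℝ) (b : A (L.incl y)), ← h, sum_inner]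
      refine sum_congr rfl fun j _ => ?_
      rw [map_smul, real_inner_smul_left, smul_eq_mul, mul_comm]
      simp only [z, hWB, inner_projB]
    have h2 := hσ (c.Ψ (0, y)) (innerₗ _ (∑ j, z j • W.Z j (c.Ψ (0, y)))) fun h => h1 _ (c.Ψ_zero y)
      (inner_self_eq_zero (𝕜 := ℝ).1 (congrArg (fun T => T (∑ j, z j • W.Z j (c.Ψ (0, y)))) h))
    refine (Function.Bijective.of_comp_iff' ((θF.map 0 y).bijective.comp (Tube.bijective_symbolSlice θE θF hσ c.zero_mem y)) _).1 ?_
    convert h2.comp (θE.map 0 y).bijective using 1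
    funext v
    simp only [Function.comp_apply]
    rw [hσB']
    exact hsymb 0 c.zero_mem y z v
  refine ⟨B 0, fun t f y => B t f y - B 0 f y, ⟨σB, hσB, hell⟩, fun t ht => ?_, fun s hs t ht y => ?_, fun r' hr' => ?_⟩
  · obtain ⟨S, b, hSs, -, hS⟩ := Tube.exists_transport hnv hc W hW WB hWB (T := (t + c.r) / 2) (by linarith [ht.1, c.r_pos]) (by linarith [ht.2])
    obtain ⟨σ', h1, -⟩ := hasSymbol_frame hE hg hWs (fun l i p => (ContMDiff.sum (t := Finset.univ) fun j _ =>
      contMDiff_cmul ((hq l i j).slice ht) (Complex.ofRealCLM.contDiff.contMDiff.comp (hSs t j p))).sub ((hq l i p).slice c.zero_mem))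
      (fun l i => ((hq₀ l i).slice ht).sub ((hq₀ l i).slice c.zero_mem)) (hR S _ hS t ⟨ht.1, by linarith [ht.2]⟩)
    exact ⟨σ', h1⟩
  · rw [add_assoc, add_sub_cancel]
    exact hform s hs t ht y
  · let T := max r' (c.r / 2)
    have hT : 0 < T ∧ T < c.r := ⟨lt_max_of_lt_right hT₀.1, max_lt hr' hT₀.2⟩
    obtain ⟨S, b, -, hSb, hS⟩ := Tube.exists_transport hnv hc W hW WB hWB hT.1 hT.2
    choose C₁ hC₁0 hC₁ using fun k : Fin r × Fin r × Fin K => (hq k.1 k.2.1 k.2.2).exists_lipschitz hT.2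
    choose C₀ hC₀0 hC₀ using fun k : Fin r × Fin r => (hq₀ k.1 k.2).exists_lipschitz hT.2
    obtain ⟨D₁, hD₁0, hD₁⟩ := exists_forall_le_of_finite C₁
    obtain ⟨D₀, hD₀0, hD₀⟩ := exists_forall_le_of_finite C₀
    obtain ⟨C, hC0, hC⟩ := WB.operator_estimate (g := fun i y => g i (L.incl y)) (fun y v => hg.sum_eq (L.incl y) v)
      (fun y hy => bijective_anchorB hy) hν (fun f y hf h1 h2 j => mfderiv_anchorB_eq_zero (c := c) hf h1 h2 (WB.Z j y))
      (ΓA := L.sectionsB) (fun X hX j => by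
        have : ∀ x, FiniteDimensional ℝ (A x) := L.finiteDimensional_fibre
        intro y
        refine ((contMDiffWithinAt_inner (isSmoothMetric_of_riemannian (m := m) FA A) (hX y).contMDiffWithinAt (hW j)).contMDiffAt
          univ_mem).congr_of_eventuallyEq (.of_forall fun y => ?_)
        simp only [hWB, inner_projB]) (fun s hs s' hs' => contMDiff_inner_along hE hg hs hs') hgi hσB hell
    let C₂ := K * (D₁ * |b|) + D₁ + D₀ * c.r
    have hC₂ : 0 ≤ C₂ := by have := c.r_pos; positivity
    refine ⟨_, fun t ht f hf => normL2_le_of_sq_le (D := 2 * (r * C₂) ^ 2 * (K * r + r)) (by positivity) hC0 ht.1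
      (ht.2.trans hr').le (fun y => by positivity) (hC f hf).2.2.1 (hC f hf).2.1 (hC f hf).1 (fun y => ?_) (hC f hf).2.2.2⟩
    have htT : t ∈ Icc 0 T := ⟨ht.1, ht.2.le.trans (le_max_left _ _)⟩
    change ‖B t f y - B 0 f y‖ ^ 2 ≤ _
    rw [hR S T hS t htT f hf.1 y]
    have ht0 := ht.1
    refine norm_sq_sum_smul_le (hg.sum_eq (L.incl y)) (fun p i => vd (WB.U p) (fun y => ⟪g i (L.incl y), f y⟫) y) (f y) ht0 hC₂
      (fun l i p => ?_) fun l i => ?_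
    · have h1 : ∑ j, q l i j (t, y) * (S t y j p : ℂ) - q l i p (0, y) =
          ∑ j, q l i j (t, y) * ((S t y j p - if j = p then 1 else 0 : ℝ) : ℂ) + (q l i p (t, y) - q l i p (0, y)) := by
        simp [mul_sub, sum_sub_distrib, apply_ite Complex.ofReal]
      rw [h1]
      have h2 : ∀ j, ‖q l i j (t, y) * ((S t y j p - if j = p then 1 else 0 : ℝ) : ℂ)‖ ≤ D₁ * |b| * t := by
        intro j
        rw [norm_mul, Complex.norm_real, mul_assoc]
        exact mul_le_mul ((hC₁ (l, i, j) t htT y).1.trans (hD₁ _)) ((hSb t htT y j p).trans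
          (mul_le_mul_of_nonneg_right (le_abs_self b) ht0)) (norm_nonneg _) hD₁0
      refine (norm_add_le _ _).trans ((add_le_add ((norm_sum_le _ _).trans (sum_le_sum fun j _ => h2 j))
        ((hC₁ (l, i, p) t htT y).2.trans (mul_le_mul_of_nonneg_right (hD₁ _) ht0))).trans ?_)
      rw [sum_const, card_univ, Fintype.card_fin, nsmul_eq_mul]
      have : 0 ≤ D₀ * c.r * t := by have := c.r_pos; positivity
      simp only [C₂]
      linarith
    · refine (hC₀ (l, i) t htT y).2.trans ?_
      have h1 : C₀ (l, i) * t ≤ D₀ * c.r := mul_le_mul (hD₀ _) (ht.2.trans hr').le ht0 hD₀0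
      have : 0 ≤ K * (D₁ * |b|) + D₁ := by positivity
      linarith

end LieManifoldWithBoundary

end LieManifold

end LieMfd

theorem mainTheorem8
    (m : ℕ)
    (M : Type*) [TopologicalSpace M] [ChartedSpace (EuclideanQuadrant (m + 1)) M]
    [IsManifold (LieMfd.Q (m + 1)) ∞ M] [CompactSpace M] [T2Space M]
    [MeasurableSpace M] [BorelSpace M]
    (Y : Type*) [TopologicalSpace Y] [ChartedSpace (EuclideanQuadrant m) Y]
    [IsManifold (LieMfd.Q m) ∞ Y] [CompactSpace Y] [T2Space Y]
    [MeasurableSpace Y] [BorelSpace Y]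
    -- the Lie algebroid `𝒜 → M` with an `𝒜`-metric
    (FA : Type*) [NormedAddCommGroup FA] [NormedSpace ℝ FA]
    (A : M → Type*) [TopologicalSpace (TotalSpace FA A)]
    [∀ x, NormedAddCommGroup (A x)] [∀ x, InnerProductSpace ℝ (A x)]
    [FiberBundle FA A] [VectorBundle ℝ FA A] [ContMDiffVectorBundle ∞ FA A (LieMfd.Q (m + 1))]
    [IsContMDiffRiemannianBundle (LieMfd.Q (m + 1)) ∞ FA A]
    (L : LieMfd.LieManifoldWithBoundary m M Y FA A)
    -- the volume measures on `M` and on `Y`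
    (μ : Measure M) (hμ : LieMfd.IsVolume L.anchor μ)
    (ν : Measure Y) (hν : LieMfd.IsVolume L.anchorB ν)
    -- the hermitian vector bundles `E, F → M`
    (FE : Type*) [NormedAddCommGroup FE] [NormedSpace ℂ FE]
    (E : M → Type*) [TopologicalSpace (TotalSpace FE E)]
    [∀ x, NormedAddCommGroup (E x)] [∀ x, InnerProductSpace ℂ (E x)]
    [∀ x, FiniteDimensional ℂ (E x)]
    [FiberBundle FE E] [VectorBundle ℂ FE E] [VectorBundle ℝ FE E]
    [ContMDiffVectorBundle ∞ FE E (LieMfd.Q (m + 1))]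
    (hE : LieMfd.IsSmoothHermitian (m + 1) FE E)
    (FF : Type*) [NormedAddCommGroup FF] [NormedSpace ℂ FF]
    (F : M → Type*) [TopologicalSpace (TotalSpace FF F)]
    [∀ x, NormedAddCommGroup (F x)] [∀ x, InnerProductSpace ℂ (F x)]
    [∀ x, FiniteDimensional ℂ (F x)]
    [FiberBundle FF F] [VectorBundle ℂ FF F] [VectorBundle ℝ FF F]
    [ContMDiffVectorBundle ∞ FF F (LieMfd.Q (m + 1))]
    (hF : LieMfd.IsSmoothHermitian (m + 1) FF F)
    -- the normal field, the tubular neighbourhood, and the identifications along it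
    (nv : ∀ y, A (L.incl y)) (hnv : L.IsUnitNormal nv)
    (c : L.Tube) (hc : c.IsNormal nv) (hcμ : c.IsMeasureProduct μ ν)
    (θE : c.Ident FE E) (θF : c.Ident FF F)
    -- the elliptic, boundary symmetric operator with its principal symbol
    (D : (∀ x, E x) → ∀ x, F x) (σ : ∀ x, Module.Dual ℝ (A x) → E x →ₗ[ℂ] F x)
    (hD : L.HasSymbolV FE E FF F D σ) (hsym : L.IsBoundarySymmetric nv σ) :
    ∃ (Dadj : (∀ x, F x) → ∀ x, E x) (σadj : ∀ x, Module.Dual ℝ (A x) → F x →ₗ[ℂ] E x)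
      (A₀ : (∀ y, E (L.incl y)) → ∀ y, E (L.incl y))
      (A₁ : (∀ y, F (L.incl y)) → ∀ y, F (L.incl y))
      (R : ℝ → (∀ y, E (L.incl y)) → ∀ y, E (L.incl y))
      (R' : ℝ → (∀ y, F (L.incl y)) → ∀ y, F (L.incl y)),
      -- `Dadj` is the formal adjoint of `D`
      L.HasSymbolV FF F FE E Dadj σadj ∧
      LieMfd.IsFormalAdjoint (m + 1) μ (LieMfd.smoothSections (m + 1) FE E) (LieMfd.smoothSections (m + 1) FF F) D Dadj ∧
      L.IsEllipticOpW FE E A₀ ∧ L.IsEllipticOpW FF F A₁ ∧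
      (∀ t ∈ Ico 0 c.r, L.IsDiffOpW FE E (R t) ∧ L.IsDiffOpW FF F (R' t)) ∧
      -- `D = σ_t (∂_t + A + R_t)` over the tubular neighbourhood
      (∀ s ∈ LieMfd.smoothSections (m + 1) FE E, ∀ t ∈ Ico 0 c.r, ∀ y,
        θF.slice (D s) t y =
          c.symbolSlice θE θF σ t y
            (θE.normalDeriv s t y + A₀ (θE.slice s t) y + R t (θE.slice s t) y)) ∧
      -- `D^* = -σ_t^* (∂_t + Ã + R̃_t)` over the tubular neighbourhood
      (∀ s ∈ LieMfd.smoothSections (m + 1) FF F, ∀ t ∈ Ico 0 c.r, ∀ y,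
        θE.slice (Dadj s) t y =
          - LinearMap.adjoint (c.symbolSlice θE θF σ t y)
            (θF.normalDeriv s t y + A₁ (θF.slice s t) y + R' t (θF.slice s t) y)) ∧
      -- the estimates, uniformly over each smaller tubular neighbourhood
      (∀ r' < c.r, ∃ C : ℝ, ∀ t ∈ Ico 0 r',
        (∀ f ∈ LieMfd.compactlySupported m (LieMfd.smoothSectionsAlong (m + 1) FE E m L.incl),
          LieMfd.normL2 ν (R t f) ≤ ENNReal.ofReal C *
            (ENNReal.ofReal t * LieMfd.normL2 ν (A₀ f) + LieMfd.normL2 ν f)) ∧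
        (∀ g ∈ LieMfd.compactlySupported m (LieMfd.smoothSectionsAlong (m + 1) FF F m L.incl),
          LieMfd.normL2 ν (R' t g) ≤ ENNReal.ofReal C *
            (ENNReal.ofReal t * LieMfd.normL2 ν (A₁ g) + LieMfd.normL2 ν g))) := by
  obtain ⟨K, W, hW⟩ := L.exists_lieFrame
  obtain ⟨Dadj, σadj, hadj, hform, hσ⟩ := W.exists_formalAdjoint L.bijective_anchor hμ
    (fun X hX j => LieMfd.isSmoothMetric_of_riemannian (m := m) FA A _ (hW j) X hX)
    (fun X hX => by simpa using LieMfd.mem_smoothSections_smul (contMDiff_const (c := (-1 : ℝ))) hX) hE hF hD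
  have hadjoint : ∀ x ξ, σadj x ξ = - LinearMap.adjoint (σ x ξ) := fun x ξ => LinearMap.ext fun w =>
    ext_inner_right ℂ fun v => by
      rw [hσ, LinearMap.neg_apply, inner_neg_left, LinearMap.adjoint_inner_left]
  have hell : LieMfd.IsEllipticSymbol σadj := by
    intro x ξ hξ
    have hb := hsym.1 x ξ hξ
    have hi : Function.Injective (σadj x ξ) := by
      refine (injective_iff_map_eq_zero _).2 fun w hw => ?_
      obtain ⟨v, rfl⟩ := hb.2 w
      have h := hσ x ξ v (σ x ξ v)
      rw [hw, inner_zero_left, eq_comm, neg_eq_zero] at h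
      exact inner_self_eq_zero.1 h
    exact ⟨hi, (LinearMap.injective_iff_surjective_of_finrank_eq_finrank
      (LinearEquiv.ofBijective _ hb).finrank_eq.symm).1 hi⟩
  obtain ⟨A₀, R, hA, hR, hDA, hC⟩ := L.exists_boundary_form hE hF hν hnv hc θE θF hD hsym.1
  obtain ⟨A₁, R', hA₁, hR', hDA₁, hC₁⟩ := L.exists_boundary_form hF hE hν hnv hc θF θE hadj hell
  refine ⟨Dadj, σadj, A₀, A₁, R, R', hadj, hform, hA, hA₁, fun t ht => ⟨hR t ht, hR' t ht⟩, hDA, fun s hs t ht y => ?_,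
    fun r' hr' => ?_⟩
  · have h : c.symbolSlice θF θE σadj t y = - LinearMap.adjoint (c.symbolSlice θE θF σ t y) := by
      refine LinearMap.ext fun w => ext_inner_right ℂ fun v => ?_
      rw [LinearMap.neg_apply, inner_neg_left, LinearMap.adjoint_inner_left]
      change inner ℂ ((θE.map t y).symm (σadj _ _ (θF.map t y w))) v = - inner ℂ w ((θF.map t y).symm (σ _ _ (θE.map t y v)))
      rw [LinearIsometryEquiv.inner_map_eq_flip, LinearIsometryEquiv.symm_symm, hσ, ← LinearIsometryEquiv.inner_map_eq_flip]
    rw [hDA₁ s hs t ht y, h, LinearMap.neg_apply]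
  · obtain ⟨C, hC⟩ := hC r' hr'
    obtain ⟨C₁, hC₁⟩ := hC₁ r' hr'
    exact ⟨max C C₁, fun t ht => ⟨fun f hf => (hC t ht f hf).trans (mul_le_mul_left (ENNReal.ofReal_le_ofReal (le_max_left _ _)) _),
      fun f hf => (hC₁ t ht f hf).trans (mul_le_mul_left (ENNReal.ofReal_le_ofReal (le_max_right _ _)) _)⟩⟩

end
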